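/- Let $k$ be a field of characteristic zero and $d$ an integer. All complexes are $\mathbb Z$-graded $k$-vector spaces with a differential of degree $+1$, tensor products and symmetries follow the Koszul sign rule, and $X[n]^i=X^{i+n}$. *$d$-algebras.* A $d$-algebra (without unit) is a complex $V$ with a dg commutative associative product and a bracket $\{\,,\}$ of degree $1-d$ that makes $V[d-1]$ a dg Lie algebra, such that $\{ab,c\}=a\{b,c\}+(-1)^{|b|(|c|+d-1)}\{a,c\}b$. For a $d$-algebra $\mathfrak a$ put $MC(\mathfrak a[d-1])=\{x\in \mathfrak a^d : dx+\tfrac12\{x,x\}=0\}$. *$d$-coalgebras.* A $d$-coalgebra with counit is defined dually: a complex $C$ with a dg cocommutative coassociative coproduct $\Delta$, a counit $\epsilon$, and a Lie cobracket $\delta:C\to C\otimes C$ of degree $1-d$, satisfying the dual identities (in particular $(\epsilon\otimes 1)\delta=0$). It is coproartinian if it has an exhaustive increasing filtration $F^0\subset F^1\subset\cdots$ by sub-$d$-coalgebras such that $F^0=k\cdot 1$ with $\epsilon(1)=1$; $\Delta x=1\otimes x+x\otimes 1-\epsilon(x)\,1\otimes 1$ and $\delta x=0$ for $x\in F^1$;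 and $\Delta x-1\otimes x-x\otimes 1$ and $\delta x$ lie in $F^{i-1}\otimes F^{i-1}$ for $x\in F^i$, $i\ge 2$. The element $1$ is then the unique grouplike element, which gives the canonical inclusion $k\to C$. Coproartinian $d$-coalgebras form a full subcategory $d\text{-}coart$ of the category of $d$-coalgebras with counit. The tensor product of complexes $C\otimes E$ is a $d$-coalgebra with $\Delta(v\otimes w)=\varepsilon(\Delta v\otimes\Delta w)$ and $\delta(v\otimes w)=\varepsilon(\delta v\otimes\Delta w)+(-1)^{(d-1)|v|}\varepsilon(\Delta v\otimes\delta w)$, where $\varepsilon$ is the signed exchange of the two middle factors. *Convolution.* For a $d$-coalgebra $C$ and a $d$-algebra $B$, the graded space $\mathrm{Hom}_k(C,B)=\bigoplus_n\mathrm{Hom}^n_k(C,B)$ carries the differential $f\mapsto d_Bf-(-1)^{|f|}f d_C$, the convolution product, and the bracket $$\{f,g\}(c)=\sum(-1)^{(|g|+d-1)|c'|}\{f(c'),g(c'')\}+\sum(-1)^{(d-1)|g|+|g||c_1|}f(c_1)g(c_2),$$ where $\Delta c=\sum c'\otimes c''$ and $\delta c=\sum c_1\otimes c_2$. *The coalgebra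 $V^\vee$.* For a $d$-algebra $V$, let $V^\vee$ be the cofree coproartinian $d$-coalgebra on $V[d]$. With $p:V^\vee\to V[d]\to V$ the projection onto cogenerators (a map of degree $d$), equip it with the coderivation $Q$ of degree $1$ determined by $pQ=(-1)^d\bigl(d_V\,p+\tfrac12\{p,p\}\bigr)$, the bracket being the convolution bracket. **Statement.** Let $V,W$ be $d$-algebras and let $\phi:V^\vee\to W^\vee$ be a morphism of $d$-coalgebras with counit. Then: 1. $V^\vee$ and $W^\vee$ are coproartinian $d$-coalgebras, and $\mathfrak a=\mathrm{Hom}_k(V^\vee,W)$ is a $d$-algebra. 2. With $p_W:W^\vee\to W$ the projection onto cogenerators, $\phi'=p_W\circ\phi$ is an element of $MC(\mathfrak a[d-1])$, and the operations of $\mathfrak a$ with the differential replaced by $d'x=dx+\{\phi',x\}$ form a $d$-algebra $\mathfrak a'$. 3. $(\mathfrak a')^\vee$ is a coproartinian $d$-coalgebra, and it represents the functor $F^\phi_{VW}:(d\text{-}coart)^{op}\to \mathrm{Sets}$ that sends $S$ to the set of all morphisms $V^\vee\otimes S\to W^\vee$ of $d$-coalgebras with counit whose restriction along $V^\vee\cong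 V^\vee\otimes k\to V^\vee\otimes S$ is $\phi$. That is, there are bijections $\mathrm{Hom}_{d\text{-}coart}(S,(\mathfrak a')^\vee)\cong F^\phi_{VW}(S)$, natural in $S$. -/

import Mathlib

open scoped TensorProduct DirectSum

universe u

namespace DAlgebras

noncomputable section

structure GradedSpace (k : Type u) [Field k] where
  carrier : Type u
  [addCommGroup : AddCommGroup carrier]
  [module : Module k carrier]
  deg : ℤ → Submodule k carrier
  isInternal : DirectSum.IsInternal deg

namespace GradedSpace
variable {k : Type u} [Field k]

instance : CoeSort (GradedSpace k) (Type u) := ⟨GradedSpace.carrier⟩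

attribute [instance] GradedSpace.addCommGroup GradedSpace.module

/-- The isomorphism with the direct sum of the homogeneous parts. -/
def decomp (X : GradedSpace k) : X ≃ₗ[k] ⨁ i, X.deg i :=
  (LinearEquiv.ofBijective (DirectSum.coeLinearMap X.deg) X.isInternal).symm

/-- The linear map which is given by `f i` on the part of degree `i`. -/
def elim (X : GradedSpace k) {M : Type u} [AddCommGroup M] [Module k M]
    (f : ∀ i, X.deg i →ₗ[k] M) : X →ₗ[k] M :=
  DirectSum.toModule k ℤ M f ∘ₗ X.decomp.toLinearMap

theorem decomp_of_mem (X : GradedSpace k) {i : ℤ} {x : X} (hx : x ∈ X.deg i) :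
    X.decomp x = DirectSum.lof k ℤ (fun i => X.deg i) i ⟨x, hx⟩ := by
  rw [decomp, LinearEquiv.symm_apply_eq]
  exact (DirectSum.coeLinearMap_lof X.deg i ⟨x, hx⟩).symm

theorem elim_of_mem (X : GradedSpace k) {M : Type u} [AddCommGroup M] [Module k M]
    (f : ∀ i, X.deg i →ₗ[k] M) {i : ℤ} {x : X} (hx : x ∈ X.deg i) :
    X.elim f x = f i ⟨x, hx⟩ := by
  simp [elim, decomp_of_mem X hx]

theorem iSup_deg (X : GradedSpace k) : ⨆ i, X.deg i = ⊤ :=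
  X.isInternal.submodule_iSup_eq_top

theorem hom_ext (X : GradedSpace k) {M : Type*} [AddCommGroup M] [Module k M]
    {f g : X →ₗ[k] M} (h : ∀ i, ∀ x ∈ X.deg i, f x = g x) : f = g := by
  have : ⨆ i, X.deg i ≤ LinearMap.eqLocus f g := iSup_le fun i x hx => h i x hx
  rw [X.iSup_deg] at this
  exact LinearMap.ext fun x => this (Submodule.mem_top)

/-- The projection onto the part of degree `i`. -/
def proj (X : GradedSpace k) (i : ℤ) : X →ₗ[k] X :=
  X.elim fun j => if j = i then (X.deg j).subtype else 0

/-- The sign operator: multiplication by `(-1) ^ (n * i)` on the part of degree `i`. -/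
def sgn (X : GradedSpace k) (n : ℤ) : X →ₗ[k] X :=
  X.elim fun i => (-1 : k) ^ (n * i) • (X.deg i).subtype

theorem proj_of_mem (X : GradedSpace k) {i : ℤ} {x : X} (hx : x ∈ X.deg i) (j : ℤ) :
    X.proj j x = if i = j then x else 0 := by
  rw [proj, elim_of_mem X _ hx]; split_ifs <;> rfl

theorem sgn_of_mem (X : GradedSpace k) {i : ℤ} {x : X} (hx : x ∈ X.deg i) (n : ℤ) :
    X.sgn n x = (-1 : k) ^ (n * i) • x := by
  rw [sgn, elim_of_mem X _ hx]; rfl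

theorem proj_mem (X : GradedSpace k) (i : ℤ) (x : X) : X.proj i x ∈ X.deg i := by
  have : ⨆ j, X.deg j ≤ (X.deg i).comap (X.proj i) := iSup_le fun j y hy => by
    rw [Submodule.mem_comap, proj_of_mem X hy]
    split_ifs with h
    · exact h ▸ hy
    · exact zero_mem _
  rw [X.iSup_deg] at this
  exact this Submodule.mem_top

/-- A criterion for a grading by submodules. -/
theorem isInternal_of_proj {M : Type u} [AddCommGroup M] [Module k M]
    (p : ℤ → Submodule k M) (htop : ⨆ i, p i = ⊤) (π : ℤ → M →ₗ[k] M)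
    (h : ∀ i, ∀ x ∈ p i, ∀ j, π j x = if i = j then x else 0) :
    DirectSum.IsInternal p := by
  refine DirectSum.isInternal_submodule_of_iSupIndep_of_iSup_eq_top ?_ htop
  intro i
  rw [Submodule.disjoint_def]
  intro x hx hx'
  have h0 : ⨆ j, ⨆ (_ : j ≠ i), p j ≤ LinearMap.ker (π i) :=
    iSup₂_le fun j hj y hy => by rw [LinearMap.mem_ker, h j y hy, if_neg hj]
  have h1 := h i x hx i
  rw [if_pos rfl] at h1
  rw [← h1]
  exact h0 hx'

/-- The weight map, which is `x ↦ single i x` on the part of degree `i`. -/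
def weight (X : GradedSpace k) : X →ₗ[k] ℤ →₀ X :=
  X.elim fun i => Finsupp.lsingle i ∘ₗ (X.deg i).subtype

theorem weight_of_mem (X : GradedSpace k) {i : ℤ} {x : X} (hx : x ∈ X.deg i) :
    X.weight x = Finsupp.single i x := by
  rw [weight, elim_of_mem X _ hx]; rfl

theorem isInternal_of_weight {M : Type u} [AddCommGroup M] [Module k M]
    (p : ℤ → Submodule k M) (htop : ⨆ i, p i = ⊤) (w : M →ₗ[k] ℤ →₀ M)
    (h : ∀ i, ∀ x ∈ p i, w x = Finsupp.single i x) :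
    DirectSum.IsInternal p :=
  isInternal_of_proj p htop (fun j => Finsupp.lapply j ∘ₗ w) fun i x hx j => by
    simp [h i x hx, Finsupp.single_apply]

/-- The ground field in degree `0`. -/
@[reducible] def unit (k : Type u) [Field k] : GradedSpace k where
  carrier := k
  deg i := if i = 0 then ⊤ else ⊥
  isInternal := isInternal_of_weight _
    (top_unique (le_iSup_of_le 0 (by simp))) (Finsupp.lsingle 0) fun i x hx => by
      split_ifs at hx with h
      · rw [h]; rfl
      · rw [(Submodule.mem_bot k).1 hx]; simp

/-- The shift `X[n]`, with `X[n]^i = X^(i+n)`. -/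
@[reducible] def shift (X : GradedSpace k) (n : ℤ) : GradedSpace k where
  carrier := X
  deg i := X.deg (i + n)
  isInternal := isInternal_of_weight _
    (top_unique (X.iSup_deg ▸ iSup_le fun i => le_iSup_of_le (i - n) (by simp)))
    (Finsupp.lmapDomain X k (fun i => i - n) ∘ₗ X.weight) fun i x hx => by
      simp [weight_of_mem X hx]

/-- The part of degree `n` of a tensor product. -/
@[reducible] def tensorDeg (X Y : GradedSpace k) (n : ℤ) : Submodule k (X ⊗[k] Y) :=
  ⨆ (i : ℤ) (j : ℤ) (_ : i + j = n), LinearMap.range (TensorProduct.mapIncl (X.deg i) (Y.deg j))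

theorem tmul_mem_tensorDeg (X Y : GradedSpace k) {i j n : ℤ} (h : i + j = n) {x : X} {y : Y}
    (hx : x ∈ X.deg i) (hy : y ∈ Y.deg j) : x ⊗ₜ[k] y ∈ tensorDeg X Y n :=
  Submodule.mem_iSup_of_mem i <| Submodule.mem_iSup_of_mem j <| Submodule.mem_iSup_of_mem h
    ⟨(⟨x, hx⟩ : X.deg i) ⊗ₜ (⟨y, hy⟩ : Y.deg j), by simp [TensorProduct.mapIncl]⟩

theorem tensorDeg_le (X Y : GradedSpace k) {n : ℤ} {P : Submodule k (X ⊗[k] Y)}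
    (h : ∀ i j, i + j = n → ∀ x ∈ X.deg i, ∀ y ∈ Y.deg j, x ⊗ₜ[k] y ∈ P) :
    tensorDeg X Y n ≤ P :=
  iSup_le fun i => iSup_le fun j => iSup_le fun hn => by
    rintro _ ⟨t, rfl⟩
    induction t using TensorProduct.induction_on with
    | zero => simp
    | tmul x y => exact h i j hn x x.2 y y.2
    | add a b ha hb => rw [map_add]; exact add_mem ha hb

/-- Two linear maps on a tensor product agree if they agree on homogeneous tensors. -/
theorem tensor_hom_ext (X Y : GradedSpace k) {M : Type*} [AddCommGroup M] [Module k M]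
    {f g : X ⊗[k] Y →ₗ[k] M}
    (h : ∀ i j, ∀ x ∈ X.deg i, ∀ y ∈ Y.deg j, f (x ⊗ₜ y) = g (x ⊗ₜ y)) : f = g := by
  refine TensorProduct.ext ?_
  refine X.hom_ext fun i x hx => Y.hom_ext fun j y hy => h i j x hx y hy

theorem iSup_tensorDeg (X Y : GradedSpace k) : ⨆ n, tensorDeg X Y n = ⊤ := by
  have : (⨆ n, tensorDeg X Y n).mkQ = 0 := tensor_hom_ext X Y fun i j x hx y hy => by
    rw [LinearMap.zero_apply, Submodule.mkQ_apply, Submodule.Quotient.mk_eq_zero]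
    exact Submodule.mem_iSup_of_mem (i + j) (tmul_mem_tensorDeg X Y rfl hx hy)
  rw [← Submodule.ker_mkQ (⨆ n, tensorDeg X Y n), this, LinearMap.ker_zero]

/-- The tensor product of graded spaces. -/
@[reducible] def tensor (X Y : GradedSpace k) : GradedSpace k where
  carrier := X ⊗[k] Y
  deg := tensorDeg X Y
  isInternal := isInternal_of_weight _ (iSup_tensorDeg X Y)
    (Finsupp.lmapDomain (X ⊗[k] Y) k (fun p : ℤ × ℤ => p.1 + p.2) ∘ₗ
      (finsuppTensorFinsupp k k X Y ℤ ℤ).toLinearMap ∘ₗ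
      TensorProduct.map X.weight Y.weight)
    fun n => tensorDeg_le (P := LinearMap.eqLocus _ (Finsupp.lsingle n)) X Y
      fun i j hn x hx y hy => by
        simp [weight_of_mem X hx, weight_of_mem Y hy, hn]

/-- The direct sum of a family of graded spaces. -/
@[reducible] def directSum {ι : Type} [DecidableEq ι] (Y : ι → GradedSpace k) : GradedSpace k where
  carrier := ⨁ t, Y t
  deg n := ⨆ t, ((Y t).deg n).map (DirectSum.lof k ι (fun t => Y t) t)
  isInternal := isInternal_of_weight _
    (by
      rw [iSup_comm]
      simp_rw [← Submodule.map_iSup, iSup_deg, Submodule.map_top]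
      rw [eq_top_iff]
      rintro x -
      induction x using DirectSum.induction_on with
      | zero => exact zero_mem _
      | of t y => exact Submodule.mem_iSup_of_mem t ⟨y, rfl⟩
      | add x y hx hy => exact add_mem hx hy)
    (DirectSum.toModule k ι _ fun t =>
      Finsupp.mapRange.linearMap (DirectSum.lof k ι (fun t => Y t) t) ∘ₗ (Y t).weight)
    fun n => by
      suffices h : (⨆ t, ((Y t).deg n).map (DirectSum.lof k ι (fun t => Y t) t)) ≤
          LinearMap.eqLocus (DirectSum.toModule k ι _ fun t =>
            Finsupp.mapRange.linearMap (DirectSum.lof k ι (fun t => Y t) t) ∘ₗ (Y t).weight)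
            (Finsupp.lsingle n) from fun x hx => h hx
      refine iSup_le fun t => ?_
      rintro _ ⟨y, hy, rfl⟩
      simp [weight_of_mem (Y t) hy]


/-- The direct sum of two graded spaces. -/
@[reducible] def prod (X Y : GradedSpace k) : GradedSpace k where
  carrier := X × Y
  deg i := (X.deg i).prod (Y.deg i)
  isInternal := isInternal_of_proj _
    (by
      have hX : ∀ x : X, (x, (0 : Y)) ∈ ⨆ i, (X.deg i).prod (Y.deg i) := by
        have : ⨆ i, X.deg i ≤ (⨆ i, (X.deg i).prod (Y.deg i)).comap (LinearMap.inl k X Y) :=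
          iSup_le fun i x hx => Submodule.mem_iSup_of_mem i ⟨hx, zero_mem _⟩
        rw [X.iSup_deg] at this
        exact fun x => this Submodule.mem_top
      have hY : ∀ y : Y, ((0 : X), y) ∈ ⨆ i, (X.deg i).prod (Y.deg i) := by
        have : ⨆ i, Y.deg i ≤ (⨆ i, (X.deg i).prod (Y.deg i)).comap (LinearMap.inr k X Y) :=
          iSup_le fun i y hy => Submodule.mem_iSup_of_mem i ⟨zero_mem _, hy⟩
        rw [Y.iSup_deg] at this
        exact fun y => this Submodule.mem_top
      rw [eq_top_iff]
      rintro ⟨x, y⟩ -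
      simpa using add_mem (hX x) (hY y))
    (fun i => LinearMap.prodMap (X.proj i) (Y.proj i))
    (by
      rintro i ⟨x, y⟩ ⟨hx, hy⟩ j
      rw [LinearMap.prodMap_apply, proj_of_mem X hx, proj_of_mem Y hy]
      split_ifs <;> rfl)

/-- A linear map of degree `n`. -/
def IsHomogeneous (X Y : GradedSpace k) (f : X →ₗ[k] Y) (n : ℤ) : Prop :=
  ∀ i, ∀ x ∈ X.deg i, f x ∈ Y.deg (i + n)

theorem IsHomogeneous.comp {X Y Z : GradedSpace k} {g : Y →ₗ[k] Z} {f : X →ₗ[k] Y} {m n : ℤ}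
    (hg : IsHomogeneous Y Z g m) (hf : IsHomogeneous X Y f n) :
    IsHomogeneous X Z (g ∘ₗ f) (n + m) := fun i x hx => by
  rw [← add_assoc]; exact hg _ _ (hf i x hx)

theorem IsHomogeneous.add {X Y : GradedSpace k} {f g : X →ₗ[k] Y} {n : ℤ}
    (hf : IsHomogeneous X Y f n) (hg : IsHomogeneous X Y g n) :
    IsHomogeneous X Y (f + g) n := fun i x hx => add_mem (hf i x hx) (hg i x hx)

theorem IsHomogeneous.smul {X Y : GradedSpace k} {f : X →ₗ[k] Y} {n : ℤ} (c : k)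
    (hf : IsHomogeneous X Y f n) : IsHomogeneous X Y (c • f) n :=
  fun i x hx => Submodule.smul_mem _ _ (hf i x hx)

theorem IsHomogeneous.id (X : GradedSpace k) : IsHomogeneous X X LinearMap.id 0 :=
  fun i x hx => by simpa using hx

theorem isHomogeneous_sgn (X : GradedSpace k) (n : ℤ) : IsHomogeneous X X (X.sgn n) 0 :=
  fun i x hx => by
    rw [sgn_of_mem X hx, add_zero]; exact Submodule.smul_mem _ _ hx

theorem IsHomogeneous.map {X Y Z W : GradedSpace k} {f : X →ₗ[k] Z} {g : Y →ₗ[k] W} {m n : ℤ}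
    (hf : IsHomogeneous X Z f m) (hg : IsHomogeneous Y W g n) :
    IsHomogeneous (X.tensor Y) (Z.tensor W) (TensorProduct.map f g) (m + n) := fun i =>
  tensorDeg_le (P := (tensorDeg Z W (i + (m + n))).comap (TensorProduct.map f g)) X Y
    fun a b hab x hx y hy => by
      rw [Submodule.mem_comap, TensorProduct.map_tmul]
      exact tmul_mem_tensorDeg Z W (by omega) (hf a x hx) (hg b y hy)

theorem IsHomogeneous.sgn_apply {X Y : GradedSpace k} {f : X →ₗ[k] Y} {m : ℤ}
    (hf : IsHomogeneous X Y f m) (n : ℤ) (x : X) :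
    Y.sgn n (f x) = (-1 : k) ^ (n * m) • f (X.sgn n x) := by
  have : Y.sgn n ∘ₗ f = (-1 : k) ^ (n * m) • f ∘ₗ X.sgn n := X.hom_ext fun i x hx => by
    simp only [LinearMap.comp_apply, LinearMap.smul_apply, sgn_of_mem X hx,
      sgn_of_mem Y (hf i x hx), map_smul, smul_smul]
    rw [← zpow_add₀ (by simp), mul_add, add_comm]
  exact LinearMap.congr_fun this x

theorem IsHomogeneous.proj_apply {X Y : GradedSpace k} {f : X →ₗ[k] Y} {m : ℤ}
    (hf : IsHomogeneous X Y f m) (n : ℤ) (x : X) :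
    Y.proj (n + m) (f x) = f (X.proj n x) := by
  have : Y.proj (n + m) ∘ₗ f = f ∘ₗ X.proj n := X.hom_ext fun i x hx => by
    simp only [LinearMap.comp_apply, proj_of_mem X hx, proj_of_mem Y (hf i x hx), add_left_inj]
    split_ifs <;> simp
  exact LinearMap.congr_fun this x

theorem sgn_tensor (X Y : GradedSpace k) (n : ℤ) :
    (X.tensor Y).sgn n = TensorProduct.map (X.sgn n) (Y.sgn n) :=
  tensor_hom_ext X Y fun i j x hx y hy => by
    rw [sgn_of_mem (X.tensor Y) (tmul_mem_tensorDeg X Y rfl hx hy), TensorProduct.map_tmul,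
      sgn_of_mem X hx, sgn_of_mem Y hy, TensorProduct.smul_tmul_smul, ← zpow_add₀ (by simp),
      mul_add]

theorem sgn_sgn (X : GradedSpace k) (n : ℤ) (x : X) : X.sgn n (X.sgn n x) = x := by
  have : X.sgn n ∘ₗ X.sgn n = LinearMap.id := X.hom_ext fun i x hx => by
    simp only [LinearMap.comp_apply, sgn_of_mem X hx, map_smul, smul_smul, LinearMap.id_apply]
    rw [← zpow_add₀ (by simp), Even.neg_one_zpow ⟨_, rfl⟩, one_smul]
  exact LinearMap.congr_fun this x

theorem exists_sum_proj (X : GradedSpace k) (x : X) : ∃ s : Finset ℤ, ∑ i ∈ s, X.proj i x = x := by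
  classical
  have : ⨆ i, X.deg i ≤ (⊤ : Submodule k X) := le_top
  have hx : x ∈ ⨆ i, X.deg i := by rw [X.iSup_deg]; trivial
  suffices h : ∃ s : Finset ℤ, ∀ t, s ⊆ t → ∑ i ∈ t, X.proj i x = x from
    h.imp fun s hs => hs s subset_rfl
  induction hx using Submodule.iSup_induction' with
  | mem i x hx =>
    refine ⟨{i}, fun t ht => ?_⟩
    simp only [proj_of_mem X hx]
    rw [Finset.sum_ite_eq, if_pos (ht (Finset.mem_singleton_self i))]
  | zero => exact ⟨∅, by simp⟩
  | add x y _ _ hx hy =>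
    obtain ⟨s, hs⟩ := hx
    obtain ⟨t, ht⟩ := hy
    refine ⟨s ∪ t, fun r hr => ?_⟩
    simp only [map_add, Finset.sum_add_distrib]
    rw [hs r (Finset.union_subset_left hr), ht r (Finset.union_subset_right hr)]

/-- A subspace which contains the homogeneous components of its elements. -/
@[reducible] def sub (X : GradedSpace k) (N : Submodule k X)
    (hN : ∀ i, ∀ x ∈ N, X.proj i x ∈ N) : GradedSpace k where
  carrier := N
  deg i := (X.deg i).comap N.subtype
  isInternal := isInternal_of_proj _
    (by
      rw [eq_top_iff]
      rintro x -
      obtain ⟨s, hs⟩ := X.exists_sum_proj x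
      have : x = ∑ i ∈ s, (⟨X.proj i x, hN i x x.2⟩ : N) := Subtype.ext (by simp [hs])
      rw [this]
      exact sum_mem fun i _ => Submodule.mem_iSup_of_mem i (X.proj_mem i x))
    (fun i => (X.proj i).restrict (hN i))
    (fun i x hx j => Subtype.ext <| by
      rw [LinearMap.coe_restrict_apply, proj_of_mem X (x := (x : X)) hx]
      split_ifs <;> rfl)

/-- An injective map of degree `0` reflects the degree. -/
theorem IsHomogeneous.mem_of_injective {X Y : GradedSpace k} {f : X →ₗ[k] Y}
    (hf : IsHomogeneous X Y f 0) (hi : Function.Injective f) {n : ℤ} {x : X}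
    (hx : f x ∈ Y.deg n) : x ∈ X.deg n := by
  have h := hf.proj_apply n x
  rw [add_zero, proj_of_mem Y hx, if_pos rfl] at h
  rw [hi h]
  exact X.proj_mem n x

/-- The symmetry of the tensor product, `x ⊗ y ↦ (-1) ^ (|x| * |y|) y ⊗ x`. -/
def swap (X Y : GradedSpace k) : X ⊗[k] Y →ₗ[k] Y ⊗[k] X :=
  TensorProduct.lift <| X.elim fun i =>
    LinearMap.lcomp k (Y ⊗[k] X) (Y.sgn i) ∘ₗ (TensorProduct.mk k Y X).flip ∘ₗ (X.deg i).subtype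

theorem swap_of_mem (X Y : GradedSpace k) {i : ℤ} {x : X} (hx : x ∈ X.deg i) (y : Y) :
    swap X Y (x ⊗ₜ y) = Y.sgn i y ⊗ₜ x := by
  rw [swap, TensorProduct.lift.tmul, elim_of_mem X _ hx]; rfl

theorem swap_of_mem_mem (X Y : GradedSpace k) {i j : ℤ} {x : X} (hx : x ∈ X.deg i) {y : Y}
    (hy : y ∈ Y.deg j) : swap X Y (x ⊗ₜ y) = (-1 : k) ^ (i * j) • y ⊗ₜ x := by
  rw [swap_of_mem X Y hx, sgn_of_mem Y hy]; rfl

theorem isHomogeneous_swap (X Y : GradedSpace k) :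
    IsHomogeneous (X.tensor Y) (Y.tensor X) (swap X Y) 0 := fun n =>
  tensorDeg_le (P := (tensorDeg Y X (n + 0)).comap (swap X Y)) X Y fun i j h x hx y hy => by
    rw [Submodule.mem_comap, swap_of_mem_mem X Y hx hy]
    exact Submodule.smul_mem _ _ (tmul_mem_tensorDeg Y X (by omega) hy hx)

/-- The cyclic permutation `(x ⊗ y) ⊗ z ↦ ± (z ⊗ x) ⊗ y`, with the sign of the permutation of
graded factors. -/
def cyc (X : GradedSpace k) : (X ⊗[k] X) ⊗[k] X →ₗ[k] (X ⊗[k] X) ⊗[k] X :=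
  (swap X X).rTensor X ∘ₗ (TensorProduct.assoc k X X X).symm.toLinearMap ∘ₗ
    (swap X X).lTensor X ∘ₗ (TensorProduct.assoc k X X X).toLinearMap

/-- The differential `D ⊗ 1 + 1 ⊗ E` of a tensor product,
`x ⊗ y ↦ D x ⊗ y + (-1) ^ |x| x ⊗ E y`. -/
def tensorDiff (X Y : GradedSpace k) (D : X →ₗ[k] X) (E : Y →ₗ[k] Y) :
    X ⊗[k] Y →ₗ[k] X ⊗[k] Y :=
  TensorProduct.map D LinearMap.id + TensorProduct.map (X.sgn 1) E

theorem isHomogeneous_tensorDiff {X Y : GradedSpace k} {D : X →ₗ[k] X} {E : Y →ₗ[k] Y}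
    (hD : IsHomogeneous X X D 1) (hE : IsHomogeneous Y Y E 1) :
    IsHomogeneous (X.tensor Y) (X.tensor Y) (tensorDiff X Y D E) 1 := by
  have h₁ := hD.map (IsHomogeneous.id Y)
  have h₂ := (isHomogeneous_sgn X 1).map hE
  rw [add_zero] at h₁
  rw [zero_add] at h₂
  exact h₁.add h₂

theorem isHomogeneous_of_tmul {X Y Z : GradedSpace k} {f : X ⊗[k] Y →ₗ[k] Z} {n : ℤ}
    (h : ∀ i j, ∀ x ∈ X.deg i, ∀ y ∈ Y.deg j, f (x ⊗ₜ y) ∈ Z.deg (i + j + n)) :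
    IsHomogeneous (X.tensor Y) Z f n := fun m =>
  tensorDeg_le (P := (Z.deg (m + n)).comap f) X Y fun i j hij x hx y hy => by
    rw [← hij]; exact h i j x hx y hy

theorem isHomogeneous_assoc (X Y Z : GradedSpace k) :
    IsHomogeneous ((X.tensor Y).tensor Z) (X.tensor (Y.tensor Z))
      (TensorProduct.assoc k X Y Z).toLinearMap 0 := by
  refine isHomogeneous_of_tmul fun i j t ht z hz => ?_
  have : tensorDeg X Y i ≤ ((X.tensor (Y.tensor Z)).deg (i + j + 0)).comap
      ((TensorProduct.assoc k X Y Z).toLinearMap ∘ₗ (TensorProduct.mk k (X ⊗[k] Y) Z).flip z) :=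
    tensorDeg_le X Y fun a b hab x hx y hy =>
      tmul_mem_tensorDeg X (Y.tensor Z) (j := b + j) (by omega) hx (tmul_mem_tensorDeg Y Z rfl hy hz)
  exact this ht

theorem isHomogeneous_assoc_symm (X Y Z : GradedSpace k) :
    IsHomogeneous (X.tensor (Y.tensor Z)) ((X.tensor Y).tensor Z)
      (TensorProduct.assoc k X Y Z).symm.toLinearMap 0 := by
  refine isHomogeneous_of_tmul fun i j x hx t ht => ?_
  have : tensorDeg Y Z j ≤ (((X.tensor Y).tensor Z).deg (i + j + 0)).comap
      ((TensorProduct.assoc k X Y Z).symm.toLinearMap ∘ₗ TensorProduct.mk k X (Y ⊗[k] Z) x) :=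
    tensorDeg_le Y Z fun a b hab y hy z hz =>
      tmul_mem_tensorDeg (X.tensor Y) Z (i := i + a) (by omega) (tmul_mem_tensorDeg X Y rfl hx hy) hz
  exact this ht

end GradedSpace

open GradedSpace

/-- The operations of a `d`-coalgebra with counit, without their identities: a coproduct and a
counit of degree `0` and a cobracket of degree `1 - d`. -/
structure CoalgData (k : Type u) [Field k] (d : ℤ) where
  space : GradedSpace k
  comul : space →ₗ[k] space ⊗[k] space
  counit : space →ₗ[k] k
  cobr : space →ₗ[k] space ⊗[k] space
  comul_deg : IsHomogeneous space (space.tensor space) comul 0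
  counit_deg : IsHomogeneous space (GradedSpace.unit k) counit 0
  cobr_deg : IsHomogeneous space (space.tensor space) cobr (1 - d)

namespace CoalgData
variable {k : Type u} [Field k] {d : ℤ}

/-- The identities of a `d`-coalgebra with counit at the element `x`. -/
structure LawsAt (C : CoalgData k d) (x : C.space) : Prop where
  cocomm : swap C.space C.space (C.comul x) = C.comul x
  coassoc : TensorProduct.assoc k C.space C.space C.space (C.comul.rTensor C.space (C.comul x)) =
    C.comul.lTensor C.space (C.comul x)
  counit_comul : TensorProduct.lid k C.space (C.counit.rTensor C.space (C.comul x)) = x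
  coskew : swap C.space C.space (C.cobr x) = (-1 : k) ^ d • C.cobr x
  cojacobi : C.cobr.rTensor C.space (C.cobr x) + cyc C.space (C.cobr.rTensor C.space (C.cobr x)) +
    cyc C.space (cyc C.space (C.cobr.rTensor C.space (C.cobr x))) = 0
  coleibniz : C.comul.rTensor C.space (C.cobr x) =
    (TensorProduct.assoc k C.space C.space C.space).symm
      (TensorProduct.map (C.space.sgn (d - 1)) C.cobr (C.comul x)) +
    (TensorProduct.assoc k C.space C.space C.space).symm
      ((swap C.space C.space).lTensor C.space
        (TensorProduct.assoc k C.space C.space C.space (C.cobr.rTensor C.space (C.comul x))))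
  counit_cobr : TensorProduct.lid k C.space (C.counit.rTensor C.space (C.cobr x)) = 0

/-- `D` is a coderivation of degree `1`. -/
structure IsCoderivation (C : CoalgData k d) (D : C.space →ₗ[k] C.space) : Prop where
  homogeneous : IsHomogeneous C.space C.space D 1
  comul : ∀ x, C.comul (D x) = tensorDiff C.space C.space D D (C.comul x)
  counit : ∀ x, C.counit (D x) = 0
  cobr : ∀ x, C.cobr (D x) = (-1 : k) ^ (d - 1) • tensorDiff C.space C.space D D (C.cobr x)

/-- `N` is a graded subspace, closed under the coproduct and the cobracket, on which the identities
of a `d`-coalgebra with counit hold. -/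
structure IsLawful (C : CoalgData k d) (N : Submodule k C.space) : Prop where
  proj : ∀ i, ∀ x ∈ N, C.space.proj i x ∈ N
  comul : ∀ x ∈ N, C.comul x ∈ LinearMap.range (TensorProduct.mapIncl N N)
  cobr : ∀ x ∈ N, C.cobr x ∈ LinearMap.range (TensorProduct.mapIncl N N)
  laws : ∀ x ∈ N, C.LawsAt x

/-- The largest `d`-coalgebra which is contained in `C`. -/
def largest (C : CoalgData k d) : Submodule k C.space := sSup {N | C.IsLawful N}

theorem laws_zero (C : CoalgData k d) : C.LawsAt 0 := by
  constructor <;> simp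

theorem LawsAt.add {C : CoalgData k d} {x y : C.space} (hx : C.LawsAt x) (hy : C.LawsAt y) :
    C.LawsAt (x + y) where
  cocomm := by simp only [map_add, hx.cocomm, hy.cocomm]
  coassoc := by simp only [map_add, hx.coassoc, hy.coassoc]
  counit_comul := by simp only [map_add, hx.counit_comul, hy.counit_comul]
  coskew := by simp only [map_add, hx.coskew, hy.coskew, smul_add]
  cojacobi := by
    have := congrArg₂ (· + ·) hx.cojacobi hy.cojacobi
    simp only [map_add, add_zero] at this ⊢
    rw [← this]; abel
  coleibniz := by simp only [map_add, hx.coleibniz, hy.coleibniz]; abel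
  counit_cobr := by simp only [map_add, hx.counit_cobr, hy.counit_cobr, add_zero]

theorem range_mapIncl_mono {M : Type*} [AddCommGroup M] [Module k M] {N P : Submodule k M}
    (h : N ≤ P) : LinearMap.range (TensorProduct.mapIncl N N) ≤
      LinearMap.range (TensorProduct.mapIncl P P) := by
  rintro _ ⟨t, rfl⟩
  refine ⟨TensorProduct.map (Submodule.inclusion h) (Submodule.inclusion h) t, ?_⟩
  rw [TensorProduct.mapIncl, TensorProduct.mapIncl, ← LinearMap.comp_apply, ← TensorProduct.map_comp]
  rfl

theorem le_largest {C : CoalgData k d} {N : Submodule k C.space} (h : C.IsLawful N) :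
    N ≤ C.largest := le_sSup h

theorem isLawful_largest (C : CoalgData k d) : C.IsLawful C.largest where
  proj i := by
    refine sSup_le (a := C.largest.comap (C.space.proj i)) fun N hN x hx => ?_
    exact le_largest hN (hN.proj i x hx)
  comul := by
    refine sSup_le (a := (LinearMap.range
      (TensorProduct.mapIncl C.largest C.largest)).comap C.comul) fun N hN x hx => ?_
    exact range_mapIncl_mono (le_largest hN) (hN.comul x hx)
  cobr := by
    refine sSup_le (a := (LinearMap.range
      (TensorProduct.mapIncl C.largest C.largest)).comap C.cobr) fun N hN x hx => ?_
    exact range_mapIncl_mono (le_largest hN) (hN.cobr x hx)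
  laws x hx := by
    rw [largest, sSup_eq_iSup'] at hx
    induction hx using Submodule.iSup_induction' with
    | mem N x hx => exact N.2.laws x hx
    | zero => exact C.laws_zero
    | add x y _ _ hx hy => exact hx.add hy

/-- The restriction of a map `M → M ⊗ M` to a subspace that it respects. -/
def restrictTensor {M : Type u} [AddCommGroup M] [Module k M] (N : Submodule k M)
    (f : M →ₗ[k] M ⊗[k] M) (h : ∀ x ∈ N, f x ∈ LinearMap.range (TensorProduct.mapIncl N N)) :
    N →ₗ[k] N ⊗[k] N :=
  LinearEquiv.toLinearMap (LinearEquiv.ofInjective (TensorProduct.mapIncl N N)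
    (TensorProduct.map_injective_of_flat_flat _ _ N.injective_subtype N.injective_subtype)).symm ∘ₗ
      (f ∘ₗ N.subtype).codRestrict _ fun x => h x x.2

theorem mapIncl_restrictTensor {M : Type u} [AddCommGroup M] [Module k M] (N : Submodule k M)
    (f : M →ₗ[k] M ⊗[k] M) (h : ∀ x ∈ N, f x ∈ LinearMap.range (TensorProduct.mapIncl N N))
    (x : N) : TensorProduct.mapIncl N N (restrictTensor N f h x) = f x :=
  congrArg Subtype.val (LinearEquiv.apply_symm_apply (LinearEquiv.ofInjective
    (TensorProduct.mapIncl N N) (TensorProduct.map_injective_of_flat_flat _ _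
      N.injective_subtype N.injective_subtype)) ⟨f x, h x x.2⟩)

theorem isHomogeneous_subtype (X : GradedSpace k) (N : Submodule k X)
    (hN : ∀ i, ∀ x ∈ N, X.proj i x ∈ N) : IsHomogeneous (X.sub N hN) X N.subtype 0 :=
  fun i x hx => by rw [add_zero]; exact hx

theorem isHomogeneous_restrictTensor (X : GradedSpace k) (N : Submodule k X)
    (hN : ∀ i, ∀ x ∈ N, X.proj i x ∈ N) (f : X →ₗ[k] X ⊗[k] X)
    (h : ∀ x ∈ N, f x ∈ LinearMap.range (TensorProduct.mapIncl N N)) {n : ℤ}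
    (hf : IsHomogeneous X (X.tensor X) f n) :
    IsHomogeneous (X.sub N hN) ((X.sub N hN).tensor (X.sub N hN)) (restrictTensor N f h) n :=
  fun i x hx => by
    have h₀ : IsHomogeneous ((X.sub N hN).tensor (X.sub N hN)) (X.tensor X)
        (TensorProduct.mapIncl N N) 0 := by
      have := (isHomogeneous_subtype X N hN).map (isHomogeneous_subtype X N hN)
      rwa [add_zero] at this
    refine h₀.mem_of_injective (TensorProduct.map_injective_of_flat_flat _ _
      N.injective_subtype N.injective_subtype) ?_
    rw [mapIncl_restrictTensor]
    exact hf i x hx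

/-- The structure of `C` on a subspace that is closed under the operations. -/
@[reducible] def sub (C : CoalgData k d) (N : Submodule k C.space) (h : C.IsLawful N) : CoalgData k d where
  space := C.space.sub N h.proj
  comul := restrictTensor N C.comul h.comul
  counit := C.counit ∘ₗ N.subtype
  cobr := restrictTensor N C.cobr h.cobr
  comul_deg := isHomogeneous_restrictTensor _ _ _ _ _ C.comul_deg
  counit_deg := fun i x hx => C.counit_deg i x hx
  cobr_deg := isHomogeneous_restrictTensor _ _ _ _ _ C.cobr_deg

end CoalgData

namespace GradedSpace
variable {k : Type u} [Field k]

theorem tensorDiff_tmul (X Y : GradedSpace k) (D : X →ₗ[k] X) (E : Y →ₗ[k] Y) (x : X) (y : Y) :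
    tensorDiff X Y D E (x ⊗ₜ y) = D x ⊗ₜ y + X.sgn 1 x ⊗ₜ E y := rfl

theorem swap_tensorDiff (X Y : GradedSpace k) {D : X →ₗ[k] X} {E : Y →ₗ[k] Y}
    (hD : IsHomogeneous X X D 1) (hE : IsHomogeneous Y Y E 1) (t : X ⊗[k] Y) :
    swap X Y (tensorDiff X Y D E t) = tensorDiff Y X E D (swap X Y t) := by
  suffices h : swap X Y ∘ₗ tensorDiff X Y D E = tensorDiff Y X E D ∘ₗ swap X Y from
    LinearMap.congr_fun h t
  refine tensor_hom_ext X Y fun i j x hx y hy => ?_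
  have h : (-1 : k) ≠ 0 := by simp
  have e : (-1 : k) ^ (1 * i) * (-1 : k) ^ (i * (j + 1)) = (-1 : k) ^ (i * j) := by
    rw [← zpow_add₀ h, show 1 * i + i * (j + 1) = i * j + (i + i) by ring, zpow_add₀ h,
      Even.neg_one_zpow ⟨i, rfl⟩, mul_one]
  have e' : (-1 : k) ^ ((i + 1) * j) = (-1 : k) ^ (i * j) * (-1 : k) ^ (1 * j) := by
    rw [← zpow_add₀ h]; congr 1; ring
  rw [LinearMap.comp_apply, LinearMap.comp_apply, tensorDiff_tmul, map_add, sgn_of_mem X hx,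
    swap_of_mem_mem X Y (hD i x hx) hy, swap_of_mem_mem X Y hx hy, ← TensorProduct.smul_tmul',
    map_smul, swap_of_mem_mem X Y hx (hE j y hy), map_smul, tensorDiff_tmul, sgn_of_mem Y hy,
    ← TensorProduct.smul_tmul', smul_add, smul_smul, smul_smul, e, e', add_comm]

theorem assoc_tensorDiff (X : GradedSpace k) {D : X →ₗ[k] X} (t : (X ⊗[k] X) ⊗[k] X) :
    TensorProduct.assoc k X X X (tensorDiff (X.tensor X) X (tensorDiff X X D D) D t) =
      tensorDiff X (X.tensor X) D (tensorDiff X X D D) (TensorProduct.assoc k X X X t) := by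
  suffices h : (TensorProduct.assoc k X X X).toLinearMap ∘ₗ
      tensorDiff (X.tensor X) X (tensorDiff X X D D) D =
      tensorDiff X (X.tensor X) D (tensorDiff X X D D) ∘ₗ
        (TensorProduct.assoc k X X X).toLinearMap from LinearMap.congr_fun h t
  refine TensorProduct.ext_threefold fun x y z => ?_
  have hs : (X.tensor X).sgn 1 (x ⊗ₜ y) = X.sgn 1 x ⊗ₜ X.sgn 1 y := by rw [sgn_tensor]; rfl
  change TensorProduct.assoc k X X X ((D x ⊗ₜ y + X.sgn 1 x ⊗ₜ D y) ⊗ₜ z +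
    (X.tensor X).sgn 1 (x ⊗ₜ y) ⊗ₜ D z) =
    D x ⊗ₜ (y ⊗ₜ z) + X.sgn 1 x ⊗ₜ (D y ⊗ₜ z + X.sgn 1 y ⊗ₜ D z)
  rw [hs]
  simp only [TensorProduct.add_tmul, map_add, TensorProduct.assoc_tmul, TensorProduct.tmul_add,
    add_assoc]

theorem assoc_symm_tensorDiff (X : GradedSpace k) {D : X →ₗ[k] X} (t : X ⊗[k] (X ⊗[k] X)) :
    (TensorProduct.assoc k X X X).symm (tensorDiff X (X.tensor X) D (tensorDiff X X D D) t) =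
      tensorDiff (X.tensor X) X (tensorDiff X X D D) D ((TensorProduct.assoc k X X X).symm t) := by
  rw [LinearEquiv.symm_apply_eq, assoc_tensorDiff, LinearEquiv.apply_symm_apply]

/-- Compatibility of `f ⊗ 1` with differentials. -/
theorem rTensor_tensorDiff {X Y Z : GradedSpace k} {D : X →ₗ[k] X} {D' : Y →ₗ[k] Y}
    {E : Z →ₗ[k] Z} {f : X →ₗ[k] Y} {m : ℤ} (hf : IsHomogeneous X Y f m)
    (h : ∀ x, f (D x) = (-1 : k) ^ m • D' (f x)) (t : X ⊗[k] Z) :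
    f.rTensor Z (tensorDiff X Z D E t) = (-1 : k) ^ m • tensorDiff Y Z D' E (f.rTensor Z t) := by
  suffices h : f.rTensor Z ∘ₗ tensorDiff X Z D E =
    (-1 : k) ^ m • tensorDiff Y Z D' E ∘ₗ f.rTensor Z from LinearMap.congr_fun h t
  refine TensorProduct.ext' fun x z => ?_
  simp only [LinearMap.comp_apply, LinearMap.smul_apply, tensorDiff_tmul, map_add,
    LinearMap.rTensor_tmul, h, hf.sgn_apply, one_mul, smul_add, TensorProduct.smul_tmul',
    smul_smul]
  rw [← zpow_add₀ (by simp), Even.neg_one_zpow ⟨m, rfl⟩, one_smul]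

/-- Compatibility of `1 ⊗ f`, with the sign of `f`, with differentials. -/
theorem map_sgn_tensorDiff {X Y Z : GradedSpace k} {D : X →ₗ[k] X} {D' : Y →ₗ[k] Y}
    {E : Z →ₗ[k] Z} {f : X →ₗ[k] Y} {m : ℤ} (hE : IsHomogeneous Z Z E 1)
    (h : ∀ x, f (D x) = (-1 : k) ^ m • D' (f x)) (t : Z ⊗[k] X) :
    TensorProduct.map (Z.sgn m) f (tensorDiff Z X E D t) =
      (-1 : k) ^ m • tensorDiff Z Y E D' (TensorProduct.map (Z.sgn m) f t) := by
  suffices h : TensorProduct.map (Z.sgn m) f ∘ₗ tensorDiff Z X E D =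
    (-1 : k) ^ m • tensorDiff Z Y E D' ∘ₗ TensorProduct.map (Z.sgn m) f from
      LinearMap.congr_fun h t
  refine TensorProduct.ext' fun z x => ?_
  simp only [LinearMap.comp_apply, LinearMap.smul_apply, tensorDiff_tmul, map_add,
    TensorProduct.map_tmul, h, hE.sgn_apply, (isHomogeneous_sgn Z m).sgn_apply, mul_one, mul_zero,
    zpow_zero, one_smul, smul_add, TensorProduct.smul_tmul', TensorProduct.tmul_smul]

theorem sgn_zero (X : GradedSpace k) : X.sgn 0 = LinearMap.id := X.hom_ext fun i x hx => by
  rw [sgn_of_mem X hx, zero_mul, zpow_zero, one_smul]; rfl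

theorem lTensor_tensorDiff {X Y Z : GradedSpace k} {D : X →ₗ[k] X} {D' : Y →ₗ[k] Y}
    {E : Z →ₗ[k] Z} {f : X →ₗ[k] Y} (hE : IsHomogeneous Z Z E 1)
    (h : ∀ x, f (D x) = D' (f x)) (t : Z ⊗[k] X) :
    f.lTensor Z (tensorDiff Z X E D t) = tensorDiff Z Y E D' (f.lTensor Z t) := by
  have := map_sgn_tensorDiff (D := D) (D' := D') (f := f) (m := 0) hE (by simpa using h) t
  rwa [sgn_zero, zpow_zero, one_smul] at this

theorem cyc_tensorDiff (X : GradedSpace k) {D : X →ₗ[k] X} (hD : IsHomogeneous X X D 1)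
    (t : (X ⊗[k] X) ⊗[k] X) :
    cyc X (tensorDiff (X.tensor X) X (tensorDiff X X D D) D t) =
      tensorDiff (X.tensor X) X (tensorDiff X X D D) D (cyc X t) := by
  have h := rTensor_tensorDiff (E := D) (m := 0) (isHomogeneous_swap X X)
    (by simpa using swap_tensorDiff X X hD hD)
  simp only [zpow_zero, one_smul] at h
  have h' := lTensor_tensorDiff (Z := X) (X := X.tensor X) (Y := X.tensor X) hD
    (swap_tensorDiff X X hD hD)
  simp only [cyc, LinearMap.comp_apply, LinearEquiv.coe_coe]
  rw [assoc_tensorDiff, h', assoc_symm_tensorDiff]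
  exact h _

end GradedSpace

namespace CoalgData
variable {k : Type u} [Field k] {d : ℤ}

theorem IsCoderivation.lawsAt {C : CoalgData k d} {D : C.space →ₗ[k] C.space}
    (hD : C.IsCoderivation D) {x : C.space} (hx : C.LawsAt x) : C.LawsAt (D x) := by
  have sq : (-1 : k) ^ (d - 1) * (-1 : k) ^ (d - 1) = 1 := by
    rw [← zpow_add₀ (by simp), Even.neg_one_zpow ⟨_, rfl⟩]
  have sq' : (-1 : k) ^ (1 - d) = (-1 : k) ^ (d - 1) := by
    rw [← neg_sub d 1, zpow_neg, inv_eq_of_mul_eq_one_left sq]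
  have h₁ : ∀ t, C.comul.rTensor C.space (tensorDiff C.space C.space D D t) =
      tensorDiff (C.space.tensor C.space) C.space (tensorDiff C.space C.space D D) D (C.comul.rTensor C.space t) := by
    have := rTensor_tensorDiff (D := D) (D' := tensorDiff C.space C.space D D) (E := D) (m := 0) C.comul_deg
      (by simpa using hD.comul)
    simpa using this
  have h₂ : ∀ t, C.cobr.rTensor C.space (tensorDiff C.space C.space D D t) = (-1 : k) ^ (d - 1) •
      tensorDiff (C.space.tensor C.space) C.space (tensorDiff C.space C.space D D) D (C.cobr.rTensor C.space t) := by
    have := rTensor_tensorDiff (D := D) (D' := tensorDiff C.space C.space D D) (E := D) C.cobr_deg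
      (by rw [sq']; exact hD.cobr)
    rwa [sq'] at this
  have h₃ : ∀ t, C.comul.lTensor C.space (tensorDiff C.space C.space D D t) =
      tensorDiff C.space (C.space.tensor C.space) D (tensorDiff C.space C.space D D) (C.comul.lTensor C.space t) :=
    lTensor_tensorDiff (Y := C.space.tensor C.space) hD.homogeneous hD.comul
  have h₄ : ∀ t, TensorProduct.map (C.space.sgn (d - 1)) C.cobr (tensorDiff C.space C.space D D t) =
      (-1 : k) ^ (d - 1) • tensorDiff C.space (C.space.tensor C.space) D (tensorDiff C.space C.space D D)
        (TensorProduct.map (C.space.sgn (d - 1)) C.cobr t) :=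
    map_sgn_tensorDiff (Y := C.space.tensor C.space) hD.homogeneous hD.cobr
  have h₅ : ∀ t, TensorProduct.lid k C.space (C.counit.rTensor C.space (tensorDiff C.space C.space D D t)) =
      D (TensorProduct.lid k C.space (C.counit.rTensor C.space t)) := by
    intro t
    have e : ∀ y, C.counit (C.space.sgn 1 y) = C.counit y := fun y => by
      have h : C.counit ∘ₗ C.space.sgn 1 = C.counit := C.space.hom_ext fun i y hy => by
        have := C.counit_deg i y hy
        rw [LinearMap.comp_apply, sgn_of_mem C.space hy, map_smul]
        by_cases hi : i = 0
        · simp [hi]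
        · simp only [add_zero, hi, if_false, Submodule.mem_bot] at this
          rw [this, smul_zero]
      exact LinearMap.congr_fun h y
    induction t using TensorProduct.induction_on with
    | zero => simp
    | tmul a b => simp [tensorDiff_tmul, hD.counit, e]
    | add a b ha hb => simp only [map_add, ha, hb]
  have h₆ := swap_tensorDiff C.space C.space hD.homogeneous hD.homogeneous
  have h₇ := lTensor_tensorDiff (Z := C.space) (Y := C.space.tensor C.space) (X := C.space.tensor C.space) hD.homogeneous h₆
  refine ⟨?_, ?_, ?_, ?_, ?_, ?_, ?_⟩
  · rw [hD.comul, h₆, hx.cocomm]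
  · rw [hD.comul, h₁, h₃, assoc_tensorDiff, hx.coassoc]
  · rw [hD.comul, h₅, hx.counit_comul]
  · rw [hD.cobr, map_smul, h₆, hx.coskew, map_smul, smul_comm]
  · rw [hD.cobr, map_smul, h₂, smul_smul, sq, one_smul, cyc_tensorDiff C.space hD.homogeneous,
      cyc_tensorDiff C.space hD.homogeneous, ← map_add, ← map_add, hx.cojacobi, map_zero]
  · rw [hD.cobr, hD.comul, map_smul, h₁, h₂, h₄, map_smul, map_smul, map_smul, map_smul,
      assoc_tensorDiff, h₇, assoc_symm_tensorDiff, assoc_symm_tensorDiff, ← smul_add, ← map_add,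
      hx.coleibniz]
  · rw [hD.cobr, map_smul, map_smul, h₅, hx.counit_cobr, map_zero, smul_zero]

/-- A coderivation respects the largest `d`-coalgebra in `C`. -/
theorem IsCoderivation.mem_largest {C : CoalgData k d} {D : C.space →ₗ[k] C.space}
    (hD : C.IsCoderivation D) : ∀ x ∈ C.largest, D x ∈ C.largest := by
  set N := C.largest with hN
  have hl : C.IsLawful N := C.isLawful_largest
  set P : Submodule k C.space := N ⊔ N.map D with hP
  have hsgn : ∀ x ∈ N, C.space.sgn 1 x ∈ N := by
    intro x hx
    obtain ⟨s, hs⟩ := C.space.exists_sum_proj x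
    rw [← hs, map_sum]
    refine sum_mem fun i _ => ?_
    rw [sgn_of_mem _ (C.space.proj_mem i x)]
    exact Submodule.smul_mem _ _ (hl.proj i x hx)
  have hNP : N ≤ P := le_sup_left
  have hDP : ∀ x ∈ N, D x ∈ P := fun x hx => Submodule.mem_sup_right (Submodule.mem_map_of_mem hx)
  have hT : ∀ t ∈ LinearMap.range (TensorProduct.mapIncl N N),
      tensorDiff C.space C.space D D t ∈ LinearMap.range (TensorProduct.mapIncl P P) := by
    rintro _ ⟨t, rfl⟩
    induction t using TensorProduct.induction_on with
    | zero => simp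
    | tmul x y =>
      refine Submodule.add_mem _ (x := D (x : C.space) ⊗ₜ[k] (y : C.space))
        (y := C.space.sgn 1 (x : C.space) ⊗ₜ[k] D (y : C.space)) ?_ ?_
      · exact ⟨(⟨D x, hDP x x.2⟩ : P) ⊗ₜ (⟨y, hNP y.2⟩ : P), by simp [TensorProduct.mapIncl]⟩
      · exact ⟨(⟨C.space.sgn 1 x, hNP (hsgn x x.2)⟩ : P) ⊗ₜ (⟨D y, hDP y y.2⟩ : P),
          by simp [TensorProduct.mapIncl]⟩
    | add a b ha hb => rw [map_add, map_add]; exact add_mem ha hb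
  have hlP : C.IsLawful P := by
    refine ⟨fun i => ?_, ?_, ?_, ?_⟩
    · refine sup_le (c := P.comap (C.space.proj i)) (fun x hx => hNP (hl.proj i x hx)) ?_
      rintro _ ⟨x, hx, rfl⟩
      have := hD.homogeneous.proj_apply (i - 1) x
      rw [sub_add_cancel] at this
      rw [Submodule.mem_comap, this]
      exact hDP _ (hl.proj _ x hx)
    · refine sup_le (c := (LinearMap.range (TensorProduct.mapIncl P P)).comap C.comul)
        (fun x hx => range_mapIncl_mono hNP (hl.comul x hx)) ?_
      rintro _ ⟨x, hx, rfl⟩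
      rw [Submodule.mem_comap, hD.comul]
      exact hT _ (hl.comul x hx)
    · refine sup_le (c := (LinearMap.range (TensorProduct.mapIncl P P)).comap C.cobr)
        (fun x hx => range_mapIncl_mono hNP (hl.cobr x hx)) ?_
      rintro _ ⟨x, hx, rfl⟩
      rw [Submodule.mem_comap, hD.cobr]
      exact Submodule.smul_mem _ _ (hT _ (hl.cobr x hx))
    · intro x hx
      obtain ⟨a, ha, _, ⟨b, hb, rfl⟩, rfl⟩ := Submodule.mem_sup.1 hx
      exact (hl.laws a ha).add (hD.lawsAt (hl.laws b hb))
  exact fun x hx => le_largest hlP (hDP x hx)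

end CoalgData

namespace CoalgData
variable {k : Type u} [Field k] {d : ℤ}

/-- The coalgebra `k ⊕ Y` which is obtained by adding a counit to `Y`, with
`Δ 1 = 1 ⊗ 1`, `Δ y = 1 ⊗ y + y ⊗ 1 + Δ' y`, `δ 1 = 0` and `δ y = δ' y`. -/
@[reducible] def addCounit (Y : GradedSpace k) (Δ' δ' : Y →ₗ[k] Y ⊗[k] Y)
    (hΔ : IsHomogeneous Y (Y.tensor Y) Δ' 0) (hδ : IsHomogeneous Y (Y.tensor Y) δ' (1 - d)) :
    CoalgData k d where
  space := (GradedSpace.unit k).prod Y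
  comul := LinearMap.coprod
    (LinearMap.toSpanSingleton k _ (((1 : k), (0 : Y)) ⊗ₜ[k] ((1 : k), (0 : Y))))
    (TensorProduct.mk k (k × Y) (k × Y) (1, 0) ∘ₗ LinearMap.inr k k Y +
      (TensorProduct.mk k (k × Y) (k × Y)).flip (1, 0) ∘ₗ LinearMap.inr k k Y +
      TensorProduct.map (LinearMap.inr k k Y) (LinearMap.inr k k Y) ∘ₗ Δ')
  counit := LinearMap.fst k k Y
  cobr := TensorProduct.map (LinearMap.inr k k Y) (LinearMap.inr k k Y) ∘ₗ δ' ∘ₗ LinearMap.snd k k Y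
  comul_deg := by
    have h1 : ((1 : k), (0 : Y)) ∈ ((GradedSpace.unit k).prod Y).deg 0 :=
      ⟨by simp, zero_mem _⟩
    have hr : IsHomogeneous Y ((GradedSpace.unit k).prod Y) (LinearMap.inr k k Y) 0 :=
      fun i y hy => ⟨zero_mem _, by simpa using hy⟩
    rintro i ⟨c, y⟩ ⟨hc, hy⟩
    rw [LinearMap.coprod_apply, LinearMap.add_apply, LinearMap.add_apply]
    refine add_mem ?_ (add_mem (add_mem ?_ ?_) ?_)
    · rw [LinearMap.toSpanSingleton_apply]
      by_cases hi : i = 0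
      · exact Submodule.smul_mem _ _ (tmul_mem_tensorDeg _ _ (by omega) h1 h1)
      · have : c = 0 := by simpa [hi] using hc
        rw [this, zero_smul]
        exact zero_mem _
    · exact tmul_mem_tensorDeg _ _ (by omega) h1 (hr i y hy)
    · exact tmul_mem_tensorDeg _ _ (by omega) (hr i y hy) h1
    · exact ((hr.map hr).comp hΔ) i y hy
  counit_deg := fun i x hx => by simpa using hx.1
  cobr_deg := by
    have hr : IsHomogeneous Y ((GradedSpace.unit k).prod Y) (LinearMap.inr k k Y) 0 :=
      fun i y hy => ⟨zero_mem _, by simpa using hy⟩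
    rintro i ⟨c, y⟩ ⟨hc, hy⟩
    have := ((hr.map hr).comp hδ) i y hy
    rw [add_zero, add_zero] at this
    exact this

theorem isCoderivation_addCounit {Y : GradedSpace k} {Δ' δ' : Y →ₗ[k] Y ⊗[k] Y}
    {hΔ : IsHomogeneous Y (Y.tensor Y) Δ' 0} {hδ : IsHomogeneous Y (Y.tensor Y) δ' (1 - d)}
    {D : Y →ₗ[k] Y} (hD : IsHomogeneous Y Y D 1)
    (h₁ : ∀ y, Δ' (D y) = tensorDiff Y Y D D (Δ' y))
    (h₂ : ∀ y, δ' (D y) = (-1 : k) ^ (d - 1) • tensorDiff Y Y D D (δ' y)) :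
    (addCounit (d := d) Y Δ' δ' hΔ hδ).IsCoderivation
      (LinearMap.inr k k Y ∘ₗ D ∘ₗ LinearMap.snd k k Y) := by
  have hone : ((GradedSpace.unit k).prod Y).sgn 1 ((1 : k), (0 : Y)) = (1, 0) := by
    have h1 : ((1 : k), (0 : Y)) ∈ ((GradedSpace.unit k).prod Y).deg 0 :=
      ⟨by simp, zero_mem _⟩
    rw [sgn_of_mem _ h1, mul_zero, zpow_zero, one_smul]
  have hsg : ∀ y, ((GradedSpace.unit k).prod Y).sgn 1 ((0 : k), y) = (0, Y.sgn 1 y) := by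
    have hr : IsHomogeneous Y ((GradedSpace.unit k).prod Y) (LinearMap.inr k k Y) 0 :=
      fun i y hy => ⟨zero_mem _, by simpa using hy⟩
    intro y
    have := hr.sgn_apply 1 y
    rwa [mul_zero, zpow_zero, one_smul] at this
  have hT : ∀ t : Y ⊗[k] Y, tensorDiff ((GradedSpace.unit k).prod Y) ((GradedSpace.unit k).prod Y)
      (LinearMap.inr k k Y ∘ₗ D ∘ₗ LinearMap.snd k k Y)
      (LinearMap.inr k k Y ∘ₗ D ∘ₗ LinearMap.snd k k Y)
      (TensorProduct.map (LinearMap.inr k k Y) (LinearMap.inr k k Y) t) =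
      TensorProduct.map (LinearMap.inr k k Y) (LinearMap.inr k k Y) (tensorDiff Y Y D D t) := by
    intro t
    induction t using TensorProduct.induction_on with
    | zero => simp
    | tmul a b =>
      rw [TensorProduct.map_tmul, tensorDiff_tmul, tensorDiff_tmul, map_add, TensorProduct.map_tmul,
        TensorProduct.map_tmul, LinearMap.inr_apply, LinearMap.inr_apply, hsg]
      rfl
    | add a b ha hb => simp only [map_add, ha, hb]
  refine ⟨?_, ?_, ?_, ?_⟩
  · rintro i ⟨c, y⟩ ⟨hc, hy⟩
    exact ⟨zero_mem _, hD i y hy⟩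
  · rintro ⟨c, y⟩
    have e : ∀ y' : Y, LinearMap.inr k k Y y' = ((0 : k), y') := fun _ => rfl
    simp only [LinearMap.comp_apply, LinearMap.snd_apply, LinearMap.coprod_apply, e, map_zero,
      zero_add, LinearMap.add_apply, TensorProduct.mk_apply, LinearMap.flip_apply, h₁, map_add,
      LinearMap.toSpanSingleton_apply, map_smul, hT]
    rw [tensorDiff_tmul, tensorDiff_tmul, tensorDiff_tmul, hone, hsg]
    simp [Prod.mk_zero_zero]
  · rintro ⟨c, y⟩
    rfl
  · rintro ⟨c, y⟩
    simp only [LinearMap.comp_apply, LinearMap.snd_apply, LinearMap.inr_apply, h₂, map_smul, hT]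

end CoalgData

/-- The shapes of iterated operations: planar binary trees with two kinds of vertices, for the
commutative product and for the bracket. -/
inductive Shape : Type
  | leaf : Shape
  | comm (l r : Shape) : Shape
  | lie (l r : Shape) : Shape

instance : DecidableEq Shape := Classical.decEq _

variable {k : Type u} [Field k]

/-- The tensor power of `X` along the leaves of a tree. A vertex for the bracket shifts the
degree, so that the removal of such a vertex at the root has degree `1 - d`. -/
def Shape.space (d : ℤ) (X : GradedSpace k) : Shape → GradedSpace k
  | .leaf => X
  | .comm l r => (Shape.space d X l).tensor (Shape.space d X r)
  | .lie l r => ((Shape.space d X l).tensor (Shape.space d X r)).shift (1 - d)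

namespace Tree
variable (d : ℤ) (X : GradedSpace k)

/-- The sum of the tensor powers of `X` along all trees. -/
@[reducible] def space : GradedSpace k := GradedSpace.directSum (Shape.space d X)

/-- The inclusion of the summand of the tree `s`. -/
def incl (s : Shape) : Shape.space d X s →ₗ[k] space d X :=
  DirectSum.lof k Shape (fun s => Shape.space d X s) s

theorem isHomogeneous_incl (s : Shape) : IsHomogeneous (Shape.space d X s) (space d X) (incl d X s) 0 :=
  fun i x hx => by
    rw [add_zero]
    exact Submodule.mem_iSup_of_mem s (Submodule.mem_map_of_mem hx)

theorem isHomogeneous_of_incl {Y : GradedSpace k} {f : space d X →ₗ[k] Y} {n : ℤ}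
    (h : ∀ s, IsHomogeneous (Shape.space d X s) Y (f ∘ₗ incl d X s) n) :
    IsHomogeneous (space d X) Y f n := fun i => by
  suffices hle : (⨆ s, ((Shape.space d X s).deg i).map (incl d X s)) ≤ (Y.deg (i + n)).comap f from
    fun x hx => hle hx
  refine iSup_le fun s => ?_
  rintro _ ⟨x, hx, rfl⟩
  exact h s i x hx

/-- The linear map that is given by `f s` on the summand of the tree `s`. -/
def desc {M : Type u} [AddCommGroup M] [Module k M] (f : ∀ s, Shape.space d X s →ₗ[k] M) :
    space d X →ₗ[k] M :=
  DirectSum.toModule k Shape M f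

theorem desc_incl {M : Type u} [AddCommGroup M] [Module k M]
    (f : ∀ s, Shape.space d X s →ₗ[k] M) (s : Shape) (x : Shape.space d X s) :
    desc d X f (incl d X s x) = f s x :=
  DirectSum.toModule_lof (φ := f) k s x

/-- The inclusion of the summand of the one-leaved tree. -/
def inclLeaf : X →ₗ[k] space d X := incl d X .leaf

/-- The inclusion of a summand whose root is a vertex for the product. -/
def inclComm (l r : Shape) : Shape.space d X l ⊗[k] Shape.space d X r →ₗ[k] space d X :=
  incl d X (.comm l r)

/-- The inclusion of a summand whose root is a vertex for the bracket. -/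
def inclLie (l r : Shape) : Shape.space d X l ⊗[k] Shape.space d X r →ₗ[k] space d X :=
  incl d X (.lie l r)

theorem hom_ext {M : Type*} [AddCommGroup M] [Module k M] {f g : space d X →ₗ[k] M}
    (h : ∀ s x, f (incl d X s x) = g (incl d X s x)) : f = g :=
  DirectSum.linearMap_ext k fun s => LinearMap.ext fun x => h s x

/-- The cooperation dual to the product: it removes the root if this is a vertex for the product,
and vanishes on other trees. -/
def comul : space d X →ₗ[k] space d X ⊗[k] space d X :=
  desc d X fun s => match s with
    | .leaf => 0
    | .comm l r => TensorProduct.map (incl d X l) (incl d X r)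
    | .lie _ _ => 0

/-- The cooperation dual to the bracket: it removes the root if this is a vertex for the bracket,
and vanishes on other trees. -/
def cobr : space d X →ₗ[k] space d X ⊗[k] space d X :=
  desc d X fun s => match s with
    | .leaf => 0
    | .comm _ _ => 0
    | .lie l r => TensorProduct.map (incl d X l) (incl d X r)

theorem comul_deg : IsHomogeneous (space d X) ((space d X).tensor (space d X)) (comul d X) 0 := by
  refine isHomogeneous_of_incl d X fun s i x hx => ?_
  rw [LinearMap.comp_apply, comul, desc_incl]
  cases s with
  | leaf => exact zero_mem _
  | comm l r => exact ((isHomogeneous_incl d X l).map (isHomogeneous_incl d X r)) i x hx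
  | lie l r => exact zero_mem _

theorem cobr_deg :
    IsHomogeneous (space d X) ((space d X).tensor (space d X)) (cobr d X) (1 - d) := by
  refine isHomogeneous_of_incl d X fun s i x hx => ?_
  rw [LinearMap.comp_apply, cobr, desc_incl]
  cases s with
  | leaf => exact zero_mem _
  | comm l r => exact zero_mem _
  | lie l r =>
    have := ((isHomogeneous_incl d X l).map (isHomogeneous_incl d X r)) (i + (1 - d)) x hx
    rwa [add_zero, add_zero] at this

/-- The map that is given by `j l r` on the tensor product of the summands of `l` and `r`. -/
def graft (j : ∀ l r : Shape, Shape.space d X l ⊗[k] Shape.space d X r →ₗ[k] space d X) :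
    space d X ⊗[k] space d X →ₗ[k] space d X :=
  TensorProduct.lift <| desc d X fun l => LinearMap.flip <| desc d X fun r => LinearMap.flip <|
    (TensorProduct.mk k (Shape.space d X l) (Shape.space d X r)).compr₂ (j l r)

theorem graft_tmul (j : ∀ l r : Shape, Shape.space d X l ⊗[k] Shape.space d X r →ₗ[k] space d X)
    (l r : Shape) (x : Shape.space d X l) (y : Shape.space d X r) :
    graft d X j (incl d X l x ⊗ₜ incl d X r y) = j l r (x ⊗ₜ y) := by
  rw [graft, TensorProduct.lift.tmul, desc_incl, LinearMap.flip_apply, desc_incl]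
  rfl

/-- The grafting of two trees onto a new root for the product. -/
def graftComm : space d X ⊗[k] space d X →ₗ[k] space d X :=
  graft d X (inclComm d X)

/-- The grafting of two trees onto a new root for the bracket. -/
def graftLie : space d X ⊗[k] space d X →ₗ[k] space d X :=
  graft d X (inclLie d X)

theorem tensor_ext {M : Type*} [AddCommGroup M] [Module k M]
    {f g : space d X ⊗[k] space d X →ₗ[k] M}
    (h : ∀ l r x y, f (incl d X l x ⊗ₜ incl d X r y) = g (incl d X l x ⊗ₜ incl d X r y)) :
    f = g :=
  TensorProduct.ext <| hom_ext d X fun l x => hom_ext d X fun r y => h l r x y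

theorem isHomogeneous_graft
    {j : ∀ l r : Shape, Shape.space d X l ⊗[k] Shape.space d X r →ₗ[k] space d X} {n : ℤ}
    (h : ∀ l r, IsHomogeneous ((Shape.space d X l).tensor (Shape.space d X r)) (space d X) (j l r) n) :
    IsHomogeneous ((space d X).tensor (space d X)) (space d X) (graft d X j) n := by
  refine isHomogeneous_of_tmul fun a b x hx y hy => ?_
  have h₁ : ∀ l, ∀ x ∈ (Shape.space d X l).deg a, (space d X).deg b ≤
      ((space d X).deg (a + b + n)).comap
        (graft d X j ∘ₗ TensorProduct.mk k (space d X) (space d X) (incl d X l x)) := by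
    intro l x hx
    refine iSup_le fun r => ?_
    rintro _ ⟨y, hy, rfl⟩
    rw [Submodule.mem_comap]
    change graft d X j (incl d X l x ⊗ₜ incl d X r y) ∈ _
    rw [graft_tmul]
    exact h l r (a + b) _ (tmul_mem_tensorDeg _ _ rfl hx hy)
  have h₂ : (space d X).deg a ≤ ((space d X).deg (a + b + n)).comap
      (graft d X j ∘ₗ (TensorProduct.mk k (space d X) (space d X)).flip y) := by
    refine iSup_le fun l => ?_
    rintro _ ⟨x, hx, rfl⟩
    exact h₁ l x hx hy
  exact h₂ hx

theorem isHomogeneous_graftComm :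
    IsHomogeneous ((space d X).tensor (space d X)) (space d X) (graftComm d X) 0 :=
  isHomogeneous_graft d X fun l r => isHomogeneous_incl d X (.comm l r)

theorem isHomogeneous_graftLie :
    IsHomogeneous ((space d X).tensor (space d X)) (space d X) (graftLie d X) (d - 1) :=
  isHomogeneous_graft d X fun l r i x hx => by
    have hx' : x ∈ (Shape.space d X (.lie l r)).deg (i + (d - 1)) := by
      change x ∈ tensorDeg _ _ (i + (d - 1) + (1 - d))
      rwa [show i + (d - 1) + (1 - d) = i by ring]
    have := isHomogeneous_incl d X (.lie l r) _ x hx'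
    rwa [add_zero] at this

theorem comul_inclComm (l r : Shape) (t : Shape.space d X l ⊗[k] Shape.space d X r) :
    comul d X (inclComm d X l r t) = TensorProduct.map (incl d X l) (incl d X r) t :=
  desc_incl d X _ (.comm l r) t

theorem comul_inclLie (l r : Shape) (t : Shape.space d X l ⊗[k] Shape.space d X r) :
    comul d X (inclLie d X l r t) = 0 :=
  desc_incl d X _ (.lie l r) t

theorem cobr_inclComm (l r : Shape) (t : Shape.space d X l ⊗[k] Shape.space d X r) :
    cobr d X (inclComm d X l r t) = 0 :=
  desc_incl d X _ (.comm l r) t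

theorem cobr_inclLie (l r : Shape) (t : Shape.space d X l ⊗[k] Shape.space d X r) :
    cobr d X (inclLie d X l r t) = TensorProduct.map (incl d X l) (incl d X r) t :=
  desc_incl d X _ (.lie l r) t

theorem comul_graftComm (t : space d X ⊗[k] space d X) : comul d X (graftComm d X t) = t := by
  have : comul d X ∘ₗ graftComm d X = LinearMap.id := tensor_ext d X fun l r x y => by
    rw [LinearMap.comp_apply, graftComm, graft_tmul, comul_inclComm]; rfl
  exact LinearMap.congr_fun this t

theorem comul_graftLie (t : space d X ⊗[k] space d X) : comul d X (graftLie d X t) = 0 := by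
  have : comul d X ∘ₗ graftLie d X = 0 := tensor_ext d X fun l r x y => by
    rw [LinearMap.comp_apply, graftLie, graft_tmul, comul_inclLie]; rfl
  exact LinearMap.congr_fun this t

theorem cobr_graftComm (t : space d X ⊗[k] space d X) : cobr d X (graftComm d X t) = 0 := by
  have : cobr d X ∘ₗ graftComm d X = 0 := tensor_ext d X fun l r x y => by
    rw [LinearMap.comp_apply, graftComm, graft_tmul, cobr_inclComm]; rfl
  exact LinearMap.congr_fun this t

theorem cobr_graftLie (t : space d X ⊗[k] space d X) : cobr d X (graftLie d X t) = t := by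
  have : cobr d X ∘ₗ graftLie d X = LinearMap.id := tensor_ext d X fun l r x y => by
    rw [LinearMap.comp_apply, graftLie, graft_tmul, cobr_inclLie]; rfl
  exact LinearMap.congr_fun this t

theorem comul_inclLeaf (x : X) : comul d X (inclLeaf d X x) = 0 := desc_incl d X _ .leaf x

theorem cobr_inclLeaf (x : X) : cobr d X (inclLeaf d X x) = 0 := desc_incl d X _ .leaf x

/-- The projection onto the summand of the one-leaved tree. -/
def corestrict : space d X →ₗ[k] X :=
  desc d X fun s => match s with
    | .leaf => LinearMap.id
    | .comm _ _ => 0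
    | .lie _ _ => 0

/-- The restriction to the summand of the tree `s` of the coderivation of degree `1` with
corestriction `h`, by recursion on the tree. -/
def coderAux (h : space d X →ₗ[k] X) : ∀ s, Shape.space d X s →ₗ[k] space d X
  | .leaf => inclLeaf d X ∘ₗ h ∘ₗ inclLeaf d X
  | .comm l r => inclLeaf d X ∘ₗ h ∘ₗ inclComm d X l r +
      graftComm d X ∘ₗ (TensorProduct.map (coderAux h l) (incl d X r) +
        TensorProduct.map (incl d X l ∘ₗ (Shape.space d X l).sgn 1) (coderAux h r))
  | .lie l r => inclLeaf d X ∘ₗ h ∘ₗ inclLie d X l r +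
      (-1 : k) ^ (d - 1) • graftLie d X ∘ₗ (TensorProduct.map (coderAux h l) (incl d X r) +
        TensorProduct.map (incl d X l ∘ₗ (Shape.space d X l).sgn 1) (coderAux h r))

/-- The coderivation of degree `1` with corestriction `h`. -/
def coder (h : space d X →ₗ[k] X) : space d X →ₗ[k] space d X := desc d X (coderAux d X h)

theorem tensorDiff_coder (h : space d X →ₗ[k] X) (l r : Shape)
    (t : Shape.space d X l ⊗[k] Shape.space d X r) :
    tensorDiff (space d X) (space d X) (coder d X h) (coder d X h)
      (TensorProduct.map (incl d X l) (incl d X r) t) =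
    TensorProduct.map (coderAux d X h l) (incl d X r) t +
      TensorProduct.map (incl d X l ∘ₗ (Shape.space d X l).sgn 1) (coderAux d X h r) t := by
  induction t using TensorProduct.induction_on with
  | zero => simp
  | tmul x y =>
    have := (isHomogeneous_incl d X l).sgn_apply 1 x
    rw [mul_zero, zpow_zero, one_smul] at this
    rw [TensorProduct.map_tmul, tensorDiff_tmul, this, coder, desc_incl, desc_incl,
      TensorProduct.map_tmul, TensorProduct.map_tmul]
    rfl
  | add a b ha hb => simp only [map_add, ha, hb]; abel

theorem comul_coder (h : space d X →ₗ[k] X) (x : space d X) : comul d X (coder d X h x) =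
    tensorDiff (space d X) (space d X) (coder d X h) (coder d X h) (comul d X x) := by
  suffices e : comul d X ∘ₗ coder d X h =
    tensorDiff (space d X) (space d X) (coder d X h) (coder d X h) ∘ₗ comul d X from
      LinearMap.congr_fun e x
  refine hom_ext d X fun s x => ?_
  rw [LinearMap.comp_apply, LinearMap.comp_apply, coder, desc_incl, ← coder]
  cases s with
  | leaf => rw [show comul d X (incl d X .leaf x) = 0 from comul_inclLeaf d X x, map_zero]; exact comul_inclLeaf d X _
  | comm l r =>
    have e : comul d X (incl d X (.comm l r) x) =
      TensorProduct.map (incl d X l) (incl d X r) x := desc_incl d X _ _ x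
    rw [e]
    refine Eq.trans ?_ (tensorDiff_coder d X h l r x).symm
    have e' : coderAux d X h (.comm l r) x = inclLeaf d X (h (inclComm d X l r x)) +
      graftComm d X (TensorProduct.map (coderAux d X h l) (incl d X r) x +
        TensorProduct.map (incl d X l ∘ₗ (Shape.space d X l).sgn 1) (coderAux d X h r) x) := rfl
    rw [e', map_add, comul_inclLeaf, zero_add]
    exact comul_graftComm d X _
  | lie l r =>
    have e : comul d X (incl d X (.lie l r) x) = 0 := desc_incl d X _ _ x
    rw [e, map_zero]
    have e' : coderAux d X h (.lie l r) x = inclLeaf d X (h (inclLie d X l r x)) +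
      (-1 : k) ^ (d - 1) • graftLie d X (TensorProduct.map (coderAux d X h l) (incl d X r) x +
        TensorProduct.map (incl d X l ∘ₗ (Shape.space d X l).sgn 1) (coderAux d X h r) x) := rfl
    rw [e', map_add, comul_inclLeaf, zero_add, map_smul]
    exact (congrArg _ (comul_graftLie d X _)).trans (smul_zero _)

theorem cobr_coder (h : space d X →ₗ[k] X) (x : space d X) : cobr d X (coder d X h x) =
    (-1 : k) ^ (d - 1) •
      tensorDiff (space d X) (space d X) (coder d X h) (coder d X h) (cobr d X x) := by
  suffices e : cobr d X ∘ₗ coder d X h = (-1 : k) ^ (d - 1) •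
    tensorDiff (space d X) (space d X) (coder d X h) (coder d X h) ∘ₗ cobr d X from
      LinearMap.congr_fun e x
  refine hom_ext d X fun s x => ?_
  rw [LinearMap.smul_apply, LinearMap.comp_apply, LinearMap.comp_apply, coder, desc_incl, ← coder]
  cases s with
  | leaf => rw [show cobr d X (incl d X .leaf x) = 0 from cobr_inclLeaf d X x, map_zero, smul_zero]; exact cobr_inclLeaf d X _
  | comm l r =>
    have e : cobr d X (incl d X (.comm l r) x) = 0 := desc_incl d X _ _ x
    rw [e, map_zero, smul_zero]
    have e' : coderAux d X h (.comm l r) x = inclLeaf d X (h (inclComm d X l r x)) +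
      graftComm d X (TensorProduct.map (coderAux d X h l) (incl d X r) x +
        TensorProduct.map (incl d X l ∘ₗ (Shape.space d X l).sgn 1) (coderAux d X h r) x) := rfl
    rw [e', map_add, cobr_inclLeaf, zero_add]
    exact cobr_graftComm d X _
  | lie l r =>
    have e : cobr d X (incl d X (.lie l r) x) =
      TensorProduct.map (incl d X l) (incl d X r) x := desc_incl d X _ _ x
    rw [e]
    refine Eq.trans ?_ (congrArg _ (tensorDiff_coder d X h l r x).symm)
    have e' : coderAux d X h (.lie l r) x = inclLeaf d X (h (inclLie d X l r x)) +
      (-1 : k) ^ (d - 1) • graftLie d X (TensorProduct.map (coderAux d X h l) (incl d X r) x +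
        TensorProduct.map (incl d X l ∘ₗ (Shape.space d X l).sgn 1) (coderAux d X h r) x) := rfl
    rw [e', map_add, cobr_inclLeaf, zero_add, map_smul]
    exact congrArg _ (cobr_graftLie d X _)

theorem isHomogeneous_coder {h : space d X →ₗ[k] X} (hh : IsHomogeneous (space d X) X h 1) :
    IsHomogeneous (space d X) (space d X) (coder d X h) 1 := by
  have hl : ∀ s, IsHomogeneous (Shape.space d X s) (space d X)
      (incl d X .leaf ∘ₗ h ∘ₗ incl d X s) 1 := fun s i x hx => by
    have h₁ := hh _ _ (isHomogeneous_incl d X s i x hx)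
    have h₂ := isHomogeneous_incl d X .leaf _ _ h₁
    rw [add_zero, add_zero] at h₂
    exact h₂
  have ht : ∀ l r, IsHomogeneous (Shape.space d X l) (space d X) (coderAux d X h l) 1 →
      IsHomogeneous (Shape.space d X r) (space d X) (coderAux d X h r) 1 →
      IsHomogeneous ((Shape.space d X l).tensor (Shape.space d X r))
        ((space d X).tensor (space d X)) (TensorProduct.map (coderAux d X h l) (incl d X r) +
        TensorProduct.map (incl d X l ∘ₗ (Shape.space d X l).sgn 1) (coderAux d X h r)) 1 := by
    intro l r hl hr
    have h₁ := hl.map (isHomogeneous_incl d X r)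
    have h₂ := ((isHomogeneous_incl d X l).comp (isHomogeneous_sgn _ 1)).map hr
    rw [add_zero] at h₁
    rw [zero_add, zero_add] at h₂
    exact h₁.add h₂
  have key : ∀ s, IsHomogeneous (Shape.space d X s) (space d X) (coderAux d X h s) 1 := by
    intro s
    induction s with
    | leaf => exact hl .leaf
    | comm l r ihl ihr =>
      intro i x hx
      refine add_mem (hl (.comm l r) i x hx) ?_
      have := isHomogeneous_graftComm d X _ _ (ht l r ihl ihr i x hx)
      rwa [add_zero] at this
    | lie l r ihl ihr =>
      intro i x hx
      refine add_mem (hl (.lie l r) i x hx) (Submodule.smul_mem _ _ ?_)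
      have := isHomogeneous_graftLie d X _ _ (ht l r ihl ihr (i + (1 - d)) x hx)
      rwa [show i + (1 - d) + 1 + (d - 1) = i + 1 by ring] at this
  refine isHomogeneous_of_incl d X fun s i x hx => ?_
  rw [LinearMap.comp_apply, coder, desc_incl]
  exact key s i x hx

/-- The cofree conilpotent coalgebra on `X` with two cooperations, of degrees `0` and `1 - d`, that
satisfy no identities, with a counit added. -/
@[reducible] def coalg : CoalgData k d :=
  CoalgData.addCounit (space d X) (comul d X) (cobr d X) (comul_deg d X) (cobr_deg d X)

end Tree

/-- The cofree coproartinian `d`-coalgebra on `X`: the largest `d`-coalgebra in the cofree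
coalgebra with two cooperations. An element of weight `n` is a family of elements of the
`n`-th tensor power of `X`, indexed by the iterated operations with `n` arguments, which respects
the relations between these operations in a `d`-algebra. -/
@[reducible] def Cofree (d : ℤ) (X : GradedSpace k) : CoalgData k d :=
  (Tree.coalg d X).sub (Tree.coalg d X).largest (Tree.coalg d X).isLawful_largest

/-- The projection of the cofree coalgebra onto its cogenerators. -/
def Cofree.corestrict (d : ℤ) (X : GradedSpace k) : (Cofree d X).space →ₗ[k] X :=
  Tree.corestrict d X ∘ₗ LinearMap.snd k k (Tree.space d X) ∘ₗ (Tree.coalg d X).largest.subtype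

variable {k : Type u} [Field k] {d : ℤ}

/-- The operations of a `d`-algebra (without unit), without their identities: a differential of
degree `1`, a product of degree `0` and a bracket of degree `1 - d`. -/
structure DGAlgData (k : Type u) [Field k] (d : ℤ) where
  space : GradedSpace k
  diff : space →ₗ[k] space
  mul : space →ₗ[k] space →ₗ[k] space
  br : space →ₗ[k] space →ₗ[k] space
  diff_deg : IsHomogeneous space space diff 1
  mul_deg : ∀ i j, ∀ x ∈ space.deg i, ∀ y ∈ space.deg j, mul x y ∈ space.deg (i + j)
  br_deg : ∀ i j, ∀ x ∈ space.deg i, ∀ y ∈ space.deg j, br x y ∈ space.deg (i + j + (1 - d))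

/-- The identities of a `d`-algebra: a differential graded commutative algebra `A`, with a bracket
which makes `A[d-1]` a differential graded Lie algebra, and the Leibniz identity
`{ab, c} = a{b, c} + (-1) ^ (|b|(|c| + d - 1)) {a, c}b`. -/
structure DGAlgData.IsDAlgebra (A : DGAlgData k d) : Prop where
  diff_diff : ∀ x, A.diff (A.diff x) = 0
  mul_comm : ∀ i j, ∀ x ∈ A.space.deg i, ∀ y ∈ A.space.deg j,
    A.mul x y = (-1 : k) ^ (i * j) • A.mul y x
  mul_assoc : ∀ x y z, A.mul (A.mul x y) z = A.mul x (A.mul y z)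
  diff_mul : ∀ i, ∀ x ∈ A.space.deg i, ∀ y,
    A.diff (A.mul x y) = A.mul (A.diff x) y + (-1 : k) ^ i • A.mul x (A.diff y)
  br_skew : ∀ i j, ∀ x ∈ A.space.deg i, ∀ y ∈ A.space.deg j,
    A.br x y = -(-1 : k) ^ ((i + d - 1) * (j + d - 1)) • A.br y x
  jacobi : ∀ i j, ∀ x ∈ A.space.deg i, ∀ y ∈ A.space.deg j, ∀ z,
    A.br x (A.br y z) =
      A.br (A.br x y) z + (-1 : k) ^ ((i + d - 1) * (j + d - 1)) • A.br y (A.br x z)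
  diff_br : ∀ i, ∀ x ∈ A.space.deg i, ∀ y,
    A.diff (A.br x y) = A.br (A.diff x) y + (-1 : k) ^ (i + d - 1) • A.br x (A.diff y)
  leibniz : ∀ x, ∀ i, ∀ y ∈ A.space.deg i, ∀ j, ∀ z ∈ A.space.deg j,
    A.br (A.mul x y) z = A.mul x (A.br y z) + (-1 : k) ^ (i * (j + d - 1)) • A.mul (A.br x z) y

/-- `x` is a Maurer-Cartan element of the Lie algebra `A[d-1]`: it has degree `1` in `A[d-1]`,
that is, degree `d` in `A`, and `dx + {x, x}/2 = 0`. -/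
def DGAlgData.IsMaurerCartan (A : DGAlgData k d) (x : A.space) : Prop :=
  x ∈ A.space.deg d ∧ A.diff x + (2 : k)⁻¹ • A.br x x = 0

/-- The operations of `A`, with the differential replaced by `y ↦ dy + {x, y}`. -/
@[reducible] def DGAlgData.twist (A : DGAlgData k d) (x : A.space) (hx : x ∈ A.space.deg d) : DGAlgData k d where
  space := A.space
  diff := A.diff + A.br x
  mul := A.mul
  br := A.br
  diff_deg i y hy := by
    refine add_mem (A.diff_deg i y hy) ?_
    have := A.br_deg d i x hx y hy
    rwa [show d + i + (1 - d) = i + 1 by ring] at this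
  mul_deg := A.mul_deg
  br_deg := A.br_deg

/-- The operations of a differential graded `d`-coalgebra with counit, without identities. -/
structure DGCoalgData (k : Type u) [Field k] (d : ℤ) extends CoalgData k d where
  diff : space →ₗ[k] space
  diff_deg : IsHomogeneous space space diff 1

/-- A differential graded `d`-coalgebra with counit. -/
structure DGCoalgData.IsDCoalgebra (C : DGCoalgData k d) : Prop where
  laws : ∀ x, C.LawsAt x
  coderivation : C.IsCoderivation C.diff
  diff_diff : ∀ x, C.diff (C.diff x) = 0

/-- The filtration `F` makes `C` coproartinian, and `e` is the element of `F 0` with counit `1`. -/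
structure DGCoalgData.IsCoproartinianFiltration (C : DGCoalgData k d)
    (F : ℕ → Submodule k C.space) (e : C.space) : Prop where
  mono : Monotone F
  exhaustive : ⨆ i, F i = ⊤
  proj : ∀ i j, ∀ x ∈ F i, C.space.proj j x ∈ F i
  diff : ∀ i, ∀ x ∈ F i, C.diff x ∈ F i
  comul : ∀ i, ∀ x ∈ F i, C.comul x ∈ LinearMap.range (TensorProduct.mapIncl (F i) (F i))
  cobr : ∀ i, ∀ x ∈ F i, C.cobr x ∈ LinearMap.range (TensorProduct.mapIncl (F i) (F i))
  zero : F 0 = Submodule.span k {e}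
  counit_e : C.counit e = 1
  comul_one : ∀ x ∈ F 1, C.comul x = e ⊗ₜ x + x ⊗ₜ e - C.counit x • e ⊗ₜ e
  cobr_one : ∀ x ∈ F 1, C.cobr x = 0
  comul_succ : ∀ i, 1 ≤ i → ∀ x ∈ F (i + 1), C.comul x - e ⊗ₜ x - x ⊗ₜ e ∈
    LinearMap.range (TensorProduct.mapIncl (F i) (F i))
  cobr_succ : ∀ i, 1 ≤ i → ∀ x ∈ F (i + 1), C.cobr x ∈
    LinearMap.range (TensorProduct.mapIncl (F i) (F i))

/-- A coproartinian differential graded `d`-coalgebra. -/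
structure DGCoalgData.IsCoproartinian (C : DGCoalgData k d) : Prop where
  isDCoalgebra : C.IsDCoalgebra
  exists_filtration : ∃ F e, C.IsCoproartinianFiltration F e

theorem sub_mem_of_tmul_mem {M : Type u} [AddCommGroup M] [Module k M] {N : Submodule k M} {x : M}
    (h : x ⊗ₜ[k] x ∈ LinearMap.range (TensorProduct.mapIncl N N)) : x ∈ N := by
  have h₀ : TensorProduct.map N.mkQ N.mkQ (x ⊗ₜ[k] x) = 0 := by
    obtain ⟨t, ht⟩ := h
    rw [← ht, TensorProduct.mapIncl, ← LinearMap.comp_apply, ← TensorProduct.map_comp]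
    have : N.mkQ ∘ₗ N.subtype = 0 := LinearMap.ext fun y => by simp
    rw [this, TensorProduct.map_zero_left, LinearMap.zero_apply]
  rw [TensorProduct.map_tmul] at h₀
  rw [← Submodule.Quotient.mk_eq_zero N, ← Submodule.mkQ_apply,
    ← Module.forall_dual_apply_eq_zero_iff k]
  intro f
  have := congrArg (TensorProduct.lid k k ∘ TensorProduct.map f f) h₀
  simpa using this

/-- A coproartinian coalgebra has exactly one grouplike element. -/
theorem DGCoalgData.IsCoproartinian.existsUnique_grouplike {C : DGCoalgData k d}
    (hC : C.IsCoproartinian) : ∃! e, C.counit e = 1 ∧ C.comul e = e ⊗ₜ e := by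
  obtain ⟨F, e, hF⟩ := hC.exists_filtration
  have he : ∀ i, e ∈ F i := fun i => hF.mono (Nat.zero_le i) (by
    rw [hF.zero]; exact Submodule.mem_span_singleton_self e)
  refine ⟨e, ⟨hF.counit_e, ?_⟩, ?_⟩
  · rw [hF.comul_one e (he 1), hF.counit_e, one_smul, add_sub_cancel_right]
  · rintro x ⟨hx, hxx⟩
    have hsq : (x - e) ⊗ₜ[k] (x - e) = C.comul x - e ⊗ₜ x - x ⊗ₜ e + e ⊗ₜ e := by
      rw [hxx, TensorProduct.sub_tmul, TensorProduct.tmul_sub, TensorProduct.tmul_sub]; abel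
    have hz : x ∈ F 0 → x = e := fun h => by
      rw [hF.zero] at h
      obtain ⟨c, rfl⟩ := Submodule.mem_span_singleton.1 h
      rw [map_smul, hF.counit_e, smul_eq_mul, mul_one] at hx
      rw [hx, one_smul]
    have hs : ∀ n, x ∈ F n → x = e := fun n => by
      induction n with
      | zero => exact hz
      | succ n ih =>
        intro h
        rcases Nat.eq_zero_or_pos n with rfl | hn
        · have h₀ : (x - e) ⊗ₜ[k] (x - e) = 0 := by
            rw [hsq, hF.comul_one x h, hx, one_smul]; abel
          have : x - e ∈ (⊥ : Submodule k C.space) :=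
            sub_mem_of_tmul_mem (by rw [h₀]; exact zero_mem _)
          exact sub_eq_zero.1 ((Submodule.mem_bot k).1 this)
        · refine ih ?_
          have : x - e ∈ F n := sub_mem_of_tmul_mem (by
            rw [hsq]
            refine add_mem (hF.comul_succ n hn x h) ?_
            exact ⟨(⟨e, he n⟩ : F n) ⊗ₜ (⟨e, he n⟩ : F n), by simp [TensorProduct.mapIncl]⟩)
          simpa using add_mem this (he n)
    have hd : Directed (· ≤ ·) F := hF.mono.directed_le
    have hx' : x ∈ ⨆ i, F i := by rw [hF.exhaustive]; trivial
    obtain ⟨n, hn⟩ := (Submodule.mem_iSup_of_directed F hd).1 hx'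
    exact hs n hn

/-- The grouplike element of a coproartinian coalgebra. -/
def DGCoalgData.IsCoproartinian.one {C : DGCoalgData k d} (hC : C.IsCoproartinian) : C.space :=
  hC.existsUnique_grouplike.choose

theorem DGCoalgData.IsCoproartinian.one_spec {C : DGCoalgData k d} (hC : C.IsCoproartinian) :
    C.counit hC.one = 1 ∧ C.comul hC.one = hC.one ⊗ₜ hC.one :=
  hC.existsUnique_grouplike.choose_spec.1

theorem DGCoalgData.IsCoproartinian.eq_one {C : DGCoalgData k d} (hC : C.IsCoproartinian)
    {x : C.space} (h : C.counit x = 1) (h' : C.comul x = x ⊗ₜ x) : x = hC.one :=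
  hC.existsUnique_grouplike.choose_spec.2 x ⟨h, h'⟩

/-! ### Convolution -/

/-- The map `x ⊗ y ↦ (-1) ^ (|g| * |x|) m (f x) (g y)`, for homogeneous `g`. The sign is written
without the degree of `g`, as the product of `(-1) ^ (|x| * |y|)` and `(-1) ^ (|x| * |g y|)`. -/
def conv {X B : GradedSpace k} (m : B →ₗ[k] B →ₗ[k] B) (f g : X →ₗ[k] B) : X ⊗[k] X →ₗ[k] B :=
  TensorProduct.lift <| X.elim fun i =>
    m.compl₂ (B.sgn i ∘ₗ g ∘ₗ X.sgn i) ∘ₗ f ∘ₗ (X.deg i).subtype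

/-- The map `(-1) ^ (n * |f|) f`, for homogeneous `f`. -/
def conj {X Y : GradedSpace k} (n : ℤ) (f : X →ₗ[k] Y) : X →ₗ[k] Y := Y.sgn n ∘ₗ f ∘ₗ X.sgn n

theorem conv_of_mem {X B : GradedSpace k} (m : B →ₗ[k] B →ₗ[k] B) (f g : X →ₗ[k] B) {i : ℤ} {x : X}
    (hx : x ∈ X.deg i) (y : X) : conv m f g (x ⊗ₜ y) = m (f x) (conj i g y) := by
  rw [conv, TensorProduct.lift.tmul, elim_of_mem X _ hx]; rfl

theorem conj_of_homogeneous {X Y : GradedSpace k} {f : X →ₗ[k] Y} {m : ℤ}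
    (hf : IsHomogeneous X Y f m) (n : ℤ) : conj n f = (-1 : k) ^ (n * m) • f :=
  LinearMap.ext fun x => by
    rw [conj, LinearMap.comp_apply, LinearMap.comp_apply, hf.sgn_apply, sgn_sgn]; rfl

theorem conj_add {X Y : GradedSpace k} (n : ℤ) (f g : X →ₗ[k] Y) :
    conj n (f + g) = conj n f + conj n g := by
  rw [conj, LinearMap.add_comp, LinearMap.comp_add]; rfl

theorem conj_smul {X Y : GradedSpace k} (n : ℤ) (c : k) (f : X →ₗ[k] Y) :
    conj n (c • f) = c • conj n f := by
  rw [conj, LinearMap.smul_comp, LinearMap.comp_smul]; rfl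

theorem conv_add_left {X B : GradedSpace k} (m : B →ₗ[k] B →ₗ[k] B) (f f' g : X →ₗ[k] B) :
    conv m (f + f') g = conv m f g + conv m f' g :=
  tensor_hom_ext X X fun i j x hx y hy => by simp [conv_of_mem _ _ _ hx]

theorem conv_smul_left {X B : GradedSpace k} (m : B →ₗ[k] B →ₗ[k] B) (c : k) (f g : X →ₗ[k] B) :
    conv m (c • f) g = c • conv m f g :=
  tensor_hom_ext X X fun i j x hx y hy => by simp [conv_of_mem _ _ _ hx]

theorem conv_add_right {X B : GradedSpace k} (m : B →ₗ[k] B →ₗ[k] B) (f g g' : X →ₗ[k] B) :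
    conv m f (g + g') = conv m f g + conv m f g' :=
  tensor_hom_ext X X fun i j x hx y hy => by simp [conv_of_mem _ _ _ hx, conj_add]

theorem conv_smul_right {X B : GradedSpace k} (m : B →ₗ[k] B →ₗ[k] B) (c : k) (f g : X →ₗ[k] B) :
    conv m f (c • g) = c • conv m f g :=
  tensor_hom_ext X X fun i j x hx y hy => by simp [conv_of_mem _ _ _ hx, conj_smul]

theorem isHomogeneous_conv {X B : GradedSpace k} {m : B →ₗ[k] B →ₗ[k] B} {c : ℤ}
    (hm : ∀ i j, ∀ x ∈ B.deg i, ∀ y ∈ B.deg j, m x y ∈ B.deg (i + j + c))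
    {f g : X →ₗ[k] B} {a b : ℤ} (hf : IsHomogeneous X B f a) (hg : IsHomogeneous X B g b) :
    IsHomogeneous (X.tensor X) B (conv m f g) (a + b + c) :=
  isHomogeneous_of_tmul fun i j x hx y hy => by
    rw [conv_of_mem m f g hx, conj_of_homogeneous hg, LinearMap.smul_apply, map_smul]
    have := hm _ _ _ (hf i x hx) _ (hg j y hy)
    rw [show i + a + (j + b) + c = i + j + (a + b + c) by ring] at this
    exact Submodule.smul_mem _ _ this

/-- The convolution product of linear maps, `f * g = m (f ⊗ g) Δ`. -/
def convMul (C : CoalgData k d) (B : DGAlgData k d) :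
    (C.space →ₗ[k] B.space) →ₗ[k] (C.space →ₗ[k] B.space) →ₗ[k] (C.space →ₗ[k] B.space) :=
  LinearMap.mk₂ k (fun f g => conv B.mul f g ∘ₗ C.comul)
    (fun f f' g => by rw [conv_add_left, LinearMap.add_comp])
    (fun c f g => by rw [conv_smul_left, LinearMap.smul_comp])
    (fun f g g' => by rw [conv_add_right, LinearMap.add_comp])
    (fun c f g => by rw [conv_smul_right, LinearMap.smul_comp])

/-- The convolution bracket of linear maps. It combines the bracket of `B` with the coproduct of
`C`, and the product of `B` with the cobracket of `C`: for homogeneous `f` and `g`,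
`{f, g} c = ∑ (-1) ^ ((|g| + d - 1) * |c'|) {f c', g c''} +
  ∑ (-1) ^ ((d - 1) * |g| + |g| * |c₁|) f c₁ * g c₂`,
where `Δ c = ∑ c' ⊗ c''` and `δ c = ∑ c₁ ⊗ c₂`. -/
def convBr (C : CoalgData k d) (B : DGAlgData k d) :
    (C.space →ₗ[k] B.space) →ₗ[k] (C.space →ₗ[k] B.space) →ₗ[k] (C.space →ₗ[k] B.space) :=
  LinearMap.mk₂ k (fun f g =>
      conv B.br f g ∘ₗ (C.space.sgn (d - 1)).rTensor C.space ∘ₗ C.comul +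
      conv B.mul f (conj (d - 1) g) ∘ₗ C.cobr)
    (fun f f' g => by simp only [conv_add_left, LinearMap.add_comp]; abel)
    (fun c f g => by simp only [conv_smul_left, LinearMap.smul_comp, smul_add])
    (fun f g g' => by simp only [conj_add, conv_add_right, LinearMap.add_comp]; abel)
    (fun c f g => by simp only [conj_smul, conv_smul_right, LinearMap.smul_comp, smul_add])

theorem isHomogeneous_convMul (C : CoalgData k d) (B : DGAlgData k d) {f g : C.space →ₗ[k] B.space}
    {a b : ℤ} (hf : IsHomogeneous C.space B.space f a) (hg : IsHomogeneous C.space B.space g b) :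
    IsHomogeneous C.space B.space (convMul C B f g) (a + b) := by
  have := (isHomogeneous_conv (m := B.mul) (c := 0) (by simpa using B.mul_deg) hf hg).comp C.comul_deg
  rwa [zero_add, add_zero] at this

theorem isHomogeneous_convBr (C : CoalgData k d) (B : DGAlgData k d) {f g : C.space →ₗ[k] B.space}
    {a b : ℤ} (hf : IsHomogeneous C.space B.space f a) (hg : IsHomogeneous C.space B.space g b) :
    IsHomogeneous C.space B.space (convBr C B f g) (a + b + (1 - d)) := by
  have hs : IsHomogeneous (C.space.tensor C.space) (C.space.tensor C.space)
      ((C.space.sgn (d - 1)).rTensor C.space) 0 := by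
    have := (isHomogeneous_sgn C.space (d - 1)).map (IsHomogeneous.id C.space)
    rwa [add_zero] at this
  have h₁ := (isHomogeneous_conv B.br_deg hf hg).comp (hs.comp C.comul_deg)
  have h₂ := (isHomogeneous_conv (m := B.mul) (c := 0) (by simpa using B.mul_deg) hf
    (hg.smul ((-1 : k) ^ ((d - 1) * b)))).comp C.cobr_deg
  rw [← conj_of_homogeneous hg] at h₂
  rw [zero_add, zero_add] at h₁
  rw [add_zero, add_comm] at h₂
  exact h₁.add h₂

/-! ### The algebra of linear maps -/

/-- The linear maps of degree `n`. -/
def homDeg (X Y : GradedSpace k) (n : ℤ) : Submodule k (X →ₗ[k] Y) where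
  carrier := {f | IsHomogeneous X Y f n}
  add_mem' := IsHomogeneous.add
  zero_mem' := fun _ _ _ => zero_mem _
  smul_mem' := fun c _ hf => hf.smul c

/-- The component of degree `n` of a linear map. -/
def homProj (X Y : GradedSpace k) (n : ℤ) : (X →ₗ[k] Y) →ₗ[k] (X →ₗ[k] Y) where
  toFun f := X.elim fun i => Y.proj (i + n) ∘ₗ f ∘ₗ (X.deg i).subtype
  map_add' f g := X.hom_ext fun i x hx => by simp [elim_of_mem X _ hx]
  map_smul' c f := X.hom_ext fun i x hx => by simp [elim_of_mem X _ hx]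

theorem homProj_apply_of_mem (X Y : GradedSpace k) (n : ℤ) (f : X →ₗ[k] Y) {i : ℤ} {x : X}
    (hx : x ∈ X.deg i) : homProj X Y n f x = Y.proj (i + n) (f x) :=
  elim_of_mem X _ hx

theorem homProj_mem (X Y : GradedSpace k) (n : ℤ) (f : X →ₗ[k] Y) :
    homProj X Y n f ∈ homDeg X Y n := fun i x hx => by
  rw [homProj_apply_of_mem X Y n f hx]; exact Y.proj_mem _ _

theorem homProj_of_mem (X Y : GradedSpace k) {m : ℤ} {f : X →ₗ[k] Y} (hf : f ∈ homDeg X Y m)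
    (n : ℤ) : homProj X Y n f = if m = n then f else 0 :=
  X.hom_ext fun i x hx => by
    rw [homProj_apply_of_mem X Y n f hx, proj_of_mem Y (hf i x hx)]
    simp only [add_right_inj]
    split_ifs <;> rfl

/-- The graded space of linear maps from `X` to `Y`, that is, the direct sum over all `n` of the
spaces of linear maps of degree `n`. -/
@[reducible] def gradedHom (X Y : GradedSpace k) : GradedSpace k where
  carrier := ↥(⨆ n, homDeg X Y n)
  deg n := (homDeg X Y n).comap (⨆ n, homDeg X Y n).subtype
  isInternal := isInternal_of_proj _
    (by
      refine Submodule.map_injective_of_injective (⨆ n, homDeg X Y n).injective_subtype ?_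
      rw [Submodule.map_iSup, Submodule.map_top, Submodule.range_subtype]
      refine iSup_congr fun n => ?_
      rw [Submodule.map_comap_subtype]
      exact inf_eq_right.2 (le_iSup (homDeg X Y) n))
    (fun n => (homProj X Y n).restrict fun f _ =>
      Submodule.mem_iSup_of_mem n (homProj_mem X Y n f))
    (fun m f hf n => Subtype.ext <| by
      rw [LinearMap.coe_restrict_apply, homProj_of_mem X Y (f := (f : X →ₗ[k] Y)) hf]
      split_ifs <;> rfl)

/-- A linear map on `gradedHom X Y` which is the restriction of a map on all linear maps. -/
theorem restrict_mem {X Y : GradedSpace k} {T : (X →ₗ[k] Y) →ₗ[k] (X →ₗ[k] Y)} {c : ℤ}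
    (hT : ∀ a, ∀ f ∈ homDeg X Y a, T f ∈ homDeg X Y (a + c)) :
    ∀ f ∈ ⨆ n, homDeg X Y n, T f ∈ ⨆ n, homDeg X Y n := by
  refine iSup_le (a := (⨆ n, homDeg X Y n).comap T) fun a f hf => ?_
  exact Submodule.mem_iSup_of_mem _ (hT a f hf)

theorem restrict₂_mem {X Y : GradedSpace k}
    {T : (X →ₗ[k] Y) →ₗ[k] (X →ₗ[k] Y) →ₗ[k] (X →ₗ[k] Y)} {c : ℤ}
    (hT : ∀ a b, ∀ f ∈ homDeg X Y a, ∀ g ∈ homDeg X Y b, T f g ∈ homDeg X Y (a + b + c)) :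
    ∀ f ∈ ⨆ n, homDeg X Y n, ∀ g ∈ ⨆ n, homDeg X Y n, T f g ∈ ⨆ n, homDeg X Y n := by
  intro f hf g hg
  have h₁ : ∀ a, ∀ f ∈ homDeg X Y a, T f g ∈ ⨆ n, homDeg X Y n := fun a f hf =>
    (iSup_le (a := (⨆ n, homDeg X Y n).comap (T f)) fun b g hg =>
      Submodule.mem_iSup_of_mem _ (hT a b f hf g hg)) hg
  exact (iSup_le (a := (⨆ n, homDeg X Y n).comap (T.flip g)) h₁) hf

/-- The restriction of a bilinear operation on linear maps to `gradedHom X Y`. -/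
def restrict₂ {X Y : GradedSpace k} (T : (X →ₗ[k] Y) →ₗ[k] (X →ₗ[k] Y) →ₗ[k] (X →ₗ[k] Y))
    (hT : ∀ f ∈ ⨆ n, homDeg X Y n, ∀ g ∈ ⨆ n, homDeg X Y n, T f g ∈ ⨆ n, homDeg X Y n) :
    gradedHom X Y →ₗ[k] gradedHom X Y →ₗ[k] gradedHom X Y :=
  LinearMap.mk₂ k (fun f g => ⟨T f g, hT f f.2 g g.2⟩)
    (fun f f' g => Subtype.ext (by simp))
    (fun c f g => Subtype.ext (by simp))
    (fun f g g' => Subtype.ext (by simp))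
    (fun c f g => Subtype.ext (by simp))

/-- The differential of linear maps, `f ↦ d f - (-1) ^ |f| f D`. -/
def homDiff {X Y : GradedSpace k} (D : X →ₗ[k] X) (E : Y →ₗ[k] Y) :
    (X →ₗ[k] Y) →ₗ[k] (X →ₗ[k] Y) where
  toFun f := E ∘ₗ f - conj 1 f ∘ₗ D
  map_add' f g := by
    rw [conj_add, LinearMap.add_comp, LinearMap.comp_add]; abel
  map_smul' c f := by
    rw [conj_smul, LinearMap.smul_comp, LinearMap.comp_smul, smul_sub]; rfl

theorem isHomogeneous_homDiff {X Y : GradedSpace k} {D : X →ₗ[k] X} {E : Y →ₗ[k] Y}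
    (hD : IsHomogeneous X X D 1) (hE : IsHomogeneous Y Y E 1) (a : ℤ) (f : X →ₗ[k] Y)
    (hf : f ∈ homDeg X Y a) : homDiff D E f ∈ homDeg X Y (a + 1) := by
  have h₁ : IsHomogeneous X Y (E ∘ₗ f) (a + 1) := hE.comp hf
  have h₂ : IsHomogeneous X Y (((-1 : k) ^ (1 * a) • f) ∘ₗ D) (1 + a) :=
    IsHomogeneous.comp (IsHomogeneous.smul _ hf) hD
  rw [← conj_of_homogeneous hf, add_comm] at h₂
  exact sub_mem (S := Submodule k (X →ₗ[k] Y)) h₁ h₂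

/-- The algebra of linear maps from a `d`-coalgebra `C` to a `d`-algebra `B`, with the convolution
operations. -/
@[reducible] def homAlg (C : DGCoalgData k d) (B : DGAlgData k d) : DGAlgData k d where
  space := gradedHom C.space B.space
  diff := (homDiff C.diff B.diff).restrict
    (restrict_mem (isHomogeneous_homDiff C.diff_deg B.diff_deg))
  mul := restrict₂ (convMul C.toCoalgData B) (restrict₂_mem (c := 0) fun a b f hf g hg => by
    rw [add_zero]; exact isHomogeneous_convMul _ _ hf hg)
  br := restrict₂ (convBr C.toCoalgData B) (restrict₂_mem fun a b f hf g hg =>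
    isHomogeneous_convBr _ _ hf hg)
  diff_deg a f hf := isHomogeneous_homDiff C.diff_deg B.diff_deg a f hf
  mul_deg a b f hf g hg := isHomogeneous_convMul C.toCoalgData B hf hg
  br_deg a b f hf g hg := isHomogeneous_convBr C.toCoalgData B hf hg

/-! ### The coalgebra of a `d`-algebra -/

namespace Vee
variable (B : DGAlgData k d)

/-- The projection onto cogenerators, as a map of degree `d` to `B`. -/
def treeProj : (Tree.coalg d (B.space.shift d)).space →ₗ[k] B.space :=
  Tree.corestrict d (B.space.shift d) ∘ₗ LinearMap.snd k k (Tree.space d (B.space.shift d))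

theorem isHomogeneous_treeProj :
    IsHomogeneous (Tree.coalg d (B.space.shift d)).space B.space (treeProj B) d := by
  have h : IsHomogeneous (Tree.space d (B.space.shift d)) B.space
      (Tree.corestrict d (B.space.shift d)) d := by
    refine Tree.isHomogeneous_of_incl d (B.space.shift d) (Y := B.space) fun s i x hx => ?_
    rw [LinearMap.comp_apply, Tree.corestrict, Tree.desc_incl]
    cases s with
    | leaf => exact hx
    | comm l r => exact zero_mem _
    | lie l r => exact zero_mem _
  rintro i ⟨c, y⟩ ⟨hc, hy⟩
  exact h i y hy

/-- The corestriction of the differential. With `p` the projection onto cogenerators, it is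
`(-1) ^ d (d p + {p, p}/2)`: the differential of `B[d]` on the cogenerators, and the bracket and
the product of `B` on the elements of weight two. -/
def treeCorestrict : (Tree.coalg d (B.space.shift d)).space →ₗ[k] B.space :=
  (-1 : k) ^ d • (B.diff ∘ₗ treeProj B +
    (2 : k)⁻¹ • convBr (Tree.coalg d (B.space.shift d)) B (treeProj B) (treeProj B))

theorem isHomogeneous_treeCorestrict :
    IsHomogeneous (Tree.coalg d (B.space.shift d)).space B.space (treeCorestrict B) (d + 1) := by
  have h := isHomogeneous_treeProj B
  have h₁ := B.diff_deg.comp h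
  have h₂ := isHomogeneous_convBr _ B h h
  rw [show d + d + (1 - d) = d + 1 by ring] at h₂
  exact (h₁.add (h₂.smul _)).smul _

/-- The coderivation of the tree coalgebra with this corestriction. -/
def treeDiff : (Tree.coalg d (B.space.shift d)).space →ₗ[k] (Tree.coalg d (B.space.shift d)).space :=
  LinearMap.inr k k (Tree.space d (B.space.shift d)) ∘ₗ
    Tree.coder d (B.space.shift d) (treeCorestrict B ∘ₗ LinearMap.inr k k _) ∘ₗ
    LinearMap.snd k k (Tree.space d (B.space.shift d))

theorem isCoderivation_treeDiff : (Tree.coalg d (B.space.shift d)).IsCoderivation (treeDiff B) :=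
  CoalgData.isCoderivation_addCounit
    (Tree.isHomogeneous_coder d (B.space.shift d) fun i x hx => by
      have := isHomogeneous_treeCorestrict B i (0, x) ⟨zero_mem _, hx⟩
      rw [show i + (d + 1) = i + 1 + d by ring] at this
      exact this)
    (Tree.comul_coder d (B.space.shift d) _) (Tree.cobr_coder d (B.space.shift d) _)

end Vee

/-- The coalgebra `B^∨`: the cofree coproartinian `d`-coalgebra on `B[d]`, with the differential
that corresponds to the operations of `B`. -/
@[reducible] def vee (B : DGAlgData k d) : DGCoalgData k d where
  toCoalgData := Cofree d (B.space.shift d)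
  diff := (Vee.treeDiff B).restrict (Vee.isCoderivation_treeDiff B).mem_largest
  diff_deg i x hx := (Vee.isCoderivation_treeDiff B).homogeneous i x hx

/-- The projection of `B^∨` onto its cogenerators, as a map of degree `d` to `B`. -/
def vee.proj (B : DGAlgData k d) : (vee B).space →ₗ[k] B.space :=
  Cofree.corestrict d (B.space.shift d)

theorem vee.proj_deg (B : DGAlgData k d) : IsHomogeneous (vee B).space B.space (vee.proj B) d :=
  fun i x hx => Vee.isHomogeneous_treeProj B i
    (Subtype.val (show (Tree.coalg d (B.space.shift d)).largest from x)) hx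

/-! ### Morphisms, tensor products and the functor -/

namespace DGCoalgData

/-- Morphisms of differential graded `d`-coalgebras with counit. -/
@[ext] structure Hom (C C' : DGCoalgData k d) where
  map : C.space →ₗ[k] C'.space
  map_deg : IsHomogeneous C.space C'.space map 0
  map_comul : ∀ x, C'.comul (map x) = TensorProduct.map map map (C.comul x)
  map_counit : ∀ x, C'.counit (map x) = C.counit x
  map_cobr : ∀ x, C'.cobr (map x) = TensorProduct.map map map (C.cobr x)
  map_diff : ∀ x, C'.diff (map x) = map (C.diff x)

/-- The identity morphism. -/
def Hom.id (C : DGCoalgData k d) : Hom C C where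
  map := LinearMap.id
  map_deg := IsHomogeneous.id _
  map_comul _ := by rw [TensorProduct.map_id]; rfl
  map_counit _ := rfl
  map_cobr _ := by rw [TensorProduct.map_id]; rfl
  map_diff _ := rfl

/-- The composition of morphisms. -/
def Hom.comp {C C' C'' : DGCoalgData k d} (g : Hom C' C'') (f : Hom C C') : Hom C C'' where
  map := g.map ∘ₗ f.map
  map_deg := g.map_deg.comp f.map_deg
  map_comul x := by
    rw [TensorProduct.map_comp, LinearMap.comp_apply, LinearMap.comp_apply, ← f.map_comul,
      g.map_comul]
  map_counit x := by rw [LinearMap.comp_apply, g.map_counit, f.map_counit]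
  map_cobr x := by
    rw [TensorProduct.map_comp, LinearMap.comp_apply, LinearMap.comp_apply, ← f.map_cobr,
      g.map_cobr]
  map_diff x := by
    rw [LinearMap.comp_apply, LinearMap.comp_apply, g.map_diff, f.map_diff]

/-- The signed permutation of the two middle factors,
`(v ⊗ v') ⊗ (w ⊗ w') ↦ (-1) ^ (|v'| * |w|) (v ⊗ w) ⊗ (v' ⊗ w')`. -/
def middleSwap (X Y : GradedSpace k) :
    (X ⊗[k] X) ⊗[k] (Y ⊗[k] Y) →ₗ[k] (X ⊗[k] Y) ⊗[k] (X ⊗[k] Y) :=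
  (TensorProduct.assoc k X Y (X ⊗[k] Y)).symm.toLinearMap ∘ₗ
    LinearMap.lTensor X ((TensorProduct.assoc k Y X Y).toLinearMap ∘ₗ
      LinearMap.rTensor Y (swap X Y) ∘ₗ (TensorProduct.assoc k X Y Y).symm.toLinearMap) ∘ₗ
    (TensorProduct.assoc k X X (Y ⊗[k] Y)).toLinearMap

theorem isHomogeneous_middleSwap (X Y : GradedSpace k) :
    IsHomogeneous ((X.tensor X).tensor (Y.tensor Y)) ((X.tensor Y).tensor (X.tensor Y))
      (middleSwap X Y) 0 := by
  have h₁ := (isHomogeneous_swap X Y).map (IsHomogeneous.id Y)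
  have h₂ := (isHomogeneous_assoc Y X Y).comp (h₁.comp (isHomogeneous_assoc_symm X Y Y))
  have h₃ := (IsHomogeneous.id X).map h₂
  have h₄ := (isHomogeneous_assoc_symm X Y (X.tensor Y)).comp
    (h₃.comp (isHomogeneous_assoc X X (Y.tensor Y)))
  simp only [add_zero] at h₄
  exact h₄

/-- The tensor product of two `d`-coalgebras with counit, with
`Δ (v ⊗ w) = ε (Δ v ⊗ Δ w)` and
`δ (v ⊗ w) = ε (δ v ⊗ Δ w) + ε ((-1) ^ ((d - 1) * |v|) Δ v ⊗ δ w)`,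
where `ε` is the signed permutation of the two middle factors. -/
@[reducible] def tensor (C E : DGCoalgData k d) : DGCoalgData k d where
  space := C.space.tensor E.space
  comul := middleSwap C.space E.space ∘ₗ TensorProduct.map C.comul E.comul
  counit := (TensorProduct.lid k k).toLinearMap ∘ₗ TensorProduct.map C.counit E.counit
  cobr := middleSwap C.space E.space ∘ₗ (TensorProduct.map C.cobr E.comul +
    TensorProduct.map (C.comul ∘ₗ C.space.sgn (d - 1)) E.cobr)
  diff := tensorDiff C.space E.space C.diff E.diff
  comul_deg := by
    have := (isHomogeneous_middleSwap C.space E.space).comp (C.comul_deg.map E.comul_deg)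
    rwa [add_zero, add_zero] at this
  counit_deg := isHomogeneous_of_tmul fun i j x hx y hy => by
    have h₁ := C.counit_deg i x hx
    have h₂ := E.counit_deg j y hy
    rw [add_zero] at h₁ h₂ ⊢
    change C.counit x * E.counit y ∈ _
    by_cases hi : i = 0
    · by_cases hj : j = 0
      · simp [hi, hj]
      · have : E.counit y = 0 := by simpa [hj] using h₂
        rw [this, mul_zero]; exact zero_mem _
    · have : C.counit x = 0 := by simpa [hi] using h₁
      rw [this, zero_mul]; exact zero_mem _
  cobr_deg := by
    have h₁ := C.cobr_deg.map E.comul_deg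
    have h₂ := (C.comul_deg.comp (isHomogeneous_sgn C.space (d - 1))).map E.cobr_deg
    rw [add_zero] at h₁
    rw [zero_add, zero_add] at h₂
    have := (isHomogeneous_middleSwap C.space E.space).comp (h₁.add h₂)
    rwa [add_zero] at this
  diff_deg := isHomogeneous_tensorDiff C.diff_deg E.diff_deg

theorem middleSwap_map {X Y Y' : GradedSpace k} {g : Y →ₗ[k] Y'} (hg : IsHomogeneous Y Y' g 0)
    (t : (X ⊗[k] X) ⊗[k] (Y ⊗[k] Y)) :
    middleSwap X Y' (TensorProduct.map LinearMap.id (TensorProduct.map g g) t) =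
      TensorProduct.map (TensorProduct.map LinearMap.id g) (TensorProduct.map LinearMap.id g)
        (middleSwap X Y t) := by
  suffices h : middleSwap X Y' ∘ₗ TensorProduct.map LinearMap.id (TensorProduct.map g g) =
      TensorProduct.map (TensorProduct.map LinearMap.id g) (TensorProduct.map LinearMap.id g) ∘ₗ
        middleSwap X Y from LinearMap.congr_fun h t
  refine TensorProduct.ext_fourfold' fun x x' y y' => ?_
  have hs : swap X Y' (x' ⊗ₜ g y) = TensorProduct.map g LinearMap.id (swap X Y (x' ⊗ₜ y)) := by
    have : swap X Y' ∘ₗ TensorProduct.map LinearMap.id g =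
        TensorProduct.map g LinearMap.id ∘ₗ swap X Y := tensor_hom_ext X Y fun i j a ha b hb => by
      have hgb := hg j b hb
      rw [add_zero] at hgb
      simp only [LinearMap.comp_apply, TensorProduct.map_tmul, LinearMap.id_apply,
        swap_of_mem_mem X Y ha hb, swap_of_mem_mem X Y' ha hgb, map_smul]
    exact LinearMap.congr_fun this (x' ⊗ₜ y)
  simp only [middleSwap, LinearMap.comp_apply, TensorProduct.map_tmul, LinearMap.id_apply,
    LinearEquiv.coe_coe, TensorProduct.assoc_tmul, LinearMap.lTensor_tmul,
    TensorProduct.assoc_symm_tmul, LinearMap.rTensor_tmul, hs]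
  generalize swap X Y (x' ⊗ₜ y) = s
  induction s using TensorProduct.induction_on with
  | zero => simp
  | tmul a b => simp
  | add a b ha hb => simp only [map_add, TensorProduct.add_tmul, TensorProduct.tmul_add, ha, hb]

/-- The morphism `1 ⊗ g`. -/
def tensorMap (C : DGCoalgData k d) {E E' : DGCoalgData k d} (g : Hom E E') :
    Hom (tensor C E) (tensor C E') where
  map := TensorProduct.map LinearMap.id g.map
  map_deg := by
    have := (IsHomogeneous.id C.space).map g.map_deg
    rwa [add_zero] at this
  map_comul x := by
    change middleSwap _ _ (TensorProduct.map C.comul E'.comul (TensorProduct.map _ _ x)) =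
      TensorProduct.map _ _ (middleSwap _ _ (TensorProduct.map C.comul E.comul x))
    rw [← middleSwap_map g.map_deg]
    congr 1
    induction x using TensorProduct.induction_on with
    | zero => simp
    | tmul a b => simp [g.map_comul]
    | add a b ha hb => simp only [map_add, ha, hb]
  map_counit x := by
    change TensorProduct.lid k k (TensorProduct.map C.counit E'.counit (TensorProduct.map _ _ x)) =
      TensorProduct.lid k k (TensorProduct.map C.counit E.counit x)
    induction x using TensorProduct.induction_on with
    | zero => simp
    | tmul a b => simp [g.map_counit]
    | add a b ha hb => simp only [map_add, ha, hb]
  map_cobr x := by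
    change middleSwap _ _ ((TensorProduct.map C.cobr E'.comul +
        TensorProduct.map (C.comul ∘ₗ C.space.sgn (d - 1)) E'.cobr) (TensorProduct.map _ _ x)) =
      TensorProduct.map _ _ (middleSwap _ _ ((TensorProduct.map C.cobr E.comul +
        TensorProduct.map (C.comul ∘ₗ C.space.sgn (d - 1)) E.cobr) x))
    rw [← middleSwap_map g.map_deg]
    congr 1
    induction x using TensorProduct.induction_on with
    | zero => simp
    | tmul a b => simp [g.map_comul, g.map_cobr]
    | add a b ha hb => simp only [map_add, ha, hb]
  map_diff x := by
    change tensorDiff _ _ _ _ (TensorProduct.map _ _ x) =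
      TensorProduct.map _ _ (tensorDiff _ _ _ _ x)
    induction x using TensorProduct.induction_on with
    | zero => simp
    | tmul a b => simp [tensorDiff_tmul, g.map_diff]
    | add a b ha hb => simp only [map_add, ha, hb]

end DGCoalgData

/-- The category of coproartinian differential graded `d`-coalgebras. -/
structure DCoart (k : Type u) [Field k] (d : ℤ) where
  coalg : DGCoalgData k d
  isCoproartinian : coalg.IsCoproartinian

instance : CategoryTheory.Category (DCoart k d) where
  Hom S T := DGCoalgData.Hom S.coalg T.coalg
  id S := DGCoalgData.Hom.id S.coalg
  comp f g := g.comp f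

/-- The grouplike element of `S`, that is, the image of `1` under the canonical inclusion of `k`. -/
def DCoart.one (S : DCoart k d) : S.coalg.space := S.isCoproartinian.one

theorem DCoart.map_one {S T : DCoart k d} (g : DGCoalgData.Hom S.coalg T.coalg) :
    g.map S.one = T.one :=
  T.isCoproartinian.eq_one
    (by rw [g.map_counit]; exact S.isCoproartinian.one_spec.1)
    (by
      rw [g.map_comul, DCoart.one, S.isCoproartinian.one_spec.2, TensorProduct.map_tmul])

/-- The functor that sends `S` to the set of morphisms `f : V^∨ ⊗ S → W^∨` whose restriction to
`V^∨` along the inclusion `k → S` is `φ`. -/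
def homFunctor (V W : DGAlgData k d) (φ : DGCoalgData.Hom (vee V) (vee W)) :
    CategoryTheory.Functor (Opposite (DCoart k d)) (Type u) where
  obj S := {f : DGCoalgData.Hom ((vee V).tensor S.unop.coalg) (vee W) //
    ∀ v : (vee V).space, f.map (v ⊗ₜ[k] S.unop.one) = φ.map v}
  map g := TypeCat.ofHom fun f => ⟨f.1.comp (DGCoalgData.tensorMap (vee V) g.unop), fun v =>
    (congrArg (fun e => f.1.map (v ⊗ₜ[k] e)) (DCoart.map_one g.unop)).trans (f.2 v)⟩
  map_id S := by
    refine CategoryTheory.ConcreteCategory.hom_ext _ _ fun f => ?_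
    refine Subtype.ext (DGCoalgData.Hom.ext ?_)
    change f.1.map ∘ₗ TensorProduct.map LinearMap.id LinearMap.id = f.1.map
    rw [TensorProduct.map_id]; rfl
  map_comp g h := by
    refine CategoryTheory.ConcreteCategory.hom_ext _ _ fun f => ?_
    refine Subtype.ext (DGCoalgData.Hom.ext ?_)
    change f.1.map ∘ₗ TensorProduct.map LinearMap.id (g.unop.map ∘ₗ h.unop.map) =
      (f.1.map ∘ₗ TensorProduct.map LinearMap.id g.unop.map) ∘ₗ
        TensorProduct.map LinearMap.id h.unop.map
    rw [LinearMap.comp_assoc, ← TensorProduct.map_comp]; rfl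

/-- The element of the algebra of linear maps from `V^∨` to `W` that corresponds to a
morphism `φ`: the composition of `φ` with the projection onto the cogenerators of `W^∨`. -/
def mcElement {V W : DGAlgData k d} (φ : DGCoalgData.Hom (vee V) (vee W)) :
    (homAlg (vee V) W).space :=
  ⟨vee.proj W ∘ₗ φ.map, Submodule.mem_iSup_of_mem (0 + d) ((vee.proj_deg W).comp φ.map_deg)⟩

theorem mcElement_deg {V W : DGAlgData k d} (φ : DGCoalgData.Hom (vee V) (vee W)) :
    mcElement φ ∈ (homAlg (vee V) W).space.deg d := by
  have : IsHomogeneous (vee V).space W.space (vee.proj W ∘ₗ φ.map) (0 + d) :=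
    (vee.proj_deg W).comp φ.map_deg
  rw [zero_add] at this
  exact this

/-- The algebra of linear maps from `V^∨` to `W`, with the differential `x ↦ dx + {φ', x}`, where
`φ'` is the Maurer-Cartan element of `φ`. -/
def twistedHom {V W : DGAlgData k d} (φ : DGCoalgData.Hom (vee V) (vee W)) : DGAlgData k d :=
  (homAlg (vee V) W).twist (mcElement φ) (mcElement_deg φ)

end

end DAlgebras

namespace DAlgebras

noncomputable section

/-! ### Signs -/

/-! The coalgebra `vee B` is universal for solutions of the Maurer-Cartan equation. For a
coproartinian `C`, a morphism of coalgebras from `C` to the cofree coalgebra is determined by its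
projection `f : C → B` to the cogenerators, and every `f` of degree `d` with `f 1 = 0` occurs. The
morphism commutes with the differentials exactly when `df + {f, f}/2 = 0` in the convolution algebra
`Hom(C, B)`; such `f` are the `IsTwisting` maps. This is the content of `vee.hom_ext` and
`vee.exists_hom`. The projection `p` of `W^∨` is itself twisting, and pulling it back along `φ`
shows that `φ' = p φ` is a Maurer-Cartan element.

For representability, an element of `F(S)` is a Maurer-Cartan element of `Hom(V^∨ ⊗ S, W)` that
agrees with `φ'` on `V^∨ ⊗ 1`. Currying respects the operations, is injective, and is onto in each
degree, so it identifies `Hom(V^∨ ⊗ S, W)` with `Hom(S, 𝔞)` as `d`-algebras (`curry_homAlg_br`,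
`isMaurerCartan_curry`). One obtains Maurer-Cartan elements `h` of `Hom(S, 𝔞)` with `h 1 = φ'`.
Write `h = ε φ' + g`, so that `g 1 = 0`. The bracket with `ε φ'` is composition with `{φ', ·}`, and
`φ'` satisfies the Maurer-Cartan equation, so the equation for `h` over `𝔞` is the equation for `g`
over the twisted algebra `𝔞'` (`isTwisting_twist_iff`). By the universal property such `g` are the
morphisms `S → (𝔞')^∨`. Naturality follows from the uniqueness of the corresponding morphism.

Four facts support this argument. The convolution operations satisfy the identities of a `d`-algebra
(`isDAlgebra_homAlg`), which is a verification with signs. Twisting by a Maurer-Cartan element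
preserves these identities. The tree coalgebra has the universal property without identities: a lift
is the fixed point of a grafting recursion, uniqueness is an induction along the filtration, and the
identities of the source force the image into the largest `d`-coalgebra; there the square of the
differential vanishes by the Bianchi identity. Finally `V^∨ ⊗ S` is a coproartinian `d`-coalgebra.
Its identities are checked on the dual, which currying embeds into `Hom(S, Hom(V^∨, k))`, already
known to be a `d`-algebra. -/

theorem neg_one_zpow_congr {k : Type u} [Field k] {m n : ℤ} (h : (m : ZMod 2) = n) :
    (-1 : k) ^ m = (-1) ^ n := by
  -- Exponents are compared in `ZMod 2`, so that the sign verifications below become polynomial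
  -- identities over the field with two elements, within reach of `ring` and `grind`.
  have h' : Even (m - n) := by
    rw [← ZMod.intCast_eq_zero_iff_even]; push_cast; rw [h, sub_self]
  have : m = n + (m - n) := by ring
  rw [this, zpow_add₀ (by simp), h'.neg_one_zpow, mul_one]

theorem neg_one_zpow_mul {k : Type u} [Field k] (m n : ℤ) :
    (-1 : k) ^ m * (-1) ^ n = (-1) ^ (m + n) := (zpow_add₀ (by simp) m n).symm

theorem neg_one_zpow_eq_neg {k : Type u} [Field k] {m n : ℤ} (h : (m : ZMod 2) = n + 1) :
    (-1 : k) ^ m = -(-1) ^ n := by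
  rw [neg_one_zpow_congr (n := n + 1) (by push_cast; exact h), zpow_add₀ (by simp), zpow_one,
    mul_neg_one]

theorem neg_one_zpow_smul_smul {k : Type u} [Field k] {M : Type*} [AddCommMonoid M] [Module k M]
    (m n : ℤ) (x : M) : (-1 : k) ^ m • (-1 : k) ^ n • x = (-1 : k) ^ (m + n) • x := by
  rw [smul_smul, neg_one_zpow_mul]

theorem neg_one_zpow_smul_congr {k : Type u} [Field k] {M : Type*} [AddCommMonoid M] [Module k M]
    {m n : ℤ} (x : M) (h : (m : ZMod 2) = n) : (-1 : k) ^ m • x = (-1 : k) ^ n • x := by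
  rw [neg_one_zpow_congr h]

/-- Some exponent identities hold only as identities of functions on the field with two elements;
`grind` is then given this relation for the variables that occur squared. -/
theorem mul_self_of_zmod_two : ∀ x : ZMod 2, x * x = x := by decide

/-! ### Signed permutations of tensor factors -/

namespace GradedSpace
variable {k : Type u} [Field k]

theorem sgn_sgn_add (X : GradedSpace k) (m n : ℤ) (x : X) :
    X.sgn m (X.sgn n x) = X.sgn (m + n) x := by
  have : X.sgn m ∘ₗ X.sgn n = X.sgn (m + n) := X.hom_ext fun i x hx => by
    simp only [LinearMap.comp_apply, sgn_of_mem X hx, map_smul, smul_smul, neg_one_zpow_mul]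
    rw [neg_one_zpow_congr (n := (m + n) * i) (by push_cast; ring)]
  exact LinearMap.congr_fun this x

theorem sgn_comp_sgn (X : GradedSpace k) (m n : ℤ) : X.sgn m ∘ₗ X.sgn n = X.sgn (m + n) :=
  LinearMap.ext (X.sgn_sgn_add m n)

theorem sgn_congr (X : GradedSpace k) {m n : ℤ} (h : (m : ZMod 2) = n) : X.sgn m = X.sgn n :=
  X.hom_ext fun i x hx => by
    rw [sgn_of_mem X hx, sgn_of_mem X hx, neg_one_zpow_congr (n := n * i) (by push_cast; rw [h])]

theorem tensor_hom_ext₃ (X Y Z : GradedSpace k) {M : Type*} [AddCommGroup M] [Module k M]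
    {f g : (X ⊗[k] Y) ⊗[k] Z →ₗ[k] M}
    (h : ∀ a b c, ∀ x ∈ X.deg a, ∀ y ∈ Y.deg b, ∀ z ∈ Z.deg c,
      f ((x ⊗ₜ y) ⊗ₜ z) = g ((x ⊗ₜ y) ⊗ₜ z)) : f = g := by
  refine TensorProduct.ext ?_
  refine tensor_hom_ext X Y fun a b x hx y hy => ?_
  exact Z.hom_ext fun c z hz => h a b c x hx y hy z hz

theorem swap_swap (X Y : GradedSpace k) (t : X ⊗[k] Y) : swap Y X (swap X Y t) = t := by
  suffices h : swap Y X ∘ₗ swap X Y = LinearMap.id from LinearMap.congr_fun h t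
  refine tensor_hom_ext X Y fun i j x hx y hy => ?_
  rw [LinearMap.comp_apply, swap_of_mem_mem X Y hx hy, map_smul, swap_of_mem_mem Y X hy hx,
    neg_one_zpow_smul_smul, LinearMap.id_apply, Even.neg_one_zpow ⟨i * j, by ring⟩, one_smul]

theorem swap_map {X Y X' Y' : GradedSpace k} {f : X →ₗ[k] X'} {g : Y →ₗ[k] Y'}
    (hf : IsHomogeneous X X' f 0) (hg : IsHomogeneous Y Y' g 0) (t : X ⊗[k] Y) :
    swap X' Y' (TensorProduct.map f g t) = TensorProduct.map g f (swap X Y t) := by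
  suffices h : swap X' Y' ∘ₗ TensorProduct.map f g = TensorProduct.map g f ∘ₗ swap X Y from
    LinearMap.congr_fun h t
  refine tensor_hom_ext X Y fun i j x hx y hy => ?_
  have h₁ := hf i x hx
  have h₂ := hg j y hy
  rw [add_zero] at h₁ h₂
  simp only [LinearMap.comp_apply, TensorProduct.map_tmul, swap_of_mem_mem X' Y' h₁ h₂,
    swap_of_mem_mem X Y hx hy, map_smul]

/-- The transposition of the last two factors, with sign. -/
def swapRight (X : GradedSpace k) : (X ⊗[k] X) ⊗[k] X →ₗ[k] (X ⊗[k] X) ⊗[k] X :=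
  (TensorProduct.assoc k X X X).symm.toLinearMap ∘ₗ
    (swap X X).lTensor X ∘ₗ (TensorProduct.assoc k X X X).toLinearMap

theorem swapRight_of_mem (X : GradedSpace k) {b c : ℤ} (x : X) {y z : X} (hy : y ∈ X.deg b)
    (hz : z ∈ X.deg c) :
    swapRight X ((x ⊗ₜ y) ⊗ₜ z) = (-1 : k) ^ (b * c) • ((x ⊗ₜ z) ⊗ₜ y) := by
  simp only [swapRight, LinearMap.comp_apply, LinearEquiv.coe_coe, TensorProduct.assoc_tmul,
    LinearMap.lTensor_tmul, swap_of_mem_mem X X hy hz, TensorProduct.tmul_smul, map_smul,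
    TensorProduct.assoc_symm_tmul]

theorem rTensor_swap_of_mem (X : GradedSpace k) {a b : ℤ} {x y : X} (hx : x ∈ X.deg a)
    (hy : y ∈ X.deg b) (z : X) :
    (swap X X).rTensor X ((x ⊗ₜ y) ⊗ₜ z) = (-1 : k) ^ (a * b) • ((y ⊗ₜ x) ⊗ₜ z) := by
  rw [LinearMap.rTensor_tmul, swap_of_mem_mem X X hx hy, ← TensorProduct.smul_tmul']

theorem cyc_of_mem (X : GradedSpace k) {a b c : ℤ} {x y z : X} (hx : x ∈ X.deg a)
    (hy : y ∈ X.deg b) (hz : z ∈ X.deg c) :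
    cyc X ((x ⊗ₜ y) ⊗ₜ z) = (-1 : k) ^ ((a + b) * c) • ((z ⊗ₜ x) ⊗ₜ y) := by
  change (swap X X).rTensor X (swapRight X ((x ⊗ₜ y) ⊗ₜ z)) = _
  rw [swapRight_of_mem X x hy hz, map_smul, rTensor_swap_of_mem X hx hz, neg_one_zpow_smul_smul]
  exact neg_one_zpow_smul_congr _ (by push_cast; ring)

/-- The last factor passes the other two taken as one block, and the Koszul sign of the block is the
product of the two single signs. -/
theorem cyc_eq_swap (X : GradedSpace k) (t : (X ⊗[k] X) ⊗[k] X) :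
    cyc X t = (TensorProduct.assoc k X X X).symm (swap (X.tensor X) X t) := by
  suffices h : cyc X = (TensorProduct.assoc k X X X).symm.toLinearMap ∘ₗ swap (X.tensor X) X from
    LinearMap.congr_fun h t
  refine tensor_hom_ext₃ X X X fun a b c x hx y hy z hz => ?_
  rw [cyc_of_mem X hx hy hz, LinearMap.comp_apply,
    swap_of_mem_mem (X.tensor X) X (tmul_mem_tensorDeg X X rfl hx hy) hz, map_smul]
  rfl

theorem cyc_map {X Y : GradedSpace k} {g : X →ₗ[k] Y} (hg : IsHomogeneous X Y g 0)
    (t : (X ⊗[k] X) ⊗[k] X) :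
    cyc Y (TensorProduct.map (TensorProduct.map g g) g t) =
      TensorProduct.map (TensorProduct.map g g) g (cyc X t) := by
  suffices h : cyc Y ∘ₗ TensorProduct.map (TensorProduct.map g g) g =
      TensorProduct.map (TensorProduct.map g g) g ∘ₗ cyc X from LinearMap.congr_fun h t
  refine tensor_hom_ext₃ X X X fun a b c x hx y hy z hz => ?_
  have h₁ := hg a x hx
  have h₂ := hg b y hy
  have h₃ := hg c z hz
  rw [add_zero] at h₁ h₂ h₃
  simp only [LinearMap.comp_apply, TensorProduct.map_tmul, cyc_of_mem Y h₁ h₂ h₃,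
    cyc_of_mem X hx hy hz, map_smul]

/-- The relation `τ σ = σ² τ` between a transposition and a 3-cycle; Koszul signs are compatible
with relations in the symmetric group. -/
theorem rTensor_swap_cyc (X : GradedSpace k) (t : (X ⊗[k] X) ⊗[k] X) :
    (swap X X).rTensor X (cyc X t) = cyc X (cyc X ((swap X X).rTensor X t)) := by
  suffices h : (swap X X).rTensor X ∘ₗ cyc X = cyc X ∘ₗ cyc X ∘ₗ (swap X X).rTensor X from
    LinearMap.congr_fun h t
  refine tensor_hom_ext₃ X X X fun a b c x hx y hy z hz => ?_
  simp only [LinearMap.comp_apply, cyc_of_mem X hx hy hz, rTensor_swap_of_mem X hx hy,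
    rTensor_swap_of_mem X hz hx, cyc_of_mem X hy hx hz, cyc_of_mem X hz hy hx, map_smul,
    neg_one_zpow_smul_smul]
  exact neg_one_zpow_smul_congr _ (by push_cast; have := mul_self_of_zmod_two a; grind)

theorem cyc_cyc_cyc (X : GradedSpace k) (t : (X ⊗[k] X) ⊗[k] X) :
    cyc X (cyc X (cyc X t)) = t := by
  suffices h : cyc X ∘ₗ cyc X ∘ₗ cyc X = LinearMap.id from LinearMap.congr_fun h t
  refine tensor_hom_ext₃ X X X fun a b c x hx y hy z hz => ?_
  simp only [LinearMap.comp_apply, cyc_of_mem X hx hy hz, 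
    cyc_of_mem X hz hx hy, cyc_of_mem X hy hz hx, map_smul,
    neg_one_zpow_smul_smul, LinearMap.id_apply]
  rw [neg_one_zpow_congr (n := 0) (by push_cast; grind), zpow_zero, one_smul]

/-- Naturality of the symmetry. A cooperation in the second factor is traded for one in the first
factor followed by `cyc`; the sign operator is the Koszul sign of `D`, of degree `e`, passing the
first factor. This lets cooperations nested on the right be rewritten as cooperations nested on the
left. -/
theorem assoc_symm_map_sgn_swap (X : GradedSpace k) {D : X →ₗ[k] X ⊗[k] X} {e : ℤ}
    (hD : IsHomogeneous X (X.tensor X) D e) (t : X ⊗[k] X) :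
    (TensorProduct.assoc k X X X).symm (TensorProduct.map (X.sgn e) D (swap X X t)) =
      cyc X (D.rTensor X t) := by
  rw [cyc_eq_swap, EmbeddingLike.apply_eq_iff_eq]
  suffices h : TensorProduct.map (X.sgn e) D ∘ₗ swap X X = swap (X.tensor X) X ∘ₗ D.rTensor X from
    LinearMap.congr_fun h t
  refine tensor_hom_ext X X fun i j x hx y hy => ?_
  simp only [LinearMap.comp_apply, swap_of_mem_mem X X hx hy, map_smul, TensorProduct.map_tmul,
    sgn_of_mem X hy, LinearMap.rTensor_tmul, swap_of_mem_mem (X.tensor X) X (hD i x hx) hy,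
    ← TensorProduct.smul_tmul', neg_one_zpow_smul_smul]
  exact neg_one_zpow_smul_congr _ (by push_cast; ring)

end GradedSpace

end

end DAlgebras

namespace DAlgebras

noncomputable section

open GradedSpace

variable {k : Type u} [Field k] {d : ℤ}

/-! ### Iterated convolution -/

/-- For `g` of degree `q` the sign `(-1) ^ (q * |x|)` is absorbed into `f`. The convolution becomes
a plain composite of linear maps, and its identities can be tested on homogeneous tensors. -/
theorem conv_eq {X B : GradedSpace k} (m : B →ₗ[k] B →ₗ[k] B) (f : X →ₗ[k] B) {g : X →ₗ[k] B}
    {q : ℤ} (hg : IsHomogeneous X B g q) :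
    conv m f g = TensorProduct.lift m ∘ₗ TensorProduct.map (f ∘ₗ X.sgn q) g :=
  tensor_hom_ext X X fun i j x hx y hy => by
    rw [conv_of_mem m f g hx, conj_of_homogeneous hg, LinearMap.comp_apply,
      TensorProduct.map_tmul, TensorProduct.lift.tmul, LinearMap.comp_apply, sgn_of_mem X hx,
      LinearMap.smul_apply, map_smul, map_smul, map_smul, LinearMap.smul_apply, mul_comm]

theorem convMul_apply (C : CoalgData k d) (B : DGAlgData k d) (f : C.space →ₗ[k] B.space)
    {g : C.space →ₗ[k] B.space} {q : ℤ} (hg : IsHomogeneous C.space B.space g q) (x : C.space) :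
    convMul C B f g x =
      TensorProduct.lift B.mul (TensorProduct.map (f ∘ₗ C.space.sgn q) g (C.comul x)) := by
  change conv B.mul f g (C.comul x) = _
  rw [conv_eq B.mul f hg]; rfl

theorem convBr_apply (C : CoalgData k d) (B : DGAlgData k d) (f : C.space →ₗ[k] B.space)
    {g : C.space →ₗ[k] B.space} {q : ℤ} (hg : IsHomogeneous C.space B.space g q) (x : C.space) :
    convBr C B f g x =
      TensorProduct.lift B.br (TensorProduct.map (f ∘ₗ C.space.sgn (q + d - 1)) g (C.comul x)) +
      (-1 : k) ^ ((d - 1) * q) •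
        TensorProduct.lift B.mul (TensorProduct.map (f ∘ₗ C.space.sgn q) g (C.cobr x)) := by
  change conv B.br f g ((C.space.sgn (d - 1)).rTensor C.space (C.comul x)) +
    conv B.mul f (conj (d - 1) g) (C.cobr x) = _
  rw [conv_eq B.br f hg, conj_of_homogeneous hg, conv_smul_right, conv_eq B.mul f hg,
    LinearMap.smul_apply, LinearMap.comp_apply, LinearMap.comp_apply, LinearMap.rTensor,
    ← LinearMap.comp_apply (TensorProduct.map _ _), ← TensorProduct.map_comp,
    LinearMap.comp_assoc, sgn_comp_sgn, LinearMap.comp_id, add_sub_assoc]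

section triple
variable {X B : GradedSpace k}

/-- The map `x ⊗ y ⊗ z ↦ m (m' (F x) (G y)) (H z)`. -/
def tripleLeft (m m' : B →ₗ[k] B →ₗ[k] B) (F G H : X →ₗ[k] B) : (X ⊗[k] X) ⊗[k] X →ₗ[k] B :=
  TensorProduct.lift m ∘ₗ TensorProduct.map (TensorProduct.lift m' ∘ₗ TensorProduct.map F G) H

/-- The map `x ⊗ y ⊗ z ↦ m (F x) (m' (G y) (H z))`. -/
def tripleRight (m m' : B →ₗ[k] B →ₗ[k] B) (F G H : X →ₗ[k] B) : (X ⊗[k] X) ⊗[k] X →ₗ[k] B :=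
  TensorProduct.lift m ∘ₗ TensorProduct.map F (TensorProduct.lift m' ∘ₗ TensorProduct.map G H) ∘ₗ
    (TensorProduct.assoc k X X X).toLinearMap

theorem tripleLeft_tmul (m m' : B →ₗ[k] B →ₗ[k] B) (F G H : X →ₗ[k] B) (x y z : X) :
    tripleLeft m m' F G H ((x ⊗ₜ y) ⊗ₜ z) = m (m' (F x) (G y)) (H z) := rfl

theorem tripleRight_tmul (m m' : B →ₗ[k] B →ₗ[k] B) (F G H : X →ₗ[k] B) (x y z : X) :
    tripleRight m m' F G H ((x ⊗ₜ y) ⊗ₜ z) = m (F x) (m' (G y) (H z)) := rfl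

/-- Separates the two sources of structure: a nested convolution is a trilinear map built from `B`,
applied to an iterated cooperation of `C`. -/
theorem lift_map_left (m m' : B →ₗ[k] B →ₗ[k] B) (F G H : X →ₗ[k] B) (D : X →ₗ[k] X ⊗[k] X)
    (t : X ⊗[k] X) :
    TensorProduct.lift m (TensorProduct.map
      (TensorProduct.lift m' ∘ₗ TensorProduct.map F G ∘ₗ D) H t) =
      tripleLeft m m' F G H (D.rTensor X t) := by
  rw [tripleLeft, LinearMap.comp_apply, LinearMap.rTensor, ← LinearMap.comp_apply
    (TensorProduct.map _ _), ← TensorProduct.map_comp]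
  rfl

theorem lift_map_right (m m' : B →ₗ[k] B →ₗ[k] B) (F G H : X →ₗ[k] B) (D : X →ₗ[k] X ⊗[k] X)
    (n : ℤ) (t : X ⊗[k] X) :
    TensorProduct.lift m (TensorProduct.map (F ∘ₗ X.sgn n)
      (TensorProduct.lift m' ∘ₗ TensorProduct.map G H ∘ₗ D) t) =
      tripleRight m m' F G H ((TensorProduct.assoc k X X X).symm
        (TensorProduct.map (X.sgn n) D t)) := by
  rw [tripleRight, LinearMap.comp_apply, LinearMap.comp_apply, LinearEquiv.coe_coe,
    LinearEquiv.apply_symm_apply, ← LinearMap.comp_apply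
    (TensorProduct.map _ _), ← TensorProduct.map_comp]
  rfl

end triple

/-! ### Normal forms of iterated cooperations -/

namespace CoalgData
variable {C : CoalgData k d}

theorem sgn_comul (C : CoalgData k d) (n : ℤ) :
    C.comul ∘ₗ C.space.sgn n =
      TensorProduct.map (C.space.sgn n) (C.space.sgn n) ∘ₗ C.comul := LinearMap.ext fun x => by
  have := C.comul_deg.sgn_apply n x
  rw [sgn_tensor, mul_zero, zpow_zero, one_smul] at this
  exact this.symm

theorem sgn_cobr (C : CoalgData k d) (n : ℤ) :
    C.cobr ∘ₗ C.space.sgn n = (-1 : k) ^ (n * (1 - d)) •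
      TensorProduct.map (C.space.sgn n) (C.space.sgn n) ∘ₗ C.cobr := LinearMap.ext fun x => by
  have := C.cobr_deg.sgn_apply n x
  rw [sgn_tensor] at this
  rw [LinearMap.smul_apply, LinearMap.comp_apply, LinearMap.comp_apply, this,
    neg_one_zpow_smul_smul, Even.neg_one_zpow ⟨n * (1 - d), rfl⟩, one_smul]

theorem LawsAt.assoc_symm_comul_comul {x : C.space} (h : C.LawsAt x) :
    (TensorProduct.assoc k C.space C.space C.space).symm
      (TensorProduct.map (C.space.sgn 0) C.comul (C.comul x)) =
      C.comul.rTensor C.space (C.comul x) := by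
  rw [sgn_zero, LinearEquiv.symm_apply_eq, h.coassoc]; rfl

theorem LawsAt.assoc_symm_cobr_comul {x : C.space} (h : C.LawsAt x) :
    (TensorProduct.assoc k C.space C.space C.space).symm
      (TensorProduct.map (C.space.sgn (1 - d)) C.cobr (C.comul x)) =
      cyc C.space (C.cobr.rTensor C.space (C.comul x)) := by
  rw [← assoc_symm_map_sgn_swap C.space C.cobr_deg, h.cocomm]

theorem LawsAt.assoc_symm_cobr_cobr {x : C.space} (h : C.LawsAt x) :
    (TensorProduct.assoc k C.space C.space C.space).symm
      (TensorProduct.map (C.space.sgn (1 - d)) C.cobr (C.cobr x)) =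
      (-1 : k) ^ d • cyc C.space (C.cobr.rTensor C.space (C.cobr x)) := by
  rw [← assoc_symm_map_sgn_swap C.space C.cobr_deg, h.coskew, map_smul, map_smul,
    neg_one_zpow_smul_smul, Even.neg_one_zpow ⟨d, rfl⟩, one_smul]

/-- The co-Leibniz identity, with its first summand turned around by cocommutativity, so that both
summands are permutations of the single element `(δ ⊗ 1) Δ x`. The exponents `d - 1` and `1 - d` of
the sign operators have the same parity. -/
theorem LawsAt.comul_cobr {x : C.space} (h : C.LawsAt x) :
    C.comul.rTensor C.space (C.cobr x) = cyc C.space (C.cobr.rTensor C.space (C.comul x)) +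
      swapRight C.space (C.cobr.rTensor C.space (C.comul x)) := by
  rw [h.coleibniz, ← h.assoc_symm_cobr_comul, sgn_congr C.space (m := d - 1) (n := 1 - d)
    (by push_cast; grind)]
  rfl

theorem LawsAt.assoc_symm_comul_cobr {x : C.space} (h : C.LawsAt x) :
    (TensorProduct.assoc k C.space C.space C.space).symm
      (TensorProduct.map (C.space.sgn 0) C.comul (C.cobr x)) =
      (-1 : k) ^ d • cyc C.space (cyc C.space (C.cobr.rTensor C.space (C.comul x)) +
        swapRight C.space (C.cobr.rTensor C.space (C.comul x))) := by
  rw [← h.comul_cobr, ← assoc_symm_map_sgn_swap C.space C.comul_deg, h.coskew, map_smul, map_smul,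
    neg_one_zpow_smul_smul, Even.neg_one_zpow ⟨d, rfl⟩, one_smul]

theorem LawsAt.swap_comul_comul {x : C.space} (h : ∀ x, C.LawsAt x) :
    (swap C.space C.space).rTensor C.space (C.comul.rTensor C.space (C.comul x)) =
      C.comul.rTensor C.space (C.comul x) := by
  rw [← LinearMap.comp_apply, ← LinearMap.rTensor_comp]
  congr 2
  exact LinearMap.ext fun y => (h y).cocomm

theorem LawsAt.swap_cobr (h : ∀ x, C.LawsAt x) (t : C.space ⊗[k] C.space) :
    (swap C.space C.space).rTensor C.space (C.cobr.rTensor C.space t) =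
      (-1 : k) ^ d • C.cobr.rTensor C.space t := by
  rw [← LinearMap.comp_apply, ← LinearMap.rTensor_comp, ← LinearMap.smul_apply,
    ← LinearMap.rTensor_smul]
  congr 2
  exact LinearMap.ext fun y => (h y).coskew

/-- Coassociativity moves the second coproduct to the last two factors, where cocommutativity makes
the transposition invisible. Together with `swap_comul_comul` this makes the iterated coproduct
symmetric in all three factors. -/
theorem LawsAt.swapRight_comul_comul {x : C.space} (h : ∀ x, C.LawsAt x) :
    swapRight C.space (C.comul.rTensor C.space (C.comul x)) =
      C.comul.rTensor C.space (C.comul x) := by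
  rw [swapRight, LinearMap.comp_apply, LinearMap.comp_apply, LinearEquiv.coe_coe,
    LinearEquiv.coe_coe, (h x).coassoc, LinearEquiv.symm_apply_eq, (h x).coassoc,
    ← LinearMap.comp_apply, ← LinearMap.lTensor_comp]
  congr 2
  exact LinearMap.ext fun y => (h y).cocomm

end CoalgData

/-! ### Nested convolution operations as trilinear maps on iterated cooperations -/

section nested
variable (C : CoalgData k d) (B : DGAlgData k d) (hC : ∀ x, C.LawsAt x)
  (f : C.space →ₗ[k] B.space) {g h : C.space →ₗ[k] B.space} {q r : ℤ}
  (hg : IsHomogeneous C.space B.space g q) (hh : IsHomogeneous C.space B.space h r)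

theorem convMul_eq (f : C.space →ₗ[k] B.space) {g : C.space →ₗ[k] B.space} {q : ℤ}
    (hg : IsHomogeneous C.space B.space g q) :
    convMul C B f g =
      TensorProduct.lift B.mul ∘ₗ TensorProduct.map (f ∘ₗ C.space.sgn q) g ∘ₗ C.comul :=
  LinearMap.ext fun x => convMul_apply C B f hg x

theorem convBr_eq (f : C.space →ₗ[k] B.space) {g : C.space →ₗ[k] B.space} {q : ℤ}
    (hg : IsHomogeneous C.space B.space g q) :
    convBr C B f g =
      TensorProduct.lift B.br ∘ₗ TensorProduct.map (f ∘ₗ C.space.sgn (q + d - 1)) g ∘ₗ C.comul +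
      (-1 : k) ^ ((d - 1) * q) •
        TensorProduct.lift B.mul ∘ₗ TensorProduct.map (f ∘ₗ C.space.sgn q) g ∘ₗ C.cobr :=
  LinearMap.ext fun x => convBr_apply C B f hg x

/-- An inner operation enters an outer one precomposed with a sign operator. The operator is
multiplicative on tensors and the coproduct has degree `0`, so it passes to both factors. -/
theorem convMul_comp_sgn (f : C.space →ₗ[k] B.space) {g : C.space →ₗ[k] B.space} {q : ℤ}
    (hg : IsHomogeneous C.space B.space g q) (n : ℤ) :
    convMul C B f g ∘ₗ C.space.sgn n = TensorProduct.lift B.mul ∘ₗ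
      TensorProduct.map (f ∘ₗ C.space.sgn (q + n)) (g ∘ₗ C.space.sgn n) ∘ₗ C.comul := by
  rw [convMul_eq C B f hg, LinearMap.comp_assoc, LinearMap.comp_assoc, CoalgData.sgn_comul,
    ← LinearMap.comp_assoc _ _ (TensorProduct.map _ g), ← TensorProduct.map_comp,
    LinearMap.comp_assoc, sgn_comp_sgn]

theorem convBr_comp_sgn (f : C.space →ₗ[k] B.space) {g : C.space →ₗ[k] B.space} {q : ℤ}
    (hg : IsHomogeneous C.space B.space g q) (n : ℤ) :
    convBr C B f g ∘ₗ C.space.sgn n = TensorProduct.lift B.br ∘ₗ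
      TensorProduct.map (f ∘ₗ C.space.sgn (q + d - 1 + n)) (g ∘ₗ C.space.sgn n) ∘ₗ C.comul +
      (-1 : k) ^ ((d - 1) * q + n * (1 - d)) • TensorProduct.lift B.mul ∘ₗ
      TensorProduct.map (f ∘ₗ C.space.sgn (q + n)) (g ∘ₗ C.space.sgn n) ∘ₗ C.cobr := by
  rw [convBr_eq C B f hg, LinearMap.add_comp, LinearMap.smul_comp]
  simp only [LinearMap.comp_assoc]
  rw [CoalgData.sgn_comul, CoalgData.sgn_cobr, LinearMap.comp_smul, LinearMap.comp_smul,
    ← LinearMap.comp_assoc _ _ (TensorProduct.map _ g), ← TensorProduct.map_comp,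
    ← LinearMap.comp_assoc _ _ (TensorProduct.map _ g), ← TensorProduct.map_comp,
    LinearMap.comp_assoc, LinearMap.comp_assoc, sgn_comp_sgn, sgn_comp_sgn, neg_one_zpow_smul_smul]

include hg hh

theorem convMul_convMul_left (x : C.space) : convMul C B (convMul C B f g) h x =
    tripleLeft B.mul B.mul (f ∘ₗ C.space.sgn (q + r)) (g ∘ₗ C.space.sgn r) h
      (C.comul.rTensor C.space (C.comul x)) := by
  rw [convMul_apply C B _ hh, convMul_comp_sgn C B f hg, lift_map_left]

theorem convBr_convMul_left (x : C.space) : convBr C B (convMul C B f g) h x =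
    tripleLeft B.br B.mul (f ∘ₗ C.space.sgn (q + (r + d - 1))) (g ∘ₗ C.space.sgn (r + d - 1)) h
      (C.comul.rTensor C.space (C.comul x)) +
    (-1 : k) ^ ((d - 1) * r) •
      tripleLeft B.mul B.mul (f ∘ₗ C.space.sgn (q + r)) (g ∘ₗ C.space.sgn r) h
      (C.comul.rTensor C.space (C.cobr x)) := by
  rw [convBr_apply C B _ hh, convMul_comp_sgn C B f hg, convMul_comp_sgn C B f hg, lift_map_left,
    lift_map_left]

theorem convMul_convBr_left (x : C.space) : convMul C B (convBr C B f g) h x =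
    tripleLeft B.mul B.br (f ∘ₗ C.space.sgn (q + d - 1 + r)) (g ∘ₗ C.space.sgn r) h
      (C.comul.rTensor C.space (C.comul x)) +
    (-1 : k) ^ ((d - 1) * q + r * (1 - d)) •
      tripleLeft B.mul B.mul (f ∘ₗ C.space.sgn (q + r)) (g ∘ₗ C.space.sgn r) h
      (C.cobr.rTensor C.space (C.comul x)) := by
  rw [convMul_apply C B _ hh, convBr_comp_sgn C B f hg, TensorProduct.map_add_left,
    TensorProduct.map_smul_left, LinearMap.add_apply, LinearMap.smul_apply, map_add, map_smul,
    lift_map_left, lift_map_left]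

/-- There are four terms because each of the two brackets contributes either the bracket of `B` with
the coproduct or the product of `B` with the cobracket. -/
theorem convBr_convBr_left (x : C.space) : convBr C B (convBr C B f g) h x =
    tripleLeft B.br B.br (f ∘ₗ C.space.sgn (q + d - 1 + (r + d - 1)))
      (g ∘ₗ C.space.sgn (r + d - 1)) h (C.comul.rTensor C.space (C.comul x)) +
    (-1 : k) ^ ((d - 1) * q + (r + d - 1) * (1 - d)) •
      tripleLeft B.br B.mul (f ∘ₗ C.space.sgn (q + (r + d - 1))) (g ∘ₗ C.space.sgn (r + d - 1)) h
      (C.cobr.rTensor C.space (C.comul x)) +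
    (-1 : k) ^ ((d - 1) * r) • tripleLeft B.mul B.br (f ∘ₗ C.space.sgn (q + d - 1 + r))
      (g ∘ₗ C.space.sgn r) h (C.comul.rTensor C.space (C.cobr x)) +
    (-1 : k) ^ ((d - 1) * r + ((d - 1) * q + r * (1 - d))) •
      tripleLeft B.mul B.mul (f ∘ₗ C.space.sgn (q + r)) (g ∘ₗ C.space.sgn r) h
      (C.cobr.rTensor C.space (C.cobr x)) := by
  rw [convBr_apply C B _ hh, convBr_comp_sgn C B f hg, convBr_comp_sgn C B f hg]
  simp only [TensorProduct.map_add_left, TensorProduct.map_smul_left, LinearMap.add_apply,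
    LinearMap.smul_apply, map_add, map_smul, lift_map_left, smul_add, neg_one_zpow_smul_smul,
    add_assoc]

include hC

theorem convMul_convMul_right (x : C.space) : convMul C B f (convMul C B g h) x =
    tripleRight B.mul B.mul (f ∘ₗ C.space.sgn (q + r)) (g ∘ₗ C.space.sgn r) h
      (C.comul.rTensor C.space (C.comul x)) := by
  have e : f ∘ₗ C.space.sgn (q + r) = (f ∘ₗ C.space.sgn (q + r)) ∘ₗ C.space.sgn 0 := by
    rw [LinearMap.comp_assoc, sgn_comp_sgn, add_zero]
  rw [convMul_apply C B _ (isHomogeneous_convMul C B hg hh), convMul_eq C B g hh, e,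
    lift_map_right, (hC x).assoc_symm_comul_comul, ← e]

theorem convMul_convBr_right (x : C.space) : convMul C B f (convBr C B g h) x =
    tripleRight B.mul B.br (f ∘ₗ C.space.sgn (q + r + (1 - d))) (g ∘ₗ C.space.sgn (r + d - 1)) h
      (C.comul.rTensor C.space (C.comul x)) +
    (-1 : k) ^ ((d - 1) * r) • tripleRight B.mul B.mul (f ∘ₗ C.space.sgn (q + r))
      (g ∘ₗ C.space.sgn r) h (cyc C.space (C.cobr.rTensor C.space (C.comul x))) := by
  rw [convMul_apply C B _ (isHomogeneous_convBr C B hg hh), convBr_eq C B g hh,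
    TensorProduct.map_add_right, TensorProduct.map_smul_right, LinearMap.add_apply,
    LinearMap.smul_apply, map_add, map_smul, ← (hC x).assoc_symm_cobr_comul,
    ← (hC x).assoc_symm_comul_comul, ← lift_map_right, ← lift_map_right, LinearMap.comp_assoc,
    LinearMap.comp_assoc, sgn_comp_sgn, sgn_comp_sgn, add_zero]

theorem convBr_convBr_right (x : C.space) : convBr C B f (convBr C B g h) x =
    tripleRight B.br B.br (f ∘ₗ C.space.sgn (q + r)) (g ∘ₗ C.space.sgn (r + d - 1)) h
      (C.comul.rTensor C.space (C.comul x)) +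
    (-1 : k) ^ ((d - 1) * r) • tripleRight B.br B.mul (f ∘ₗ C.space.sgn (q + r + (d - 1)))
      (g ∘ₗ C.space.sgn r) h (cyc C.space (C.cobr.rTensor C.space (C.comul x))) +
    (-1 : k) ^ ((d - 1) * (q + r + (1 - d)) + d) •
      tripleRight B.mul B.br (f ∘ₗ C.space.sgn (q + r + (1 - d))) (g ∘ₗ C.space.sgn (r + d - 1)) h
      (cyc C.space (cyc C.space (C.cobr.rTensor C.space (C.comul x)) +
        swapRight C.space (C.cobr.rTensor C.space (C.comul x)))) +
    (-1 : k) ^ ((d - 1) * (q + r + (1 - d)) + ((d - 1) * r + d)) •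
      tripleRight B.mul B.mul (f ∘ₗ C.space.sgn (q + r)) (g ∘ₗ C.space.sgn r) h
      (cyc C.space (C.cobr.rTensor C.space (C.cobr x))) := by
  -- To apply `lift_map_right`, the sign operator on `f` is split so that the part next to the
  -- cooperation has the degree of the inner cooperation: `0` for the coproduct and `1 - d` for the
  -- cobracket.
  have e₁ : f ∘ₗ C.space.sgn (q + r + (1 - d) + d - 1) =
      (f ∘ₗ C.space.sgn (q + r)) ∘ₗ C.space.sgn 0 := by
    rw [LinearMap.comp_assoc, sgn_comp_sgn]; congr 2; ring
  have e₂ : f ∘ₗ C.space.sgn (q + r + (1 - d) + d - 1) =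
      (f ∘ₗ C.space.sgn (q + r + (d - 1))) ∘ₗ C.space.sgn (1 - d) := by
    rw [LinearMap.comp_assoc, sgn_comp_sgn]; congr 2; ring
  have e₃ : f ∘ₗ C.space.sgn (q + r + (1 - d)) =
      (f ∘ₗ C.space.sgn (q + r + (1 - d))) ∘ₗ C.space.sgn 0 := by
    rw [LinearMap.comp_assoc, sgn_comp_sgn, add_zero]
  have e₄ : f ∘ₗ C.space.sgn (q + r + (1 - d)) =
      (f ∘ₗ C.space.sgn (q + r)) ∘ₗ C.space.sgn (1 - d) := by
    rw [LinearMap.comp_assoc, sgn_comp_sgn]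
  have h₁ := lift_map_right B.br B.br (f ∘ₗ C.space.sgn (q + r)) (g ∘ₗ C.space.sgn (r + d - 1)) h
    C.comul 0 (C.comul x)
  have h₂ := lift_map_right B.br B.mul (f ∘ₗ C.space.sgn (q + r + (d - 1))) (g ∘ₗ C.space.sgn r) h
    C.cobr (1 - d) (C.comul x)
  have h₃ := lift_map_right B.mul B.br (f ∘ₗ C.space.sgn (q + r + (1 - d)))
    (g ∘ₗ C.space.sgn (r + d - 1)) h C.comul 0 (C.cobr x)
  have h₄ := lift_map_right B.mul B.mul (f ∘ₗ C.space.sgn (q + r)) (g ∘ₗ C.space.sgn r) h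
    C.cobr (1 - d) (C.cobr x)
  rw [← e₁, (hC x).assoc_symm_comul_comul] at h₁
  rw [← e₂, (hC x).assoc_symm_cobr_comul] at h₂
  rw [← e₃, (hC x).assoc_symm_comul_cobr, map_smul] at h₃
  rw [← e₄, (hC x).assoc_symm_cobr_cobr, map_smul] at h₄
  rw [convBr_apply C B _ (isHomogeneous_convBr C B hg hh), convBr_eq C B g hh]
  have hadd : ∀ (m : B.space →ₗ[k] B.space →ₗ[k] B.space) s t, TensorProduct.lift m (s + t) =
    TensorProduct.lift m s + TensorProduct.lift m t := fun m => map_add _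
  have hsmul : ∀ (m : B.space →ₗ[k] B.space →ₗ[k] B.space) (c : k) t, TensorProduct.lift m (c • t) =
    c • TensorProduct.lift m t := fun m => map_smul _
  simp only [TensorProduct.map_add_right, TensorProduct.map_smul_right, LinearMap.add_apply,
    LinearMap.smul_apply, hadd, hsmul, h₁, h₂, h₃, h₄, smul_add, neg_one_zpow_smul_smul]
  simp only [add_assoc]

end nested

end

end DAlgebras

namespace DAlgebras

noncomputable section

open GradedSpace

variable {k : Type u} [Field k] {d : ℤ}

/-! ### The identities of the convolution algebra -/

/-- The Leibniz identity in the second argument of the bracket. -/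
theorem DGAlgData.IsDAlgebra.br_mul {B : DGAlgData k d} (hB : B.IsDAlgebra) {a b c : ℤ}
    {x y z : B.space} (hx : x ∈ B.space.deg a) (hy : y ∈ B.space.deg b) (hz : z ∈ B.space.deg c) :
    B.br x (B.mul y z) =
      B.mul (B.br x y) z + (-1 : k) ^ (b * (a + d - 1)) • B.mul y (B.br x z) := by
  rw [hB.br_skew _ _ x hx _ (B.mul_deg b c y hy z hz), hB.leibniz y c z hz a x hx,
    hB.br_skew _ _ z hz x hx, hB.br_skew _ _ y hy x hx]
  simp only [neg_smul, map_neg, LinearMap.neg_apply, map_smul, LinearMap.smul_apply, smul_add,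
    smul_neg, neg_neg, neg_one_zpow_smul_smul]
  rw [add_comm]
  congr 1
  · rw [neg_one_zpow_congr (n := 0), zpow_zero, one_smul]
    push_cast; have := mul_self_of_zmod_two a; have := mul_self_of_zmod_two d; grind
  · refine neg_one_zpow_smul_congr _ ?_
    push_cast; have := mul_self_of_zmod_two a; have := mul_self_of_zmod_two d
    have := mul_self_of_zmod_two c; grind

section laws
variable {C : CoalgData k d} {B : DGAlgData k d} (hC : ∀ x, C.LawsAt x) (hB : B.IsDAlgebra)
  {f g h : C.space →ₗ[k] B.space} {p q r : ℤ}
  (hf : IsHomogeneous C.space B.space f p) (hg : IsHomogeneous C.space B.space g q)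
  (hh : IsHomogeneous C.space B.space h r)

include hC hB hf hg

/-- Cocommutativity inserts a transposition at no cost, and commutativity of `B` undoes it. -/
theorem convMul_comm : convMul C B f g = (-1 : k) ^ (p * q) • convMul C B g f := by
  refine LinearMap.ext fun x => ?_
  rw [LinearMap.smul_apply, convMul_apply C B f hg, convMul_apply C B g hf]
  suffices e : TensorProduct.lift B.mul ∘ₗ TensorProduct.map (f ∘ₗ C.space.sgn q) g ∘ₗ
      swap C.space C.space = (-1 : k) ^ (p * q) •
      TensorProduct.lift B.mul ∘ₗ TensorProduct.map (g ∘ₗ C.space.sgn p) f by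
    have := LinearMap.congr_fun e (C.comul x)
    rwa [LinearMap.comp_apply, LinearMap.comp_apply, (hC x).cocomm] at this
  refine tensor_hom_ext C.space C.space fun a b x hx y hy => ?_
  simp only [LinearMap.comp_apply, LinearMap.smul_apply, swap_of_mem_mem _ _ hx hy, map_smul,
    TensorProduct.map_tmul, TensorProduct.lift.tmul, sgn_of_mem _ hx, sgn_of_mem _ hy]
  rw [hB.mul_comm _ _ _ (hf b y hy) _ (hg a x hx)]
  simp only [neg_one_zpow_smul_smul]
  refine neg_one_zpow_smul_congr _ ?_
  push_cast; grind

theorem convBr_skew : convBr C B f g =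
    -(-1 : k) ^ ((p + d - 1) * (q + d - 1)) • convBr C B g f := by
  refine LinearMap.ext fun x => ?_
  rw [LinearMap.smul_apply, convBr_apply C B f hg, convBr_apply C B g hf]
  -- The two halves of the bracket are skew for different reasons: the first pairs a skew bracket
  -- with a symmetric coproduct, the second a commutative product with a cobracket whose symmetry
  -- contributes `(-1) ^ d`.
  have e₁ : TensorProduct.lift B.br ∘ₗ TensorProduct.map (f ∘ₗ C.space.sgn (q + d - 1)) g ∘ₗ
      swap C.space C.space = -(-1 : k) ^ ((p + d - 1) * (q + d - 1)) •
      TensorProduct.lift B.br ∘ₗ TensorProduct.map (g ∘ₗ C.space.sgn (p + d - 1)) f := by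
    refine tensor_hom_ext C.space C.space fun a b x hx y hy => ?_
    simp only [LinearMap.comp_apply, LinearMap.smul_apply, swap_of_mem_mem _ _ hx hy, map_smul,
      TensorProduct.map_tmul, TensorProduct.lift.tmul, sgn_of_mem _ hx, sgn_of_mem _ hy]
    rw [hB.br_skew _ _ _ (hf b y hy) _ (hg a x hx)]
    simp only [neg_smul, smul_neg, neg_one_zpow_smul_smul, neg_inj]
    refine neg_one_zpow_smul_congr _ ?_
    push_cast; grind
  have e₂ : TensorProduct.lift B.mul ∘ₗ TensorProduct.map (f ∘ₗ C.space.sgn q) g ∘ₗ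
      swap C.space C.space = (-1 : k) ^ (p * q) •
      TensorProduct.lift B.mul ∘ₗ TensorProduct.map (g ∘ₗ C.space.sgn p) f := by
    refine tensor_hom_ext C.space C.space fun a b x hx y hy => ?_
    simp only [LinearMap.comp_apply, LinearMap.smul_apply, swap_of_mem_mem _ _ hx hy, map_smul,
      TensorProduct.map_tmul, TensorProduct.lift.tmul, sgn_of_mem _ hx, sgn_of_mem _ hy]
    rw [hB.mul_comm _ _ _ (hf b y hy) _ (hg a x hx)]
    simp only [neg_one_zpow_smul_smul]
    refine neg_one_zpow_smul_congr _ ?_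
    push_cast; grind
  have h₁ := LinearMap.congr_fun e₁ (C.comul x)
  have h₂ := LinearMap.congr_fun e₂ (C.cobr x)
  simp only [LinearMap.comp_apply, (hC x).cocomm, (hC x).coskew, map_smul,
    LinearMap.smul_apply] at h₁ h₂
  have h₃ := congrArg (fun t => (-1 : k) ^ d • t) h₂
  simp only [neg_one_zpow_smul_smul] at h₃
  rw [Even.neg_one_zpow ⟨d, rfl⟩, one_smul] at h₃
  rw [h₁, h₃, smul_add, neg_one_zpow_smul_smul, neg_smul, neg_smul, add_right_inj,
    neg_one_zpow_smul_smul, neg_one_zpow_eq_neg (k := k) (m := (d - 1) * q + (d + p * q))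
      (n := (p + d - 1) * (q + d - 1) + (d - 1) * p), neg_smul]
  push_cast
  have := mul_self_of_zmod_two d; grind

include hh

omit hf in
theorem convMul_assoc :
    convMul C B (convMul C B f g) h = convMul C B f (convMul C B g h) := by
  refine LinearMap.ext fun x => ?_
  rw [convMul_convMul_left C B f hg hh, convMul_convMul_right C B hC f hg hh]
  generalize C.comul.rTensor C.space (C.comul x) = t
  suffices e : tripleLeft B.mul B.mul (f ∘ₗ C.space.sgn (q + r)) (g ∘ₗ C.space.sgn r) h =
    tripleRight B.mul B.mul (f ∘ₗ C.space.sgn (q + r)) (g ∘ₗ C.space.sgn r) h by rw [e]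
  refine tensor_hom_ext₃ C.space C.space C.space fun a b c x hx y hy z hz => ?_
  rw [tripleLeft_tmul, tripleRight_tmul, hB.mul_assoc]

omit hf in
-- Over the iterated coproduct this is the Leibniz identity of `B`. The other part consists of
-- triple products: the co-Leibniz identity splits the left side into the two terms of the right
-- side, which then match by associativity and commutativity of `B`.
theorem convBr_leibniz : convBr C B (convMul C B f g) h = convMul C B f (convBr C B g h) +
    (-1 : k) ^ (q * (r + d - 1)) • convMul C B (convBr C B f h) g := by
  refine LinearMap.ext fun x => ?_
  rw [LinearMap.add_apply, LinearMap.smul_apply, convBr_convMul_left C B f hg hh,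
    convMul_convBr_right C B hC f hg hh, convMul_convBr_left C B f hh hg, (hC x).comul_cobr,
    map_add]
  have e₁ : tripleLeft B.br B.mul (f ∘ₗ C.space.sgn (q + (r + d - 1)))
      (g ∘ₗ C.space.sgn (r + d - 1)) h =
      tripleRight B.mul B.br (f ∘ₗ C.space.sgn (q + r + (1 - d))) (g ∘ₗ C.space.sgn (r + d - 1)) h +
      (-1 : k) ^ (q * (r + d - 1)) •
        tripleLeft B.mul B.br (f ∘ₗ C.space.sgn (r + d - 1 + q)) (h ∘ₗ C.space.sgn q) g ∘ₗ
          swapRight C.space := by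
    refine tensor_hom_ext₃ C.space C.space C.space fun a b c x hx y hy z hz => ?_
    simp only [LinearMap.add_apply, LinearMap.smul_apply, LinearMap.comp_apply,
      swapRight_of_mem _ _ hy hz, map_smul, tripleLeft_tmul, tripleRight_tmul, sgn_of_mem _ hx,
      sgn_of_mem _ hy, sgn_of_mem _ hz, LinearMap.smul_apply, neg_one_zpow_smul_smul]
    rw [hB.leibniz _ _ _ (hg b y hy) _ _ (hh c z hz), smul_add, neg_one_zpow_smul_smul]
    congr 1 <;> refine neg_one_zpow_smul_congr _ ?_ <;> push_cast <;> grind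
  have e₂ : tripleLeft B.mul B.mul (f ∘ₗ C.space.sgn (q + r)) (g ∘ₗ C.space.sgn r) h =
      tripleRight B.mul B.mul (f ∘ₗ C.space.sgn (q + r)) (g ∘ₗ C.space.sgn r) h := by
    refine tensor_hom_ext₃ C.space C.space C.space fun a b c x hx y hy z hz => ?_
    rw [tripleLeft_tmul, tripleRight_tmul, hB.mul_assoc]
  -- The summand of the co-Leibniz identity that contains `swapRight` corresponds to the product in
  -- which `g` and `h` have changed places.
  have e₃ : tripleLeft B.mul B.mul (f ∘ₗ C.space.sgn (q + r)) (g ∘ₗ C.space.sgn r) h ∘ₗ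
      swapRight C.space = (-1 : k) ^ (q * r) •
      tripleLeft B.mul B.mul (f ∘ₗ C.space.sgn (r + q)) (h ∘ₗ C.space.sgn q) g := by
    refine tensor_hom_ext₃ C.space C.space C.space fun a b c x hx y hy z hz => ?_
    simp only [LinearMap.smul_apply, LinearMap.comp_apply,
      swapRight_of_mem _ _ hy hz, map_smul, tripleLeft_tmul, sgn_of_mem _ hx,
      sgn_of_mem _ hy, sgn_of_mem _ hz, LinearMap.smul_apply, neg_one_zpow_smul_smul]
    rw [hB.mul_assoc, hB.mul_assoc, hB.mul_comm _ _ _ (hg c z hz) _ (hh b y hy), map_smul,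
      neg_one_zpow_smul_smul]
    refine neg_one_zpow_smul_congr _ ?_
    push_cast; grind
  have h₁ := LinearMap.congr_fun e₁ (C.comul.rTensor C.space (C.comul x))
  have h₃ := LinearMap.congr_fun e₃ (C.cobr.rTensor C.space (C.comul x))
  rw [LinearMap.add_apply, LinearMap.smul_apply, LinearMap.comp_apply,
    CoalgData.LawsAt.swapRight_comul_comul hC] at h₁
  rw [LinearMap.comp_apply, LinearMap.smul_apply] at h₃
  rw [h₁, h₃, e₂]
  simp only [smul_add, neg_one_zpow_smul_smul]
  rw [neg_one_zpow_congr (k := k) (m := (d - 1) * r + q * r)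
    (n := q * (r + d - 1) + ((d - 1) * r + q * (1 - d))) (by push_cast; ring)]
  abel_nf

end laws

/-! ### The differential of linear maps as a derivation -/

section diff
variable {C : CoalgData k d} {B : DGAlgData k d} (hB : B.IsDAlgebra)
  {D : C.space →ₗ[k] C.space} (hD : C.IsCoderivation D)
  {f g : C.space →ₗ[k] B.space} {p q : ℤ}
  (hf : IsHomogeneous C.space B.space f p) (hg : IsHomogeneous C.space B.space g q)

theorem homDiff_of_mem {X Y : GradedSpace k} {D : X →ₗ[k] X} {E : Y →ₗ[k] Y} {f : X →ₗ[k] Y}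
    {p : ℤ} (hf : IsHomogeneous X Y f p) :
    homDiff D E f = E ∘ₗ f - (-1 : k) ^ p • f ∘ₗ D := by
  change E ∘ₗ f - conj 1 f ∘ₗ D = _
  rw [conj_of_homogeneous hf, one_mul, LinearMap.smul_comp]

include hB hD hf hg

/-- The product rule in `B` and the coderivation rule in `C` yield the same four terms on both
sides, in which one of `f`, `g` is composed with one of the two differentials. Only signs remain to
be matched. -/
theorem homDiff_convMul : homDiff D B.diff (convMul C B f g) =
    convMul C B (homDiff D B.diff f) g + (-1 : k) ^ p • convMul C B f (homDiff D B.diff g) := by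
  refine LinearMap.ext fun x => ?_
  rw [homDiff_of_mem (isHomogeneous_convMul C B hf hg), LinearMap.add_apply, LinearMap.smul_apply,
    convMul_apply C B _ hg,
    convMul_apply C B f (isHomogeneous_homDiff hD.homogeneous B.diff_deg q g hg),
    LinearMap.sub_apply, LinearMap.smul_apply, LinearMap.comp_apply, LinearMap.comp_apply,
    convMul_apply C B f hg, convMul_apply C B f hg, hD.comul, homDiff_of_mem hf, homDiff_of_mem hg]
  generalize C.comul x = t
  suffices e : B.diff ∘ₗ TensorProduct.lift B.mul ∘ₗ TensorProduct.map (f ∘ₗ C.space.sgn q) g -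
      (-1 : k) ^ (p + q) • TensorProduct.lift B.mul ∘ₗ TensorProduct.map (f ∘ₗ C.space.sgn q) g ∘ₗ
      tensorDiff C.space C.space D D =
      TensorProduct.lift B.mul ∘ₗ
        TensorProduct.map ((B.diff ∘ₗ f - (-1 : k) ^ p • f ∘ₗ D) ∘ₗ C.space.sgn q) g +
      (-1 : k) ^ p • TensorProduct.lift B.mul ∘ₗ
        TensorProduct.map (f ∘ₗ C.space.sgn (q + 1)) (B.diff ∘ₗ g - (-1 : k) ^ q • g ∘ₗ D) from
    LinearMap.congr_fun e t
  refine tensor_hom_ext C.space C.space fun a b x hx y hy => ?_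
  simp only [LinearMap.add_apply, LinearMap.sub_apply, LinearMap.smul_apply, LinearMap.comp_apply,
    tensorDiff_tmul, map_add, map_sub, map_smul, TensorProduct.map_tmul, TensorProduct.lift.tmul,
    sgn_of_mem _ hx, sgn_of_mem _ (hD.homogeneous a x hx), hB.diff_mul _ _ (hf a x hx),
    smul_add, smul_sub, neg_one_zpow_smul_smul, LinearMap.sub_apply]
  rw [neg_one_zpow_congr (k := k) (m := p + q + q * (a + 1)) (n := q * a + p) (by push_cast; grind),
    neg_one_zpow_congr (k := k) (m := p + q + (1 * a + q * a)) (n := p + ((q + 1) * a + q))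
      (by push_cast; grind),
    neg_one_zpow_congr (k := k) (m := q * a + (a + p)) (n := p + (q + 1) * a) (by push_cast; grind)]
  abel_nf

theorem homDiff_convBr : homDiff D B.diff (convBr C B f g) =
    convBr C B (homDiff D B.diff f) g +
      (-1 : k) ^ (p + d - 1) • convBr C B f (homDiff D B.diff g) := by
  refine LinearMap.ext fun x => ?_
  rw [homDiff_of_mem (isHomogeneous_convBr C B hf hg), LinearMap.add_apply, LinearMap.smul_apply,
    convBr_apply C B _ hg,
    convBr_apply C B f (isHomogeneous_homDiff hD.homogeneous B.diff_deg q g hg),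
    LinearMap.sub_apply, LinearMap.smul_apply, LinearMap.comp_apply, LinearMap.comp_apply,
    convBr_apply C B f hg, convBr_apply C B f hg, hD.comul, hD.cobr, homDiff_of_mem hf,
    homDiff_of_mem hg]
  generalize C.comul x = t
  generalize C.cobr x = s
  -- The parts over `Δ x` and over `δ x` satisfy the derivation rule separately. In the second, the
  -- sign `(-1) ^ (d - 1)` of the rule for the cobracket enters the exponent.
  have e₁ : B.diff ∘ₗ TensorProduct.lift B.br ∘ₗ
        TensorProduct.map (f ∘ₗ C.space.sgn (q + d - 1)) g -
      (-1 : k) ^ (p + q + (1 - d)) • TensorProduct.lift B.br ∘ₗ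
        TensorProduct.map (f ∘ₗ C.space.sgn (q + d - 1)) g ∘ₗ tensorDiff C.space C.space D D =
      TensorProduct.lift B.br ∘ₗ
        TensorProduct.map ((B.diff ∘ₗ f - (-1 : k) ^ p • f ∘ₗ D) ∘ₗ C.space.sgn (q + d - 1)) g +
      (-1 : k) ^ (p + d - 1) • TensorProduct.lift B.br ∘ₗ
        TensorProduct.map (f ∘ₗ C.space.sgn (q + 1 + d - 1))
          (B.diff ∘ₗ g - (-1 : k) ^ q • g ∘ₗ D) := by
    refine tensor_hom_ext C.space C.space fun a b x hx y hy => ?_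
    simp only [LinearMap.add_apply, LinearMap.sub_apply, LinearMap.smul_apply, LinearMap.comp_apply,
      tensorDiff_tmul, map_add, map_sub, map_smul, TensorProduct.map_tmul, TensorProduct.lift.tmul,
      sgn_of_mem _ hx, sgn_of_mem _ (hD.homogeneous a x hx), hB.diff_br _ _ (hf a x hx),
      smul_add, smul_sub, neg_one_zpow_smul_smul, LinearMap.sub_apply]
    rw [neg_one_zpow_congr (k := k) (m := p + q + (1 - d) + (q + d - 1) * (a + 1))
        (n := (q + d - 1) * a + p) (by push_cast; grind),
      neg_one_zpow_congr (k := k) (m := p + q + (1 - d) + (1 * a + (q + d - 1) * a))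
        (n := p + d - 1 + ((q + 1 + d - 1) * a + q)) (by push_cast; grind),
      neg_one_zpow_congr (k := k) (m := (q + d - 1) * a + (a + p + d - 1))
        (n := p + d - 1 + (q + 1 + d - 1) * a) (by push_cast; grind)]
    abel_nf
  have e₂ : (-1 : k) ^ ((d - 1) * q) • B.diff ∘ₗ TensorProduct.lift B.mul ∘ₗ
        TensorProduct.map (f ∘ₗ C.space.sgn q) g -
      (-1 : k) ^ (p + q + (1 - d) + ((d - 1) * q + (d - 1))) • TensorProduct.lift B.mul ∘ₗ
        TensorProduct.map (f ∘ₗ C.space.sgn q) g ∘ₗ tensorDiff C.space C.space D D =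
      (-1 : k) ^ ((d - 1) * q) • TensorProduct.lift B.mul ∘ₗ
        TensorProduct.map ((B.diff ∘ₗ f - (-1 : k) ^ p • f ∘ₗ D) ∘ₗ C.space.sgn q) g +
      (-1 : k) ^ (p + d - 1 + (d - 1) * (q + 1)) • TensorProduct.lift B.mul ∘ₗ
        TensorProduct.map (f ∘ₗ C.space.sgn (q + 1)) (B.diff ∘ₗ g - (-1 : k) ^ q • g ∘ₗ D) := by
    refine tensor_hom_ext C.space C.space fun a b x hx y hy => ?_
    simp only [LinearMap.add_apply, LinearMap.sub_apply, LinearMap.smul_apply, LinearMap.comp_apply,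
      tensorDiff_tmul, map_add, map_sub, map_smul, TensorProduct.map_tmul, TensorProduct.lift.tmul,
      sgn_of_mem _ hx, sgn_of_mem _ (hD.homogeneous a x hx), hB.diff_mul _ _ (hf a x hx),
      smul_add, smul_sub, neg_one_zpow_smul_smul, LinearMap.sub_apply]
    rw [neg_one_zpow_congr (k := k) (m := p + q + (1 - d) + ((d - 1) * q + (d - 1)) + q * (a + 1))
        (n := (d - 1) * q + (q * a + p)) (by push_cast; grind),
      neg_one_zpow_congr (k := k)
        (m := p + q + (1 - d) + ((d - 1) * q + (d - 1)) + (1 * a + q * a))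
        (n := p + d - 1 + (d - 1) * (q + 1) + ((q + 1) * a + q)) (by push_cast; grind),
      neg_one_zpow_congr (k := k) (m := (d - 1) * q + (q * a + (a + p)))
        (n := p + d - 1 + (d - 1) * (q + 1) + (q + 1) * a) (by push_cast; grind)]
    abel_nf
  have h₁ := LinearMap.congr_fun e₁ t
  have h₂ := LinearMap.congr_fun e₂ s
  simp only [LinearMap.add_apply, LinearMap.sub_apply, LinearMap.smul_apply, LinearMap.comp_apply]
    at h₁ h₂
  have h₃ := congrArg₂ (· + ·) h₁ h₂
  simp only [map_add, map_smul, smul_add, neg_one_zpow_smul_smul] at h₃ ⊢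
  rw [show ∀ a b c e : B.space, a + b - (c + e) = a - c + (b - e) from fun a b c e => by abel, h₃]
  abel_nf

end diff

end

end DAlgebras

namespace DAlgebras

noncomputable section

open GradedSpace

variable {k : Type u} [Field k] {d : ℤ}

/-! ### The Jacobi identity for the convolution bracket -/

namespace GradedSpace

theorem cyc_cyc_rTensor_swap (X : GradedSpace k) (t : (X ⊗[k] X) ⊗[k] X) :
    cyc X (cyc X ((swap X X).rTensor X t)) = swapRight X t := by
  suffices h : cyc X ∘ₗ cyc X ∘ₗ (swap X X).rTensor X = swapRight X from LinearMap.congr_fun h t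
  refine tensor_hom_ext₃ X X X fun a b c x hx y hy z hz => ?_
  simp only [LinearMap.comp_apply, rTensor_swap_of_mem X hx hy, cyc_of_mem X hy hx hz,
    cyc_of_mem X hz hy hx, swapRight_of_mem X x hy hz, map_smul]
  simp only [neg_one_zpow_smul_smul]
  exact neg_one_zpow_smul_congr _ (by push_cast; grind)

theorem cyc_swapRight_rTensor_swap (X : GradedSpace k) (t : (X ⊗[k] X) ⊗[k] X) :
    cyc X (swapRight X ((swap X X).rTensor X t)) = t := by
  rw [← cyc_cyc_rTensor_swap, cyc_cyc_cyc, ← LinearMap.comp_apply, ← LinearMap.rTensor_comp,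
    show swap X X ∘ₗ swap X X = LinearMap.id from LinearMap.ext (swap_swap X X),
    LinearMap.rTensor_id, LinearMap.id_apply]

theorem swapRight_swapRight (X : GradedSpace k) (t : (X ⊗[k] X) ⊗[k] X) :
    swapRight X (swapRight X t) = t := by
  suffices h : swapRight X ∘ₗ swapRight X = LinearMap.id from LinearMap.congr_fun h t
  refine tensor_hom_ext₃ X X X fun a b c x hx y hy z hz => ?_
  simp only [LinearMap.comp_apply, swapRight_of_mem X x hy hz, swapRight_of_mem X x hz hy,
    map_smul]
  simp only [neg_one_zpow_smul_smul]
  rw [Even.neg_one_zpow ⟨b * c, by ring⟩, one_smul, LinearMap.id_apply]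

end GradedSpace

section functionals
variable {X : GradedSpace k} {B : DGAlgData k d} (hB : B.IsDAlgebra)
  {f g h : X →ₗ[k] B.space} {p q r : ℤ} (hf : IsHomogeneous X B.space f p)
  (hg : IsHomogeneous X B.space g q) (hh : IsHomogeneous X B.space h r)

/-- The map `x ⊗ y ⊗ z ↦ ± f x * {g y, h z}`. -/
def mulBr (B : DGAlgData k d) (f g h : X →ₗ[k] B.space) (q r : ℤ) :
    (X ⊗[k] X) ⊗[k] X →ₗ[k] B.space :=
  tripleRight B.mul B.br (f ∘ₗ X.sgn (q + r + (1 - d))) (g ∘ₗ X.sgn (r + d - 1)) h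

include hB

theorem tripleRight_mul_mul :
    tripleRight B.mul B.mul f g h = tripleLeft B.mul B.mul f g h :=
  tensor_hom_ext₃ X X X fun a b c x hx y hy z hz => by
    rw [tripleLeft_tmul, tripleRight_tmul, hB.mul_assoc]

include hf hg hh

omit hh in
theorem tripleLeft_mul_mul_swap :
    tripleLeft B.mul B.mul (g ∘ₗ X.sgn (p + r)) (f ∘ₗ X.sgn r) h = (-1 : k) ^ (p * q) •
      tripleLeft B.mul B.mul (f ∘ₗ X.sgn (q + r)) (g ∘ₗ X.sgn r) h ∘ₗ (swap X X).rTensor X := by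
  refine tensor_hom_ext₃ X X X fun a b c x hx y hy z hz => ?_
  simp only [LinearMap.smul_apply, LinearMap.comp_apply, rTensor_swap_of_mem X hx hy,
    map_smul, tripleLeft_tmul, sgn_of_mem _ hx, sgn_of_mem _ hy, LinearMap.smul_apply,
    neg_one_zpow_smul_smul]
  rw [hB.mul_comm _ _ _ (hg a x hx) _ (hf b y hy), map_smul, LinearMap.smul_apply,
    neg_one_zpow_smul_smul]
  exact neg_one_zpow_smul_congr _ (by push_cast; grind)

/-- A normal form for the mixed terms: the Leibniz identity moves the bracket inside the product,
and commutativity puts the remaining factor in front, so every combination of one product and one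
bracket becomes a sum of `mulBr` terms on permuted tensors. -/
theorem tripleLeft_br_mul :
    tripleLeft B.br B.mul (f ∘ₗ X.sgn (q + (r + d - 1))) (g ∘ₗ X.sgn (r + d - 1)) h =
      mulBr B f g h q r + (-1 : k) ^ (p * q) • mulBr B g f h p r ∘ₗ (swap X X).rTensor X := by
  refine tensor_hom_ext₃ X X X fun a b c x hx y hy z hz => ?_
  simp only [mulBr, LinearMap.smul_apply, LinearMap.comp_apply, rTensor_swap_of_mem X hx hy,
    map_smul, tripleLeft_tmul, tripleRight_tmul, sgn_of_mem _ hx, sgn_of_mem _ hy,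
    LinearMap.smul_apply, neg_one_zpow_smul_smul, LinearMap.add_apply]
  rw [hB.leibniz _ _ _ (hg b y hy) _ _ (hh c z hz), smul_add, neg_one_zpow_smul_smul,
    hB.mul_comm _ _ _ (B.br_deg _ _ _ (hf a x hx) _ (hh c z hz)) _ (hg b y hy),
    neg_one_zpow_smul_smul]
  congr 1 <;> refine neg_one_zpow_smul_congr _ ?_ <;> push_cast <;> grind

theorem tripleLeft_mul_br :
    tripleLeft B.mul B.br (f ∘ₗ X.sgn (q + d - 1 + r)) (g ∘ₗ X.sgn r) h =
      (-1 : k) ^ (r * (p + q + d - 1)) • mulBr B h f g p q ∘ₗ cyc X := by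
  refine tensor_hom_ext₃ X X X fun a b c x hx y hy z hz => ?_
  simp only [mulBr, LinearMap.smul_apply, LinearMap.comp_apply, cyc_of_mem X hx hy hz,
    map_smul, tripleLeft_tmul, tripleRight_tmul, sgn_of_mem _ hx, sgn_of_mem _ hy,
    sgn_of_mem _ hz, LinearMap.smul_apply, neg_one_zpow_smul_smul]
  rw [hB.mul_comm _ _ _ (B.br_deg _ _ _ (hf a x hx) _ (hg b y hy)) _ (hh c z hz),
    neg_one_zpow_smul_smul]
  exact neg_one_zpow_smul_congr _ (by push_cast; grind)

theorem tripleRight_br_mul :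
    tripleRight B.br B.mul (f ∘ₗ X.sgn (q + r + (d - 1))) (g ∘ₗ X.sgn r) h =
      (-1 : k) ^ (r * (p + q + d - 1)) • mulBr B h f g p q ∘ₗ cyc X +
      (-1 : k) ^ (q * (p + d - 1)) • mulBr B g f h p r ∘ₗ (swap X X).rTensor X := by
  refine tensor_hom_ext₃ X X X fun a b c x hx y hy z hz => ?_
  simp only [mulBr, LinearMap.smul_apply, LinearMap.comp_apply, cyc_of_mem X hx hy hz,
    rTensor_swap_of_mem X hx hy,
    map_smul, tripleRight_tmul, sgn_of_mem _ hx, sgn_of_mem _ hy,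
    sgn_of_mem _ hz, LinearMap.smul_apply, neg_one_zpow_smul_smul, LinearMap.add_apply]
  rw [hB.br_mul (hf a x hx) (hg b y hy) (hh c z hz),
    hB.mul_comm _ _ _ (B.br_deg _ _ _ (hf a x hx) _ (hg b y hy)) _ (hh c z hz), smul_add,
    neg_one_zpow_smul_smul, neg_one_zpow_smul_smul]
  congr 1 <;> refine neg_one_zpow_smul_congr _ ?_ <;> push_cast <;> grind

omit hh in
-- By skew-symmetry only three kinds of `mulBr` are needed, one for each choice of the argument
-- outside the bracket.
theorem mulBr_swap : mulBr B h g f q p =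
    -(-1 : k) ^ ((p + d - 1) * (q + d - 1)) • mulBr B h f g p q ∘ₗ swapRight X := by
  refine tensor_hom_ext₃ X X X fun a b c x hx y hy z hz => ?_
  simp only [mulBr, LinearMap.smul_apply, LinearMap.comp_apply, swapRight_of_mem X x hy hz,
    map_smul, tripleRight_tmul, sgn_of_mem _ hx, sgn_of_mem _ hy,
    sgn_of_mem _ hz, LinearMap.smul_apply, neg_one_zpow_smul_smul]
  rw [hB.br_skew _ _ _ (hg b y hy) _ (hf c z hz)]
  simp only [neg_smul, map_neg, smul_neg, map_smul, neg_one_zpow_smul_smul, neg_inj]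
  refine neg_one_zpow_smul_congr _ ?_
  push_cast; grind

omit hh in
-- The Jacobi identity of `B` on homogeneous arguments. The transposition of tensor factors
-- disappears when the map is evaluated on an iterated coproduct.
theorem tripleRight_br_br :
    tripleRight B.br B.br (f ∘ₗ X.sgn (q + r)) (g ∘ₗ X.sgn (r + d - 1)) h =
      tripleLeft B.br B.br (f ∘ₗ X.sgn (q + d - 1 + (r + d - 1))) (g ∘ₗ X.sgn (r + d - 1)) h +
      (-1 : k) ^ ((p + d - 1) * (q + d - 1)) •
        tripleRight B.br B.br (g ∘ₗ X.sgn (p + r)) (f ∘ₗ X.sgn (r + d - 1)) h ∘ₗ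
          (swap X X).rTensor X := by
  refine tensor_hom_ext₃ X X X fun a b c x hx y hy z hz => ?_
  simp only [LinearMap.smul_apply, LinearMap.comp_apply, LinearMap.add_apply,
    rTensor_swap_of_mem X hx hy, map_smul, tripleLeft_tmul, tripleRight_tmul, sgn_of_mem _ hx,
    sgn_of_mem _ hy, LinearMap.smul_apply, neg_one_zpow_smul_smul]
  rw [hB.jacobi _ _ _ (hf a x hx) _ (hg b y hy), smul_add, neg_one_zpow_smul_smul]
  congr 1 <;> refine neg_one_zpow_smul_congr _ ?_ <;> push_cast
  · have := mul_self_of_zmod_two a; grind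
  · have := mul_self_of_zmod_two d; grind

end functionals

/-- Expand each double bracket by the kind of its operations. Terms with two brackets of `B` sit
over `(Δ ⊗ 1) Δ x` and cancel by the Jacobi identity of `B` and the symmetry of the iterated
coproduct. Terms with two products sit over `(δ ⊗ 1) δ x` and cancel by the co-Jacobi identity.
Mixed terms are all brought to `mulBr` evaluated on permutations of `(δ ⊗ 1) Δ x` and cancel in
pairs. -/
theorem convBr_jacobi {C : CoalgData k d} {B : DGAlgData k d} (hC : ∀ x, C.LawsAt x)
    (hB : B.IsDAlgebra) {f g h : C.space →ₗ[k] B.space} {p q r : ℤ}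
    (hf : IsHomogeneous C.space B.space f p) (hg : IsHomogeneous C.space B.space g q)
    (hh : IsHomogeneous C.space B.space h r) :
    convBr C B f (convBr C B g h) = convBr C B (convBr C B f g) h +
      (-1 : k) ^ ((p + d - 1) * (q + d - 1)) • convBr C B g (convBr C B f h) := by
  refine LinearMap.ext fun x => ?_
  rw [LinearMap.add_apply, LinearMap.smul_apply, convBr_convBr_right C B hC f hg hh,
    convBr_convBr_right C B hC g hf hh, convBr_convBr_left C B f hg hh, (hC x).comul_cobr]
  have hu := CoalgData.LawsAt.swap_cobr hC (C.comul x)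
  have hw := CoalgData.LawsAt.swap_cobr hC (C.cobr x)
  have hΔ := CoalgData.LawsAt.swap_comul_comul (x := x) hC
  have hJ := (hC x).cojacobi
  generalize C.comul.rTensor C.space (C.comul x) = t at *
  generalize C.cobr.rTensor C.space (C.comul x) = u at *
  generalize C.cobr.rTensor C.space (C.cobr x) = w at *
  have sq : ∀ (M : Type u) [AddCommMonoid M] [Module k M] (m : M),
      (-1 : k) ^ d • (-1 : k) ^ d • m = m := fun M _ _ m => by
    rw [neg_one_zpow_smul_smul, Even.neg_one_zpow ⟨d, rfl⟩, one_smul]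
  -- Since a transposition of the first two factors multiplies `u` by `(-1) ^ d`, all permutations
  -- of `u` that remain in the mixed terms reduce, up to sign, to `u` and `swapRight u`.
  have hu₁ : cyc C.space (cyc C.space u) = (-1 : k) ^ d • swapRight C.space u := by
    rw [← cyc_cyc_rTensor_swap, hu, map_smul, map_smul, sq]
  have hu₂ : cyc C.space (swapRight C.space u) = (-1 : k) ^ d • u := by
    conv_rhs => rw [← cyc_swapRight_rTensor_swap C.space u, hu, map_smul, map_smul, sq]
  have hu₃ : (swap C.space C.space).rTensor C.space (cyc C.space u) = swapRight C.space u := by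
    rw [rTensor_swap_cyc, cyc_cyc_rTensor_swap]
  have hw₁ : (swap C.space C.space).rTensor C.space (cyc C.space w) =
      (-1 : k) ^ d • cyc C.space (cyc C.space w) := by
    rw [rTensor_swap_cyc, hw, map_smul, map_smul]
  have e₁ := LinearMap.congr_fun (tripleRight_br_br (h := h) (r := r) hB hf hg) t
  rw [LinearMap.add_apply, LinearMap.smul_apply, LinearMap.comp_apply, hΔ] at e₁
  have eM : ∀ F G H : C.space →ₗ[k] B.space, tripleRight B.mul B.mul F G H =
    tripleLeft B.mul B.mul F G H := fun F G H => tripleRight_mul_mul hB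
  -- The co-Jacobi identity is used only after applying the triple product; it expresses `w₁` by
  -- `w₀` and `w₂` at the end.
  have hJ' := congrArg (tripleLeft B.mul B.mul (f ∘ₗ C.space.sgn (q + r)) (g ∘ₗ C.space.sgn r) h) hJ
  rw [map_add, map_add, map_zero] at hJ'
  rw [e₁, eM, eM, tripleLeft_mul_mul_swap (f := f) (g := g) (q := q) hB hf hg,
    tripleRight_br_mul hB hf hg hh, tripleRight_br_mul hB hg hf hh, tripleLeft_br_mul hB hf hg hh,
    tripleLeft_mul_br hB hf hg hh, mulBr_swap (f := f) (g := g) (h := h) hB hf hg, ← mulBr, ← mulBr]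
  simp only [map_add, hu₁, hu₂, LinearMap.add_apply, LinearMap.smul_apply, LinearMap.comp_apply,
    map_smul, hu, hu₃, hw₁, swapRight_swapRight, neg_smul, smul_neg,
    LinearMap.neg_apply]
  generalize tripleLeft B.mul B.mul (f ∘ₗ C.space.sgn (q + r)) (g ∘ₗ C.space.sgn r) h w = w₀ at *
  generalize tripleLeft B.mul B.mul (f ∘ₗ C.space.sgn (q + r)) (g ∘ₗ C.space.sgn r) h
    (cyc C.space w) = w₁ at *
  generalize tripleLeft B.mul B.mul (f ∘ₗ C.space.sgn (q + r)) (g ∘ₗ C.space.sgn r) h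
    (cyc C.space (cyc C.space w)) = w₂ at *
  generalize mulBr B f g h q r u = a₁
  generalize mulBr B f g h q r (swapRight C.space u) = a₂
  generalize mulBr B g f h p r u = b₁
  generalize mulBr B g f h p r (swapRight C.space u) = b₂
  generalize mulBr B h f g p q u = c₁
  generalize mulBr B h f g p q (swapRight C.space u) = c₂
  simp only [smul_add, smul_neg, neg_one_zpow_smul_smul]
  have hd := mul_self_of_zmod_two d
  -- Exponents of equal parity are made literally equal, with an explicit minus sign where parities
  -- differ, so that `module` can treat the remaining powers of `-1` as independent scalars.
  rw [neg_one_zpow_congr (k := k) (m := (d - 1) * (q + r + (1 - d)) + d + d)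
      (n := (d - 1) * (q + r + (1 - d))) (by push_cast; grind),
    neg_one_zpow_congr (k := k) (m := (d - 1) * q + (r + d - 1) * (1 - d))
      (n := (d - 1) * (q + r + (1 - d))) (by push_cast; grind),
    neg_one_zpow_congr (k := k)
      (m := (p + d - 1) * (q + d - 1) + ((d - 1) * r + p * (q + d - 1)))
      (n := (d - 1) * (q + r + (1 - d))) (by push_cast; grind),
    neg_one_zpow_congr (k := k)
      (m := (p + d - 1) * (q + d - 1) + ((d - 1) * (p + r + (1 - d)) + d + d))
      (n := (d - 1) * r + q * (p + d - 1)) (by push_cast; grind),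
    neg_one_zpow_eq_neg (k := k) (m := (d - 1) * q + (r + d - 1) * (1 - d) + (p * q + d))
      (n := (d - 1) * r + q * (p + d - 1)) (by push_cast; grind),
    neg_one_zpow_congr (k := k) (m := (p + d - 1) * (q + d - 1) +
        ((d - 1) * r + (r * (q + p + d - 1) + (d + (p + d - 1) * (q + d - 1)))))
      (n := (d - 1) * r + (r * (p + q + d - 1) + d)) (by push_cast; grind),
    neg_one_zpow_eq_neg (k := k) (m := (d - 1) * (q + r + (1 - d)) + ((d - 1) * r + d))
      (n := (d - 1) * r + ((d - 1) * q + r * (1 - d))) (by push_cast; grind),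
    neg_one_zpow_congr (k := k) (m := (p + d - 1) * (q + d - 1) +
        ((d - 1) * (p + r + (1 - d)) + ((d - 1) * r + d) + (p * q + d)))
      (n := (d - 1) * r + ((d - 1) * q + r * (1 - d))) (by push_cast; grind),
    show w₁ = -w₀ - w₂ by rw [← sub_eq_zero, ← hJ']; abel]
  module

end

end DAlgebras

namespace DAlgebras

noncomputable section

open GradedSpace

variable {k : Type u} [Field k] {d : ℤ}

/-! ### The `d`-algebra of linear maps -/

@[elab_as_elim]
theorem GradedSpace.induction (X : GradedSpace k) {P : X → Prop} (x : X) (zero : P 0)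
    (add : ∀ x y, P x → P y → P (x + y)) (mem : ∀ i, ∀ x ∈ X.deg i, P x) : P x := by
  have hx : x ∈ ⨆ i, X.deg i := by rw [X.iSup_deg]; trivial
  induction hx using Submodule.iSup_induction' with
  | mem i x hx => exact mem i x hx
  | zero => exact zero
  | add x y _ _ hx hy => exact add x y hx hy

theorem homDiff_homDiff {X Y : GradedSpace k} {D : X →ₗ[k] X} {E : Y →ₗ[k] Y}
    (hD : IsHomogeneous X X D 1) (hE : IsHomogeneous Y Y E 1) (hD₂ : ∀ x, D (D x) = 0)
    (hE₂ : ∀ y, E (E y) = 0) {f : X →ₗ[k] Y} {p : ℤ} (hf : IsHomogeneous X Y f p) :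
    homDiff D E (homDiff D E f) = 0 := by
  refine LinearMap.ext fun x => ?_
  rw [homDiff_of_mem (isHomogeneous_homDiff hD hE p f hf), homDiff_of_mem hf,
    neg_one_zpow_eq_neg (m := p + 1) (n := p) (by push_cast; ring)]
  simp [hD₂, hE₂]

/-- The linear maps from a `d`-coalgebra to a `d`-algebra are a `d`-algebra. -/
theorem isDAlgebra_homAlg {C : DGCoalgData k d} {B : DGAlgData k d} (hC : C.IsDCoalgebra)
    (hB : B.IsDAlgebra) : (homAlg C B).IsDAlgebra where
  diff_diff x := by
    refine (homAlg C B).space.induction x (by simp)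
      (fun x y hx hy => by rw [map_add, map_add, hx, hy, add_zero]) fun p f hf => Subtype.ext ?_
    exact homDiff_homDiff C.diff_deg B.diff_deg hC.diff_diff hB.diff_diff hf
  mul_comm p q f hf g hg := Subtype.ext (convMul_comm hC.laws hB hf hg)
  mul_assoc f g h := by
    refine (homAlg C B).space.induction g (by simp)
      (fun x y hx hy => by simp only [map_add, LinearMap.add_apply, hx, hy]) fun q g hg => ?_
    refine (homAlg C B).space.induction h (by simp)
      (fun x y hx hy => by simp only [map_add, hx, hy]) fun r h hh => Subtype.ext ?_
    exact convMul_assoc hC.laws hB hg hh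
  diff_mul p f hf g := by
    refine (homAlg C B).space.induction g (by simp)
      (fun x y hx hy => by simp only [map_add, hx, hy, smul_add]; abel)
      fun q g hg => Subtype.ext ?_
    exact homDiff_convMul hB hC.coderivation hf hg
  br_skew p q f hf g hg := Subtype.ext (convBr_skew hC.laws hB hf hg)
  jacobi p q f hf g hg h := by
    refine (homAlg C B).space.induction h (by simp)
      (fun x y hx hy => by simp only [map_add, hx, hy, smul_add]; abel)
      fun r h hh => Subtype.ext ?_
    exact convBr_jacobi hC.laws hB hf hg hh
  diff_br p f hf g := by
    refine (homAlg C B).space.induction g (by simp)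
      (fun x y hx hy => by simp only [map_add, hx, hy, smul_add]; abel)
      fun q g hg => Subtype.ext ?_
    exact homDiff_convBr hB hC.coderivation hf hg
  leibniz f q g hg r h hh := Subtype.ext (convBr_leibniz hC.laws hB hg hh)

/-! ### Twisting -/

/-- Twisting the differential by a Maurer-Cartan element yields a `d`-algebra. -/
theorem DGAlgData.IsDAlgebra.twist [CharZero k] {A : DGAlgData k d} (hA : A.IsDAlgebra)
    {x : A.space} (hx : A.IsMaurerCartan x) : (A.twist x hx.1).IsDAlgebra where
  diff_diff := by
    intro y
    change A.diff (A.diff y + A.br x y) + A.br x (A.diff y + A.br x y) = 0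
    have h₁ := hA.diff_br d x hx.1 y
    have h₂ := hA.jacobi d d x hx.1 x hx.1 y
    rw [neg_one_zpow_eq_neg (m := d + d - 1) (n := 0) (by push_cast; grind), zpow_zero] at h₁
    rw [neg_one_zpow_eq_neg (m := (d + d - 1) * (d + d - 1)) (n := 0) (by push_cast; grind),
      zpow_zero] at h₂
    -- The shifted degree of `x` is `2d - 1`, which is odd, so the Jacobi identity reads `2{x, {x,
    -- y}} = {{x, x}, y}`. The Maurer-Cartan equation then cancels this term against `{dx, y}`.
    have h₃ : A.br x (A.br x y) = (2 : k)⁻¹ • A.br (A.br x x) y := by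
      rw [eq_inv_smul_iff₀ two_ne_zero, two_smul]
      nth_rw 1 [h₂]
      simp
    have h₄ := congrArg (fun z => A.br z y) hx.2
    simp only [map_add, map_smul, LinearMap.add_apply, LinearMap.smul_apply, map_zero,
      LinearMap.zero_apply] at h₄
    rw [map_add, map_add, hA.diff_diff, zero_add, h₁, h₃, ← h₄]
    module
  mul_comm := hA.mul_comm
  mul_assoc := hA.mul_assoc
  diff_mul i y hy z := by
    change A.diff (A.mul y z) + A.br x (A.mul y z) =
      A.mul (A.diff y + A.br x y) z + (-1 : k) ^ i • A.mul y (A.diff z + A.br x z)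
    refine A.space.induction z (by simp)
      (fun z w hz hw => by simp only [map_add, smul_add] at hz hw ⊢; rw [add_add_add_comm, hz, hw]; abel)
      fun j z hz => ?_
    -- Bracketing with `x` is a derivation of degree `1` of the product, so its sum with the
    -- differential is one too.
    rw [hA.diff_mul i y hy, hA.br_mul hx.1 hy hz, neg_one_zpow_congr (m := i * (d + d - 1)) (n := i)
      (by push_cast; grind)]
    simp only [map_add, LinearMap.add_apply, smul_add]
    abel
  br_skew := hA.br_skew
  jacobi := hA.jacobi
  diff_br i y hy z := by
    change A.diff (A.br y z) + A.br x (A.br y z) =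
      A.br (A.diff y + A.br x y) z + (-1 : k) ^ (i + d - 1) • A.br y (A.diff z + A.br x z)
    rw [hA.diff_br i y hy, hA.jacobi d i x hx.1 y hy,
      neg_one_zpow_congr (m := (d + d - 1) * (i + d - 1)) (n := i + d - 1) (by push_cast; grind)]
    simp only [map_add, LinearMap.add_apply, smul_add]
    abel
  leibniz := hA.leibniz

end

end DAlgebras

namespace DAlgebras

noncomputable section

open GradedSpace

variable {k : Type u} [Field k] {d : ℤ}

/-! ### Morphisms of coalgebras -/

namespace CoalgData

/-- A linear map of degree `0` that respects the coproduct, the counit and the cobracket. -/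
structure IsHom (C C' : CoalgData k d) (g : C.space →ₗ[k] C'.space) : Prop where
  deg : IsHomogeneous C.space C'.space g 0
  comul : ∀ x, C'.comul (g x) = TensorProduct.map g g (C.comul x)
  counit : ∀ x, C'.counit (g x) = C.counit x
  cobr : ∀ x, C'.cobr (g x) = TensorProduct.map g g (C.cobr x)

theorem _root_.DAlgebras.DGCoalgData.Hom.isHom {C C' : DGCoalgData k d} (g : C.Hom C') :
    IsHom C.toCoalgData C'.toCoalgData g.map :=
  ⟨g.map_deg, g.map_comul, g.map_counit, g.map_cobr⟩

theorem map_rTensor {M N M₂ N₂ : Type u} [AddCommGroup M] [Module k M] [AddCommGroup N] [Module k N]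
    [AddCommGroup M₂] [Module k M₂] [AddCommGroup N₂] [Module k N₂]
    {g : M →ₗ[k] N} {g₂ : M₂ →ₗ[k] N₂} {D : M →ₗ[k] M₂} {D' : N →ₗ[k] N₂}
    (h : ∀ x, D' (g x) = g₂ (D x)) (t : M ⊗[k] M) :
    D'.rTensor N (TensorProduct.map g g t) = TensorProduct.map g₂ g (D.rTensor M t) := by
  induction t using TensorProduct.induction_on with
  | zero => simp
  | tmul x y => simp [h]
  | add x y hx hy => simp only [map_add, hx, hy]

theorem map_lTensor {M N M₂ N₂ : Type u} [AddCommGroup M] [Module k M] [AddCommGroup N] [Module k N]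
    [AddCommGroup M₂] [Module k M₂] [AddCommGroup N₂] [Module k N₂]
    {g : M →ₗ[k] N} {g₂ : M₂ →ₗ[k] N₂} {D : M →ₗ[k] M₂} {D' : N →ₗ[k] N₂}
    (h : ∀ x, D' (g x) = g₂ (D x)) (t : M ⊗[k] M) :
    D'.lTensor N (TensorProduct.map g g t) = TensorProduct.map g g₂ (D.lTensor M t) := by
  induction t using TensorProduct.induction_on with
  | zero => simp
  | tmul x y => simp [h]
  | add x y hx hy => simp only [map_add, hx, hy]

theorem assoc_map {M N : Type u} [AddCommGroup M] [Module k M] [AddCommGroup N] [Module k N]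
    (g : M →ₗ[k] N) (t : (M ⊗[k] M) ⊗[k] M) :
    TensorProduct.assoc k N N N (TensorProduct.map (TensorProduct.map g g) g t) =
      TensorProduct.map g (TensorProduct.map g g) (TensorProduct.assoc k M M M t) := by
  suffices h : (TensorProduct.assoc k N N N).toLinearMap ∘ₗ
      TensorProduct.map (TensorProduct.map g g) g = TensorProduct.map g (TensorProduct.map g g) ∘ₗ
        (TensorProduct.assoc k M M M).toLinearMap from LinearMap.congr_fun h t
  exact TensorProduct.ext_threefold fun x y z => by simp

theorem assoc_symm_map {M N : Type u} [AddCommGroup M] [Module k M] [AddCommGroup N] [Module k N]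
    (g : M →ₗ[k] N) (t : M ⊗[k] (M ⊗[k] M)) :
    (TensorProduct.assoc k N N N).symm (TensorProduct.map g (TensorProduct.map g g) t) =
      TensorProduct.map (TensorProduct.map g g) g ((TensorProduct.assoc k M M M).symm t) := by
  rw [LinearEquiv.symm_apply_eq, assoc_map, LinearEquiv.apply_symm_apply]

namespace IsHom
variable {C C' : CoalgData k d} {g : C.space →ₗ[k] C'.space} (hg : IsHom C C' g)
include hg

theorem lid_counit (t : C.space ⊗[k] C.space) :
    TensorProduct.lid k C'.space (C'.counit.rTensor C'.space (TensorProduct.map g g t)) =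
      g (TensorProduct.lid k C.space (C.counit.rTensor C.space t)) := by
  induction t using TensorProduct.induction_on with
  | zero => simp
  | tmul x y => simp [hg.counit]
  | add x y hx hy => simp only [map_add, hx, hy]

theorem map_sgn_cobr (n : ℤ) (t : C.space ⊗[k] C.space) :
    TensorProduct.map (C'.space.sgn n) C'.cobr (TensorProduct.map g g t) =
      TensorProduct.map g (TensorProduct.map g g) (TensorProduct.map (C.space.sgn n) C.cobr t) := by
  induction t using TensorProduct.induction_on with
  | zero => simp
  | tmul x y =>
    have := hg.deg.sgn_apply n x
    rw [mul_zero, zpow_zero, one_smul] at this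
    simp [hg.cobr, this]
  | add x y hx hy => simp only [map_add, hx, hy]

theorem swap (t : C.space ⊗[k] C.space) : GradedSpace.swap C'.space C'.space
    (TensorProduct.map g g t) = TensorProduct.map g g (GradedSpace.swap C.space C.space t) :=
  swap_map hg.deg hg.deg t

theorem lTensor_swap (t : C.space ⊗[k] (C.space ⊗[k] C.space)) :
    (GradedSpace.swap C'.space C'.space).lTensor C'.space
      (TensorProduct.map g (TensorProduct.map g g) t) =
    TensorProduct.map g (TensorProduct.map g g)
      ((GradedSpace.swap C.space C.space).lTensor C.space t) := by
  rw [LinearMap.lTensor, LinearMap.lTensor, ← LinearMap.comp_apply, ← LinearMap.comp_apply,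
    ← TensorProduct.map_comp, ← TensorProduct.map_comp]
  congr 2
  exact LinearMap.ext hg.swap

/-- The identities hold on the image of a morphism. -/
theorem lawsAt {x : C.space} (hx : C.LawsAt x) : C'.LawsAt (g x) where
  cocomm := by rw [hg.comul, hg.swap, hx.cocomm]
  coassoc := by
    rw [hg.comul, map_rTensor hg.comul, map_lTensor hg.comul, assoc_map, hx.coassoc]
  counit_comul := by rw [hg.comul, hg.lid_counit, hx.counit_comul]
  coskew := by rw [hg.cobr, hg.swap, hx.coskew, map_smul]
  cojacobi := by
    rw [hg.cobr, map_rTensor hg.cobr, cyc_map hg.deg, cyc_map hg.deg, ← map_add, ← map_add,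
      hx.cojacobi, map_zero]
  coleibniz := by
    rw [hg.cobr, hg.comul, map_rTensor hg.comul, map_rTensor hg.cobr, hg.map_sgn_cobr, assoc_map,
      hg.lTensor_swap, assoc_symm_map, assoc_symm_map, ← map_add, hx.coleibniz]
  counit_cobr := by rw [hg.cobr, hg.lid_counit, hx.counit_cobr, map_zero]

/-- An injective morphism reflects the identities. -/
theorem lawsAt_of_injective (hi : Function.Injective g) {x : C.space} (hx : C'.LawsAt (g x)) :
    C.LawsAt x := by
  -- Over a field every module is flat, so tensor powers of an injective map are injective and each
  -- identity can be tested in `C'`.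
  have h₂ : Function.Injective (TensorProduct.map g g) :=
    TensorProduct.map_injective_of_flat_flat _ _ hi hi
  have h₃ : Function.Injective (TensorProduct.map (TensorProduct.map g g) g) :=
    TensorProduct.map_injective_of_flat_flat _ _ h₂ hi
  have h₃' : Function.Injective (TensorProduct.map g (TensorProduct.map g g)) :=
    TensorProduct.map_injective_of_flat_flat _ _ hi h₂
  refine ⟨h₂ ?_, h₃' ?_, hi ?_, h₂ ?_, h₃ ?_, h₃ ?_, hi ?_⟩
  · rw [← hg.swap, ← hg.comul, hx.cocomm]
  · rw [← assoc_map, ← map_rTensor hg.comul, ← map_lTensor hg.comul, ← hg.comul, hx.coassoc]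
  · rw [← hg.lid_counit, ← hg.comul, hx.counit_comul]
  · rw [← hg.swap, ← hg.cobr, hx.coskew, map_smul, ← hg.cobr]
  · rw [map_add, map_add, ← cyc_map hg.deg, ← cyc_map hg.deg, ← cyc_map hg.deg,
      ← map_rTensor hg.cobr, ← hg.cobr, hx.cojacobi, map_zero]
  · rw [map_add, ← assoc_symm_map, ← assoc_symm_map, ← hg.lTensor_swap, ← assoc_map,
      ← hg.map_sgn_cobr, ← map_rTensor hg.cobr, ← map_rTensor hg.comul, ← hg.cobr, ← hg.comul,
      hx.coleibniz]
  · rw [← hg.lid_counit, ← hg.cobr, hx.counit_cobr, map_zero]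

end IsHom

theorem isHom_subtype (C : CoalgData k d) (N : Submodule k C.space) (h : C.IsLawful N) :
    IsHom (C.sub N h) C N.subtype where
  deg := isHomogeneous_subtype C.space N h.proj
  comul x := (mapIncl_restrictTensor N C.comul h.comul x).symm
  counit _ := rfl
  cobr x := (mapIncl_restrictTensor N C.cobr h.cobr x).symm

theorem lawsAt_sub (C : CoalgData k d) (N : Submodule k C.space) (h : C.IsLawful N) (x : N) :
    (C.sub N h).LawsAt x :=
  (isHom_subtype C N h).lawsAt_of_injective N.injective_subtype (h.laws x x.2)

theorem tmul_mem_range {M : Type u} [AddCommGroup M] [Module k M] {N : Submodule k M} {x y : M}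
    (hx : x ∈ N) (hy : y ∈ N) : x ⊗ₜ[k] y ∈ LinearMap.range (TensorProduct.mapIncl N N) :=
  ⟨(⟨x, hx⟩ : N) ⊗ₜ (⟨y, hy⟩ : N), rfl⟩

theorem range_mapIncl_le {M : Type u} [AddCommGroup M] [Module k M] {N : Submodule k M}
    {P : Submodule k (M ⊗[k] M)} (h : ∀ x ∈ N, ∀ y ∈ N, x ⊗ₜ[k] y ∈ P) :
    LinearMap.range (TensorProduct.mapIncl N N) ≤ P := by
  rintro _ ⟨t, rfl⟩
  induction t using TensorProduct.induction_on with
  | zero => simp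
  | tmul x y => exact h x x.2 y y.2
  | add a b ha hb => rw [map_add]; exact add_mem ha hb

/-- The image of a morphism from a `d`-coalgebra lies in the largest `d`-coalgebra. -/
theorem IsHom.mem_largest {C C' : CoalgData k d} {g : C.space →ₗ[k] C'.space} (hg : IsHom C C' g)
    (hC : ∀ x, C.LawsAt x) (x : C.space) : g x ∈ C'.largest := by
  refine le_largest (N := LinearMap.range g) ⟨?_, ?_, ?_, ?_⟩ ⟨x, rfl⟩
  · rintro i _ ⟨y, rfl⟩
    have := hg.deg.proj_apply i y
    rw [add_zero] at this
    exact ⟨_, this.symm⟩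
  · rintro _ ⟨y, rfl⟩
    rw [hg.comul]
    generalize C.comul y = t
    induction t using TensorProduct.induction_on with
    | zero => simp
    | tmul a b => exact tmul_mem_range ⟨a, rfl⟩ ⟨b, rfl⟩
    | add a b ha hb => rw [map_add]; exact add_mem ha hb
  · rintro _ ⟨y, rfl⟩
    rw [hg.cobr]
    generalize C.cobr y = t
    induction t using TensorProduct.induction_on with
    | zero => simp
    | tmul a b => exact tmul_mem_range ⟨a, rfl⟩ ⟨b, rfl⟩
    | add a b ha hb => rw [map_add]; exact add_mem ha hb
  · rintro _ ⟨y, rfl⟩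
    exact hg.lawsAt (hC y)

/-! ### The filtration by iterated cooperations -/

/-- The element `e` is grouplike, of degree `0`, and annihilated by the cobracket. -/
structure IsGrouplike (C : CoalgData k d) (e : C.space) : Prop where
  deg : e ∈ C.space.deg 0
  counit : C.counit e = 1
  comul : C.comul e = e ⊗ₜ e
  cobr : C.cobr e = 0

/-- The map `x ↦ Δ x - e ⊗ x - x ⊗ e`. -/
def reducedComul (C : CoalgData k d) (e : C.space) : C.space →ₗ[k] C.space ⊗[k] C.space :=
  C.comul - TensorProduct.mk k C.space C.space e - (TensorProduct.mk k C.space C.space).flip e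

theorem reducedComul_apply (C : CoalgData k d) (e x : C.space) :
    C.reducedComul e x = C.comul x - e ⊗ₜ x - x ⊗ₜ e := rfl

/-- The filtration by the number of cooperations that annihilate an element. -/
def filtration (C : CoalgData k d) (e : C.space) : ℕ → Submodule k C.space
  | 0 => Submodule.span k {e}
  | n + 1 => (LinearMap.range (TensorProduct.mapIncl (filtration C e n) (filtration C e n))).comap
        (C.reducedComul e) ⊓
      (LinearMap.range (TensorProduct.mapIncl (filtration C e n) (filtration C e n))).comap C.cobr

/-- Each level of `filtration` is a full preimage of the previous one, hence it is the largest
filtration on which the cooperations lower the level. Any filtration chosen for a coproartinian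
coalgebra is compared with it by this lemma. -/
theorem filtration_le_of_le {C : CoalgData k d} {e : C.space} {F : ℕ → Submodule k C.space}
    (h₀ : F 0 ≤ Submodule.span k {e})
    (h : ∀ n, ∀ x ∈ F (n + 1),
      C.reducedComul e x ∈ LinearMap.range (TensorProduct.mapIncl (F n) (F n)) ∧
      C.cobr x ∈ LinearMap.range (TensorProduct.mapIncl (F n) (F n))) (n : ℕ) :
    F n ≤ C.filtration e n := by
  induction n with
  | zero => exact h₀
  | succ n ih =>
    exact fun x hx => ⟨range_mapIncl_mono ih (h n x hx).1, range_mapIncl_mono ih (h n x hx).2⟩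

namespace IsGrouplike
variable {C : CoalgData k d} {e : C.space} (he : C.IsGrouplike e)
include he

theorem reducedComul_self : C.reducedComul e e = -e ⊗ₜ e := by
  rw [reducedComul_apply, he.comul, sub_self, zero_sub]

/-- The map `reducedComul` does not kill `e` but sends it to `-e ⊗ e`, which still lies in the
tensor square of level zero. -/
theorem filtration_zero_le_one : C.filtration e 0 ≤ C.filtration e 1 := by
  have h : e ∈ C.filtration e 0 := Submodule.mem_span_singleton_self e
  refine (Submodule.span_singleton_le_iff_mem _ _).2 ⟨?_, ?_⟩
  · rw [SetLike.mem_coe, Submodule.mem_comap, he.reducedComul_self]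
    exact neg_mem (tmul_mem_range h h)
  · rw [SetLike.mem_coe, Submodule.mem_comap, he.cobr]
    exact zero_mem _

theorem filtration_mono : Monotone (C.filtration e) := by
  refine monotone_nat_of_le_succ fun n => ?_
  induction n with
  | zero => exact he.filtration_zero_le_one
  | succ n ih => exact fun x hx => ⟨range_mapIncl_mono ih hx.1, range_mapIncl_mono ih hx.2⟩

theorem mem_filtration (n : ℕ) : e ∈ C.filtration e n :=
  he.filtration_mono (Nat.zero_le n) (Submodule.mem_span_singleton_self e)

theorem sgn_apply (n : ℤ) : C.space.sgn n e = e := by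
  rw [sgn_of_mem _ he.deg, mul_zero, zpow_zero, one_smul]

theorem proj_mem_filtration (n : ℕ) (i : ℤ) : ∀ x ∈ C.filtration e n,
    C.space.proj i x ∈ C.filtration e n := by
  induction n generalizing i with
  | zero =>
    intro x hx
    obtain ⟨c, rfl⟩ := Submodule.mem_span_singleton.1 hx
    rw [map_smul, proj_of_mem _ he.deg]
    refine Submodule.smul_mem _ _ ?_
    split_ifs
    · exact he.mem_filtration 0
    · exact zero_mem _
  | succ n ih =>
    have hproj : ∀ j, ∀ t ∈ LinearMap.range (TensorProduct.mapIncl (C.filtration e n)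
        (C.filtration e n)), (C.space.tensor C.space).proj j t ∈ LinearMap.range
          (TensorProduct.mapIncl (C.filtration e n) (C.filtration e n)) := by
      intro j
      refine range_mapIncl_le (P := (LinearMap.range (TensorProduct.mapIncl (C.filtration e n)
        (C.filtration e n))).comap ((C.space.tensor C.space).proj j)) fun x hx y hy => ?_
      obtain ⟨s, hs⟩ := C.space.exists_sum_proj x
      obtain ⟨s', hs'⟩ := C.space.exists_sum_proj y
      rw [Submodule.mem_comap, ← hs, ← hs', TensorProduct.sum_tmul, map_sum]
      refine sum_mem fun a _ => ?_
      rw [TensorProduct.tmul_sum, map_sum]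
      refine sum_mem fun b _ => ?_
      rw [proj_of_mem (C.space.tensor C.space) (tmul_mem_tensorDeg C.space C.space rfl
        (C.space.proj_mem a x) (C.space.proj_mem b y))]
      split_ifs
      · exact tmul_mem_range (ih a x hx) (ih b y hy)
      · exact zero_mem _
    rintro x ⟨hx₁, hx₂⟩
    refine ⟨?_, ?_⟩
    · have hd : IsHomogeneous C.space (C.space.tensor C.space) (C.reducedComul e) 0 :=
        fun i x hx => by
          rw [reducedComul_apply]
          exact sub_mem (sub_mem (C.comul_deg i x hx)
            (tmul_mem_tensorDeg _ _ (by ring) he.deg hx)) (tmul_mem_tensorDeg _ _ (by ring) hx he.deg)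
      have := hd.proj_apply i x
      rw [SetLike.mem_coe, Submodule.mem_comap, ← this]
      exact hproj _ _ hx₁
    · have := C.cobr_deg.proj_apply i x
      rw [SetLike.mem_coe, Submodule.mem_comap, ← this]
      exact hproj _ _ hx₂

theorem sgn_mem_filtration (n : ℕ) (m : ℤ) : ∀ x ∈ C.filtration e n,
    C.space.sgn m x ∈ C.filtration e n := by
  intro x hx
  obtain ⟨s, hs⟩ := C.space.exists_sum_proj x
  rw [← hs, map_sum]
  refine sum_mem fun i _ => ?_
  rw [sgn_of_mem _ (C.space.proj_mem i x)]
  exact Submodule.smul_mem _ _ (he.proj_mem_filtration n i x hx)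

theorem coderivation_mem_filtration {D : C.space →ₗ[k] C.space} (hD : C.IsCoderivation D)
    (hDe : D e = 0) (n : ℕ) : ∀ x ∈ C.filtration e n, D x ∈ C.filtration e n := by
  induction n with
  | zero =>
    intro x hx
    obtain ⟨c, rfl⟩ := Submodule.mem_span_singleton.1 hx
    rw [map_smul, hDe, smul_zero]
    exact zero_mem _
  | succ n ih =>
    have hT : ∀ t ∈ LinearMap.range (TensorProduct.mapIncl (C.filtration e n)
        (C.filtration e n)), tensorDiff C.space C.space D D t ∈ LinearMap.range
          (TensorProduct.mapIncl (C.filtration e n) (C.filtration e n)) :=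
      range_mapIncl_le (P := (LinearMap.range (TensorProduct.mapIncl (C.filtration e n)
        (C.filtration e n))).comap (tensorDiff C.space C.space D D)) fun x hx y hy =>
          add_mem (tmul_mem_range (ih x hx) hy)
            (tmul_mem_range (he.sgn_mem_filtration n 1 x hx) (ih y hy))
    rintro x ⟨hx₁, hx₂⟩
    refine ⟨?_, ?_⟩
    -- Because `D e = 0` and `e` has degree `0`, the terms `e ⊗ x` and `x ⊗ e` are carried to `e ⊗ D
    -- x` and `D x ⊗ e`.
    · have : C.reducedComul e (D x) = tensorDiff C.space C.space D D (C.reducedComul e x) := by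
        rw [reducedComul_apply, reducedComul_apply, hD.comul, map_sub, map_sub, tensorDiff_tmul,
          tensorDiff_tmul, hDe, he.sgn_apply, TensorProduct.zero_tmul, TensorProduct.tmul_zero,
          zero_add, add_zero]
      rw [SetLike.mem_coe, Submodule.mem_comap, this]
      exact hT _ hx₁
    · rw [SetLike.mem_coe, Submodule.mem_comap, hD.cobr]
      exact Submodule.smul_mem _ _ (hT _ hx₂)

theorem comul_mem (n : ℕ) : ∀ x ∈ C.filtration e n, C.comul x ∈
    LinearMap.range (TensorProduct.mapIncl (C.filtration e n) (C.filtration e n)) := by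
  intro x hx
  cases n with
  | zero =>
    obtain ⟨c, rfl⟩ := Submodule.mem_span_singleton.1 hx
    rw [map_smul, he.comul]
    exact Submodule.smul_mem _ _ (tmul_mem_range (he.mem_filtration 0) (he.mem_filtration 0))
  | succ n =>
    have h : C.comul x = C.reducedComul e x + e ⊗ₜ x + x ⊗ₜ e := by
      rw [reducedComul_apply]; abel
    rw [h]
    exact add_mem (add_mem (range_mapIncl_mono (he.filtration_mono n.le_succ) hx.1)
      (tmul_mem_range (he.mem_filtration _) hx)) (tmul_mem_range hx (he.mem_filtration _))

theorem cobr_mem (n : ℕ) : ∀ x ∈ C.filtration e n, C.cobr x ∈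
    LinearMap.range (TensorProduct.mapIncl (C.filtration e n) (C.filtration e n)) := by
  intro x hx
  cases n with
  | zero =>
    obtain ⟨c, rfl⟩ := Submodule.mem_span_singleton.1 hx
    rw [map_smul, he.cobr, smul_zero]
    exact zero_mem _
  | succ n => exact range_mapIncl_mono (he.filtration_mono n.le_succ) hx.2

end IsGrouplike

theorem range_mapIncl_span_singleton {M : Type u} [AddCommGroup M] [Module k M] {e : M}
    {t : M ⊗[k] M} (ht : t ∈ LinearMap.range (TensorProduct.mapIncl (Submodule.span k {e})
      (Submodule.span k {e}))) : ∃ c : k, t = c • e ⊗ₜ e := by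
  have : LinearMap.range (TensorProduct.mapIncl (Submodule.span k {e}) (Submodule.span k {e})) ≤
      Submodule.span k {e ⊗ₜ[k] e} := range_mapIncl_le fun x hx y hy => by
    obtain ⟨a, rfl⟩ := Submodule.mem_span_singleton.1 hx
    obtain ⟨b, rfl⟩ := Submodule.mem_span_singleton.1 hy
    rw [TensorProduct.smul_tmul_smul]
    exact Submodule.smul_mem _ _ (Submodule.mem_span_singleton_self _)
  obtain ⟨c, hc⟩ := Submodule.mem_span_singleton.1 (this ht)
  exact ⟨c, hc.symm⟩

end CoalgData

/-! ### Coproartinian coalgebras and the canonical filtration -/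

open CoalgData

/-- A criterion for a `d`-coalgebra to be coproartinian. -/
theorem DGCoalgData.IsDCoalgebra.isCoproartinian {C : DGCoalgData k d} (hC : C.IsDCoalgebra)
    {e : C.space} (he : C.IsGrouplike e) (hDe : C.diff e = 0) (hF : ⨆ n, C.filtration e n = ⊤) :
    C.IsCoproartinian where
  isDCoalgebra := hC
  exists_filtration := by
    -- On level one the reduced coproduct is `c • e ⊗ e` for some scalar `c`. Applying the counit to
    -- one factor determines `c = -ε(x)`, which is the required formula for `Δ x`.
    have hred : ∀ x, TensorProduct.lid k C.space (C.counit.rTensor C.space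
        (C.reducedComul e x)) = -C.counit x • e := fun x => by
      rw [reducedComul_apply, map_sub, map_sub, map_sub, map_sub, (hC.laws x).counit_comul]
      simp [he.counit]
    refine ⟨C.filtration e, e, he.filtration_mono, hF, fun n i => he.proj_mem_filtration n i,
      he.coderivation_mem_filtration hC.coderivation hDe, he.comul_mem, he.cobr_mem, rfl, he.counit,
      fun x hx => ?_, fun x hx => ?_, fun i _ x hx => hx.1, fun i _ x hx => hx.2⟩
    · obtain ⟨c, hc⟩ := range_mapIncl_span_singleton hx.1
      have h := hred x
      rw [hc] at h
      simp only [map_smul, LinearMap.rTensor_tmul, TensorProduct.lid_tmul, he.counit, one_smul] at h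
      have h' := congrArg C.counit h
      simp only [map_smul, he.counit, smul_eq_mul, mul_one] at h'
      rw [h', reducedComul_apply, neg_smul] at hc
      rw [sub_eq_add_neg _ (C.counit x • e ⊗ₜ e), ← hc]
      abel
    -- Likewise `δ x = c • e ⊗ e` on level one, and the identity `(ε ⊗ 1) δ = 0` forces `c = 0`.
    · obtain ⟨c, hc⟩ := range_mapIncl_span_singleton hx.2
      have h := (hC.laws x).counit_cobr
      rw [hc] at h
      simp only [map_smul, LinearMap.rTensor_tmul, TensorProduct.lid_tmul, he.counit, one_smul] at h
      have h' := congrArg C.counit h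
      simp only [map_smul, he.counit, smul_eq_mul, mul_one, map_zero] at h'
      rw [hc, h', zero_smul]

/-- Converse of the preceding criterion: whichever filtration witnesses that `C` is coproartinian,
the canonical one built from the grouplike element is exhaustive as well. All later inductions use
the canonical filtration. -/
theorem DGCoalgData.IsCoproartinian.isGrouplike {C : DGCoalgData k d} (hC : C.IsCoproartinian) :
    C.IsGrouplike hC.one ∧ C.diff hC.one = 0 ∧ ⨆ n, C.filtration hC.one n = ⊤ := by
  obtain ⟨F, e, hF⟩ := hC.exists_filtration
  have he₀ : e ∈ F 0 := by rw [hF.zero]; exact Submodule.mem_span_singleton_self e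
  have he₁ : e ∈ F 1 := hF.mono (Nat.zero_le 1) he₀
  have hΔ : C.comul e = e ⊗ₜ e := by
    rw [hF.comul_one e he₁, hF.counit_e, one_smul, add_sub_cancel_right]
  have hone : hC.one = e := (hC.eq_one hF.counit_e hΔ).symm
  rw [hone]
  -- The component of `e` in degree `0` lies in `F 0`, so it is a multiple of `e`. The counit has
  -- degree `0`, so this component has counit `1`, and the multiple is `e` itself.
  have hdeg : e ∈ C.space.deg 0 := by
    have h := hF.proj 0 0 e he₀
    rw [hF.zero] at h
    obtain ⟨c, hc⟩ := Submodule.mem_span_singleton.1 h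
    have h₁ : C.counit (C.space.proj 0 e) = C.counit e := by
      have := C.counit_deg.proj_apply 0 e
      rw [add_zero] at this
      rw [← this, proj_of_mem (GradedSpace.unit k) (i := 0) (by simp), if_pos rfl]
    rw [← hc, map_smul, hF.counit_e, smul_eq_mul, mul_one] at h₁
    rw [h₁, one_smul] at hc
    rw [hc]
    exact C.space.proj_mem 0 e
  refine ⟨⟨hdeg, hF.counit_e, hΔ, hF.cobr_one e he₁⟩, ?_, ?_⟩
  · have h := hF.diff 0 e he₀
    rw [hF.zero] at h
    obtain ⟨c, hc⟩ := Submodule.mem_span_singleton.1 h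
    have h₁ := hC.isDCoalgebra.coderivation.counit e
    rw [← hc, map_smul, hF.counit_e, smul_eq_mul, mul_one] at h₁
    rw [← hc, h₁, zero_smul]
  · refine top_unique (hF.exhaustive ▸ iSup_mono (filtration_le_of_le hF.zero.le ?_))
    intro n x hx
    rcases Nat.eq_zero_or_pos n with rfl | hn
    -- The passage from level zero to level one has its own axioms, under which the reduced
    -- coproduct is `-ε(x) e ⊗ e`.
    · rw [reducedComul_apply, hF.comul_one x hx, hF.cobr_one x hx]
      refine ⟨?_, zero_mem _⟩
      rw [show e ⊗ₜ[k] x + x ⊗ₜ[k] e - C.counit x • e ⊗ₜ[k] e - e ⊗ₜ[k] x - x ⊗ₜ[k] e =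
        -(C.counit x • e ⊗ₜ[k] e) by abel]
      exact neg_mem (Submodule.smul_mem _ _ (tmul_mem_range he₀ he₀))
    · exact ⟨hF.comul_succ n hn x hx, hF.cobr_succ n hn x hx⟩

end

end DAlgebras

namespace DAlgebras

noncomputable section

open GradedSpace

variable {k : Type u} [Field k] {d : ℤ}

/-! ### The tree coalgebra -/

namespace Tree
variable (X : GradedSpace k)

/-- A tree is a leaf, or two trees grafted at a product vertex, or two trees grafted at a bracket
vertex. Consequently an element is recovered from its corestriction and its two cooperations, which
drives both the existence and the uniqueness of lifts. -/
theorem eq_inclLeaf_add_graft (y : space d X) : y = inclLeaf d X (corestrict d X y) +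
    graftComm d X (comul d X y) + graftLie d X (cobr d X y) := by
  suffices h : LinearMap.id = inclLeaf d X ∘ₗ corestrict d X + graftComm d X ∘ₗ comul d X +
    graftLie d X ∘ₗ cobr d X from LinearMap.congr_fun h y
  refine hom_ext d X fun s x => ?_
  have hc : ∀ s x, corestrict d X (incl d X s x) = _ := fun s x => desc_incl d X _ s x
  have hm : ∀ s x, comul d X (incl d X s x) = _ := fun s x => desc_incl d X _ s x
  have hb : ∀ s x, cobr d X (incl d X s x) = _ := fun s x => desc_incl d X _ s x
  simp only [LinearMap.add_apply, LinearMap.comp_apply, LinearMap.id_apply, hc, hm, hb]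
  have hj : ∀ (j : ∀ l r : Shape, Shape.space d X l ⊗[k] Shape.space d X r →ₗ[k] space d X) l r
      (t : Shape.space d X l ⊗[k] Shape.space d X r),
      graft d X j (TensorProduct.map (incl d X l) (incl d X r) t) = j l r t := fun j l r t => by
    induction t using TensorProduct.induction_on with
    | zero => simp
    | tmul x y => exact graft_tmul d X j l r x y
    | add a b ha hb => simp only [map_add, ha, hb]
  cases s with
  | leaf => simp only [LinearMap.zero_apply, map_zero, add_zero]; rfl
  | comm l r =>
    simp only [LinearMap.zero_apply, map_zero, add_zero, zero_add]
    exact (hj (inclComm d X) l r x).symm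
  | lie l r =>
    simp only [LinearMap.zero_apply, map_zero, zero_add]
    exact (hj (inclLie d X) l r x).symm

theorem eq_zero_of_corestrict {y : space d X} (h₀ : corestrict d X y = 0) (h₁ : comul d X y = 0)
    (h₂ : cobr d X y = 0) : y = 0 := by
  rw [eq_inclLeaf_add_graft X y, h₀, h₁, h₂, map_zero, map_zero, map_zero, add_zero, add_zero]

theorem corestrict_inclLeaf (x : X) : corestrict d X (inclLeaf d X x) = x :=
  desc_incl d X _ .leaf x

theorem corestrict_graftComm (t : space d X ⊗[k] space d X) :
    corestrict d X (graftComm d X t) = 0 := by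
  have : corestrict d X ∘ₗ graftComm d X = 0 := tensor_ext d X fun l r x y => by
    rw [LinearMap.comp_apply, graftComm, graft_tmul]
    exact desc_incl d X _ (.comm l r) _
  exact LinearMap.congr_fun this t

theorem corestrict_graftLie (t : space d X ⊗[k] space d X) :
    corestrict d X (graftLie d X t) = 0 := by
  have : corestrict d X ∘ₗ graftLie d X = 0 := tensor_ext d X fun l r x y => by
    rw [LinearMap.comp_apply, graftLie, graft_tmul]
    exact desc_incl d X _ (.lie l r) _
  exact LinearMap.congr_fun this t

theorem corestrict_coder (h : space d X →ₗ[k] X) (y : space d X) :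
    corestrict d X (coder d X h y) = h y := by
  suffices e : corestrict d X ∘ₗ coder d X h = h from LinearMap.congr_fun e y
  refine hom_ext d X fun s x => ?_
  rw [LinearMap.comp_apply, coder, desc_incl]
  cases s with
  | leaf => exact corestrict_inclLeaf X _
  | comm l r =>
    have e' : coderAux d X h (.comm l r) x = inclLeaf d X (h (inclComm d X l r x)) +
      graftComm d X (TensorProduct.map (coderAux d X h l) (incl d X r) x +
        TensorProduct.map (incl d X l ∘ₗ (Shape.space d X l).sgn 1) (coderAux d X h r) x) := rfl
    rw [e', map_add, corestrict_inclLeaf]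
    exact (congrArg _ (corestrict_graftComm X _)).trans (add_zero _)
  | lie l r =>
    have e' : coderAux d X h (.lie l r) x = inclLeaf d X (h (inclLie d X l r x)) +
      (-1 : k) ^ (d - 1) • graftLie d X (TensorProduct.map (coderAux d X h l) (incl d X r) x +
        TensorProduct.map (incl d X l ∘ₗ (Shape.space d X l).sgn 1) (coderAux d X h r) x) := rfl
    rw [e', map_add, corestrict_inclLeaf, map_smul]
    refine (congrArg _ ((congrArg _ (corestrict_graftLie X _)).trans (smul_zero _))).trans
      (add_zero _)

/-- The grouplike element of the tree coalgebra. -/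
def one : (coalg d X).space := ((1 : k), (0 : space d X))

theorem isGrouplike_one : (coalg d X).IsGrouplike (one X) where
  deg := ⟨by simp [one], zero_mem _⟩
  counit := rfl
  comul := by
    change LinearMap.coprod _ _ ((1 : k), (0 : space d X)) = _
    rw [LinearMap.coprod_apply, map_zero, add_zero, LinearMap.toSpanSingleton_apply, one_smul]
    rfl
  cobr := by
    change TensorProduct.map (LinearMap.inr k k (space d X)) (LinearMap.inr k k (space d X))
      (cobr d X 0) = 0
    rw [map_zero, map_zero]

/-- The inclusion of the elements without constant term. -/
def inr : space d X →ₗ[k] (coalg d X).space := LinearMap.inr k k (space d X)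

theorem inr_injective : Function.Injective (inr (d := d) X) := LinearMap.inr_injective

theorem map_inr_injective :
    Function.Injective (TensorProduct.map (inr (d := d) X) (inr (d := d) X)) :=
  TensorProduct.map_injective_of_flat_flat _ _ (inr_injective X) (inr_injective X)

theorem eq_smul_one_add_inr (x : (coalg d X).space) :
    x = (coalg d X).counit x • one X + inr X x.2 := by
  change x = x.1 • ((1 : k), (0 : space d X)) + ((0 : k), x.2)
  simp

theorem reducedComul_inr (y : space d X) : (coalg d X).reducedComul (one X) (inr X y) =
    TensorProduct.map (inr X) (inr X) (comul d X y) := by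
  rw [CoalgData.reducedComul_apply]
  change LinearMap.coprod _ _ ((0 : k), y) - _ - _ = _
  rw [LinearMap.coprod_apply, map_zero, zero_add]
  change ((one X) ⊗ₜ[k] (inr X y) + (inr X y) ⊗ₜ[k] (one X) +
    TensorProduct.map (inr X) (inr X) (comul d X y)) - _ - _ = _
  abel

theorem cobr_inr (y : space d X) : (coalg d X).cobr (inr X y) =
    TensorProduct.map (inr X) (inr X) (cobr d X y) := rfl

/-- The tree coalgebra is exhausted by the filtration by iterated cooperations. -/
theorem iSup_filtration : ⨆ n, (coalg d X).filtration (one X) n = ⊤ := by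
  have hmono := (isGrouplike_one (d := d) X).filtration_mono
  have key : ∀ s, ∃ n, ∀ x, inr X (incl d X s x) ∈ (coalg d X).filtration (one X) n := by
    intro s
    induction s with
    | leaf =>
      -- Leaves enter at level one, since level zero contains only multiples of the grouplike
      -- element; each vertex then raises the level by one above the larger of its two branches.
      refine ⟨1, fun x => ⟨?_, ?_⟩⟩
      · rw [SetLike.mem_coe, Submodule.mem_comap, reducedComul_inr]
        rw [show comul d X (incl d X .leaf x) = 0 from comul_inclLeaf d X x, map_zero]
        exact zero_mem _
      · rw [SetLike.mem_coe, Submodule.mem_comap, cobr_inr]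
        rw [show cobr d X (incl d X .leaf x) = 0 from cobr_inclLeaf d X x, map_zero]
        exact zero_mem _
    | comm l r hl hr =>
      obtain ⟨n, hn⟩ := hl
      obtain ⟨m, hm⟩ := hr
      refine ⟨max n m + 1, fun x => ⟨?_, ?_⟩⟩
      · rw [SetLike.mem_coe, Submodule.mem_comap, reducedComul_inr]
        rw [show comul d X (incl d X (.comm l r) x) =
          TensorProduct.map (incl d X l) (incl d X r) x from comul_inclComm d X l r x]
        change TensorProduct.map _ _ (TensorProduct.map (incl d X l) (incl d X r)
          (show Shape.space d X l ⊗[k] Shape.space d X r from x)) ∈ _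
        generalize (show Shape.space d X l ⊗[k] Shape.space d X r from x) = t
        induction t using TensorProduct.induction_on with
        | zero => simp
        | tmul a b =>
          exact CoalgData.tmul_mem_range (hmono (le_max_left n m) (hn a))
            (hmono (le_max_right n m) (hm b))
        | add a b ha hb => simp only [map_add]; exact add_mem ha hb
      · rw [SetLike.mem_coe, Submodule.mem_comap, cobr_inr]
        rw [show cobr d X (incl d X (.comm l r) x) = 0 from cobr_inclComm d X l r x, map_zero]
        exact zero_mem _
    | lie l r hl hr =>
      obtain ⟨n, hn⟩ := hl
      obtain ⟨m, hm⟩ := hr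
      refine ⟨max n m + 1, fun x => ⟨?_, ?_⟩⟩
      · rw [SetLike.mem_coe, Submodule.mem_comap, reducedComul_inr]
        rw [show comul d X (incl d X (.lie l r) x) = 0 from comul_inclLie d X l r x, map_zero]
        exact zero_mem _
      · rw [SetLike.mem_coe, Submodule.mem_comap, cobr_inr]
        rw [show cobr d X (incl d X (.lie l r) x) =
          TensorProduct.map (incl d X l) (incl d X r) x from cobr_inclLie d X l r x]
        change TensorProduct.map _ _ (TensorProduct.map (incl d X l) (incl d X r)
          (show Shape.space d X l ⊗[k] Shape.space d X r from x)) ∈ _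
        generalize (show Shape.space d X l ⊗[k] Shape.space d X r from x) = t
        induction t using TensorProduct.induction_on with
        | zero => simp
        | tmul a b =>
          exact CoalgData.tmul_mem_range (hmono (le_max_left n m) (hn a))
            (hmono (le_max_right n m) (hm b))
        | add a b ha hb => simp only [map_add]; exact add_mem ha hb
  refine eq_top_iff.2 fun x _ => ?_
  rw [eq_smul_one_add_inr X x]
  refine add_mem (Submodule.smul_mem _ _ (Submodule.mem_iSup_of_mem 0
    ((isGrouplike_one X).mem_filtration 0))) ?_
  have : (⊤ : Submodule k (space d X)) ≤
      (⨆ n, (coalg d X).filtration (one X) n).comap (inr X) := by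
    rw [← Submodule.ker_mkQ (⨆ n, (coalg d X).filtration (one X) n), ← LinearMap.ker_comp]
    refine (LinearMap.ker_eq_top.2 (hom_ext d X fun s x => ?_)).ge
    obtain ⟨n, hn⟩ := key s
    rw [LinearMap.comp_apply, LinearMap.zero_apply, Submodule.mkQ_apply,
      Submodule.Quotient.mk_eq_zero]
    exact Submodule.mem_iSup_of_mem n (hn x)
  exact this trivial

end Tree

/-! ### Induction and recursion along the filtration -/

namespace CoalgData

theorem induction_filtration {C : CoalgData k d} {e : C.space} (he : C.IsGrouplike e)
    (hF : ⨆ n, C.filtration e n = ⊤) (x : C.space) : ∃ n, x ∈ C.filtration e n := by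
  have : x ∈ ⨆ n, C.filtration e n := hF ▸ trivial
  exact (Submodule.mem_iSup_of_directed _ he.filtration_mono.directed_le).1 this

theorem map_eq_zero_of_range_mapIncl {M P Q : Type u} [AddCommGroup M] [Module k M]
    [AddCommGroup P] [Module k P] [AddCommGroup Q] [Module k Q] {N : Submodule k M}
    {f : M →ₗ[k] P} {g : M →ₗ[k] Q} (h : ∀ x ∈ N, ∀ y ∈ N, f x ⊗ₜ[k] g y = 0) {t : M ⊗[k] M}
    (ht : t ∈ LinearMap.range (TensorProduct.mapIncl N N)) : TensorProduct.map f g t = 0 :=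
  range_mapIncl_le (P := LinearMap.ker (TensorProduct.map f g)) (fun x hx y hy => h x hx y hy) ht

/-- A generalized coderivation into the tree coalgebra with zero corestriction vanishes. -/
theorem eq_zero_of_corestrict {X : GradedSpace k} {C : CoalgData k d} {e : C.space}
    (he : C.IsGrouplike e) (hF : ⨆ n, C.filtration e n = ⊤)
    {Ψ Φ Φ' : C.space →ₗ[k] (Tree.coalg d X).space}
    (hΦ : Φ e = Tree.one X) (hΦ' : Φ' e = Tree.one X) (hΨ : Ψ e = 0)
    (hcounit : ∀ x, (Tree.coalg d X).counit (Ψ x) = 0)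
    (hcomul : ∀ x, (Tree.coalg d X).comul (Ψ x) =
      TensorProduct.map Ψ Φ (C.comul x) + TensorProduct.map Φ' Ψ (C.comul x)) {c : k}
    (hcobr : ∀ x, (Tree.coalg d X).cobr (Ψ x) =
      c • (TensorProduct.map Ψ Φ (C.cobr x) + TensorProduct.map Φ' Ψ (C.cobr x)))
    (hcores : ∀ x, Tree.corestrict d X (Ψ x).2 = 0) : Ψ = 0 := by
  have key : ∀ n, ∀ x ∈ C.filtration e n, Ψ x = 0 := by
    intro n
    induction n with
    | zero =>
      intro x hx
      obtain ⟨c, rfl⟩ := Submodule.mem_span_singleton.1 hx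
      rw [map_smul, hΨ, smul_zero]
    | succ n ih =>
      -- On level `n + 1` the reduced cooperations land in the tensor square of level `n`, where `Ψ`
      -- already vanishes. What remains of the coproduct of `Ψ x` is `1 ⊗ Ψ x + Ψ x ⊗ 1`, because
      -- `Φ` and `Φ'` preserve the grouplike element; so both cooperations of the tree part of `Ψ x`
      -- vanish.
      have hz : ∀ t ∈ LinearMap.range (TensorProduct.mapIncl (C.filtration e n)
          (C.filtration e n)), TensorProduct.map Ψ Φ t = 0 ∧ TensorProduct.map Φ' Ψ t = 0 :=
        fun t ht => ⟨map_eq_zero_of_range_mapIncl (fun x hx y _ => by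
            rw [ih x hx, TensorProduct.zero_tmul]) ht,
          map_eq_zero_of_range_mapIncl (fun x _ y hy => by
            rw [ih y hy, TensorProduct.tmul_zero]) ht⟩
      rintro x ⟨hx₁, hx₂⟩
      have hx : Ψ x = Tree.inr X (Ψ x).2 := by
        conv_lhs => rw [Tree.eq_smul_one_add_inr X (Ψ x)]
        rw [hcounit, zero_smul, zero_add]
      have hcx : C.comul x = C.reducedComul e x + e ⊗ₜ x + x ⊗ₜ e := by
        rw [reducedComul_apply]; abel
      have h₁ : Tree.comul d X (Ψ x).2 = 0 := by
        apply Tree.map_inr_injective X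
        rw [← Tree.reducedComul_inr, ← hx, map_zero, reducedComul_apply, hcomul, hcx]
        simp only [map_add, (hz _ hx₁).1, (hz _ hx₁).2, TensorProduct.map_tmul, hΦ, hΦ', hΨ,
          TensorProduct.zero_tmul, TensorProduct.tmul_zero]
        abel
      have h₂ : Tree.cobr d X (Ψ x).2 = 0 := by
        apply Tree.map_inr_injective X
        rw [← Tree.cobr_inr, ← hx, map_zero, hcobr, (hz _ hx₂).1, (hz _ hx₂).2, add_zero,
          smul_zero]
      rw [hx, Tree.eq_zero_of_corestrict X (hcores x) h₁ h₂, map_zero]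
  refine LinearMap.ext fun x => ?_
  obtain ⟨n, hn⟩ := induction_filtration he hF x
  exact key n x hn

/-- A map that is contracting for an exhaustive filtration has a fixed point. -/
theorem exists_fixedPoint {M N : Type u} [AddCommGroup M] [Module k M] [AddCommGroup N]
    [Module k N] {F : ℕ → Submodule k M} (hmono : Monotone F) (hF : ⨆ n, F n = ⊤)
    (step : (M →ₗ[k] N) → (M →ₗ[k] N)) (h₀ : ∀ g g', ∀ x ∈ F 0, step g x = step g' x)
    (h : ∀ n g g', (∀ x ∈ F n, g x = g' x) → ∀ x ∈ F (n + 1), step g x = step g' x) :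
    ∃ g, step g = g ∧ ∀ x, ∃ n, g x = step^[n] 0 x := by
  have hex : ∀ x, ∃ n, x ∈ F n := fun x =>
    (Submodule.mem_iSup_of_directed _ hmono.directed_le).1 (hF ▸ trivial)
  -- On level `n` the iterates are independent of the starting map after `n + 1` steps, hence
  -- stationary from then on.
  have key : ∀ n g g', ∀ x ∈ F n, step^[n + 1] g x = step^[n + 1] g' x := by
    intro n
    induction n with
    | zero => exact h₀
    | succ n ih =>
      intro g g'
      rw [Function.iterate_succ_apply' step (n + 1), Function.iterate_succ_apply' step (n + 1)]
      exact h n _ _ (ih g g')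
  have hst : ∀ n m, n ≤ m → ∀ x ∈ F n, step^[m + 1] 0 x = step^[n + 1] 0 x := by
    intro n m hnm x hx
    obtain ⟨j, rfl⟩ := Nat.exists_eq_add_of_le hnm
    rw [show n + j + 1 = (n + 1) + j by ring, Function.iterate_add_apply]
    exact key n _ _ x hx
  choose ν hν using hex
  have hg : ∀ n, ∀ x ∈ F n, step^[ν x + 1] 0 x = step^[n + 1] 0 x := fun n x hx => by
    rw [← hst _ _ (le_max_left (ν x) n) x (hν x), hst _ _ (le_max_right (ν x) n) x hx]
  -- The limit is read off at a chosen level `ν x` of `x`. By `hg` any other level containing `x`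
  -- gives the same value, so a common level for two elements yields additivity.
  let g : M →ₗ[k] N :=
    { toFun := fun x => step^[ν x + 1] 0 x
      map_add' := fun x y => by
        have hx := hmono (le_max_left (ν x) (ν y)) (hν x)
        have hy := hmono (le_max_right (ν x) (ν y)) (hν y)
        rw [hg _ x hx, hg _ y hy, hg _ _ (add_mem hx hy), map_add]
      map_smul' := fun c x => by
        rw [hg _ _ ((F (ν x)).smul_mem c (hν x)), map_smul]; rfl }
  refine ⟨g, LinearMap.ext fun x => ?_, fun x => ⟨ν x + 1, rfl⟩⟩
  have hx : x ∈ F (ν x + 1) := hmono (Nat.le_succ _) (hν x)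
  rw [h (ν x) g (step^[ν x + 1] 0) (fun y hy => hg _ y hy) x hx]
  rw [← Function.iterate_succ_apply' step (ν x + 1)]
  exact (hg _ x hx).symm

end CoalgData
end

end DAlgebras

namespace DAlgebras

noncomputable section

open GradedSpace

variable {k : Type u} [Field k] {d : ℤ}

/-! ### The universal property of the tree coalgebra -/

namespace CoalgData

theorem rid_counit (C : CoalgData k d) (t : C.space ⊗[k] C.space) :
    TensorProduct.rid k C.space (C.counit.lTensor C.space t) =
      TensorProduct.lid k C.space (C.counit.rTensor C.space (swap C.space C.space t)) := by
  suffices e : (TensorProduct.rid k C.space).toLinearMap ∘ₗ C.counit.lTensor C.space =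
      (TensorProduct.lid k C.space).toLinearMap ∘ₗ C.counit.rTensor C.space ∘ₗ
        swap C.space C.space from LinearMap.congr_fun e t
  refine tensor_hom_ext _ _ fun i j x hx y hy => ?_
  simp only [LinearMap.comp_apply, swap_of_mem_mem _ _ hx hy, map_smul, LinearMap.lTensor_tmul,
    LinearMap.rTensor_tmul, LinearEquiv.coe_coe, TensorProduct.rid_tmul, TensorProduct.lid_tmul]
  have hc := C.counit_deg j y hy
  rw [add_zero] at hc
  by_cases hj : j = 0
  · rw [hj, mul_zero, zpow_zero, one_smul]
  · have : C.counit y = 0 := by simpa [hj] using hc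
    rw [this, zero_smul, smul_zero]

theorem LawsAt.rid_counit_comul {C : CoalgData k d} {x : C.space} (h : C.LawsAt x) :
    TensorProduct.rid k C.space (C.counit.lTensor C.space (C.comul x)) = x := by
  rw [rid_counit, h.cocomm, h.counit_comul]

theorem LawsAt.rid_counit_cobr {C : CoalgData k d} {x : C.space} (h : C.LawsAt x) :
    TensorProduct.rid k C.space (C.counit.lTensor C.space (C.cobr x)) = 0 := by
  rw [rid_counit, h.coskew, map_smul, map_smul, h.counit_cobr, smul_zero]

/-- The operator whose fixed point is the lift of `f` to the tree coalgebra. -/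
def liftStep {X : GradedSpace k} (C : CoalgData k d) (e : C.space) (f : C.space →ₗ[k] X)
    (g : C.space →ₗ[k] Tree.space d X) : C.space →ₗ[k] Tree.space d X :=
  Tree.inclLeaf d X ∘ₗ f + Tree.graftComm d X ∘ₗ TensorProduct.map g g ∘ₗ
    (C.reducedComul e + C.counit.smulRight (e ⊗ₜ[k] e)) +
    Tree.graftLie d X ∘ₗ TensorProduct.map g g ∘ₗ C.cobr

theorem liftStep_apply {X : GradedSpace k} (C : CoalgData k d) (e : C.space) (f : C.space →ₗ[k] X)
    (g : C.space →ₗ[k] Tree.space d X) (x : C.space) : liftStep C e f g x =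
      Tree.inclLeaf d X (f x) + Tree.graftComm d X (TensorProduct.map g g
        (C.reducedComul e x + C.counit x • e ⊗ₜ[k] e)) +
      Tree.graftLie d X (TensorProduct.map g g (C.cobr x)) := rfl

theorem IsGrouplike.isHomogeneous_reducedComul {C : CoalgData k d} {e : C.space}
    (he : C.IsGrouplike e) :
    IsHomogeneous C.space (C.space.tensor C.space) (C.reducedComul e) 0 := fun i x hx => by
  rw [reducedComul_apply]
  exact sub_mem (sub_mem (C.comul_deg i x hx)
    (tmul_mem_tensorDeg _ _ (by ring) he.deg hx)) (tmul_mem_tensorDeg _ _ (by ring) hx he.deg)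

theorem isHomogeneous_liftStep {X : GradedSpace k} {C : CoalgData k d} {e : C.space}
    (he : C.IsGrouplike e) {f : C.space →ₗ[k] X} (hf : IsHomogeneous C.space X f 0)
    {g : C.space →ₗ[k] Tree.space d X} (hg : IsHomogeneous C.space (Tree.space d X) g 0) :
    IsHomogeneous C.space (Tree.space d X) (liftStep C e f g) 0 := by
  have h₁ := (Tree.isHomogeneous_incl d X .leaf).comp hf
  have hε : IsHomogeneous C.space (C.space.tensor C.space)
      (C.counit.smulRight (e ⊗ₜ[k] e)) 0 := fun i x hx => by
    have hc := C.counit_deg i x hx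
    rw [add_zero] at hc ⊢
    rw [LinearMap.smulRight_apply]
    by_cases hi : i = 0
    · exact Submodule.smul_mem _ _ (tmul_mem_tensorDeg _ _ (by omega) he.deg he.deg)
    · have : C.counit x = 0 := by simpa [hi] using hc
      rw [this, zero_smul]
      exact zero_mem _
  have h₂ := (Tree.isHomogeneous_graftComm d X).comp
    ((hg.map hg).comp (he.isHomogeneous_reducedComul.add hε))
  have h₃ := (Tree.isHomogeneous_graftLie d X).comp ((hg.map hg).comp C.cobr_deg)
  simp only [add_zero] at h₁ h₂
  rw [show 1 - d + (0 + 0) + (d - 1) = 0 by ring] at h₃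
  exact (h₁.add h₂).add h₃

/-- A lift has to solve the recursion `g = leaf(f) + graft((g ⊗ g) Δ') + graft((g ⊗ g) δ)`, which is
contracting for the filtration. Ungrafting shows that a solution respects both cooperations. Of the
identities of `C` only those of the counit and the symmetry of the cooperations are used. -/
theorem exists_lift {X : GradedSpace k} {C : CoalgData k d} (hC : ∀ x, C.LawsAt x) {e : C.space}
    (he : C.IsGrouplike e) (hF : ⨆ n, C.filtration e n = ⊤) {f : C.space →ₗ[k] X}
    (hf : IsHomogeneous C.space X f 0) (hfe : f e = 0) :
    ∃ F : C.space →ₗ[k] (Tree.coalg d X).space, IsHom C (Tree.coalg d X) F ∧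
      F e = Tree.one X ∧ ∀ x, Tree.corestrict d X (F x).2 = f x := by
  -- The term `ε(x) e ⊗ e` in `liftStep` cancels `reducedComul e e = -e ⊗ e`, so the operator
  -- vanishes at `e` for every `g`. This is the base case of the contraction.
  have hstep_e : ∀ g, liftStep C e f g e = 0 := fun g => by
    rw [liftStep_apply, hfe, he.reducedComul_self, he.counit, he.cobr, one_smul]
    simp
  obtain ⟨g, hg, hit⟩ := exists_fixedPoint he.filtration_mono hF (liftStep C e f)
    (fun g g' x hx => by
      obtain ⟨c, rfl⟩ := Submodule.mem_span_singleton.1 hx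
      rw [map_smul, map_smul, hstep_e, hstep_e])
    (fun n g g' h x hx => by
      have hz : ∀ t ∈ LinearMap.range (TensorProduct.mapIncl (C.filtration e n)
          (C.filtration e n)), TensorProduct.map g g t = TensorProduct.map g' g' t := fun t ht =>
        range_mapIncl_le (P := LinearMap.eqLocus (TensorProduct.map g g) (TensorProduct.map g' g'))
          (fun x hx y hy => by
            rw [LinearMap.mem_eqLocus, TensorProduct.map_tmul, TensorProduct.map_tmul, h x hx,
              h y hy]) ht
      rw [liftStep_apply, liftStep_apply, hz _ hx.2, hz _ (add_mem hx.1
        (Submodule.smul_mem _ _ (tmul_mem_range (he.mem_filtration n) (he.mem_filtration n))))])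
  -- Every value of the fixed point is a value of an iterate starting from `0`, so homogeneity
  -- passes from the iterates to the limit.
  have hgd : IsHomogeneous C.space (Tree.space d X) g 0 := by
    have : ∀ n, IsHomogeneous C.space (Tree.space d X) ((liftStep C e f)^[n] 0) 0 := by
      intro n
      induction n with
      | zero => exact fun _ _ _ => zero_mem _
      | succ n ih =>
        rw [Function.iterate_succ_apply']
        exact isHomogeneous_liftStep he hf ih
    intro i x hx
    obtain ⟨n, hn⟩ := hit x
    rw [hn]
    exact this n i x hx
  have hge : g e = 0 := by rw [← hg, hstep_e]
  have hcores : ∀ x, Tree.corestrict d X (g x) = f x := fun x => by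
    rw [← hg, liftStep_apply, map_add, map_add, Tree.corestrict_inclLeaf,
      Tree.corestrict_graftComm, Tree.corestrict_graftLie, add_zero, add_zero]
  have hΔ : ∀ x, Tree.comul d X (g x) = TensorProduct.map g g (C.comul x) := fun x => by
    conv_lhs => rw [← hg, liftStep_apply, map_add, map_add, Tree.comul_inclLeaf,
      Tree.comul_graftComm, Tree.comul_graftLie, add_zero, zero_add, reducedComul_apply]
    simp [hge]
  have hδ : ∀ x, Tree.cobr d X (g x) = TensorProduct.map g g (C.cobr x) := fun x => by
    conv_lhs => rw [← hg, liftStep_apply, map_add, map_add, Tree.cobr_inclLeaf,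
      Tree.cobr_graftComm, Tree.cobr_graftLie, zero_add, zero_add]
  let F : C.space →ₗ[k] (Tree.coalg d X).space :=
    C.counit.smulRight (Tree.one X) + Tree.inr X ∘ₗ g
  have hF_apply : ∀ x, F x = C.counit x • Tree.one X + Tree.inr X (g x) := fun _ => rfl
  have hF_snd : ∀ x, F x = (C.counit x, g x) := fun x => by
    change C.counit x • ((1 : k), (0 : Tree.space d X)) + ((0 : k), g x) = _
    simp
  -- Splitting `F` into its constant part and its tree part gives four terms. On `Δ x` and `δ x` the
  -- three that involve the constant part are evaluated by the counit identities.
  have hmap : ∀ t, TensorProduct.map F F t =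
      C.counit (TensorProduct.lid k C.space (C.counit.rTensor C.space t)) •
        (Tree.one X ⊗ₜ[k] Tree.one X) +
      Tree.one X ⊗ₜ[k] Tree.inr X (g (TensorProduct.lid k C.space (C.counit.rTensor C.space t))) +
      Tree.inr X (g (TensorProduct.rid k C.space (C.counit.lTensor C.space t))) ⊗ₜ[k] Tree.one X +
      TensorProduct.map (Tree.inr X) (Tree.inr X) (TensorProduct.map g g t) := by
    intro t
    induction t using TensorProduct.induction_on with
    | zero => simp
    | tmul x y =>
      simp only [TensorProduct.map_tmul, hF_apply, LinearMap.rTensor_tmul, LinearMap.lTensor_tmul,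
        TensorProduct.lid_tmul, TensorProduct.rid_tmul, map_smul, TensorProduct.add_tmul,
        TensorProduct.tmul_add, ← TensorProduct.smul_tmul', TensorProduct.tmul_smul, smul_eq_mul,
        mul_smul, smul_add, smul_comm (C.counit y) (C.counit x)]
      abel
    | add x y hx hy =>
      simp only [map_add, hx, hy, TensorProduct.add_tmul, TensorProduct.tmul_add, add_smul]
      abel
  refine ⟨F, ⟨?_, fun x => ?_, fun x => ?_, fun x => ?_⟩, ?_, fun x => ?_⟩
  · intro i x hx
    rw [hF_snd]
    exact ⟨C.counit_deg i x hx, hgd i x hx⟩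
  · rw [hmap, (hC x).counit_comul, (hC x).rid_counit_comul, ← hΔ, ← Tree.reducedComul_inr,
      hF_apply, map_add, map_smul, (Tree.isGrouplike_one X).comul, reducedComul_apply]
    abel
  · rw [hF_snd]
    rfl
  · rw [hmap, (hC x).counit_cobr, (hC x).rid_counit_cobr, ← hδ, ← Tree.cobr_inr, hF_apply, map_add,
      map_smul, (Tree.isGrouplike_one X).cobr]
    simp
  · rw [hF_snd, he.counit, hge]
    rfl
  · rw [hF_snd, hcores]

/-! ### The cofree coalgebra -/

/-- The intersection of `N ⊗ M` and `M ⊗ N` is `N ⊗ N`. Exactness gives a preimage in `N ⊗ M`, and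
flatness allows the second condition to be tested there. -/
theorem mem_range_mapIncl_of_ker {M : Type u} [AddCommGroup M] [Module k M] {N : Submodule k M}
    {t : M ⊗[k] M} (h₁ : N.mkQ.rTensor M t = 0) (h₂ : N.mkQ.lTensor M t = 0) :
    t ∈ LinearMap.range (TensorProduct.mapIncl N N) := by
  have hex : Function.Exact N.subtype N.mkQ := LinearMap.exact_subtype_mkQ N
  obtain ⟨s, rfl⟩ := (rTensor_exact M hex N.mkQ_surjective t).1 h₁
  have h₃ : N.subtype.rTensor (M ⧸ N) (N.mkQ.lTensor N s) = 0 := by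
    rw [← LinearMap.comp_apply, LinearMap.rTensor_comp_lTensor, ← LinearMap.lTensor_comp_rTensor]
    exact h₂
  have h₄ : N.mkQ.lTensor N s = 0 :=
    Module.Flat.rTensor_preserves_injective_linearMap N.subtype N.injective_subtype
      (h₃.trans (map_zero _).symm)
  obtain ⟨r, rfl⟩ := (lTensor_exact N hex N.mkQ_surjective s).1 h₄
  refine ⟨r, ?_⟩
  rw [← LinearMap.comp_apply (LinearMap.rTensor _ _), LinearMap.rTensor_comp_lTensor]

/-- The quotient of `M` by the preimage of `P` embeds into the quotient of `M'` by `P`, so vanishing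
in the quotients can be tested after applying `g`. -/
theorem mem_range_mapIncl_comap {M M' : Type u} [AddCommGroup M] [Module k M] [AddCommGroup M']
    [Module k M'] {g : M →ₗ[k] M'} (hg : Function.Injective g) {P : Submodule k M'}
    {t : M ⊗[k] M}
    (ht : TensorProduct.map g g t ∈ LinearMap.range (TensorProduct.mapIncl P P)) :
    t ∈ LinearMap.range (TensorProduct.mapIncl (P.comap g) (P.comap g)) := by
  let q : (M ⧸ P.comap g) →ₗ[k] M' ⧸ P := (P.comap g).mapQ P g le_rfl
  have hq : Function.Injective q := by
    rw [← LinearMap.ker_eq_bot, Submodule.ker_mapQ, Submodule.mkQ_map_self]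
  have h₁ : P.mkQ.rTensor M' (TensorProduct.map g g t) = 0 := by
    rw [LinearMap.rTensor]
    exact map_eq_zero_of_range_mapIncl (fun x hx y _ => by
      rw [Submodule.mkQ_apply, (Submodule.Quotient.mk_eq_zero P).2 hx, TensorProduct.zero_tmul]) ht
  have h₂ : P.mkQ.lTensor M' (TensorProduct.map g g t) = 0 := by
    rw [LinearMap.lTensor]
    exact map_eq_zero_of_range_mapIncl (fun x _ y hy => by
      rw [Submodule.mkQ_apply, (Submodule.Quotient.mk_eq_zero P).2 hy, TensorProduct.tmul_zero]) ht
  refine mem_range_mapIncl_of_ker ?_ ?_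
  · refine TensorProduct.map_injective_of_flat_flat q g hq hg ?_
    rw [map_zero, ← h₁]
    exact (map_rTensor (g := g) (g₂ := q) (fun x => rfl) t).symm
  · refine TensorProduct.map_injective_of_flat_flat g q hg hq ?_
    rw [map_zero, ← h₂]
    exact (map_lTensor (g := g) (g₂ := q) (fun x => rfl) t).symm

/-- Restricting the canonical filtration to a subcoalgebra gives a filtration on which cooperations
lower the level, so it is contained in the canonical one of the subcoalgebra. In this way
exhaustiveness passes from the tree coalgebra to the cofree coalgebra. -/
theorem IsHom.comap_filtration_le {C C' : CoalgData k d} {g : C.space →ₗ[k] C'.space}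
    (hg : IsHom C C' g) (hi : Function.Injective g) (e : C.space) (n : ℕ) :
    (C'.filtration (g e) n).comap g ≤ C.filtration e n := by
  refine filtration_le_of_le (F := fun n => (C'.filtration (g e) n).comap g) ?_ ?_ n
  · intro x hx
    obtain ⟨c, hc⟩ := Submodule.mem_span_singleton.1 (show g x ∈ Submodule.span k {g e} from hx)
    rw [← map_smul] at hc
    exact Submodule.mem_span_singleton.2 ⟨c, hi hc⟩
  · intro n x hx
    refine ⟨mem_range_mapIncl_comap hi ?_, mem_range_mapIncl_comap hi ?_⟩
    · rw [reducedComul_apply, map_sub, map_sub, ← hg.comul, TensorProduct.map_tmul,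
        TensorProduct.map_tmul]
      exact hx.1
    · rw [← hg.cobr]
      exact hx.2

theorem IsHom.iSup_filtration {C C' : CoalgData k d} {g : C.space →ₗ[k] C'.space}
    (hg : IsHom C C' g) (hi : Function.Injective g) {e : C.space} (he : C'.IsGrouplike (g e))
    (hF : ⨆ n, C'.filtration (g e) n = ⊤) : ⨆ n, C.filtration e n = ⊤ := by
  refine eq_top_iff.2 fun x _ => ?_
  obtain ⟨n, hn⟩ := induction_filtration he hF (g x)
  exact Submodule.mem_iSup_of_mem n (hg.comap_filtration_le hi e n hn)

theorem IsHom.isGrouplike_of_injective {C C' : CoalgData k d} {g : C.space →ₗ[k] C'.space}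
    (hg : IsHom C C' g) (hi : Function.Injective g) {e : C.space} (he : C'.IsGrouplike (g e)) :
    C.IsGrouplike e where
  deg := hg.deg.mem_of_injective hi he.deg
  counit := by rw [← hg.counit, he.counit]
  comul := by
    apply TensorProduct.map_injective_of_flat_flat g g hi hi
    rw [← hg.comul, he.comul, TensorProduct.map_tmul]
  cobr := by
    apply TensorProduct.map_injective_of_flat_flat g g hi hi
    rw [← hg.cobr, he.cobr, map_zero]

end CoalgData

open CoalgData

namespace Cofree
variable (d) (X : GradedSpace k)

theorem isHom_subtype :
    IsHom (Cofree d X) (Tree.coalg d X) (Tree.coalg d X).largest.subtype :=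
  CoalgData.isHom_subtype _ _ _

theorem lawsAt (x : (Cofree d X).space) : (Cofree d X).LawsAt x := lawsAt_sub _ _ _ x

theorem one_mem_largest : Tree.one X ∈ (Tree.coalg d X).largest := by
  have he := Tree.isGrouplike_one (d := d) X
  have hs : ∀ n, (Tree.coalg d X).space.sgn n (Tree.one X) = Tree.one X := he.sgn_apply
  have hswap : swap (Tree.coalg d X).space (Tree.coalg d X).space (Tree.one X ⊗ₜ Tree.one X) =
      Tree.one X ⊗ₜ Tree.one X := by
    rw [swap_of_mem_mem _ _ he.deg he.deg, mul_zero, zpow_zero, one_smul]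
  refine le_largest (N := Submodule.span k {Tree.one X}) ⟨?_, ?_, ?_, ?_⟩
    (Submodule.mem_span_singleton_self _)
  · exact fun i => he.proj_mem_filtration 0 i
  · exact he.comul_mem 0
  · exact he.cobr_mem 0
  · intro x hx
    obtain ⟨c, rfl⟩ := Submodule.mem_span_singleton.1 hx
    refine ⟨?_, ?_, ?_, ?_, ?_, ?_, ?_⟩ <;>
      simp [he.comul, he.cobr, he.counit, hswap]

/-- The grouplike element of the cofree coalgebra. -/
def one : (Cofree d X).space := ⟨Tree.one X, one_mem_largest d X⟩

theorem isGrouplike_one : (Cofree d X).IsGrouplike (one d X) :=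
  (isHom_subtype d X).isGrouplike_of_injective (Submodule.injective_subtype _)
    (Tree.isGrouplike_one X)

theorem iSup_filtration : ⨆ n, (Cofree d X).filtration (one d X) n = ⊤ :=
  (isHom_subtype d X).iSup_filtration (Submodule.injective_subtype _)
    (e := one d X) (Tree.isGrouplike_one X) (Tree.iSup_filtration X)

end Cofree
end

end DAlgebras

namespace DAlgebras

noncomputable section

open GradedSpace

variable {k : Type u} [Field k] {d : ℤ}

/-! ### Uniqueness of morphisms to the tree coalgebra -/

/-- The cross terms `D x ⊗ E y` cancel because `D` is odd. -/
theorem GradedSpace.tensorDiff_tensorDiff {X Y : GradedSpace k} {D : X →ₗ[k] X} (E : Y →ₗ[k] Y)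
    (hD : IsHomogeneous X X D 1) (t : X ⊗[k] Y) :
    tensorDiff X Y D E (tensorDiff X Y D E t) =
      TensorProduct.map (D ∘ₗ D) LinearMap.id t + TensorProduct.map LinearMap.id (E ∘ₗ E) t := by
  induction t using TensorProduct.induction_on with
  | zero => simp
  | tmul x y =>
    simp only [tensorDiff_tmul, map_add, hD.sgn_apply, sgn_sgn, TensorProduct.map_tmul,
      LinearMap.comp_apply, LinearMap.id_apply]
    simp only [mul_one, zpow_one, neg_smul, one_smul, TensorProduct.neg_tmul]
    abel
  | add a b ha hb => simp only [map_add, ha, hb]; abel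

namespace CoalgData

theorem IsHom.comp {C C' C'' : CoalgData k d} {g : C'.space →ₗ[k] C''.space}
    {f : C.space →ₗ[k] C'.space} (hg : IsHom C' C'' g) (hf : IsHom C C' f) :
    IsHom C C'' (g ∘ₗ f) where
  deg := hg.deg.comp hf.deg
  comul x := by
    rw [TensorProduct.map_comp, LinearMap.comp_apply, LinearMap.comp_apply, ← hf.comul, hg.comul]
  counit x := by rw [LinearMap.comp_apply, hg.counit, hf.counit]
  cobr x := by
    rw [TensorProduct.map_comp, LinearMap.comp_apply, LinearMap.comp_apply, ← hf.cobr, hg.cobr]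

theorem IsHom.sgn_apply {C C' : CoalgData k d} {g : C.space →ₗ[k] C'.space} (hg : IsHom C C' g)
    (n : ℤ) (x : C.space) : C'.space.sgn n (g x) = g (C.space.sgn n x) := by
  rw [hg.deg.sgn_apply, mul_zero, zpow_zero, one_smul]

section
variable {C C' : CoalgData k d} {F G : C.space →ₗ[k] C'.space} (hF : IsHom C C' F)
include hF

/-- From `F ⊗ F - G ⊗ G = (F - G) ⊗ F + G ⊗ (F - G)`. This lemma and the next two bring a difference
of morphisms, the failure of a morphism to commute with coderivations, and the square of a
coderivation into the form required by `eq_zero_of_corestrict`. -/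
theorem IsHom.comul_cobr_sub (hG : IsHom C C' G) (x : C.space) :
    C'.comul ((F - G) x) =
      TensorProduct.map (F - G) F (C.comul x) + TensorProduct.map G (F - G) (C.comul x) ∧
    C'.cobr ((F - G) x) = (1 : k) •
      (TensorProduct.map (F - G) F (C.cobr x) + TensorProduct.map G (F - G) (C.cobr x)) := by
  have hsub : ∀ t, TensorProduct.map F F t - TensorProduct.map G G t =
      TensorProduct.map (F - G) F t + TensorProduct.map G (F - G) t := by
    intro t
    induction t using TensorProduct.induction_on with
    | zero => simp
    | tmul x y => simp [TensorProduct.sub_tmul, TensorProduct.tmul_sub]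
    | add x y hx hy =>
      simp only [map_add, add_sub_add_comm, hx, hy]
      abel
  rw [LinearMap.sub_apply, map_sub, map_sub, hF.comul, hG.comul, hF.cobr, hG.cobr, hsub, hsub,
    one_smul]
  exact ⟨rfl, rfl⟩

theorem IsHom.comul_cobr_commutator {D : C.space →ₗ[k] C.space} (hD : C.IsCoderivation D)
    {Q : C'.space →ₗ[k] C'.space} (hQ : C'.IsCoderivation Q) (x : C.space) :
    C'.comul ((Q ∘ₗ F - F ∘ₗ D) x) = TensorProduct.map (Q ∘ₗ F - F ∘ₗ D) F (C.comul x) +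
      TensorProduct.map (F ∘ₗ C.space.sgn 1) (Q ∘ₗ F - F ∘ₗ D) (C.comul x) ∧
    C'.cobr ((Q ∘ₗ F - F ∘ₗ D) x) = (-1 : k) ^ (d - 1) •
      (TensorProduct.map (Q ∘ₗ F - F ∘ₗ D) F (C.cobr x) +
        TensorProduct.map (F ∘ₗ C.space.sgn 1) (Q ∘ₗ F - F ∘ₗ D) (C.cobr x)) := by
  have hsub : ∀ t, tensorDiff _ _ Q Q (TensorProduct.map F F t) -
      TensorProduct.map F F (tensorDiff _ _ D D t) =
      TensorProduct.map (Q ∘ₗ F - F ∘ₗ D) F t +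
        TensorProduct.map (F ∘ₗ C.space.sgn 1) (Q ∘ₗ F - F ∘ₗ D) t := by
    intro t
    induction t using TensorProduct.induction_on with
    | zero => simp
    | tmul x y =>
      simp only [TensorProduct.map_tmul, tensorDiff_tmul, map_add, hF.sgn_apply,
        LinearMap.sub_apply, LinearMap.comp_apply, TensorProduct.sub_tmul, TensorProduct.tmul_sub]
      abel
    | add x y hx hy =>
      simp only [map_add, add_sub_add_comm, hx, hy]
      abel
  rw [LinearMap.sub_apply, map_sub, map_sub, LinearMap.comp_apply, LinearMap.comp_apply, hQ.comul,
    hF.comul, hF.comul, hD.comul, hQ.cobr, hF.cobr, hF.cobr, hD.cobr, map_smul, ← smul_sub, hsub,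
    hsub]
  exact ⟨rfl, rfl⟩

theorem IsHom.comul_cobr_square {Q : C'.space →ₗ[k] C'.space} (hQ : C'.IsCoderivation Q)
    (x : C.space) :
    C'.comul ((Q ∘ₗ Q ∘ₗ F) x) = TensorProduct.map (Q ∘ₗ Q ∘ₗ F) F (C.comul x) +
      TensorProduct.map F (Q ∘ₗ Q ∘ₗ F) (C.comul x) ∧
    C'.cobr ((Q ∘ₗ Q ∘ₗ F) x) = (1 : k) • (TensorProduct.map (Q ∘ₗ Q ∘ₗ F) F (C.cobr x) +
      TensorProduct.map F (Q ∘ₗ Q ∘ₗ F) (C.cobr x)) := by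
  have hmap : ∀ t, TensorProduct.map (Q ∘ₗ Q) LinearMap.id (TensorProduct.map F F t) +
      TensorProduct.map LinearMap.id (Q ∘ₗ Q) (TensorProduct.map F F t) =
      TensorProduct.map (Q ∘ₗ Q ∘ₗ F) F t + TensorProduct.map F (Q ∘ₗ Q ∘ₗ F) t := by
    intro t
    induction t using TensorProduct.induction_on with
    | zero => simp
    | tmul x y => rfl
    | add x y hx hy =>
      simp only [map_add] at hx hy ⊢
      rw [add_add_add_comm, hx, hy]
      abel
  rw [LinearMap.comp_apply, LinearMap.comp_apply, hQ.comul, hQ.comul, hF.comul,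
    tensorDiff_tensorDiff Q hQ.homogeneous, hmap, hQ.cobr, hQ.cobr, hF.cobr, map_smul,
    tensorDiff_tensorDiff Q hQ.homogeneous, hmap, neg_one_zpow_smul_smul,
    Even.neg_one_zpow ⟨_, rfl⟩]
  exact ⟨rfl, rfl⟩

end

section
variable {X : GradedSpace k} {C : CoalgData k d} {e : C.space}
  (he : C.IsGrouplike e) (hF : ⨆ n, C.filtration e n = ⊤)
include he hF

theorem IsHom.ext_corestrict {F G : C.space →ₗ[k] (Tree.coalg d X).space}
    (hF' : IsHom C (Tree.coalg d X) F) (hG : IsHom C (Tree.coalg d X) G)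
    (hFe : F e = Tree.one X) (hGe : G e = Tree.one X)
    (h : ∀ x, Tree.corestrict d X (F x).2 = Tree.corestrict d X (G x).2) : F = G := by
  refine sub_eq_zero.1 (eq_zero_of_corestrict he hF hFe hGe ?_ ?_
    (fun x => (hF'.comul_cobr_sub hG x).1) (fun x => (hF'.comul_cobr_sub hG x).2) ?_)
  · rw [LinearMap.sub_apply, hFe, hGe, sub_self]
  · intro x
    rw [LinearMap.sub_apply, map_sub, hF'.counit, hG.counit, sub_self]
  · intro x
    change Tree.corestrict d X ((F x).2 - (G x).2) = 0
    rw [map_sub, h, sub_self]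

theorem IsHom.commute_coderivation {F : C.space →ₗ[k] (Tree.coalg d X).space}
    (hF' : IsHom C (Tree.coalg d X) F) (hFe : F e = Tree.one X)
    {D : C.space →ₗ[k] C.space} (hD : C.IsCoderivation D) (hDe : D e = 0)
    {Q : (Tree.coalg d X).space →ₗ[k] (Tree.coalg d X).space}
    (hQ : (Tree.coalg d X).IsCoderivation Q) (hQe : Q (Tree.one X) = 0)
    (h : ∀ x, Tree.corestrict d X (Q (F x)).2 = Tree.corestrict d X (F (D x)).2) (x : C.space) :
    Q (F x) = F (D x) := by
  suffices e : Q ∘ₗ F - F ∘ₗ D = 0 from LinearMap.congr_fun (sub_eq_zero.1 e) x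
  refine eq_zero_of_corestrict he hF hFe ?_ ?_ ?_
    (fun x => (hF'.comul_cobr_commutator hD hQ x).1)
    (fun x => (hF'.comul_cobr_commutator hD hQ x).2) ?_
  · rw [LinearMap.comp_apply, he.sgn_apply, hFe]
  · rw [LinearMap.sub_apply, LinearMap.comp_apply, LinearMap.comp_apply, hFe, hQe, hDe, map_zero,
      sub_zero]
  · intro x
    rw [LinearMap.sub_apply, map_sub, LinearMap.comp_apply, LinearMap.comp_apply, hQ.counit,
      hF'.counit, hD.counit, sub_self]
  · intro x
    change Tree.corestrict d X ((Q (F x)).2 - (F (D x)).2) = 0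
    rw [map_sub, h, sub_self]

/-- The square of an odd coderivation is again a coderivation and is therefore determined by its
corestriction. The statement is relative to a map `F` because the corestriction need only vanish on
the image of `F`, which in the application is the cofree coalgebra inside the tree coalgebra. -/
theorem coderivation_comp_self_eq_zero {F : C.space →ₗ[k] (Tree.coalg d X).space}
    (hF' : IsHom C (Tree.coalg d X) F) (hFe : F e = Tree.one X)
    {Q : (Tree.coalg d X).space →ₗ[k] (Tree.coalg d X).space}
    (hQ : (Tree.coalg d X).IsCoderivation Q) (hQe : Q (Tree.one X) = 0)
    (h : ∀ x, Tree.corestrict d X (Q (Q (F x))).2 = 0) (x : C.space) : Q (Q (F x)) = 0 := by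
  suffices e : Q ∘ₗ Q ∘ₗ F = 0 from LinearMap.congr_fun e x
  refine eq_zero_of_corestrict he hF hFe hFe ?_ (fun x => hQ.counit _)
    (fun x => (hF'.comul_cobr_square hQ x).1) (fun x => (hF'.comul_cobr_square hQ x).2) h
  rw [LinearMap.comp_apply, LinearMap.comp_apply, hFe, hQe, map_zero]

end

/-! ### Twisting maps -/

theorem IsHom.lift_map {C C' : CoalgData k d} {F : C.space →ₗ[k] C'.space} (hF : IsHom C C' F)
    {B : GradedSpace k} (m : B →ₗ[k] B →ₗ[k] B) (f g : C'.space →ₗ[k] B) (n : ℤ)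
    (t : C.space ⊗[k] C.space) :
    TensorProduct.lift m (TensorProduct.map (f ∘ₗ C'.space.sgn n) g (TensorProduct.map F F t)) =
      TensorProduct.lift m (TensorProduct.map ((f ∘ₗ F) ∘ₗ C.space.sgn n) (g ∘ₗ F) t) := by
  induction t using TensorProduct.induction_on with
  | zero => simp
  | tmul x y => simp [hF.sgn_apply]
  | add x y hx hy => simp only [map_add, hx, hy]

theorem IsHom.convBr_comp {C C' : CoalgData k d} {F : C.space →ₗ[k] C'.space} (hF : IsHom C C' F)
    (B : DGAlgData k d) (f : C'.space →ₗ[k] B.space) {g : C'.space →ₗ[k] B.space} {q : ℤ}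
    (hg : IsHomogeneous C'.space B.space g q) :
    convBr C' B f g ∘ₗ F = convBr C B (f ∘ₗ F) (g ∘ₗ F) := LinearMap.ext fun x => by
  have hg' := hg.comp hF.deg
  rw [zero_add] at hg'
  rw [LinearMap.comp_apply, convBr_apply C' B f hg, convBr_apply C B _ hg', hF.comul, hF.cobr,
    hF.lift_map, hF.lift_map]

end CoalgData

open CoalgData

/-- The Maurer-Cartan equation for a linear map from a coalgebra to an algebra. -/
structure IsTwisting (C : DGCoalgData k d) (B : DGAlgData k d) (f : C.space →ₗ[k] B.space) :
    Prop where
  deg : IsHomogeneous C.space B.space f d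
  eq : homDiff C.diff B.diff f + (2 : k)⁻¹ • convBr C.toCoalgData B f f = 0

theorem IsTwisting.comp {C C' : DGCoalgData k d} {B : DGAlgData k d} {f : C'.space →ₗ[k] B.space}
    (hf : IsTwisting C' B f) (F : C.Hom C') : IsTwisting C B (f ∘ₗ F.map) := by
  have hd := hf.deg.comp F.map_deg
  rw [zero_add] at hd
  refine ⟨hd, ?_⟩
  have h := hf.eq
  rw [homDiff_of_mem hf.deg] at h
  rw [homDiff_of_mem hd, ← F.isHom.convBr_comp B f hf.deg]
  have h' := congrArg (fun g => g ∘ₗ F.map) h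
  simp only [LinearMap.add_comp, LinearMap.sub_comp, LinearMap.smul_comp, LinearMap.zero_comp,
    LinearMap.comp_assoc] at h' ⊢
  rwa [show C'.diff ∘ₗ F.map = F.map ∘ₗ C.diff from LinearMap.ext F.map_diff] at h'

/-- The curvature of a map of degree `d` satisfies the Bianchi identity. -/
theorem homDiff_convBr_self [CharZero k] {C : CoalgData k d} {B : DGAlgData k d}
    (hC : ∀ x, C.LawsAt x) (hB : B.IsDAlgebra) {D : C.space →ₗ[k] C.space}
    (hD : C.IsCoderivation D) {f : C.space →ₗ[k] B.space} (hf : IsHomogeneous C.space B.space f d)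
    (h : homDiff D B.diff f + (2 : k)⁻¹ • convBr C B f f = 0) :
    homDiff D B.diff (convBr C B f f) = 0 := by
  have hff := isHomogeneous_convBr C B hf hf
  rw [show d + d + (1 - d) = d + 1 by ring] at hff
  have hDf : homDiff D B.diff f = -((2 : k)⁻¹ • convBr C B f f) := eq_neg_of_add_eq_zero_left h
  have hj := convBr_jacobi hC hB hf hf hf
  have hs := convBr_skew hC hB hff hf
  rw [Even.neg_one_zpow (by
    rw [show (d + 1 + d - 1) * (d + d - 1) = d * (d + d - 1) + d * (d + d - 1) by ring]
    exact ⟨_, rfl⟩)] at hs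
  rw [Odd.neg_one_zpow (by
    rw [show (d + d - 1) * (d + d - 1) = 2 * (2 * d * d - 2 * d) + 1 by ring]
    exact ⟨_, rfl⟩)] at hj
  -- For `f` of odd shifted degree, the Jacobi identity and skew-symmetry give `{f, {f, f}} = -2{f,
  -- {f, f}}`. Since `3` is invertible, the triple bracket vanishes.
  have h3 : convBr C B f (convBr C B f f) = 0 := by
    rw [hs] at hj
    simp only [neg_smul, one_smul] at hj
    have : (3 : k) • convBr C B f (convBr C B f f) = 0 := by
      have e : (3 : k) = 1 + 1 + 1 := by norm_num
      rw [e, add_smul, add_smul, one_smul]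
      nth_rewrite 1 [hj]
      abel
    exact (smul_eq_zero.1 this).resolve_left (by norm_num)
  rw [homDiff_convBr hB hD hf hf, hDf]
  simp only [map_neg, map_smul, LinearMap.neg_apply, LinearMap.smul_apply, hs, h3]
  simp

end

end DAlgebras

namespace DAlgebras

noncomputable section

open GradedSpace

variable {k : Type u} [Field k] {d : ℤ}

open CoalgData

/-! ### The coalgebra of a `d`-algebra and its universal property -/

namespace Vee
variable (B : DGAlgData k d)

theorem treeProj_one : treeProj B (Tree.one (B.space.shift d)) = 0 :=
  map_zero (Tree.corestrict d (B.space.shift d))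

theorem treeCorestrict_one : treeCorestrict B (Tree.one (B.space.shift d)) = 0 := by
  have he := Tree.isGrouplike_one (d := d) (B.space.shift d)
  rw [treeCorestrict, LinearMap.smul_apply, LinearMap.add_apply, LinearMap.comp_apply,
    LinearMap.smul_apply, convBr_apply _ B _ (isHomogeneous_treeProj B), he.comul, he.cobr,
    TensorProduct.map_tmul, treeProj_one]
  simp

theorem treeDiff_one : treeDiff B (Tree.one (B.space.shift d)) = 0 := by
  change LinearMap.inr k k (Tree.space d (B.space.shift d)) (Tree.coder d (B.space.shift d)
    (treeCorestrict B ∘ₗ LinearMap.inr k k _) 0) = 0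
  rw [map_zero, map_zero]

theorem treeProj_treeDiff (x : (Tree.coalg d (B.space.shift d)).space) :
    treeProj B (treeDiff B x) = treeCorestrict B x := by
  refine (Tree.corestrict_coder (B.space.shift d) _ x.2).trans ?_
  conv_rhs => rw [Tree.eq_smul_one_add_inr (B.space.shift d) x]
  rw [map_add, map_smul, treeCorestrict_one, smul_zero, zero_add]
  rfl

end Vee

theorem CoalgData.IsHom.of_comp {C C' C'' : CoalgData k d} {g : C'.space →ₗ[k] C''.space}
    (hg : IsHom C' C'' g) (hi : Function.Injective g) {f : C.space →ₗ[k] C'.space}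
    (hf : IsHom C C'' (g ∘ₗ f)) : IsHom C C' f := by
  have h₂ := TensorProduct.map_injective_of_flat_flat g g hi hi
  have hm : ∀ t, TensorProduct.map g g (TensorProduct.map f f t) =
      TensorProduct.map (g ∘ₗ f) (g ∘ₗ f) t := fun t => by
    rw [TensorProduct.map_comp, LinearMap.comp_apply]
  refine ⟨fun i x hx => hg.deg.mem_of_injective hi (hf.deg i x hx), fun x => h₂ ?_, fun x => ?_,
    fun x => h₂ ?_⟩
  · rw [hm, ← hf.comul, ← hg.comul]; rfl
  · rw [← hg.counit]; exact hf.counit x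
  · rw [hm, ← hf.cobr, ← hg.cobr]; rfl

theorem CoalgData.IsHom.isCoderivation_of_injective {C C' : CoalgData k d}
    {g : C.space →ₗ[k] C'.space} (hg : IsHom C C' g) (hi : Function.Injective g)
    {Q : C'.space →ₗ[k] C'.space} (hQ : C'.IsCoderivation Q) {D : C.space →ₗ[k] C.space}
    (hD : IsHomogeneous C.space C.space D 1) (h : ∀ x, Q (g x) = g (D x)) :
    C.IsCoderivation D := by
  have ht : ∀ t, tensorDiff _ _ Q Q (TensorProduct.map g g t) =
      TensorProduct.map g g (tensorDiff _ _ D D t) := by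
    intro t
    induction t using TensorProduct.induction_on with
    | zero => simp
    | tmul x y => simp only [TensorProduct.map_tmul, tensorDiff_tmul, map_add, hg.sgn_apply, h]
    | add x y hx hy => simp only [map_add, hx, hy]
  have h₂ := TensorProduct.map_injective_of_flat_flat g g hi hi
  refine ⟨hD, fun x => h₂ ?_, fun x => ?_, fun x => h₂ ?_⟩
  · rw [← hg.comul, ← h, hQ.comul, hg.comul, ht]
  · rw [← hg.counit, ← h, hQ.counit]
  · rw [← hg.cobr, ← h, hQ.cobr, hg.cobr, ht, map_smul]

namespace vee
variable (B : DGAlgData k d)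

/-- The defining formula for the differential holds on trees. It passes to the cofree coalgebra
because the convolution bracket is natural along the inclusion. -/
theorem proj_diff (x : (vee B).space) : vee.proj B ((vee B).diff x) =
    (-1 : k) ^ d • (B.diff (vee.proj B x) +
      (2 : k)⁻¹ • convBr (vee B).toCoalgData B (vee.proj B) (vee.proj B) x) := by
  have hn := (Cofree.isHom_subtype d (B.space.shift d)).convBr_comp B (Vee.treeProj B)
    (Vee.isHomogeneous_treeProj B)
  change _ = convBr (vee B).toCoalgData B (vee.proj B) (vee.proj B) at hn
  rw [← hn]
  exact Vee.treeProj_treeDiff B _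

/-- The defining formula for the differential of `vee B` is the Maurer-Cartan equation for its
projection; the factor `(-1) ^ d` is the sign in the differential of a map of degree `d`. -/
theorem isTwisting_proj : IsTwisting (vee B) B (vee.proj B) where
  deg := vee.proj_deg B
  eq := LinearMap.ext fun x => by
    rw [homDiff_of_mem (vee.proj_deg B), LinearMap.add_apply, LinearMap.sub_apply,
      LinearMap.smul_apply, LinearMap.comp_apply, LinearMap.comp_apply, proj_diff,
      neg_one_zpow_smul_smul, Even.neg_one_zpow ⟨_, rfl⟩, one_smul, LinearMap.smul_apply,
      LinearMap.zero_apply]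
    abel

theorem isCoderivation : (vee B).IsCoderivation (vee B).diff :=
  (Cofree.isHom_subtype d (B.space.shift d)).isCoderivation_of_injective
    (Submodule.injective_subtype _) (Vee.isCoderivation_treeDiff B) (vee B).diff_deg fun _ => rfl

/-- The grouplike element of `B^∨`. -/
def one : (vee B).space := Cofree.one d (B.space.shift d)

theorem isGrouplike_one : (vee B).IsGrouplike (one B) := Cofree.isGrouplike_one d (B.space.shift d)

theorem diff_one : (vee B).diff (one B) = 0 := Subtype.ext (Vee.treeDiff_one B)

theorem proj_one : vee.proj B (one B) = 0 := Vee.treeProj_one B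

variable {B}

theorem isDCoalgebra [CharZero k] (hB : B.IsDAlgebra) : (vee B).IsDCoalgebra where
  laws := Cofree.lawsAt d (B.space.shift d)
  coderivation := isCoderivation B
  diff_diff x := by
    have hb := homDiff_convBr_self (C := (vee B).toCoalgData)
      (Cofree.lawsAt d (B.space.shift d)) hB (isCoderivation B)
      (vee.proj_deg B) (isTwisting_proj B).eq
    have hff := isHomogeneous_convBr (vee B).toCoalgData B (vee.proj_deg B) (vee.proj_deg B)
    rw [show d + d + (1 - d) = d + 1 by ring] at hff
    rw [homDiff_of_mem hff] at hb
    -- Applying the formula for `p Q` twice leaves `d{p, p}` and `{p, p} Q`, each with the factor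
    -- one half; they cancel by the Bianchi identity `hb`.
    have hz : ∀ x, vee.proj B ((vee B).diff ((vee B).diff x)) = 0 := fun x => by
      have h := LinearMap.congr_fun hb x
      rw [LinearMap.sub_apply, LinearMap.smul_apply, LinearMap.comp_apply, LinearMap.comp_apply,
        LinearMap.zero_apply, sub_eq_zero] at h
      rw [proj_diff, proj_diff, map_smul, map_add, hB.diff_diff, zero_add, map_smul, h,
        smul_comm ((-1 : k) ^ d) (2 : k)⁻¹ (((-1 : k) ^ (d + 1)) • _), neg_one_zpow_smul_smul,
        Odd.neg_one_zpow (n := d + (d + 1)) ⟨d, by ring⟩, neg_one_smul, ← smul_add,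
        neg_add_cancel, smul_zero, smul_zero]
    exact Subtype.ext (coderivation_comp_self_eq_zero
      (Cofree.isGrouplike_one d (B.space.shift d)) (Cofree.iSup_filtration d (B.space.shift d))
      (Cofree.isHom_subtype d (B.space.shift d)) rfl (Vee.isCoderivation_treeDiff B)
      (Vee.treeDiff_one B) hz x)

theorem isCoproartinian [CharZero k] (hB : B.IsDAlgebra) : (vee B).IsCoproartinian :=
  (isDCoalgebra hB).isCoproartinian (isGrouplike_one B) (diff_one B)
    (Cofree.iSup_filtration d (B.space.shift d))

section
variable [CharZero k] {C : DGCoalgData k d} (hC : C.IsCoproartinian) (hB : B.IsDAlgebra)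
include hC hB

theorem map_one (F : C.Hom (vee B)) : F.map hC.one = one B := by
  have h := (isGrouplike_one B)
  rw [(isCoproartinian hB).eq_one h.counit h.comul]
  refine (isCoproartinian hB).eq_one ?_ ?_
  · rw [F.map_counit, hC.one_spec.1]
  · rw [F.map_comul, hC.one_spec.2, TensorProduct.map_tmul]

/-- The uniqueness half of the universal property. The comparison takes place in the tree coalgebra,
where both morphisms send the grouplike element to `Tree.one`. -/
theorem hom_ext {F G : C.Hom (vee B)} (h : ∀ x, vee.proj B (F.map x) = vee.proj B (G.map x)) :
    F = G := by
  obtain ⟨he, -, hF⟩ := hC.isGrouplike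
  have hι := Cofree.isHom_subtype d (B.space.shift d)
  have key := IsHom.ext_corestrict he hF (hι.comp F.isHom) (hι.comp G.isHom)
    (congrArg Subtype.val (map_one hC hB F)) (congrArg Subtype.val (map_one hC hB G)) h
  exact DGCoalgData.Hom.ext (LinearMap.ext fun x => Subtype.ext (LinearMap.congr_fun key x))

omit hB [CharZero k] in
-- The existence half of the universal property. The lift to the tree coalgebra commutes with the
-- differentials because this can be tested on corestrictions, where it is the Maurer-Cartan
-- equation for `f`.
theorem exists_hom {f : C.space →ₗ[k] B.space} (hf : IsTwisting C B f) (hfe : f hC.one = 0) :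
    ∃ F : C.Hom (vee B), ∀ x, vee.proj B (F.map x) = f x := by
  obtain ⟨he, hDe, hF⟩ := hC.isGrouplike
  obtain ⟨F, hFh, hFe, hFf⟩ := exists_lift (X := B.space.shift d) hC.isDCoalgebra.laws he hF
    (f := f) (fun i x hx => by
      have := hf.deg i x hx
      rw [add_zero]
      exact this) hfe
  -- The image of a coalgebra in which the identities hold is contained in the largest
  -- `d`-coalgebra, so the lift takes values in the cofree coalgebra.
  have hmem := hFh.mem_largest hC.isDCoalgebra.laws
  have hdiff := hFh.commute_coderivation he hF hFe hC.isDCoalgebra.coderivation hDe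
    (Vee.isCoderivation_treeDiff B) (Vee.treeDiff_one B) fun x => by
      have hn := hFh.convBr_comp B (Vee.treeProj B) (Vee.isHomogeneous_treeProj B)
      have hfF : Vee.treeProj B ∘ₗ F = f := LinearMap.ext hFf
      rw [hfF] at hn
      have hx := LinearMap.congr_fun hf.eq x
      rw [homDiff_of_mem hf.deg] at hx
      rw [LinearMap.add_apply, LinearMap.sub_apply, LinearMap.smul_apply, LinearMap.comp_apply,
        LinearMap.comp_apply, LinearMap.zero_apply, sub_add_eq_add_sub, sub_eq_zero] at hx
      refine (Vee.treeProj_treeDiff B (F x)).trans (Eq.trans ?_ (hFf (C.diff x)).symm)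
      have h₁ : Vee.treeCorestrict B (F x) = (-1 : k) ^ d •
          (B.diff (f x) + ((2 : k)⁻¹ • convBr C.toCoalgData B f f) x) := by
        rw [← hn, ← hfF]
        rfl
      rw [h₁, hx, neg_one_zpow_smul_smul, Even.neg_one_zpow ⟨_, rfl⟩, one_smul]
  have hF' : IsHom C.toCoalgData (vee B).toCoalgData (F.codRestrict _ hmem) :=
    (Cofree.isHom_subtype d (B.space.shift d)).of_comp (Submodule.injective_subtype _) hFh
  exact ⟨⟨_, hF'.deg, hF'.comul, hF'.counit, hF'.cobr, fun x => Subtype.ext (hdiff x)⟩, hFf⟩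

end
end vee
end

end DAlgebras

namespace DAlgebras

noncomputable section

open GradedSpace

variable {k : Type u} [Field k] {d : ℤ}

/-! ### Currying -/

section
variable (X Y B : GradedSpace k)

/-- The map `f ↦ (y ↦ (x ↦ (-1) ^ (|x| * |y|) f (x ⊗ y)))`. -/
def curryLin : (X ⊗[k] Y →ₗ[k] B) →ₗ[k] (Y →ₗ[k] X →ₗ[k] B) where
  toFun f := TensorProduct.curry (f ∘ₗ swap Y X)
  map_add' _ _ := rfl
  map_smul' _ _ := rfl

variable {X Y B}

theorem curryLin_apply (f : X ⊗[k] Y →ₗ[k] B) (y : Y) (x : X) :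
    curryLin X Y B f y x = f (swap Y X (y ⊗ₜ x)) := rfl

theorem curryLin_of_mem (f : X ⊗[k] Y →ₗ[k] B) {i j : ℤ} {x : X} {y : Y} (hx : x ∈ X.deg i)
    (hy : y ∈ Y.deg j) : curryLin X Y B f y x = (-1 : k) ^ (j * i) • f (x ⊗ₜ y) := by
  rw [curryLin_apply, swap_of_mem_mem _ _ hy hx, map_smul]

theorem isHomogeneous_curryLin_apply {f : X ⊗[k] Y →ₗ[k] B} {n j : ℤ}
    (hf : IsHomogeneous (X.tensor Y) B f n) {y : Y} (hy : y ∈ Y.deg j) :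
    IsHomogeneous X B (curryLin X Y B f y) (j + n) := fun i x hx => by
  rw [curryLin_of_mem f hx hy]
  have := hf (i + j) (x ⊗ₜ y) (tmul_mem_tensorDeg _ _ rfl hx hy)
  rw [add_assoc] at this
  exact Submodule.smul_mem _ _ this

theorem curryLin_mem : ∀ f ∈ ⨆ n, homDeg (X.tensor Y) B n, ∀ y : Y,
    curryLin X Y B f y ∈ ⨆ n, homDeg X B n := by
  intro f hf y
  refine Y.induction y ?_ (fun y y' h h' => ?_) fun j y hy => ?_
  · rw [map_zero]
    exact zero_mem _
  · rw [map_add]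
    exact add_mem h h'
  · exact (iSup_le (a := (⨆ n, homDeg X B n).comap
      ((LinearMap.applyₗ y).comp (curryLin X Y B))) fun n f hf =>
        Submodule.mem_iSup_of_mem _ (isHomogeneous_curryLin_apply hf hy)) hf

theorem isHomogeneous_codRestrict_curryLin {f : X ⊗[k] Y →ₗ[k] B}
    (hf : f ∈ ⨆ n, homDeg (X.tensor Y) B n) {n : ℤ} (hf' : IsHomogeneous (X.tensor Y) B f n) :
    IsHomogeneous Y (gradedHom X B) ((curryLin X Y B f).codRestrict _ (curryLin_mem f hf)) n :=
  fun _ _ hy => isHomogeneous_curryLin_apply hf' hy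

variable (X Y B) in
/-- The currying isomorphism for graded spaces of linear maps. -/
def curry : gradedHom (X.tensor Y) B →ₗ[k] gradedHom Y (gradedHom X B) where
  toFun f := ⟨(curryLin X Y B f.1).codRestrict _ (curryLin_mem f.1 f.2), by
    refine (gradedHom (X.tensor Y) B).induction f ?_ (fun f g hf hg => ?_) fun n f hf => ?_
    · convert zero_mem (⨆ n, homDeg Y (gradedHom X B) n)
      exact LinearMap.ext fun y => Subtype.ext (by simp)
    · convert add_mem hf hg using 1
      exact LinearMap.ext fun y => Subtype.ext (by simp)
    · exact Submodule.mem_iSup_of_mem n (isHomogeneous_codRestrict_curryLin f.2 hf)⟩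
  map_add' f g := Subtype.ext <| LinearMap.ext fun y => Subtype.ext <| by simp
  map_smul' c f := Subtype.ext <| LinearMap.ext fun y => Subtype.ext <| by simp

theorem curry_apply (f : gradedHom (X.tensor Y) B) (y : Y) (x : X) :
    (((curry X Y B f).1 y).1 x : B) = f.1 (swap Y X (y ⊗ₜ x)) := rfl

theorem curry_deg (n : ℤ) (f : gradedHom (X.tensor Y) B) (hf : f ∈ (gradedHom (X.tensor Y) B).deg n) :
    curry X Y B f ∈ (gradedHom Y (gradedHom X B)).deg n :=
  isHomogeneous_codRestrict_curryLin f.2 hf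

theorem curry_ext {F G : gradedHom Y (gradedHom X B)}
    (h : ∀ i j, ∀ y ∈ Y.deg i, ∀ x ∈ X.deg j, (F.1 y).1 x = (G.1 y).1 x) : F = G :=
  Subtype.ext <| Y.hom_ext fun i y hy => Subtype.ext <| X.hom_ext fun j x hx => h i j y hy x hx

theorem curry_injective : Function.Injective (curry X Y B) := fun f g h => by
  refine Subtype.ext (LinearMap.ext fun t => ?_)
  rw [← swap_swap X Y t]
  generalize swap X Y t = s
  induction s using TensorProduct.induction_on with
  | zero => simp
  | tmul y x => rw [← curry_apply, ← curry_apply, h]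
  | add a b ha hb => simp only [map_add, ha, hb]

/-- Surjectivity is stated degree by degree, together with homogeneity of the preimage, so that
injectivity of `curry` also allows degrees to be reflected. -/
theorem exists_curry_eq {n : ℤ} (F : gradedHom Y (gradedHom X B))
    (hF : F ∈ (gradedHom Y (gradedHom X B)).deg n) :
    ∃ f ∈ (gradedHom (X.tensor Y) B).deg n, curry X Y B f = F := by
  have hd : IsHomogeneous (X.tensor Y) B (TensorProduct.lift
      ((⨆ n, homDeg X B n).subtype ∘ₗ F.1) ∘ₗ swap X Y) n := by
    refine isHomogeneous_of_tmul fun i j x hx y hy => ?_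
    rw [LinearMap.comp_apply, swap_of_mem_mem _ _ hx hy, map_smul, TensorProduct.lift.tmul]
    have := hF j y hy i x hx
    rw [show i + (j + n) = i + j + n by ring] at this
    exact Submodule.smul_mem _ _ this
  refine ⟨⟨_, Submodule.mem_iSup_of_mem n hd⟩, hd, Subtype.ext (LinearMap.ext fun y =>
    Subtype.ext (LinearMap.ext fun x => ?_))⟩
  rw [curry_apply]
  change TensorProduct.lift _ (swap X Y (swap Y X (y ⊗ₜ x))) = _
  rw [swap_swap]
  rfl

/-- The convolution with a pairing, on a tensor product of graded spaces. -/
theorem lift_map_curryLin (m : B →ₗ[k] B →ₗ[k] B) (f g : X ⊗[k] Y →ₗ[k] B) (n : ℤ) {a b : ℤ}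
    {y y' : Y} (hy : y ∈ Y.deg a) (hy' : y' ∈ Y.deg b) (u : X ⊗[k] X) :
    (-1 : k) ^ (n * a) • TensorProduct.lift m (TensorProduct.map
      (curryLin X Y B f y ∘ₗ X.sgn (n + b)) (curryLin X Y B g y') u) =
    TensorProduct.lift m (TensorProduct.map (f ∘ₗ (X.tensor Y).sgn n) g
      (DGCoalgData.middleSwap X Y (swap (Y.tensor Y) (X.tensor X) ((y ⊗ₜ y') ⊗ₜ u)))) := by
  suffices h : (-1 : k) ^ (n * a) • TensorProduct.lift m ∘ₗ TensorProduct.map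
      (curryLin X Y B f y ∘ₗ X.sgn (n + b)) (curryLin X Y B g y') =
      TensorProduct.lift m ∘ₗ TensorProduct.map (f ∘ₗ (X.tensor Y).sgn n) g ∘ₗ
        DGCoalgData.middleSwap X Y ∘ₗ swap (Y.tensor Y) (X.tensor X) ∘ₗ
          TensorProduct.mk k (Y ⊗[k] Y) (X ⊗[k] X) (y ⊗ₜ y') from LinearMap.congr_fun h u
  refine tensor_hom_ext X X fun i j x hx x' hx' => ?_
  have hm : DGCoalgData.middleSwap X Y ((x ⊗ₜ x') ⊗ₜ (y ⊗ₜ y')) =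
      (-1 : k) ^ (j * a) • (x ⊗ₜ y) ⊗ₜ (x' ⊗ₜ y') := by
    simp only [DGCoalgData.middleSwap, LinearMap.comp_apply, LinearEquiv.coe_coe,
      TensorProduct.assoc_tmul, LinearMap.lTensor_tmul, TensorProduct.assoc_symm_tmul,
      LinearMap.rTensor_tmul, swap_of_mem_mem _ _ hx' hy, ← TensorProduct.smul_tmul',
      TensorProduct.tmul_smul, map_smul]
  have hs : swap (Y.tensor Y) (X.tensor X) ((y ⊗ₜ y') ⊗ₜ (x ⊗ₜ x')) =
      (-1 : k) ^ ((a + b) * (i + j)) • (x ⊗ₜ x') ⊗ₜ (y ⊗ₜ y') :=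
    swap_of_mem_mem _ _ (tmul_mem_tensorDeg _ _ rfl hy hy') (tmul_mem_tensorDeg _ _ rfl hx hx')
  have hg : (X.tensor Y).sgn n (x ⊗ₜ y) = (-1 : k) ^ (n * (i + a)) • x ⊗ₜ y :=
    sgn_of_mem _ (tmul_mem_tensorDeg _ _ rfl hx hy) _
  simp only [LinearMap.smul_apply, LinearMap.comp_apply, TensorProduct.mk_apply, hs, hm, map_smul,
    TensorProduct.map_tmul, TensorProduct.lift.tmul, hg, sgn_of_mem _ hx, curryLin_of_mem _ hx hy,
    curryLin_of_mem _ hx' hy', neg_one_zpow_smul_smul]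
  exact neg_one_zpow_smul_congr _ (by push_cast; grind)

end

/-! ### Convolution on a tensor product -/

section
variable {V S : DGCoalgData k d} {B : DGAlgData k d}
  {f g : gradedHom (V.tensor S).space B.space} {p q : ℤ}
  (hf : f ∈ (gradedHom (V.tensor S).space B.space).deg p)
  (hg : g ∈ (gradedHom (V.tensor S).space B.space).deg q)

include hg

/-- The inner product in `Hom(V, B)` brings in the coproduct of `V`; evaluation at `v` then produces
the same two-fold map on `V ⊗ S`, with the factors of `S` and `V` rearranged by `swap` and
`middleSwap`. -/
theorem lift_homAlg_mul (t : S.space ⊗[k] S.space) (v : V.space) :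
    (TensorProduct.lift (homAlg V B).mul (TensorProduct.map
      ((curry V.space S.space B.space f).1 ∘ₗ S.space.sgn q)
      (curry V.space S.space B.space g).1 t)).1 v =
    TensorProduct.lift B.mul (TensorProduct.map (f.1 ∘ₗ (V.tensor S).space.sgn q) g.1
      (DGCoalgData.middleSwap V.space S.space (swap (S.space.tensor S.space)
        (V.space.tensor V.space) (t ⊗ₜ V.comul v)))) := by
  suffices h : LinearMap.applyₗ v ∘ₗ (⨆ n, homDeg V.space B.space n).subtype ∘ₗ
      TensorProduct.lift (homAlg V B).mul ∘ₗ TensorProduct.map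
      ((curry V.space S.space B.space f).1 ∘ₗ S.space.sgn q)
      (curry V.space S.space B.space g).1 =
      TensorProduct.lift B.mul ∘ₗ TensorProduct.map (f.1 ∘ₗ (V.tensor S).space.sgn q) g.1 ∘ₗ
        DGCoalgData.middleSwap V.space S.space ∘ₗ swap (S.space.tensor S.space)
        (V.space.tensor V.space) ∘ₗ
          (TensorProduct.mk k (S.space ⊗[k] S.space) (V.space ⊗[k] V.space)).flip (V.comul v) from
    LinearMap.congr_fun h t
  refine tensor_hom_ext _ _ fun a b y hy y' hy' => ?_
  have hg' : IsHomogeneous V.space B.space (curryLin V.space S.space B.space g.1 y') (b + q) :=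
    isHomogeneous_curryLin_apply hg hy'
  refine Eq.trans ?_ (lift_map_curryLin B.mul f.1 g.1 q hy hy' (V.comul v))
  rw [add_comm q b]
  change ((homAlg V B).mul ((curry V.space S.space B.space f).1 (S.space.sgn q y))
    ((curry V.space S.space B.space g).1 y')).1 v = _
  rw [sgn_of_mem _ hy, map_smul, map_smul]
  exact congrArg _ (convMul_apply V.toCoalgData B _ hg' v)

theorem lift_homAlg_br (t : S.space ⊗[k] S.space) (v : V.space) :
    (TensorProduct.lift (homAlg V B).br (TensorProduct.map
      ((curry V.space S.space B.space f).1 ∘ₗ S.space.sgn (q + d - 1))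
      (curry V.space S.space B.space g).1 t)).1 v =
    TensorProduct.lift B.br (TensorProduct.map (f.1 ∘ₗ (V.tensor S).space.sgn (q + d - 1)) g.1
      (DGCoalgData.middleSwap V.space S.space (swap (S.space.tensor S.space)
        (V.space.tensor V.space) (t ⊗ₜ V.comul v)))) +
    (-1 : k) ^ ((d - 1) * q) •
    TensorProduct.lift B.mul (TensorProduct.map (f.1 ∘ₗ (V.tensor S).space.sgn q) g.1
      (DGCoalgData.middleSwap V.space S.space (swap (S.space.tensor S.space)
        (V.space.tensor V.space) ((S.space.tensor S.space).sgn (d - 1) t ⊗ₜ V.cobr v)))) := by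
  suffices h : LinearMap.applyₗ v ∘ₗ (⨆ n, homDeg V.space B.space n).subtype ∘ₗ
      TensorProduct.lift (homAlg V B).br ∘ₗ TensorProduct.map
      ((curry V.space S.space B.space f).1 ∘ₗ S.space.sgn (q + d - 1))
      (curry V.space S.space B.space g).1 =
      TensorProduct.lift B.br ∘ₗ
        TensorProduct.map (f.1 ∘ₗ (V.tensor S).space.sgn (q + d - 1)) g.1 ∘ₗ
        DGCoalgData.middleSwap V.space S.space ∘ₗ swap (S.space.tensor S.space)
        (V.space.tensor V.space) ∘ₗ
          (TensorProduct.mk k (S.space ⊗[k] S.space) (V.space ⊗[k] V.space)).flip (V.comul v) +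
      (-1 : k) ^ ((d - 1) * q) • TensorProduct.lift B.mul ∘ₗ
        TensorProduct.map (f.1 ∘ₗ (V.tensor S).space.sgn q) g.1 ∘ₗ
        DGCoalgData.middleSwap V.space S.space ∘ₗ swap (S.space.tensor S.space)
        (V.space.tensor V.space) ∘ₗ
          (TensorProduct.mk k (S.space ⊗[k] S.space) (V.space ⊗[k] V.space)).flip (V.cobr v) ∘ₗ
          (S.space.tensor S.space).sgn (d - 1) from
    LinearMap.congr_fun h t
  refine tensor_hom_ext _ _ fun a b y hy y' hy' => ?_
  have hg' : IsHomogeneous V.space B.space (curryLin V.space S.space B.space g.1 y') (b + q) :=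
    isHomogeneous_curryLin_apply hg hy'
  have hs : (S.space.tensor S.space).sgn (d - 1) (y ⊗ₜ y') =
      (-1 : k) ^ ((d - 1) * (a + b)) • y ⊗ₜ y' :=
    sgn_of_mem _ (tmul_mem_tensorDeg _ _ rfl hy hy') _
  have h₁ := lift_map_curryLin B.br f.1 g.1 (q + d - 1) hy hy' (V.comul v)
  have h₂ := lift_map_curryLin B.mul f.1 g.1 q hy hy' (V.cobr v)
  simp only [LinearMap.add_apply, LinearMap.smul_apply, LinearMap.comp_apply,
    LinearMap.flip_apply, TensorProduct.mk_apply, hs, map_smul]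
  rw [← h₁, ← h₂]
  change ((homAlg V B).br ((curry V.space S.space B.space f).1 (S.space.sgn (q + d - 1) y))
    ((curry V.space S.space B.space g).1 y')).1 v = _
  rw [sgn_of_mem _ hy, map_smul, map_smul]
  refine (congrArg (fun x : B.space => (-1 : k) ^ ((q + d - 1) * a) • x)
    (convBr_apply V.toCoalgData B _ hg' v)).trans ?_
  simp only [smul_add]
  rw [show q + d - 1 + b = b + q + d - 1 by ring, add_comm q b]
  simp only [neg_one_zpow_smul_smul]
  congr 1
  exact neg_one_zpow_smul_congr _ (by push_cast; grind)

theorem curry_mul : curry V.space S.space B.space ((homAlg (V.tensor S) B).mul f g) =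
    (homAlg S (homAlg V B)).mul (curry V.space S.space B.space f)
      (curry V.space S.space B.space g) := by
  refine curry_ext fun i j s hs v hv => ?_
  have h₁ := convMul_apply S.toCoalgData (homAlg V B) (curry V.space S.space B.space f).1
    (show IsHomogeneous S.space (homAlg V B).space (curry V.space S.space B.space g).1 q from
      curry_deg q g hg) s
  change convMul (V.tensor S).toCoalgData B f.1 g.1 (swap S.space V.space (s ⊗ₜ v)) =
    (convMul S.toCoalgData (homAlg V B) (curry V.space S.space B.space f).1
      (curry V.space S.space B.space g).1 s).1 v
  have hg' : IsHomogeneous (V.tensor S).space B.space g.1 q := hg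
  rw [h₁, lift_homAlg_mul hg, convMul_apply _ B f.1 hg']
  have h₂ := swap_map S.comul_deg V.comul_deg (s ⊗ₜ v)
  rw [TensorProduct.map_tmul] at h₂
  rw [h₂]
  rfl

/-- Both sides have three parts: the bracket of `B` with the two coproducts, the product of `B` with
the cobracket of `V`, and the product of `B` with the cobracket of `S`. On the right the first two
come from the inner bracket (`lift_homAlg_br`) and the third from the outer one. -/
theorem curry_br : curry V.space S.space B.space ((homAlg (V.tensor S) B).br f g) =
    (homAlg S (homAlg V B)).br (curry V.space S.space B.space f)
      (curry V.space S.space B.space g) := by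
  refine curry_ext fun i j s hs v hv => ?_
  have h₁ := convBr_apply S.toCoalgData (homAlg V B) (curry V.space S.space B.space f).1
    (show IsHomogeneous S.space (homAlg V B).space (curry V.space S.space B.space g).1 q from
      curry_deg q g hg) s
  change convBr (V.tensor S).toCoalgData B f.1 g.1 (swap S.space V.space (s ⊗ₜ v)) =
    (convBr S.toCoalgData (homAlg V B) (curry V.space S.space B.space f).1
      (curry V.space S.space B.space g).1 s).1 v
  have h₂ := swap_map S.comul_deg V.comul_deg (s ⊗ₜ v)
  rw [TensorProduct.map_tmul] at h₂
  -- The two summands of the cobracket of `V ⊗ S` are matched separately. The sign operator of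
  -- weight `d - 1` is the Koszul sign of the cobracket passing the other factor.
  have h₃ : TensorProduct.map V.cobr S.comul (swap S.space V.space (s ⊗ₜ v)) =
      swap (S.space.tensor S.space) (V.space.tensor V.space)
        ((S.space.tensor S.space).sgn (d - 1) (S.comul s) ⊗ₜ V.cobr v) := by
    have hs' := S.comul_deg i s hs
    rw [add_zero] at hs'
    rw [swap_of_mem_mem _ _ hs hv, sgn_of_mem _ hs', ← TensorProduct.smul_tmul', map_smul,
      map_smul, swap_of_mem_mem _ _ hs' (V.cobr_deg j v hv), neg_one_zpow_smul_smul,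
      TensorProduct.map_tmul]
    exact neg_one_zpow_smul_congr _ (by push_cast; grind)
  have h₄ : TensorProduct.map (V.comul ∘ₗ V.space.sgn (d - 1)) S.cobr
      (swap S.space V.space (s ⊗ₜ v)) =
      swap (S.space.tensor S.space) (V.space.tensor V.space) (S.cobr s ⊗ₜ V.comul v) := by
    have hv' := V.comul_deg j v hv
    rw [add_zero] at hv'
    rw [swap_of_mem_mem _ _ hs hv, map_smul, swap_of_mem_mem _ _ (S.cobr_deg i s hs) hv',
      TensorProduct.map_tmul, LinearMap.comp_apply, sgn_of_mem _ hv, map_smul,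
      ← TensorProduct.smul_tmul', neg_one_zpow_smul_smul]
    exact neg_one_zpow_smul_congr _ (by push_cast; grind)
  rw [h₁]
  refine Eq.trans ?_ (congrArg₂ (· + ·) (lift_homAlg_br hg (S.comul s) v).symm
    (congrArg (fun x => (-1 : k) ^ ((d - 1) * q) • x) (lift_homAlg_mul hg (S.cobr s) v).symm))
  have hg' : IsHomogeneous (V.tensor S).space B.space g.1 q := hg
  rw [convBr_apply _ B f.1 hg', h₂, ← h₃, ← h₄, add_assoc, ← smul_add, ← map_add, ← map_add,
    ← map_add]
  rfl

omit hg in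
include hf in
theorem curry_diff : curry V.space S.space B.space ((homAlg (V.tensor S) B).diff f) =
    (homAlg S (homAlg V B)).diff (curry V.space S.space B.space f) := by
  refine curry_ext fun i j s hs v hv => ?_
  have hf' : IsHomogeneous (V.tensor S).space B.space f.1 p := hf
  have hc : IsHomogeneous S.space (homAlg V B).space (curry V.space S.space B.space f).1 p :=
    curry_deg p f hf
  have h₁ := LinearMap.congr_fun (homDiff_of_mem (D := S.diff) (E := (homAlg V B).diff) hc) s
  have h₂ := LinearMap.congr_fun (homDiff_of_mem (D := V.diff) (E := B.diff)
    (isHomogeneous_curryLin_apply hf' hs)) v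
  change homDiff (V.tensor S).diff B.diff f.1 (swap S.space V.space (s ⊗ₜ v)) =
    (homDiff S.diff (homAlg V B).diff (curry V.space S.space B.space f).1 s).1 v
  rw [h₁, homDiff_of_mem hf']
  refine Eq.trans ?_ (congrArg (fun x : B.space => x - (-1 : k) ^ p •
    curryLin V.space S.space B.space f.1 (S.diff s) v) h₂.symm)
  simp only [LinearMap.sub_apply, LinearMap.smul_apply, LinearMap.comp_apply,
    swap_of_mem_mem _ _ hs hv, map_smul, tensorDiff_tmul, curryLin_of_mem _ hv hs,
    curryLin_of_mem _ (V.diff_deg j v hv) hs, curryLin_of_mem _ hv (S.diff_deg i s hs), map_add,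
    smul_add, sgn_of_mem _ hv, ← TensorProduct.smul_tmul', neg_one_zpow_smul_smul, sub_sub,
    smul_sub]
  congr 1
  congr 1
  · exact neg_one_zpow_smul_congr _ (by push_cast; grind)
  · exact neg_one_zpow_smul_congr _ (by push_cast; grind)

end

theorem DGAlgData.IsDAlgebra.of_injective {A A' : DGAlgData k d} (hA : A'.IsDAlgebra)
    {T : A.space →ₗ[k] A'.space} (hi : Function.Injective T)
    (hT : ∀ n, ∀ x ∈ A.space.deg n, T x ∈ A'.space.deg n)
    (hd : ∀ x, T (A.diff x) = A'.diff (T x)) (hm : ∀ x y, T (A.mul x y) = A'.mul (T x) (T y))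
    (hb : ∀ x y, T (A.br x y) = A'.br (T x) (T y)) : A.IsDAlgebra where
  diff_diff x := hi (by rw [hd, hd, hA.diff_diff, map_zero])
  mul_comm i j x hx y hy := hi (by
    rw [map_smul, hm, hm]; exact hA.mul_comm i j _ (hT i x hx) _ (hT j y hy))
  mul_assoc x y z := hi (by rw [hm, hm, hm, hm, hA.mul_assoc])
  diff_mul i x hx y := hi (by
    rw [map_add, map_smul, hd, hm, hm, hm, hd, hd]; exact hA.diff_mul i _ (hT i x hx) _)
  br_skew i j x hx y hy := hi (by
    rw [map_smul, hb, hb]; exact hA.br_skew i j _ (hT i x hx) _ (hT j y hy))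
  jacobi i j x hx y hy z := hi (by
    rw [map_add, map_smul, hb, hb, hb, hb, hb, hb]
    exact hA.jacobi i j _ (hT i x hx) _ (hT j y hy) _)
  diff_br i x hx y := hi (by
    rw [map_add, map_smul, hd, hb, hb, hb, hd, hd]; exact hA.diff_br i _ (hT i x hx) _)
  leibniz x i y hy j z hz := hi (by
    rw [map_add, map_smul, hb, hm, hm, hm, hb, hb]
    exact hA.leibniz _ i _ (hT i y hy) j _ (hT j z hz))

section
variable {V S : DGCoalgData k d} {B : DGAlgData k d}

theorem curry_homAlg_mul (f g : (homAlg (V.tensor S) B).space) :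
    curry V.space S.space B.space ((homAlg (V.tensor S) B).mul f g) =
      (homAlg S (homAlg V B)).mul (curry V.space S.space B.space f)
        (curry V.space S.space B.space g) :=
  (homAlg (V.tensor S) B).space.induction g (by simp)
    (fun x y hx hy => by simp only [map_add, hx, hy]) fun _ _ hg => curry_mul hg

theorem curry_homAlg_br (f g : (homAlg (V.tensor S) B).space) :
    curry V.space S.space B.space ((homAlg (V.tensor S) B).br f g) =
      (homAlg S (homAlg V B)).br (curry V.space S.space B.space f)
        (curry V.space S.space B.space g) :=
  (homAlg (V.tensor S) B).space.induction g (by simp)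
    (fun x y hx hy => by simp only [map_add, hx, hy]) fun _ _ hg => curry_br hg

theorem curry_homAlg_diff (f : (homAlg (V.tensor S) B).space) :
    curry V.space S.space B.space ((homAlg (V.tensor S) B).diff f) =
      (homAlg S (homAlg V B)).diff (curry V.space S.space B.space f) :=
  (homAlg (V.tensor S) B).space.induction f (by simp)
    (fun x y hx hy => by simp only [map_add, hx, hy]) fun _ _ hf => curry_diff hf

/-- Does not presuppose that `V ⊗ S` is a `d`-coalgebra: the convolution algebra is embedded by
currying into `Hom(S, Hom(V, B))`, where `isDAlgebra_homAlg` applies twice. With `B = k` this is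
what proves the identities of `V ⊗ S`. -/
theorem isDAlgebra_homAlg_tensor (hV : V.IsDCoalgebra) (hS : S.IsDCoalgebra) (hB : B.IsDAlgebra) :
    (homAlg (V.tensor S) B).IsDAlgebra :=
  (isDAlgebra_homAlg hS (isDAlgebra_homAlg hV hB)).of_injective curry_injective curry_deg
    curry_homAlg_diff curry_homAlg_mul curry_homAlg_br

theorem isMaurerCartan_curry {f : (homAlg (V.tensor S) B).space} :
    (homAlg S (homAlg V B)).IsMaurerCartan (curry V.space S.space B.space f) ↔
      (homAlg (V.tensor S) B).IsMaurerCartan f := by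
  have key : curry V.space S.space B.space
      ((homAlg (V.tensor S) B).diff f + (2 : k)⁻¹ • (homAlg (V.tensor S) B).br f f) =
      (homAlg S (homAlg V B)).diff (curry V.space S.space B.space f) + (2 : k)⁻¹ •
        (homAlg S (homAlg V B)).br (curry V.space S.space B.space f)
          (curry V.space S.space B.space f) := by
    rw [map_add, map_smul, curry_homAlg_diff, curry_homAlg_br]
  refine ⟨fun h => ⟨?_, curry_injective ?_⟩, fun h => ⟨curry_deg d f h.1, ?_⟩⟩
  -- The degree of `f` is recovered from the degree of its curried form by choosing a homogeneous
  -- preimage, which equals `f` by injectivity.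
  · obtain ⟨f', hf', e⟩ := exists_curry_eq _ h.1
    rwa [curry_injective e] at hf'
  · rw [key, map_zero]
    exact h.2
  · rw [← key, h.2, map_zero]

end

end

end DAlgebras

namespace DAlgebras

noncomputable section

open GradedSpace

variable {k : Type u} [Field k] {d : ℤ}

/-! ### Separating families of functionals -/

/-- The tensor product of two functionals. -/
def pairing {M N : Type u} [AddCommGroup M] [Module k M] [AddCommGroup N] [Module k N]
    (f : M →ₗ[k] k) (g : N →ₗ[k] k) : M ⊗[k] N →ₗ[k] k :=
  TensorProduct.lift (LinearMap.mul k k) ∘ₗ TensorProduct.map f g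

theorem pairing_tmul {M N : Type u} [AddCommGroup M] [Module k M] [AddCommGroup N] [Module k N]
    (f : M →ₗ[k] k) (g : N →ₗ[k] k) (x : M) (y : N) : pairing f g (x ⊗ₜ y) = f x * g y := rfl

/-- The functionals in `P` separate points. -/
def Separates {M : Type u} [AddCommGroup M] [Module k M] (P : Set (M →ₗ[k] k)) : Prop :=
  ∀ x, (∀ f ∈ P, f x = 0) → x = 0

theorem Separates.pairing {M N : Type u} [AddCommGroup M] [Module k M] [AddCommGroup N] [Module k N]
    {P : Set (M →ₗ[k] k)} {Q : Set (N →ₗ[k] k)} (hP : Separates P) (hQ : Separates Q)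
    {t : M ⊗[k] N} (h : ∀ f ∈ P, ∀ g ∈ Q, pairing f g t = 0) : t = 0 := by
  have hl : ∀ (f : M →ₗ[k] k) (g : N →ₗ[k] k) (t : M ⊗[k] N), DAlgebras.pairing f g t =
      f (TensorProduct.rid k M (g.lTensor M t)) := by
    intro f g t
    induction t using TensorProduct.induction_on with
    | zero => simp
    | tmul x y => simp [pairing_tmul, mul_comm]
    | add a b ha hb => simp only [map_add, ha, hb]
  have hr : ∀ (f : M →ₗ[k] k) (g : N →ₗ[k] k) (t : M ⊗[k] N), DAlgebras.pairing f g t =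
      g (TensorProduct.lid k N (f.rTensor N t)) := by
    intro f g t
    induction t using TensorProduct.induction_on with
    | zero => simp
    | tmul x y => simp [pairing_tmul]
    | add a b ha hb => simp only [map_add, ha, hb]
  -- Contracting the second factor with `g` leaves an element of `M` that `P` detects. Exchanging
  -- roles shows that contraction of the first factor with any functional vanishes, not only with
  -- those in `P`; coordinate functionals of a basis then give `t = 0`.
  have h₁ : ∀ g ∈ Q, TensorProduct.rid k M (g.lTensor M t) = 0 := fun g hg =>
    hP _ fun f hf => by rw [← hl]; exact h f hf g hg
  have h₂ : ∀ f : M →ₗ[k] k, TensorProduct.lid k N (f.rTensor N t) = 0 := fun f =>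
    hQ _ fun g hg => by rw [← hr, hl, h₁ g hg, map_zero]
  let b := Module.Free.chooseBasis k M
  refine (TensorProduct.equivFinsuppOfBasisLeft b).map_eq_zero_iff.1 (Finsupp.ext fun i => ?_)
  rw [TensorProduct.equivFinsuppOfBasisLeft_apply]
  exact h₂ (b.coord i)

/-- The homogeneous functionals on a graded space. -/
def homFunctionals (X : GradedSpace k) : Set (X →ₗ[k] k) :=
  {f | ∃ p, IsHomogeneous X (GradedSpace.unit k) f p}

theorem separates_homFunctionals (X : GradedSpace k) : Separates (homFunctionals X) := by
  intro x hx
  have h : ∀ i, X.proj i x = 0 := fun i => by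
    refine (Module.forall_dual_apply_eq_zero_iff k _).1 fun f => ?_
    -- A functional supported in degree `i` is homogeneous of degree `-i`, as `k` lives in degree
    -- `0`.
    refine hx (f ∘ₗ X.proj i) ⟨-i, fun j y hy => ?_⟩
    rw [LinearMap.comp_apply, proj_of_mem X hy]
    split_ifs with hji
    · rw [hji, add_neg_cancel]
      simp
    · rw [map_zero]
      exact zero_mem _
  obtain ⟨s, hs⟩ := X.exists_sum_proj x
  rw [← hs]
  exact Finset.sum_eq_zero fun i _ => h i

section
variable {X : GradedSpace k} {f g h : X →ₗ[k] k} {p q r : ℤ}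

theorem functional_eq_zero (hf : IsHomogeneous X (GradedSpace.unit k) f p) {i : ℤ} {x : X}
    (hx : x ∈ X.deg i) : i = -p ∨ f x = 0 := by
  have := hf i x hx
  by_cases hi : i + p = 0
  · exact Or.inl (by omega)
  · exact Or.inr (by simpa [hi] using this)

theorem pairing_congr {t t' : X ⊗[k] X} (h : ∀ (f g : X →ₗ[k] k) (p q : ℤ),
    IsHomogeneous X (GradedSpace.unit k) f p → IsHomogeneous X (GradedSpace.unit k) g q →
      pairing f g t = pairing f g t') : t = t' := by
  refine sub_eq_zero.1 ((separates_homFunctionals X).pairing (separates_homFunctionals X) ?_)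
  rintro f ⟨p, hf⟩ g ⟨q, hg⟩
  rw [map_sub, h f g p q hf hg, sub_self]

theorem pairing_congr₃ {t t' : (X ⊗[k] X) ⊗[k] X} (h : ∀ (f g h : X →ₗ[k] k) (p q r : ℤ),
    IsHomogeneous X (GradedSpace.unit k) f p → IsHomogeneous X (GradedSpace.unit k) g q →
    IsHomogeneous X (GradedSpace.unit k) h r →
      pairing (pairing f g) h t = pairing (pairing f g) h t') : t = t' := by
  have hs : Separates {F | ∃ f ∈ homFunctionals X, ∃ g ∈ homFunctionals X, F = pairing f g} :=
    fun x hx => (separates_homFunctionals X).pairing (separates_homFunctionals X)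
      fun f hf g hg => hx _ ⟨f, hf, g, hg, rfl⟩
  refine sub_eq_zero.1 (hs.pairing (separates_homFunctionals X) ?_)
  rintro _ ⟨f, ⟨p, hf⟩, g, ⟨q, hg⟩, rfl⟩ h' ⟨r, hh⟩
  rw [map_sub, h f g h' p q r hf hg hh, sub_self]

theorem pairing_rTensor (D : X →ₗ[k] X ⊗[k] X) (t : X ⊗[k] X) :
    pairing (pairing f g) h (D.rTensor X t) = pairing (pairing f g ∘ₗ D) h t := by
  induction t using TensorProduct.induction_on with
  | zero => simp
  | tmul x y => rfl
  | add a b ha hb => simp only [map_add, ha, hb]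

theorem pairing_assoc_symm (D : X →ₗ[k] X ⊗[k] X) (E : X →ₗ[k] X) (t : X ⊗[k] X) :
    pairing (pairing f g) h ((TensorProduct.assoc k X X X).symm (TensorProduct.map E D t)) =
      pairing (f ∘ₗ E) (pairing g h ∘ₗ D) t := by
  induction t using TensorProduct.induction_on with
  | zero => simp
  | tmul x y =>
    rw [TensorProduct.map_tmul, pairing_tmul, LinearMap.comp_apply, LinearMap.comp_apply]
    generalize D y = s
    induction s using TensorProduct.induction_on with
    | zero => simp
    | tmul y z =>
      rw [TensorProduct.assoc_symm_tmul, pairing_tmul, pairing_tmul, pairing_tmul, mul_assoc]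
    | add a b ha hb => simp only [map_add, TensorProduct.tmul_add, ha, hb, mul_add]
  | add a b ha hb => simp only [map_add, ha, hb]

/-- A functional of degree `p` is supported in degree `-p`, where the sign operator is a scalar. -/
theorem functional_comp_sgn (hf : IsHomogeneous X (GradedSpace.unit k) f p) (n : ℤ) :
    f ∘ₗ X.sgn n = (-1 : k) ^ (n * p) • f := X.hom_ext fun i x hx => by
  rw [LinearMap.comp_apply, sgn_of_mem _ hx, map_smul, LinearMap.smul_apply]
  rcases functional_eq_zero hf hx with rfl | h
  · exact neg_one_zpow_smul_congr _ (by push_cast; grind)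
  · rw [h, smul_zero, smul_zero]

theorem pairing_smul_left (c : k) (t : X ⊗[k] X) : pairing (c • f) g t = c • pairing f g t := by
  rw [pairing, TensorProduct.map_smul_left, LinearMap.comp_smul]; rfl

theorem pairing_swap (hf : IsHomogeneous X (GradedSpace.unit k) f p)
    (hg : IsHomogeneous X (GradedSpace.unit k) g q) (t : X ⊗[k] X) :
    pairing f g (swap X X t) = (-1 : k) ^ (p * q) • pairing g f t := by
  suffices e : pairing f g ∘ₗ swap X X = (-1 : k) ^ (p * q) • pairing g f from
    LinearMap.congr_fun e t
  refine tensor_hom_ext X X fun i j x hx y hy => ?_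
  rw [LinearMap.comp_apply, swap_of_mem_mem _ _ hx hy, map_smul, LinearMap.smul_apply,
    pairing_tmul, pairing_tmul, mul_comm (f y)]
  rcases functional_eq_zero hg hx with rfl | h
  · rcases functional_eq_zero hf hy with rfl | h
    · exact neg_one_zpow_smul_congr _ (by push_cast; grind)
    · rw [h, mul_zero, smul_zero, smul_zero]
  · rw [h, zero_mul, smul_zero, smul_zero]

theorem pairing_swapRight (hg : IsHomogeneous X (GradedSpace.unit k) g q)
    (hh : IsHomogeneous X (GradedSpace.unit k) h r) (t : (X ⊗[k] X) ⊗[k] X) :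
    pairing (pairing f g) h (swapRight X t) =
      (-1 : k) ^ (q * r) • pairing (pairing f h) g t := by
  suffices e : pairing (pairing f g) h ∘ₗ swapRight X =
    (-1 : k) ^ (q * r) • pairing (pairing f h) g from LinearMap.congr_fun e t
  refine tensor_hom_ext₃ X X X fun a b c x hx y hy z hz => ?_
  rw [LinearMap.comp_apply, swapRight_of_mem _ _ hy hz, map_smul, LinearMap.smul_apply,
    pairing_tmul, pairing_tmul, pairing_tmul, pairing_tmul, mul_right_comm]
  rcases functional_eq_zero hh hy with rfl | h'
  · rcases functional_eq_zero hg hz with rfl | h'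
    · exact neg_one_zpow_smul_congr _ (by push_cast; grind)
    · rw [h', mul_zero, smul_zero, smul_zero]
  · rw [h', mul_zero, zero_mul, smul_zero, smul_zero]

theorem pairing_cyc (hf : IsHomogeneous X (GradedSpace.unit k) f p)
    (hg : IsHomogeneous X (GradedSpace.unit k) g q)
    (hh : IsHomogeneous X (GradedSpace.unit k) h r) (t : (X ⊗[k] X) ⊗[k] X) :
    pairing (pairing f g) h (cyc X t) =
      (-1 : k) ^ (p * (q + r)) • pairing (pairing g h) f t := by
  suffices e : pairing (pairing f g) h ∘ₗ cyc X =
    (-1 : k) ^ (p * (q + r)) • pairing (pairing g h) f from LinearMap.congr_fun e t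
  refine tensor_hom_ext₃ X X X fun a b c x hx y hy z hz => ?_
  rw [LinearMap.comp_apply, cyc_of_mem _ hx hy hz, map_smul, LinearMap.smul_apply,
    pairing_tmul, pairing_tmul, pairing_tmul, pairing_tmul, mul_assoc, mul_comm (f z)]
  rcases functional_eq_zero hg hx with rfl | h'
  · rcases functional_eq_zero hh hy with rfl | h'
    · rcases functional_eq_zero hf hz with rfl | h'
      · exact neg_one_zpow_smul_congr _ (by push_cast; grind)
      · rw [h', mul_zero, smul_zero, smul_zero]
    · rw [h', mul_zero, zero_mul, smul_zero, smul_zero]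
  · rw [h', zero_mul, zero_mul, smul_zero, smul_zero]

end

/-! ### The dual algebra of a coalgebra -/

/-- The field `k`, as a `d`-algebra with the zero bracket. -/
@[reducible] def scalarAlg (k : Type u) [Field k] (d : ℤ) : DGAlgData k d where
  space := GradedSpace.unit k
  diff := 0
  mul := LinearMap.mul k k
  br := 0
  diff_deg _ _ _ := zero_mem _
  mul_deg i j x hx y hy := by
    by_cases hi : i = 0
    · by_cases hj : j = 0
      · simp [hi, hj]
      · have : y = 0 := by simpa [hj] using hy
        rw [this, map_zero]
        exact zero_mem _
    · have : x = 0 := by simpa [hi] using hx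
      rw [this, map_zero]
      exact zero_mem _
  br_deg _ _ _ _ _ _ := zero_mem _

theorem isDAlgebra_scalarAlg : (scalarAlg k d).IsDAlgebra where
  diff_diff _ := rfl
  mul_comm i j x hx y hy := by
    change x * y = (-1 : k) ^ (i * j) * (y * x)
    by_cases hi : i = 0
    · rw [hi, zero_mul, zpow_zero, one_mul, mul_comm]
    · have : x = 0 := by simpa [hi] using hx
      rw [this, zero_mul, mul_zero, mul_zero]
  mul_assoc x y z := mul_assoc (x : k) y z
  diff_mul i x hx y := by simp
  br_skew i j x hx y hy := by simp
  jacobi i j x hx y hy z := by simp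
  diff_br i x hx y := by simp
  leibniz x i y hy j z hz := by simp

section
variable {C : CoalgData k d} {f g : C.space →ₗ[k] k} {p q : ℤ}
  (hf : IsHomogeneous C.space (GradedSpace.unit k) f p)
  (hg : IsHomogeneous C.space (GradedSpace.unit k) g q)
include hf hg

/-- Up to a sign, pairing with the coproduct is the convolution product of functionals. This
dictionary, with its analogue for the cobracket, translates identities of the dual algebra into
identities of the coalgebra. -/
theorem pairing_comp_comul : pairing f g ∘ₗ C.comul =
    (-1 : k) ^ (p * q) • convMul C (scalarAlg k d) f g := LinearMap.ext fun x => by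
  rw [LinearMap.smul_apply, convMul_apply C (scalarAlg k d) f hg, functional_comp_sgn hf]
  change _ = (-1 : k) ^ (p * q) • pairing ((-1 : k) ^ (q * p) • f) g (C.comul x)
  rw [pairing_smul_left, neg_one_zpow_smul_smul, Even.neg_one_zpow ⟨p * q, by ring⟩, one_smul]
  rfl

theorem pairing_comp_cobr : pairing f g ∘ₗ C.cobr =
    (-1 : k) ^ ((d - 1) * q + p * q) • convBr C (scalarAlg k d) f g := LinearMap.ext fun x => by
  rw [LinearMap.smul_apply, convBr_apply C (scalarAlg k d) f hg, functional_comp_sgn hf q]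
  have h : TensorProduct.lift (scalarAlg k d).br = 0 := TensorProduct.ext' fun _ _ => rfl
  rw [h, LinearMap.zero_apply, zero_add]
  change _ = (-1 : k) ^ ((d - 1) * q + p * q) • (-1 : k) ^ ((d - 1) * q) •
    pairing ((-1 : k) ^ (q * p) • f) g (C.cobr x)
  rw [pairing_smul_left, neg_one_zpow_smul_smul, neg_one_zpow_smul_smul,
    Even.neg_one_zpow ⟨p * q + (d - 1) * q, by ring⟩, one_smul]
  rfl

theorem isHomogeneous_pairing_comul :
    IsHomogeneous C.space (GradedSpace.unit k) (pairing f g ∘ₗ C.comul) (p + q) := by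
  rw [pairing_comp_comul hf hg]
  exact (isHomogeneous_convMul C (scalarAlg k d) hf hg).smul _

theorem isHomogeneous_pairing_cobr :
    IsHomogeneous C.space (GradedSpace.unit k) (pairing f g ∘ₗ C.cobr) (p + q + (1 - d)) := by
  rw [pairing_comp_cobr hf hg]
  exact (isHomogeneous_convBr C (scalarAlg k d) hf hg).smul _

end

section
variable {X : GradedSpace k} {f g : X →ₗ[k] k} {p : ℤ}

theorem pairing_tensorDiff (hf : IsHomogeneous X (GradedSpace.unit k) f p) (D : X →ₗ[k] X)
    (t : X ⊗[k] X) : pairing f g (tensorDiff X X D D t) =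
      pairing (f ∘ₗ D) g t + (-1 : k) ^ p • pairing f (g ∘ₗ D) t := by
  have h := functional_comp_sgn hf 1
  rw [one_mul] at h
  rw [← pairing_smul_left, ← h]
  induction t using TensorProduct.induction_on with
  | zero => simp
  | tmul x y => rw [tensorDiff_tmul, map_add]; rfl
  | add a b ha hb => simp only [map_add, ha, hb]; abel

end

/-- The Jacobi identity in cyclic form, which is the form dual to the co-Jacobi identity written
with `cyc`. -/
theorem DGAlgData.IsDAlgebra.br_br_cyclic {A : DGAlgData k d} (hA : A.IsDAlgebra) {p q r : ℤ}
    {x y z : A.space} (hx : x ∈ A.space.deg p) (hy : y ∈ A.space.deg q) (hz : z ∈ A.space.deg r) :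
    A.br (A.br x y) z + (-1 : k) ^ ((p + d - 1) * (q + r)) • A.br (A.br y z) x +
      (-1 : k) ^ ((p + d - 1) * (q + r) + (q + d - 1) * (r + p)) • A.br (A.br z x) y = 0 := by
  have h₁ := hA.br_skew p _ x hx _ (A.br_deg q r y hy z hz)
  have h₂ := hA.br_skew q _ y hy _ (A.br_deg p r x hx z hz)
  have h₃ := hA.jacobi p q x hx y hy z
  rw [h₁, h₂, hA.br_skew p r x hx z hz, map_smul, LinearMap.smul_apply] at h₃
  rw [← sub_eq_zero] at h₃
  rw [← neg_eq_zero, ← h₃]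
  simp only [neg_smul, smul_neg, neg_neg, neg_one_zpow_smul_smul]
  rw [neg_add, neg_add, add_comm (-_) (-_), add_assoc]
  refine Eq.trans ?_ (((congrArg _ (neg_add _ _)).symm).trans (sub_eq_add_neg _ _).symm)
  refine congrArg₂ (· + ·) ?_ (congrArg₂ (· + ·) rfl ?_)
  · exact congrArg Neg.neg (neg_one_zpow_smul_congr _ (by clear * -; push_cast; grind))
  · exact congrArg Neg.neg (neg_one_zpow_smul_congr _ (by clear * -; push_cast; grind))

/-! ### Identities of the dual algebra, read on the coalgebra -/

section
variable {Z : DGCoalgData k d} {f : Z.space →ₗ[k] k} {p : ℤ}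
  (hf : IsHomogeneous Z.space (GradedSpace.unit k) f p)
include hf

theorem comp_diff : IsHomogeneous Z.space (GradedSpace.unit k) (f ∘ₗ Z.diff) (1 + p) :=
  hf.comp Z.diff_deg

theorem homDiff_scalarAlg :
    homDiff Z.diff (scalarAlg k d).diff f = (-1 : k) ^ (p + 1) • f ∘ₗ Z.diff := by
  refine (homDiff_of_mem (E := (scalarAlg k d).diff) hf).trans ?_
  change 0 - (-1 : k) ^ p • (f ∘ₗ Z.diff) = _
  rw [neg_one_zpow_eq_neg (m := p + 1) (n := p) (by push_cast; rfl)]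
  exact (zero_sub _).trans (neg_smul _ _).symm

end

section
variable {Z : DGCoalgData k d} (hA : (homAlg Z (scalarAlg k d)).IsDAlgebra)
  {f g h : Z.space →ₗ[k] k} {p q r : ℤ}
  (hf : IsHomogeneous Z.space (GradedSpace.unit k) f p)
  (hg : IsHomogeneous Z.space (GradedSpace.unit k) g q)
  (hh : IsHomogeneous Z.space (GradedSpace.unit k) h r)
include hA hf hg

theorem pairing_comul_comm : pairing f g ∘ₗ Z.comul =
    (-1 : k) ^ (p * q) • pairing g f ∘ₗ Z.comul := by
  have e : convMul Z.toCoalgData (scalarAlg k d) f g =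
      (-1 : k) ^ (p * q) • convMul Z.toCoalgData (scalarAlg k d) g f :=
    congrArg Subtype.val (hA.mul_comm p q ⟨f, Submodule.mem_iSup_of_mem p hf⟩ hf
      ⟨g, Submodule.mem_iSup_of_mem q hg⟩ hg)
  rw [pairing_comp_comul hf hg, pairing_comp_comul hg hf, e, neg_one_zpow_smul_smul,
    neg_one_zpow_smul_smul]
  exact neg_one_zpow_smul_congr _ (by clear * -; push_cast; grind)

theorem pairing_cobr_skew : pairing f g ∘ₗ Z.cobr =
    (-1 : k) ^ (p * q + d) • pairing g f ∘ₗ Z.cobr := by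
  have e : convBr Z.toCoalgData (scalarAlg k d) f g =
      -(-1 : k) ^ ((p + d - 1) * (q + d - 1)) • convBr Z.toCoalgData (scalarAlg k d) g f :=
    congrArg Subtype.val (hA.br_skew p q ⟨f, Submodule.mem_iSup_of_mem p hf⟩ hf
      ⟨g, Submodule.mem_iSup_of_mem q hg⟩ hg)
  rw [← neg_one_zpow_eq_neg (n := (p + d - 1) * (q + d - 1)) (m := (p + d - 1) * (q + d - 1) + 1)
    (by clear * -; push_cast; grind)] at e
  rw [pairing_comp_cobr hf hg, pairing_comp_cobr hg hf, e, neg_one_zpow_smul_smul,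
    neg_one_zpow_smul_smul]
  have hd := mul_self_of_zmod_two d
  exact neg_one_zpow_smul_congr _ (by clear * - hd; push_cast; grind)

theorem pairing_comul_diff : pairing f g ∘ₗ Z.comul ∘ₗ Z.diff =
    pairing (f ∘ₗ Z.diff) g ∘ₗ Z.comul + (-1 : k) ^ p • pairing f (g ∘ₗ Z.diff) ∘ₗ Z.comul := by
  have e : homDiff Z.diff (scalarAlg k d).diff (convMul Z.toCoalgData (scalarAlg k d) f g) =
      convMul Z.toCoalgData (scalarAlg k d) (homDiff Z.diff (scalarAlg k d).diff f) g +
      (-1 : k) ^ p • convMul Z.toCoalgData (scalarAlg k d) f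
        (homDiff Z.diff (scalarAlg k d).diff g) :=
    congrArg Subtype.val (hA.diff_mul p ⟨f, Submodule.mem_iSup_of_mem p hf⟩ hf
      ⟨g, Submodule.mem_iSup_of_mem q hg⟩)
  rw [homDiff_scalarAlg hf, homDiff_scalarAlg hg, homDiff_scalarAlg (isHomogeneous_convMul Z.toCoalgData (scalarAlg k d) hf hg)] at e
  have e' := congrArg (fun F : Z.space →ₗ[k] k => (-1 : k) ^ (p + q + 1 + p * q) • F) e
  rw [← LinearMap.comp_assoc, pairing_comp_comul hf hg,
    pairing_comp_comul (comp_diff hf) hg, pairing_comp_comul hf (comp_diff hg)]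
  simp only [map_smul, LinearMap.smul_apply, smul_add, neg_one_zpow_smul_smul,
    LinearMap.smul_comp] at e' ⊢
  refine Eq.trans (neg_one_zpow_smul_congr _ ?_) (e'.trans (congrArg₂ (· + ·)
    (neg_one_zpow_smul_congr _ ?_) (neg_one_zpow_smul_congr _ ?_)))
  · clear * -; push_cast; grind
  · clear * -; push_cast; grind
  · clear * -; push_cast; grind

theorem pairing_cobr_diff : pairing f g ∘ₗ Z.cobr ∘ₗ Z.diff =
    (-1 : k) ^ (d - 1) • (pairing (f ∘ₗ Z.diff) g ∘ₗ Z.cobr +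
      (-1 : k) ^ p • pairing f (g ∘ₗ Z.diff) ∘ₗ Z.cobr) := by
  have e : homDiff Z.diff (scalarAlg k d).diff (convBr Z.toCoalgData (scalarAlg k d) f g) =
      convBr Z.toCoalgData (scalarAlg k d) (homDiff Z.diff (scalarAlg k d).diff f) g +
      (-1 : k) ^ (p + d - 1) • convBr Z.toCoalgData (scalarAlg k d) f
        (homDiff Z.diff (scalarAlg k d).diff g) :=
    congrArg Subtype.val (hA.diff_br p ⟨f, Submodule.mem_iSup_of_mem p hf⟩ hf
      ⟨g, Submodule.mem_iSup_of_mem q hg⟩)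
  rw [homDiff_scalarAlg hf, homDiff_scalarAlg hg, homDiff_scalarAlg (isHomogeneous_convBr Z.toCoalgData (scalarAlg k d) hf hg)] at e
  have e' := congrArg (fun F : Z.space →ₗ[k] k =>
    (-1 : k) ^ (p + q + (1 - d) + 1 + ((d - 1) * q + p * q)) • F) e
  rw [← LinearMap.comp_assoc, pairing_comp_cobr hf hg,
    pairing_comp_cobr (comp_diff hf) hg, pairing_comp_cobr hf (comp_diff hg)]
  simp only [map_smul, LinearMap.smul_apply, smul_add, neg_one_zpow_smul_smul,
    LinearMap.smul_comp] at e' ⊢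
  refine Eq.trans (neg_one_zpow_smul_congr _ ?_) (e'.trans (congrArg₂ (· + ·)
    (neg_one_zpow_smul_congr _ ?_) (neg_one_zpow_smul_congr _ ?_)))
  · clear * -; push_cast; grind
  · clear * -; push_cast; grind
  · clear * -; push_cast; grind

include hh

theorem pairing_comul_assoc : pairing (pairing f g ∘ₗ Z.comul) h ∘ₗ Z.comul =
    pairing f (pairing g h ∘ₗ Z.comul) ∘ₗ Z.comul := by
  have e : convMul Z.toCoalgData (scalarAlg k d) (convMul Z.toCoalgData (scalarAlg k d) f g) h =
      convMul Z.toCoalgData (scalarAlg k d) f (convMul Z.toCoalgData (scalarAlg k d) g h) :=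
    congrArg Subtype.val (hA.mul_assoc ⟨f, Submodule.mem_iSup_of_mem p hf⟩
      ⟨g, Submodule.mem_iSup_of_mem q hg⟩ ⟨h, Submodule.mem_iSup_of_mem r hh⟩)
  rw [pairing_comp_comul (isHomogeneous_pairing_comul hf hg) hh,
    pairing_comp_comul hf (isHomogeneous_pairing_comul hg hh), pairing_comp_comul hf hg,
    pairing_comp_comul hg hh, map_smul, map_smul, LinearMap.smul_apply, e, neg_one_zpow_smul_smul,
    neg_one_zpow_smul_smul]
  exact neg_one_zpow_smul_congr _ (by clear * -; push_cast; grind)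

theorem pairing_comul_cobr : pairing (pairing f g ∘ₗ Z.comul) h ∘ₗ Z.cobr =
    (-1 : k) ^ ((d - 1) * p) • pairing f (pairing g h ∘ₗ Z.cobr) ∘ₗ Z.comul +
      (-1 : k) ^ (q * r) • pairing (pairing f h ∘ₗ Z.cobr) g ∘ₗ Z.comul := by
  have e : convBr Z.toCoalgData (scalarAlg k d) (convMul Z.toCoalgData (scalarAlg k d) f g) h =
      convMul Z.toCoalgData (scalarAlg k d) f (convBr Z.toCoalgData (scalarAlg k d) g h) +
      (-1 : k) ^ (q * (r + d - 1)) •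
      convMul Z.toCoalgData (scalarAlg k d) (convBr Z.toCoalgData (scalarAlg k d) f h) g :=
    congrArg Subtype.val (hA.leibniz ⟨f, Submodule.mem_iSup_of_mem p hf⟩
      q ⟨g, Submodule.mem_iSup_of_mem q hg⟩ hg r ⟨h, Submodule.mem_iSup_of_mem r hh⟩ hh)
  rw [pairing_comp_cobr (isHomogeneous_pairing_comul hf hg) hh,
    pairing_comp_comul hf (isHomogeneous_pairing_cobr hg hh),
    pairing_comp_comul (isHomogeneous_pairing_cobr hf hh) hg, pairing_comp_comul hf hg,
    pairing_comp_cobr hg hh, pairing_comp_cobr hf hh]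
  simp only [map_smul, LinearMap.smul_apply, e, neg_one_zpow_smul_smul, smul_add]
  congr 1 <;> exact neg_one_zpow_smul_congr _ (by clear * -; push_cast; grind)

theorem pairing_cobr_cobr : pairing (pairing f g ∘ₗ Z.cobr) h ∘ₗ Z.cobr +
    (-1 : k) ^ (p * (q + r)) • pairing (pairing g h ∘ₗ Z.cobr) f ∘ₗ Z.cobr +
    (-1 : k) ^ (p * (q + r) + q * (r + p)) • pairing (pairing h f ∘ₗ Z.cobr) g ∘ₗ Z.cobr = 0 := by
  have e : convBr Z.toCoalgData (scalarAlg k d) (convBr Z.toCoalgData (scalarAlg k d) f g) h +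
      (-1 : k) ^ ((p + d - 1) * (q + r)) •
        convBr Z.toCoalgData (scalarAlg k d) (convBr Z.toCoalgData (scalarAlg k d) g h) f +
      (-1 : k) ^ ((p + d - 1) * (q + r) + (q + d - 1) * (r + p)) •
        convBr Z.toCoalgData (scalarAlg k d) (convBr Z.toCoalgData (scalarAlg k d) h f) g = 0 :=
    congrArg Subtype.val (hA.br_br_cyclic (x := ⟨f, Submodule.mem_iSup_of_mem p hf⟩)
      (y := ⟨g, Submodule.mem_iSup_of_mem q hg⟩) (z := ⟨h, Submodule.mem_iSup_of_mem r hh⟩)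
      hf hg hh)
  have e' := congrArg (fun F : Z.space →ₗ[k] k =>
    (-1 : k) ^ ((d - 1) * r + (p + q + (1 - d)) * r + ((d - 1) * q + p * q)) • F) e
  rw [pairing_comp_cobr (isHomogeneous_pairing_cobr hf hg) hh,
    pairing_comp_cobr (isHomogeneous_pairing_cobr hg hh) hf,
    pairing_comp_cobr (isHomogeneous_pairing_cobr hh hf) hg, pairing_comp_cobr hf hg,
    pairing_comp_cobr hg hh, pairing_comp_cobr hh hf]
  simp only [map_smul, LinearMap.smul_apply, smul_add, neg_one_zpow_smul_smul, smul_zero] at e' ⊢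
  refine Eq.trans (congrArg₂ (· + ·) (congrArg₂ (· + ·) rfl (neg_one_zpow_smul_congr _ ?_))
    (neg_one_zpow_smul_congr _ ?_)) e'
  · clear * -; push_cast; grind
  · clear * -; push_cast; grind

end

/-- A coalgebra with counit is a `d`-coalgebra if its dual is a `d`-algebra. -/
theorem isDCoalgebra_of_isDAlgebra_homAlg {Z : DGCoalgData k d}
    (hA : (homAlg Z (scalarAlg k d)).IsDAlgebra)
    (h₁ : ∀ x, TensorProduct.lid k Z.space (Z.counit.rTensor Z.space (Z.comul x)) = x)
    (h₂ : ∀ x, TensorProduct.lid k Z.space (Z.counit.rTensor Z.space (Z.cobr x)) = 0)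
    (h₃ : ∀ x, Z.counit (Z.diff x) = 0) (h₄ : ∀ x, Z.diff (Z.diff x) = 0) : Z.IsDCoalgebra where
  -- A `d`-algebra has no unit, so its dual identities say nothing about the counit, whose
  -- properties are hypotheses here. The remaining identities in `laws` are equalities of tensors
  -- and are tested on products of homogeneous functionals.
  laws x :=
    { cocomm := pairing_congr fun f g p q hf hg => by
        rw [pairing_swap hf hg]
        exact (LinearMap.congr_fun (pairing_comul_comm hA hf hg) x).symm
      coassoc := by
        rw [← LinearEquiv.eq_symm_apply]
        refine pairing_congr₃ fun f g h p q r hf hg hh => ?_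
        rw [pairing_rTensor, LinearMap.lTensor, pairing_assoc_symm]
        exact LinearMap.congr_fun (pairing_comul_assoc hA hf hg hh) x
      counit_comul := h₁ x
      coskew := pairing_congr fun f g p q hf hg => by
        rw [pairing_swap hf hg, map_smul]
        have := LinearMap.congr_fun (pairing_cobr_skew hA hg hf) x
        change pairing g f (Z.cobr x) = (-1 : k) ^ (q * p + d) • pairing f g (Z.cobr x) at this
        rw [this, neg_one_zpow_smul_smul]
        exact neg_one_zpow_smul_congr _ (by clear * -; push_cast; grind)
      cojacobi := pairing_congr₃ fun f g h p q r hf hg hh => by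
        rw [map_add, map_add, pairing_cyc hf hg hh, pairing_cyc hf hg hh, pairing_cyc hg hh hf,
          pairing_rTensor, pairing_rTensor, pairing_rTensor, map_zero]
        rw [neg_one_zpow_smul_smul]
        exact LinearMap.congr_fun (pairing_cobr_cobr hA hf hg hh) x
      coleibniz := pairing_congr₃ fun f g h p q r hf hg hh => by
        rw [map_add, pairing_rTensor, pairing_assoc_symm, functional_comp_sgn hf,
          pairing_smul_left]
        refine (LinearMap.congr_fun (pairing_comul_cobr hA hf hg hh) x).trans ?_
        rw [LinearMap.add_apply]
        refine congrArg₂ (· + ·) rfl ?_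
        refine Eq.trans ?_ (pairing_swapRight hg hh _).symm
        rw [pairing_rTensor]
        rfl
      counit_cobr := h₂ x }
  coderivation :=
    { homogeneous := Z.diff_deg
      comul x := pairing_congr fun f g p q hf hg => by
        rw [pairing_tensorDiff hf]
        exact LinearMap.congr_fun (pairing_comul_diff hA hf hg) x
      counit := h₃
      cobr x := pairing_congr fun f g p q hf hg => by
        rw [map_smul, pairing_tensorDiff hf]
        exact LinearMap.congr_fun (pairing_cobr_diff hA hf hg) x }
  diff_diff := h₄

end

end DAlgebras

namespace DAlgebras

noncomputable section

open GradedSpace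

variable {k : Type u} [Field k] {d : ℤ}

open CoalgData

/-! ### Tensor products of coalgebras -/

namespace DGCoalgData

theorem middleSwap_tmul {X Y : GradedSpace k} {j : ℤ} (x : X) {x' : X} (hx' : x' ∈ X.deg j) (y y' : Y) :
    middleSwap X Y ((x ⊗ₜ x') ⊗ₜ (y ⊗ₜ y')) = (x ⊗ₜ Y.sgn j y) ⊗ₜ (x' ⊗ₜ y') := by
  simp only [middleSwap, LinearMap.comp_apply, LinearEquiv.coe_coe,
    TensorProduct.assoc_tmul, LinearMap.lTensor_tmul, TensorProduct.assoc_symm_tmul,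
    LinearMap.rTensor_tmul, swap_of_mem _ _ hx' y]

/-- The middle exchange depends on degrees, so the subspaces involved must contain the homogeneous
components of `x'` and be stable under the sign operators applied to `y`. -/
theorem middleSwap_mem_range {X Y : GradedSpace k} {A A' : Submodule k X} {B B' : Submodule k Y}
    {P : Submodule k (X ⊗[k] Y)} (hA' : ∀ i, ∀ x ∈ A', X.proj i x ∈ A')
    (hB : ∀ n, ∀ y ∈ B, Y.sgn n y ∈ B) (h : ∀ x ∈ A, ∀ y ∈ B, x ⊗ₜ[k] y ∈ P)
    (h' : ∀ x ∈ A', ∀ y ∈ B', x ⊗ₜ[k] y ∈ P) {u : X ⊗[k] X}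
    (hu : u ∈ LinearMap.range (TensorProduct.mapIncl A A')) {t : Y ⊗[k] Y}
    (ht : t ∈ LinearMap.range (TensorProduct.mapIncl B B')) :
    middleSwap X Y (u ⊗ₜ t) ∈ LinearMap.range (TensorProduct.mapIncl P P) := by
  obtain ⟨u, rfl⟩ := hu
  obtain ⟨t, rfl⟩ := ht
  induction u using TensorProduct.induction_on with
  | zero => rw [map_zero, TensorProduct.zero_tmul, map_zero]; exact zero_mem _
  | add a b ha hb => rw [map_add, TensorProduct.add_tmul, map_add]; exact add_mem ha hb
  | tmul x x' =>
    induction t using TensorProduct.induction_on with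
    | zero => rw [map_zero, TensorProduct.tmul_zero, map_zero]; exact zero_mem _
    | add a b ha hb => rw [map_add, TensorProduct.tmul_add, map_add]; exact add_mem ha hb
    | tmul y y' =>
      rw [TensorProduct.mapIncl, TensorProduct.map_tmul, TensorProduct.mapIncl,
        TensorProduct.map_tmul]
      obtain ⟨s, hs⟩ := X.exists_sum_proj x'.1
      change middleSwap X Y ((x.1 ⊗ₜ x'.1) ⊗ₜ (y.1 ⊗ₜ y'.1)) ∈ _
      rw [← hs, TensorProduct.tmul_sum, TensorProduct.sum_tmul, map_sum]
      refine sum_mem fun i _ => ?_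
      rw [middleSwap_tmul _ (X.proj_mem i _)]
      exact tmul_mem_range (h _ x.2 _ (hB _ _ y.2)) (h' _ (hA' _ _ x'.2) _ y'.2)

theorem lid_counit_middleSwap (C E : DGCoalgData k d) (u : C.space ⊗[k] C.space)
    (t : E.space ⊗[k] E.space) :
    TensorProduct.lid k (C.tensor E).space ((C.tensor E).counit.rTensor (C.tensor E).space
      (middleSwap C.space E.space (u ⊗ₜ t))) =
    TensorProduct.lid k C.space (C.counit.rTensor C.space u) ⊗ₜ
      TensorProduct.lid k E.space (E.counit.rTensor E.space t) := by
  have hE : ∀ n y, E.counit (E.space.sgn n y) = E.counit y := fun n y => by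
    have h := functional_comp_sgn E.counit_deg n
    rw [mul_zero, zpow_zero, one_smul] at h
    exact LinearMap.congr_fun h y
  induction u using TensorProduct.induction_on with
  | zero => simp
  | add a b ha hb => simp only [map_add, TensorProduct.add_tmul, ha, hb]
  | tmul x x' =>
    induction t using TensorProduct.induction_on with
    | zero => simp
    | add a b ha hb => simp only [map_add, TensorProduct.tmul_add, ha, hb]
    | tmul y y' =>
      obtain ⟨s, hs⟩ := C.space.exists_sum_proj x'
      rw [← hs, TensorProduct.tmul_sum, TensorProduct.sum_tmul]
      simp only [map_sum, TensorProduct.sum_tmul]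
      refine Finset.sum_congr rfl fun i _ => ?_
      rw [middleSwap_tmul _ (C.space.proj_mem i _)]
      change (C.counit x * E.counit (E.space.sgn i y)) • (C.space.proj i x' ⊗ₜ[k] y') =
        (C.counit x • C.space.proj i x') ⊗ₜ[k] (E.counit y • y')
      rw [hE, TensorProduct.smul_tmul_smul]

variable {V S : DGCoalgData k d}

theorem tensor_counit_comul (hV : V.IsDCoalgebra) (hS : S.IsDCoalgebra) (x : (V.tensor S).space) :
    TensorProduct.lid k (V.tensor S).space ((V.tensor S).counit.rTensor (V.tensor S).space
      ((V.tensor S).comul x)) = x := by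
  suffices h : (TensorProduct.lid k (V.tensor S).space).toLinearMap ∘ₗ
      (V.tensor S).counit.rTensor (V.tensor S).space ∘ₗ (V.tensor S).comul = LinearMap.id from
    LinearMap.congr_fun h x
  refine TensorProduct.ext' fun v s => ?_
  refine (lid_counit_middleSwap V S (V.comul v) (S.comul s)).trans ?_
  rw [(hV.laws v).counit_comul, (hS.laws s).counit_comul]
  rfl

theorem tensor_counit_cobr (hV : V.IsDCoalgebra) (hS : S.IsDCoalgebra) (x : (V.tensor S).space) :
    TensorProduct.lid k (V.tensor S).space ((V.tensor S).counit.rTensor (V.tensor S).space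
      ((V.tensor S).cobr x)) = 0 := by
  suffices h : (TensorProduct.lid k (V.tensor S).space).toLinearMap ∘ₗ
      (V.tensor S).counit.rTensor (V.tensor S).space ∘ₗ (V.tensor S).cobr = 0 from
    LinearMap.congr_fun h x
  refine TensorProduct.ext' fun v s => ?_
  have h : (V.tensor S).cobr (v ⊗ₜ s) = middleSwap V.space S.space (V.cobr v ⊗ₜ S.comul s) +
      middleSwap V.space S.space (V.comul (V.space.sgn (d - 1) v) ⊗ₜ S.cobr s) :=
    map_add (middleSwap V.space S.space) _ _
  rw [LinearMap.comp_apply, LinearMap.comp_apply, h, map_add, map_add]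
  refine (congrArg₂ (· + ·) (lid_counit_middleSwap V S _ _)
    (lid_counit_middleSwap V S _ _)).trans ?_
  rw [(hV.laws v).counit_cobr, (hS.laws s).counit_cobr, TensorProduct.zero_tmul,
    TensorProduct.tmul_zero]
  exact add_zero _

theorem tensor_counit_diff (hV : V.IsDCoalgebra) (hS : S.IsDCoalgebra) (x : (V.tensor S).space) :
    (V.tensor S).counit ((V.tensor S).diff x) = 0 := by
  suffices h : (V.tensor S).counit ∘ₗ (V.tensor S).diff = 0 from LinearMap.congr_fun h x
  refine TensorProduct.ext' fun v s => ?_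
  have h : (V.tensor S).counit ((V.tensor S).diff (v ⊗ₜ s)) = V.counit (V.diff v) * S.counit s +
      V.counit (V.space.sgn 1 v) * S.counit (S.diff s) := map_add (V.tensor S).counit _ _
  refine h.trans ?_
  rw [hV.coderivation.counit, hS.coderivation.counit, zero_mul, mul_zero, add_zero]
  rfl

theorem tensor_diff_diff (hV : V.IsDCoalgebra) (hS : S.IsDCoalgebra) (x : (V.tensor S).space) :
    (V.tensor S).diff ((V.tensor S).diff x) = 0 := by
  refine (tensorDiff_tensorDiff S.diff V.diff_deg x).trans ?_
  rw [show V.diff ∘ₗ V.diff = 0 from LinearMap.ext hV.diff_diff,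
    show S.diff ∘ₗ S.diff = 0 from LinearMap.ext hS.diff_diff, TensorProduct.map_zero_left,
    TensorProduct.map_zero_right]
  exact add_zero _

/-- The dual of `V ⊗ S` is a `d`-algebra by currying, and this implies the coalgebra identities that
do not involve the counit. The counit identities and the square of the differential are checked
directly. -/
theorem IsDCoalgebra.tensor (hV : V.IsDCoalgebra) (hS : S.IsDCoalgebra) :
    (V.tensor S).IsDCoalgebra :=
  isDCoalgebra_of_isDAlgebra_homAlg (isDAlgebra_homAlg_tensor hV hS isDAlgebra_scalarAlg)
    (tensor_counit_comul hV hS) (tensor_counit_cobr hV hS) (tensor_counit_diff hV hS)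
    (tensor_diff_diff hV hS)

/-! ### The filtration on a tensor product -/

section
variable {e : V.space} (he : V.IsGrouplike e) {e' : S.space} (he' : S.IsGrouplike e')
include he he'

theorem tensor_isGrouplike : (V.tensor S).IsGrouplike (e ⊗ₜ e') where
  deg := tmul_mem_tensorDeg _ _ (add_zero 0) he.deg he'.deg
  counit := by
    change V.counit e * S.counit e' = 1
    rw [he.counit, he'.counit, one_mul]
  comul := by
    change middleSwap V.space S.space (V.comul e ⊗ₜ S.comul e') = _
    rw [he.comul, he'.comul, middleSwap_tmul _ he.deg, he'.sgn_apply]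
  cobr := by
    change middleSwap V.space S.space (V.cobr e ⊗ₜ S.comul e' +
      V.comul (V.space.sgn (d - 1) e) ⊗ₜ S.cobr e') = 0
    rw [he.cobr, he'.cobr, TensorProduct.zero_tmul, TensorProduct.tmul_zero, add_zero, map_zero]

omit he in
theorem middleSwap_grouplike_left (v : V.space) (s : S.space) :
    middleSwap V.space S.space ((e ⊗ₜ v) ⊗ₜ (e' ⊗ₜ s)) = (e ⊗ₜ e') ⊗ₜ (v ⊗ₜ s) := by
  obtain ⟨a, ha⟩ := V.space.exists_sum_proj v
  rw [← ha, TensorProduct.tmul_sum, TensorProduct.sum_tmul, map_sum, TensorProduct.sum_tmul,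
    TensorProduct.tmul_sum]
  refine Finset.sum_congr rfl fun i _ => ?_
  rw [middleSwap_tmul _ (V.space.proj_mem i v), he'.sgn_apply]

theorem reducedComul_tmul (v : V.space) (s : S.space) :
    (V.tensor S).reducedComul (e ⊗ₜ e') (v ⊗ₜ s) = middleSwap V.space S.space
      (V.comul v ⊗ₜ S.comul s - (e ⊗ₜ v) ⊗ₜ (e' ⊗ₜ s) - (v ⊗ₜ e) ⊗ₜ (s ⊗ₜ e')) := by
  have h : middleSwap V.space S.space ((v ⊗ₜ e) ⊗ₜ (s ⊗ₜ e')) = (v ⊗ₜ s) ⊗ₜ (e ⊗ₜ e') := by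
    rw [middleSwap_tmul _ he.deg, S.space.sgn_zero]; rfl
  rw [map_sub, map_sub, middleSwap_grouplike_left he', h]
  rfl

/-- Levels add under the tensor product. A reduced coproduct or a cobracket lowers the level in at
least one of the two tensor factors, so every term of a cooperation of `v ⊗ s` consists of two
factors of level at most `n`. -/
theorem tmul_mem_filtration (n : ℕ) : ∀ i j, i + j ≤ n → ∀ v ∈ V.filtration e i,
    ∀ s ∈ S.filtration e' j, v ⊗ₜ[k] s ∈ (V.tensor S).filtration (e ⊗ₜ e') n := by
  have hZ := tensor_isGrouplike he he'
  induction n with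
  | zero =>
    intro i j hij v hv s hs
    obtain ⟨rfl, rfl⟩ : i = 0 ∧ j = 0 := by omega
    obtain ⟨a, rfl⟩ := Submodule.mem_span_singleton.1 hv
    obtain ⟨b, rfl⟩ := Submodule.mem_span_singleton.1 hs
    rw [TensorProduct.smul_tmul_smul]
    exact Submodule.smul_mem _ _ (hZ.mem_filtration 0)
  | succ n ih =>
    intro i j hij v hv s hs
    -- After the middle exchange the levels regroup as `a + b` and `a' + b'`, so each later
    -- membership is reduced to two inequalities between natural numbers.
    have hm : ∀ {a a' b b' : ℕ} {u : V.space ⊗[k] V.space} {t : S.space ⊗[k] S.space},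
        a + b ≤ n → a' + b' ≤ n →
        u ∈ LinearMap.range (TensorProduct.mapIncl (V.filtration e a) (V.filtration e a')) →
        t ∈ LinearMap.range (TensorProduct.mapIncl (S.filtration e' b) (S.filtration e' b')) →
        middleSwap V.space S.space (u ⊗ₜ t) ∈ LinearMap.range (TensorProduct.mapIncl
          ((V.tensor S).filtration (e ⊗ₜ e') n) ((V.tensor S).filtration (e ⊗ₜ e') n)) :=
      fun h h' hu ht => middleSwap_mem_range (fun i => he.proj_mem_filtration _ i)
        (fun n => he'.sgn_mem_filtration _ n) (ih _ _ h) (ih _ _ h') hu ht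
    have ht : ∀ {a b : ℕ} {x y : V.space}, x ∈ V.filtration e a → y ∈ V.filtration e b →
        x ⊗ₜ[k] y ∈ LinearMap.range (TensorProduct.mapIncl (V.filtration e a)
          (V.filtration e b)) := fun hx hy => ⟨⟨_, hx⟩ ⊗ₜ ⟨_, hy⟩, rfl⟩
    have ht' : ∀ {a b : ℕ} {x y : S.space}, x ∈ S.filtration e' a → y ∈ S.filtration e' b →
        x ⊗ₜ[k] y ∈ LinearMap.range (TensorProduct.mapIncl (S.filtration e' a)
          (S.filtration e' b)) := fun hx hy => ⟨⟨_, hx⟩ ⊗ₜ ⟨_, hy⟩, rfl⟩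
    have he₀ := he.mem_filtration 0
    have he₀' := he'.mem_filtration 0
    have hb : ∀ v s, (V.tensor S).cobr (v ⊗ₜ s) = middleSwap V.space S.space (V.cobr v ⊗ₜ S.comul s) +
        middleSwap V.space S.space (V.comul (V.space.sgn (d - 1) v) ⊗ₜ S.cobr s) :=
      fun v s => map_add (middleSwap V.space S.space) _ _
    rcases i with _ | i
    · rcases j with _ | j
      · exact hZ.filtration_mono n.le_succ (ih 0 0 (by omega) v hv s hs)
      obtain ⟨c, rfl⟩ := Submodule.mem_span_singleton.1 hv
      rw [← TensorProduct.smul_tmul']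
      refine Submodule.smul_mem _ _ ⟨?_, ?_⟩
      · rw [SetLike.mem_coe, Submodule.mem_comap, reducedComul_tmul he he', he.comul,
          ← TensorProduct.tmul_sub, ← TensorProduct.tmul_sub]
        exact hm (by omega) (by omega) (ht he₀ he₀) hs.1
      · rw [SetLike.mem_coe, Submodule.mem_comap, hb, he.cobr, he.sgn_apply, he.comul,
          TensorProduct.zero_tmul, map_zero, zero_add]
        exact hm (by omega) (by omega) (ht he₀ he₀) hs.2
    · rcases j with _ | j
      · obtain ⟨c, rfl⟩ := Submodule.mem_span_singleton.1 hs
        rw [TensorProduct.tmul_smul]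
        refine Submodule.smul_mem _ _ ⟨?_, ?_⟩
        · rw [SetLike.mem_coe, Submodule.mem_comap, reducedComul_tmul he he', he'.comul,
            ← TensorProduct.sub_tmul, ← TensorProduct.sub_tmul]
          exact hm (by omega) (by omega) hv.1 (ht' he₀' he₀')
        · rw [SetLike.mem_coe, Submodule.mem_comap, hb, he'.cobr, he'.comul,
            TensorProduct.tmul_zero, map_zero, add_zero]
          exact hm (by omega) (by omega) hv.2 (ht' he₀' he₀')
      refine ⟨?_, ?_⟩
      · have e₁ : V.comul v = V.reducedComul e v + e ⊗ₜ v + v ⊗ₜ e := by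
          rw [reducedComul_apply]; abel
        have e₂ : S.comul s = S.reducedComul e' s + e' ⊗ₜ s + s ⊗ₜ e' := by
          rw [reducedComul_apply]; abel
        rw [SetLike.mem_coe, Submodule.mem_comap, reducedComul_tmul he he']
        -- Inclusion and exclusion on the reduced coproducts. The two cross terms become `(e ⊗ s) ⊗
        -- (v ⊗ e')` and `(v ⊗ e') ⊗ (e ⊗ s)` up to signs; they have small enough level because both
        -- levels are positive here, which is why level zero is treated apart.
        have : V.comul v ⊗ₜ[k] S.comul s - (e ⊗ₜ v) ⊗ₜ (e' ⊗ₜ s) - (v ⊗ₜ e) ⊗ₜ (s ⊗ₜ e') =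
            V.reducedComul e v ⊗ₜ S.comul s + V.comul v ⊗ₜ S.reducedComul e' s -
              V.reducedComul e v ⊗ₜ S.reducedComul e' s +
              (e ⊗ₜ v) ⊗ₜ (s ⊗ₜ e') + (v ⊗ₜ e) ⊗ₜ (e' ⊗ₜ s) := by
          rw [e₁, e₂]
          simp only [TensorProduct.add_tmul, TensorProduct.tmul_add]
          abel
        rw [this]
        simp only [map_add, map_sub]
        exact add_mem (add_mem (sub_mem (add_mem
          (hm (by omega) (by omega) hv.1 (he'.comul_mem _ s hs))
          (hm (by omega) (by omega) (he.comul_mem _ v hv) hs.1))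
          (hm (by omega) (by omega) hv.1 hs.1))
          (hm (by omega) (by omega) (ht he₀ hv) (ht' hs he₀')))
          (hm (by omega) (by omega) (ht hv he₀) (ht' he₀' hs))
      · rw [SetLike.mem_coe, Submodule.mem_comap, hb]
        exact add_mem (hm (by omega) (by omega) hv.2 (he'.comul_mem _ s hs))
          (hm (by omega) (by omega) (he.comul_mem _ _ (he.sgn_mem_filtration _ _ v hv)) hs.2)

end

section
variable {e : S.space} (he : S.IsGrouplike e)
include he

theorem middleSwap_grouplike_right (u : V.space ⊗[k] V.space) :
    middleSwap V.space S.space (u ⊗ₜ (e ⊗ₜ e)) =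
      TensorProduct.map ((TensorProduct.mk k V.space S.space).flip e)
        ((TensorProduct.mk k V.space S.space).flip e) u := by
  suffices h : middleSwap V.space S.space ∘ₗ (TensorProduct.mk k _ _).flip (e ⊗ₜ e) =
      TensorProduct.map ((TensorProduct.mk k V.space S.space).flip e)
        ((TensorProduct.mk k V.space S.space).flip e) from LinearMap.congr_fun h u
  refine tensor_hom_ext _ _ fun i j x hx y hy => ?_
  rw [LinearMap.comp_apply, LinearMap.flip_apply, TensorProduct.mk_apply, middleSwap_tmul _ hy,
    he.sgn_apply]
  rfl

theorem tensor_comul_tmul (v : V.space) : (V.tensor S).comul (v ⊗ₜ e) =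
    TensorProduct.map ((TensorProduct.mk k V.space S.space).flip e)
        ((TensorProduct.mk k V.space S.space).flip e) (V.comul v) := by
  rw [← middleSwap_grouplike_right he, ← he.comul]
  rfl

theorem tensor_cobr_tmul (v : V.space) : (V.tensor S).cobr (v ⊗ₜ e) =
    TensorProduct.map ((TensorProduct.mk k V.space S.space).flip e)
        ((TensorProduct.mk k V.space S.space).flip e) (V.cobr v) := by
  have h : (V.tensor S).cobr (v ⊗ₜ e) = middleSwap V.space S.space (V.cobr v ⊗ₜ S.comul e) +
      middleSwap V.space S.space (V.comul (V.space.sgn (d - 1) v) ⊗ₜ S.cobr e) :=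
    map_add (middleSwap V.space S.space) _ _
  rw [h, he.cobr, TensorProduct.tmul_zero, map_zero, add_zero, he.comul,
    middleSwap_grouplike_right he]

/-- The morphism `v ↦ v ⊗ e`. -/
def tmulHom (hD : S.diff e = 0) : Hom V (V.tensor S) where
  map := (TensorProduct.mk k V.space S.space).flip e
  map_deg i v hv := tmul_mem_tensorDeg _ _ (by ring) hv he.deg
  map_comul := tensor_comul_tmul he
  map_counit v := (congrArg (V.counit v * ·) he.counit).trans (mul_one _)
  map_cobr := tensor_cobr_tmul he
  map_diff v := (tensorDiff_tmul V.space S.space V.diff S.diff v e).trans (by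
    rw [hD, TensorProduct.tmul_zero, add_zero]; rfl)

end

theorem IsCoproartinian.tensor (hV : V.IsCoproartinian) (hS : S.IsCoproartinian) :
    (V.tensor S).IsCoproartinian := by
  obtain ⟨he, hDe, hF⟩ := hV.isGrouplike
  obtain ⟨he', hDe', hF'⟩ := hS.isGrouplike
  refine (hV.isDCoalgebra.tensor hS.isDCoalgebra).isCoproartinian (tensor_isGrouplike he he')
    ?_ (top_unique fun x _ => ?_)
  · rw [tensorDiff_tmul, hDe, hDe', TensorProduct.zero_tmul, TensorProduct.tmul_zero, add_zero]
  · induction x using TensorProduct.induction_on with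
    | zero => exact zero_mem _
    | add a b ha hb => exact add_mem (ha trivial) (hb trivial)
    | tmul v s =>
      obtain ⟨i, hi⟩ := induction_filtration he hF v
      obtain ⟨j, hj⟩ := induction_filtration he' hF' s
      exact Submodule.mem_iSup_of_mem (i + j) (tmul_mem_filtration he he' _ i j le_rfl v hi s hj)

theorem IsCoproartinian.tensor_one (hV : V.IsCoproartinian) (hS : S.IsCoproartinian) :
    (hV.tensor hS).one = hV.one ⊗ₜ hS.one :=
  ((hV.tensor hS).eq_one (tensor_isGrouplike hV.isGrouplike.1 hS.isGrouplike.1).counit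
    (tensor_isGrouplike hV.isGrouplike.1 hS.isGrouplike.1).comul).symm

end DGCoalgData

end

end DAlgebras

namespace DAlgebras

noncomputable section

open GradedSpace

variable {k : Type u} [Field k] {d : ℤ}

open CoalgData

/-! ### Twisting by a Maurer-Cartan element -/

theorem isTwisting_iff_isMaurerCartan {C : DGCoalgData k d} {B : DGAlgData k d}
    {f : (homAlg C B).space} : IsTwisting C B f.1 ↔ (homAlg C B).IsMaurerCartan f :=
  ⟨fun h => ⟨h.deg, Subtype.ext h.eq⟩, fun h => ⟨h.1, congrArg Subtype.val h.2⟩⟩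

theorem counit_comp_sgn (C : CoalgData k d) (n : ℤ) : C.counit ∘ₗ C.space.sgn n = C.counit := by
  rw [functional_comp_sgn C.counit_deg, mul_zero, zpow_zero, one_smul]

section
variable {C : CoalgData k d} {B : DGAlgData k d} {x : B.space}

theorem isHomogeneous_counit_smulRight {p : ℤ} (hx : x ∈ B.space.deg p) :
    IsHomogeneous C.space B.space (C.counit.smulRight x) p := fun i y hy => by
  rcases functional_eq_zero C.counit_deg hy with h | h
  · rw [h, neg_zero, zero_add]
    exact Submodule.smul_mem _ _ hx
  · rw [LinearMap.smulRight_apply, h, zero_smul]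
    exact zero_mem _

/-- The counit removes one factor of the coproduct and kills the cobracket, so only the bracket of
`B` with `x` survives. -/
theorem convBr_counit_smulRight (hC : ∀ y, C.LawsAt y) (x : B.space) {g : C.space →ₗ[k] B.space}
    {q : ℤ} (hg : IsHomogeneous C.space B.space g q) :
    convBr C B (C.counit.smulRight x) g = B.br x ∘ₗ g := by
  have h : ∀ (m : B.space →ₗ[k] B.space →ₗ[k] B.space) (n : ℤ) (t : C.space ⊗[k] C.space),
      TensorProduct.lift m (TensorProduct.map (C.counit.smulRight x ∘ₗ C.space.sgn n) g t) =
        m x (g (TensorProduct.lid k C.space (C.counit.rTensor C.space t))) := fun m n t => by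
    induction t using TensorProduct.induction_on with
    | zero => simp
    | add a b ha hb => simp only [map_add, ha, hb]
    | tmul a b =>
      have := LinearMap.congr_fun (counit_comp_sgn C n) a
      rw [LinearMap.comp_apply] at this
      simp [this]
  refine LinearMap.ext fun y => ?_
  rw [convBr_apply C B _ hg, h, h, (hC y).counit_comul, (hC y).counit_cobr, map_zero, map_zero,
    smul_zero, add_zero, LinearMap.comp_apply]

theorem homDiff_counit_smulRight {p : ℤ} (hx : x ∈ B.space.deg p) {D : C.space →ₗ[k] C.space}
    (hD : C.IsCoderivation D) :
    homDiff D B.diff (C.counit.smulRight x) = C.counit.smulRight (B.diff x) := by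
  rw [homDiff_of_mem (isHomogeneous_counit_smulRight hx)]
  refine LinearMap.ext fun y => ?_
  simp [hD.counit]

/-- Elements of degree `d` have odd shifted degree, so the bracket is symmetric on them and the
square of a sum has its usual expansion. -/
theorem convBr_self_add [CharZero k] (hC : ∀ y, C.LawsAt y) (hB : B.IsDAlgebra)
    {f g : C.space →ₗ[k] B.space} (hf : IsHomogeneous C.space B.space f d)
    (hg : IsHomogeneous C.space B.space g d) : (2 : k)⁻¹ • convBr C B (f + g) (f + g) =
      (2 : k)⁻¹ • convBr C B f f + convBr C B f g + (2 : k)⁻¹ • convBr C B g g := by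
  have h := convBr_skew hC hB hg hf
  rw [Odd.neg_one_zpow (by
    rw [show (d + d - 1) * (d + d - 1) = 2 * (2 * d * d - 2 * d) + 1 by ring]
    exact ⟨_, rfl⟩), neg_neg, one_smul] at h
  have h2 : convBr C B f g = (2 : k)⁻¹ • (convBr C B f g + convBr C B f g) := by
    rw [← two_smul k, smul_smul, inv_mul_cancel₀ two_ne_zero, one_smul]
  rw [h2]
  simp only [map_add, LinearMap.add_apply, h, smul_add]
  abel

end

/-- Expanding the Maurer-Cartan expression of `ε x + g` gives that of `ε x`, which vanishes because
`x` is Maurer-Cartan, plus that of `g` with the extra term `{x, g}`, which is the differential of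
the twisted algebra. -/
theorem isTwisting_twist_iff [CharZero k] {C : DGCoalgData k d} {B : DGAlgData k d} {x : B.space}
    (hC : C.IsDCoalgebra) (hB : B.IsDAlgebra) (hx : B.IsMaurerCartan x)
    {g : C.space →ₗ[k] B.space} :
    IsTwisting C (B.twist x hx.1) g ↔ IsTwisting C B (C.counit.smulRight x + g) := by
  have hc : IsHomogeneous C.space B.space (C.counit.smulRight x) d :=
    isHomogeneous_counit_smulRight hx.1
  by_cases hg : IsHomogeneous C.space B.space g d
  · have e : homDiff C.diff (B.twist x hx.1).diff g +
        (2 : k)⁻¹ • convBr C.toCoalgData (B.twist x hx.1) g g =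
        homDiff C.diff B.diff (C.counit.smulRight x + g) + (2 : k)⁻¹ •
          convBr C.toCoalgData B (C.counit.smulRight x + g) (C.counit.smulRight x + g) := by
      rw [map_add, convBr_self_add hC.laws hB hc hg, convBr_counit_smulRight hC.laws x hg,
        convBr_counit_smulRight hC.laws x hc, homDiff_counit_smulRight hx.1 hC.coderivation,
        homDiff_of_mem hg, homDiff_of_mem (Y := (B.twist x hx.1).space) hg]
      have h : C.counit.smulRight (B.diff x) + (2 : k)⁻¹ • (B.br x ∘ₗ C.counit.smulRight x) = 0 := by
        refine LinearMap.ext fun y => ?_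
        simp only [LinearMap.add_apply, LinearMap.smul_apply, LinearMap.comp_apply,
          LinearMap.smulRight_apply, map_smul, LinearMap.zero_apply]
        rw [smul_comm, ← smul_add, hx.2, smul_zero]
      change B.diff ∘ₗ g + B.br x ∘ₗ g - (-1 : k) ^ d • g ∘ₗ C.diff +
        (2 : k)⁻¹ • convBr C.toCoalgData B g g = _
      rw [← zero_add (_ + _), ← h]
      abel
    exact ⟨fun h => ⟨hc.add hg, e ▸ h.eq⟩, fun h => ⟨hg, e.symm ▸ h.eq⟩⟩
  -- If `g` does not have degree `d`, neither side can hold, as `ε x` has degree `d`.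
  · refine ⟨fun h => (hg h.deg).elim, fun h => (hg ?_).elim⟩
    intro i y hy
    have := sub_mem (h.deg i y hy) (hc i y hy)
    rwa [LinearMap.add_apply, add_sub_cancel_left] at this

section
variable {V W : DGAlgData k d} (φ : DGCoalgData.Hom (vee V) (vee W))

/-- The projection of `W^∨` is twisting, and twisting maps pull back along morphisms of coalgebras.
-/
theorem isMaurerCartan_mcElement : (homAlg (vee V) W).IsMaurerCartan (mcElement φ) :=
  isTwisting_iff_isMaurerCartan.1 ((vee.isTwisting_proj W).comp φ)

variable [CharZero k] (hV : V.IsDAlgebra) (hW : W.IsDAlgebra)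
include hV hW

theorem isDAlgebra_homAlg_vee : (homAlg (vee V) W).IsDAlgebra :=
  isDAlgebra_homAlg (vee.isDCoalgebra hV) hW

theorem isDAlgebra_twistedHom : (twistedHom φ).IsDAlgebra :=
  (isDAlgebra_homAlg_vee hV hW).twist (isMaurerCartan_mcElement φ)

end

/-! ### Representability -/

section
variable {V S : DGCoalgData k d} {W : DGAlgData k d} {x : (homAlg V W).space}
  {hx : x ∈ (homAlg V W).space.deg d}

/-- The morphisms `G : S → (Hom (V, W)')^∨` and `F : V ⊗ S → W^∨` correspond to each other. -/
def IsTranspose (G : S.Hom (vee ((homAlg V W).twist x hx))) (F : (V.tensor S).Hom (vee W)) :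
    Prop := ∀ (s : S.space) (v : V.space), vee.proj W (F.map (swap S.space V.space (s ⊗ₜ v))) =
      (S.counit s • x + vee.proj ((homAlg V W).twist x hx) (G.map s)).1 v

theorem swap_tmul_grouplike {e : S.space} (he : S.IsGrouplike e) (v : V.space) :
    swap S.space V.space (e ⊗ₜ v) = v ⊗ₜ e := by
  rw [swap_of_mem _ _ he.deg, sgn_zero]
  rfl

namespace IsTranspose
variable {G G' : S.Hom (vee ((homAlg V W).twist x hx))} {F F' : (V.tensor S).Hom (vee W)}

/-- The source of naturality: both sides change by composition with `f`, and `f` preserves the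
counit. -/
theorem comp {S' : DGCoalgData k d} (h : IsTranspose G F) (f : S'.Hom S) :
    IsTranspose (G.comp f) (F.comp (DGCoalgData.tensorMap V f)) := fun s v => by
  have e : (F.comp (DGCoalgData.tensorMap V f)).map (swap S'.space V.space (s ⊗ₜ v)) =
      F.map (swap S.space V.space (f.map s ⊗ₜ v)) :=
    congrArg F.map (swap_map f.map_deg (IsHomogeneous.id V.space) (s ⊗ₜ v)).symm
  rw [e, h, f.map_counit]
  rfl

variable [CharZero k] (hV : V.IsCoproartinian) (hS : S.IsCoproartinian) (hW : W.IsDAlgebra)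
  (hm : (homAlg V W).IsMaurerCartan x)
include hV hS hW

theorem eq_right (h : IsTranspose G F) (h' : IsTranspose G F') : F = F' := by
  refine vee.hom_ext (hV.tensor hS) hW fun t => ?_
  rw [← swap_swap V.space S.space t]
  generalize swap V.space S.space t = u
  induction u using TensorProduct.induction_on with
  | zero => simp
  | add a b ha hb => simp only [map_add, ha, hb]
  | tmul s v => rw [h, h']

include hm

/-- Both morphisms have the same projection to the twisted algebra, since the common summand `ε(s)
x` cancels. -/
theorem eq_left (h : IsTranspose G F) (h' : IsTranspose G' F) : G = G' := by
  have hA := (isDAlgebra_homAlg hV.isDCoalgebra hW).twist hm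
  refine vee.hom_ext hS hA fun s => Subtype.ext (LinearMap.ext fun v => ?_)
  have := (h s v).symm.trans (h' s v)
  exact add_left_cancel this

/-- Evaluated at the grouplike element of `S`, the projection of `G` vanishes and only `x` remains;
this yields the condition on the restriction to `V`. -/
theorem proj_tmul_one (h : IsTranspose G F) (v : V.space) :
    vee.proj W (F.map (v ⊗ₜ hS.one)) = x.1 v := by
  have hA := (isDAlgebra_homAlg hV.isDCoalgebra hW).twist hm
  have he := hS.isGrouplike.1
  rw [← swap_tmul_grouplike he, h, he.counit, vee.map_one hS hA, vee.proj_one, one_smul]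
  exact congrArg (fun y : (homAlg V W).space => y.1 v) (add_zero x)

/-- Add `ε x` to the projection of `G`, uncurry, and lift by the universal property of `W^∨`. The
hypothesis on `x` at the grouplike element makes the uncurried map vanish at `1 ⊗ 1`. -/
theorem exists_right (hx₁ : x.1 hV.one = 0) (G : S.Hom (vee ((homAlg V W).twist x hx))) :
    ∃ F, IsTranspose G F := by
  have hA := isDAlgebra_homAlg hV.isDCoalgebra hW
  have he := hS.isGrouplike.1
  have ht := (isTwisting_twist_iff hS.isDCoalgebra hA hm).1 ((vee.isTwisting_proj _).comp G)
  obtain ⟨f, hf, hc⟩ := exists_curry_eq (n := d) (⟨_, Submodule.mem_iSup_of_mem d ht.deg⟩ :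
    gradedHom S.space (gradedHom V.space W.space)) ht.deg
  have hc' : (homAlg S (homAlg V W)).IsMaurerCartan (curry V.space S.space W.space f) := by
    rw [hc]
    exact isTwisting_iff_isMaurerCartan.1 ht
  have hf' := isTwisting_iff_isMaurerCartan.2 (isMaurerCartan_curry.1 hc')
  have key : ∀ s v, f.1 (swap S.space V.space (s ⊗ₜ v)) =
      (S.counit s • x + vee.proj ((homAlg V W).twist x hx) (G.map s)).1 v := fun s v => by
    rw [← curry_apply, hc]
    rfl
  obtain ⟨F, hF⟩ := vee.exists_hom (hV.tensor hS) hf' (by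
    rw [hV.tensor_one hS, ← swap_tmul_grouplike he]
    refine (key _ _).trans ?_
    rw [he.counit, vee.map_one hS (hA.twist hm), vee.proj_one, one_smul]
    exact (congrArg (· + _) hx₁).trans (add_zero _))
  exact ⟨F, fun s v => (hF _).trans (key s v)⟩

/-- The same steps reversed: curry the projection of `F`, subtract `ε x`, and lift. The assumption
on the restriction to `V` says that the difference vanishes at the grouplike element of `S`. -/
theorem exists_left (F : (V.tensor S).Hom (vee W))
    (hF : ∀ v, vee.proj W (F.map (v ⊗ₜ hS.one)) = x.1 v) :
    ∃ G : S.Hom (vee ((homAlg V W).twist x hx)), IsTranspose G F := by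
  have hA := isDAlgebra_homAlg hV.isDCoalgebra hW
  have he := hS.isGrouplike.1
  have ht := (vee.isTwisting_proj W).comp F
  let f : (homAlg (V.tensor S) W).space := ⟨_, Submodule.mem_iSup_of_mem d ht.deg⟩
  have hc' : (homAlg S (homAlg V W)).IsMaurerCartan (curry V.space S.space W.space f) :=
    isMaurerCartan_curry.2 (isTwisting_iff_isMaurerCartan.1 ht)
  have hc := isTwisting_iff_isMaurerCartan.2 hc'
  -- Exhibits the curried map in the form `ε x + g`, to which `isTwisting_twist_iff` applies.
  rw [← add_sub_cancel (S.counit.smulRight x) (curry V.space S.space W.space f).1] at hc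
  obtain ⟨G, hG⟩ := vee.exists_hom hS ((isTwisting_twist_iff hS.isDCoalgebra hA hm).2 hc) (by
    refine Subtype.ext (LinearMap.ext fun v => ?_)
    have h := hF v
    rw [← swap_tmul_grouplike he] at h
    rw [LinearMap.sub_apply, LinearMap.smulRight_apply, he.counit, one_smul]
    exact (congrArg (· - _) h).trans (sub_self _))
  refine ⟨G, fun s v => ?_⟩
  rw [hG, LinearMap.sub_apply, LinearMap.smulRight_apply, add_sub_cancel]
  rfl

end IsTranspose

end

open Opposite CategoryTheory in
theorem nonempty_representableBy [CharZero k] {V W : DGAlgData k d} (hV : V.IsDAlgebra)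
    (hW : W.IsDAlgebra) (φ : DGCoalgData.Hom (vee V) (vee W))
    (h : (vee (twistedHom φ)).IsCoproartinian) :
    Nonempty ((homFunctor V W φ).RepresentableBy ⟨vee (twistedHom φ), h⟩) := by
  have hm := isMaurerCartan_mcElement φ
  have hV' := vee.isCoproartinian hV
  -- The morphism `φ` preserves the grouplike element, and the projection to cogenerators kills it.
  have hφ : (mcElement φ).1 hV'.one = 0 :=
    (congrArg (vee.proj W) (vee.map_one hV' hW φ)).trans (vee.proj_one W)
  have hΦ : ∀ (S : DCoart k d) (G : S ⟶ ⟨vee (twistedHom φ), h⟩),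
      ∃ F : (homFunctor V W φ).obj (op S), IsTranspose (hx := mcElement_deg φ) G F.1 := fun S G => by
    obtain ⟨F, hF⟩ := IsTranspose.exists_right (hx := mcElement_deg φ) hV' S.isCoproartinian hW hm hφ G
    -- The restriction of `F` along `v ↦ v ⊗ 1` is a morphism with the same projection as `φ`, hence
    -- it equals `φ`.
    exact ⟨⟨F, fun v => congrArg (fun H : (vee V).Hom (vee W) => H.map v) (vee.hom_ext hV' hW (F := F.comp
      (DGCoalgData.tmulHom S.isCoproartinian.isGrouplike.1 S.isCoproartinian.isGrouplike.2.1))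
        (hF.proj_tmul_one hV' S.isCoproartinian hW hm))⟩, hF⟩
  choose Φ hΦ using hΦ
  refine ⟨⟨fun {S} => Equiv.ofBijective (Φ S) ⟨fun G G' e => ?_, fun F => ?_⟩, fun {S T} f G => ?_⟩⟩
  · have h' := hΦ S G'
    rw [← e] at h'
    exact (hΦ S G).eq_left hV' S.isCoproartinian hW hm h'
  · obtain ⟨G, hG⟩ := IsTranspose.exists_left (hx := mcElement_deg φ) hV' S.isCoproartinian hW hm F.1 fun v =>
      congrArg (vee.proj W) (F.2 v)
    exact ⟨G, Subtype.ext ((hΦ S G).eq_right hV' S.isCoproartinian hW hG)⟩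
  -- Naturality needs no formula for `Φ`: both candidates are transposes of the same morphism.
  · exact Subtype.ext ((hΦ S (f ≫ G)).eq_right hV' S.isCoproartinian hW ((hΦ T G).comp f))

end

end DAlgebras

theorem mainTheorem2 {k : Type u} [Field k] [CharZero k] (d : ℤ)
    (V W : DAlgebras.DGAlgData k d) (hV : V.IsDAlgebra) (hW : W.IsDAlgebra)
    (φ : DAlgebras.DGCoalgData.Hom (DAlgebras.vee V) (DAlgebras.vee W)) :
    (DAlgebras.vee V).IsCoproartinian ∧ (DAlgebras.vee W).IsCoproartinian ∧
    (DAlgebras.homAlg (DAlgebras.vee V) W).IsDAlgebra ∧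
    (DAlgebras.homAlg (DAlgebras.vee V) W).IsMaurerCartan (DAlgebras.mcElement φ) ∧
    (DAlgebras.twistedHom φ).IsDAlgebra ∧
    ∃ h : (DAlgebras.vee (DAlgebras.twistedHom φ)).IsCoproartinian,
      Nonempty ((DAlgebras.homFunctor V W φ).RepresentableBy
        ⟨DAlgebras.vee (DAlgebras.twistedHom φ), h⟩) := by
  have h := DAlgebras.isDAlgebra_twistedHom φ hV hW
  exact ⟨DAlgebras.vee.isCoproartinian hV, DAlgebras.vee.isCoproartinian hW,
    DAlgebras.isDAlgebra_homAlg_vee hV hW, DAlgebras.isMaurerCartan_mcElement φ, h,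
    DAlgebras.vee.isCoproartinian h, DAlgebras.nonempty_representableBy hV hW φ _⟩
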